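/- **Setting.** Let $V$ be a symmetric monoidal category and let $\mathscr D=(\mathscr D,\boxtimes_0,\boxtimes_1,e,v)$ be a strict duoidal $V$-category: strict monoidal $V$-categories $(\mathscr D,\boxtimes_0,e)$ and $(\mathscr D,\boxtimes_1,v)$ with a $V$-natural interchange $(X\boxtimes_1Y)\boxtimes_0(Z\boxtimes_1W)\to(X\boxtimes_0Z)\boxtimes_1(Y\boxtimes_0W)$ and maps $\delta:e\to e\boxtimes_1e$, $\mu:v\boxtimes_0v\to v$, $\varepsilon:e\to v$ satisfying the usual coherence axioms, with $v$ a monoid for $\boxtimes_0$ (multiplication $\mu$, unit $\varepsilon$) and $e$ a comonoid for $\boxtimes_1$ (comultiplication $\delta$, counit $\varepsilon$). A *1-operad* $\mathscr A=\{\mathscr A(n)\}_{n\ge0}$ in $\mathscr D$ has associative and unital structure maps $\gamma:(\mathscr A(k_1)\boxtimes_1\cdots\boxtimes_1\mathscr A(k_n))\boxtimes_0\mathscr A(n)\to\mathscr A(k_1+\cdots+k_n)$, for $n\ge0$ (for $n=0$ a $v$-module structure $v\boxtimes_0\mathscr A(0)\to\mathscr A(0)$), and a unit $j:e\to\mathscr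 A(1)$. It is *multiplicative* if it is equipped with a morphism of 1-operads $\alpha:\mathrm{UAss}\to\mathscr A$, where $\mathrm{UAss}(n)=v$ for all $n$. **Levelled trees.** $\mathrm{LTr}$ is the operadic category of planar rooted trees with white, vertical and horizontal vertices of arities $\ge0$, arranged in levels; each level consists either of white and/or vertical vertices, or only of horizontal vertices (a *horizontal level*). The tree without vertices, of arity 1, is included. Morphisms are generated by contracting adjacent levels (in the order horizontal $\prec$ vertical $\prec$ white, the higher type wins), by raising the type of a vertical vertex to white or of all the vertices of a horizontal level to vertical, and by introducing a level of white vertices of arity 1. The cardinality of a tree is its set of white vertices, the fibres of a morphism are the subtrees contracted to white vertices, and the chosen terminal objects are the white corollas. $\Omega_2^{\mathbb N}$ is the operadic category of 2-level trees (not necessarily pruned) whose leaves of height 2 and whose root are coloured by $\mathbb N$; the cardinality is the set of leaves of height 2. The operadic functor $\Omega:\mathrm{LTr}\to\Omega_2^{\mathbb N}$ sends $\beta$ to the 2-level tree whose 1-vertices are the non-horizontal levels of $\beta$, whose leaves are the white vertices, coloured by their arities, and whose output colour is the arity of $\beta$. **Endomorphism objects.** For a collection $\mathscr E=\{\mathscr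 E(n)\}_{n\ge 0}$ in $\mathscr D$ and $T\in\Omega_2^{\mathbb N}$ with output colour $n$, let $\mathscr E^T$ be the $\boxtimes_0$-product, in reversed order, over the 1-vertices of $T$, of the $\boxtimes_1$-products of the objects $\mathscr E(c)$ over the colours $c$ of the leaves above the 1-vertex ($v$ if there are none), and put $\mathrm{End}^{\Omega_2^{\mathbb N}}_{\mathscr E}(T)=\mathscr D(\mathscr E^T,\mathscr E(n))\in V$, with the structure maps given by the interchange and composition. Likewise, for $\beta\in\mathrm{LTr}$ of arity $n$, $\mathscr E^\beta$ is the $\boxtimes_0$-product, in reversed order from the root level on, over the levels of $\beta$, of the $\boxtimes_1$-products over the vertices of the level of: $\mathscr E(k)$ for a white vertex of arity $k$, $v$ for a vertical vertex, $e$ for a horizontal vertex; a level without vertices contributes $v$ if it is not horizontal and $e$ if it is horizontal. Put $\mathrm{End}^{\mathrm{LTr}}_{\mathscr E}(\beta)=\mathscr D(\mathscr E^\beta,\mathscr E(n))$. This $\mathrm{LTr}$-collection has structure operations given, in addition, by $\delta$, $\varepsilon$, $\mu$ and the maps $e\boxtimes_1\cdots\boxtimes_1e\to e$ applying $\varepsilon$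 to all factors but the first. The iterated $\delta$ on horizontal levels gives maps $\theta_\beta:\mathscr E^{\Omega(\beta)}\to\mathscr E^\beta$, which induce $\Lambda_\beta:\mathrm{End}^{\mathrm{LTr}}_{\mathscr E}(\beta)\to\mathrm{End}^{\Omega_2^{\mathbb N}}_{\mathscr E}(\Omega(\beta))$. For a multiplicative 1-operad $\mathscr A$ and $\beta\in\mathrm{LTr}$ of arity $n$, let $\Psi_\beta:\mathbf 1=\mathbf 1^{\mathrm{LTr}}(\beta)\to\mathrm{End}^{\mathrm{LTr}}_{\mathscr A}(\beta)$ be given by the map $\mathscr A^\beta\to\mathscr A(n)$ which applies $\alpha:v\to\mathscr A(k)$ at the vertical vertices, $e\xrightarrow{\varepsilon}v\xrightarrow{\alpha}\mathscr A(k)$ at the horizontal vertices, $\varepsilon:e\to v$ at the horizontal levels without vertices, and then the iterated structure maps of $\mathscr A$, starting with $j$ at the root. Here $\mathbf 1^{\mathrm{LTr}}$ is the $\mathrm{LTr}$-operad all of whose components are the unit of $V$. **Theorem.** 1. The maps $\Psi_\beta$ form a map of $\mathrm{LTr}$-collections $\Psi:\mathbf 1^{\mathrm{LTr}}\to\mathrm{End}^{\mathrm{LTr}}_{\mathscr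 A}$ which is natural in $\mathscr A$: for each morphism $F:\mathscr A\to\mathscr B$ of multiplicative 1-operads in $\mathscr D$ and each $\beta$, the two composites $\mathbf 1\to\mathscr D(\mathscr A^\beta,\mathscr B(n))$ given by $\Psi_\beta$ for $\mathscr A$ followed by $F(n)$, and by $\Psi_\beta$ for $\mathscr B$ preceded by $F^\beta:\mathscr A^\beta\to\mathscr B^\beta$, agree. 2. For each multiplicative 1-operad $\mathscr A$ in $\mathscr D$, the composite $$\Xi:\mathbf 1^{\mathrm{LTr}}\xrightarrow{\ \Psi\ }\mathrm{End}^{\mathrm{LTr}}_{\mathscr A}\xrightarrow{\ \Lambda\ }\Omega^*\mathrm{End}^{\Omega_2^{\mathbb N}}_{\mathscr A}$$ is a morphism of $\mathrm{LTr}$-operads; in particular its source and its target are $\mathrm{LTr}$-operads. 3. If the two maps $e\boxtimes_1e\to e\boxtimes_1v=e$ and $e\boxtimes_1e\to v\boxtimes_1e=e$ induced by $\varepsilon:e\to v$ agree, then $\mathrm{End}^{\mathrm{LTr}}_{\mathscr A}$ is an $\mathrm{LTr}$-operad and $\Psi$, $\Lambda$ (and $\Xi$) are morphisms of $\mathrm{LTr}$-operads.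 -/

import Mathlib

open CategoryTheory MonoidalCategory

/-! ### Tensor products of finite families in a symmetric monoidal category -/

section Tensors

universe vV uV
variable {V : Type uV} [Category.{vV} V] [MonoidalCategory V] {ι κ : Type*}

/-- `F i₁ ⊗ (F i₂ ⊗ ⋯ ⊗ 𝟙_ V)` for a list `[i₁, i₂, …]` of indices. -/
def tensL (F : ι → V) : List ι → V
  | [] => 𝟙_ V
  | i :: l => F i ⊗ tensL F l

/-- Tensor product of a family of morphisms. -/
def tensMap {F G : ι → V} (φ : ∀ i, F i ⟶ G i) : ∀ l : List ι, tensL F l ⟶ tensL G l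
  | [] => 𝟙 _
  | i :: l => φ i ⊗ₘ tensMap φ l

/-- The tensor product of a family of morphisms out of the unit. -/
def tensUnit {F : ι → V} (η : ∀ i, 𝟙_ V ⟶ F i) : ∀ l : List ι, 𝟙_ V ⟶ tensL F l
  | [] => 𝟙 _
  | i :: l => (λ_ (𝟙_ V)).inv ≫ (η i ⊗ₘ tensUnit η l)

theorem tensL_map (g : κ → ι) (F : ι → V) :
    ∀ l : List κ, tensL F (l.map g) = tensL (fun k => F (g k)) l
  | [] => rfl
  | k :: l => congrArg (fun Z => F (g k) ⊗ Z) (tensL_map g F l)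

/-- The tensor product over a concatenation. -/
def tensSplit (F : ι → V) (l' : List ι) :
    ∀ l : List ι, tensL F (l ++ l') ⟶ tensL F l ⊗ tensL F l'
  | [] => (λ_ _).inv
  | i :: l => (F i ◁ tensSplit F l' l) ≫ (α_ _ _ _).inv

/-- The tensor product over a concatenation of a family of lists. -/
def tensUnflatten (F : ι → V) (r : κ → List ι) :
    ∀ m : List κ, tensL F (m.flatMap r) ⟶ tensL (fun k => tensL F (r k)) m
  | [] => 𝟙 _
  | k :: m => eqToHom (by rw [List.flatMap_cons]) ≫ tensSplit F (m.flatMap r) (r k) ≫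
      (_ ◁ tensUnflatten F r m)

variable [SymmetricCategory V]

/-- The symmetry moving the factor with index `j` to the front. -/
def tensPull [DecidableEq ι] (F : ι → V) (j : ι) :
    ∀ l : List ι, j ∈ l → (tensL F l ⟶ F j ⊗ tensL F (l.erase j))
  | i :: l, h =>
    if hij : i = j then eqToHom (by subst hij; simp [tensL])
    else (F i ◁ tensPull F j l (by simpa [Ne.symm hij] using h)) ≫ (α_ _ _ _).inv ≫
      ((β_ (F i) (F j)).hom ▷ _) ≫ (α_ _ _ _).hom ≫
      eqToHom (by rw [List.erase_cons_tail (by simpa using hij)]; rfl)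

/-- The symmetry permuting the factors of a tensor product from the order `l` to the order `m`. -/
def tensReorder [DecidableEq ι] (F : ι → V) :
    ∀ m l : List ι, l.Perm m → (tensL F l ⟶ tensL F m)
  | [], l, h => eqToHom (by rw [List.perm_nil.1 h])
  | j :: m, l, h => tensPull F j l (h.mem_iff.2 List.mem_cons_self) ≫
      (F j ◁ tensReorder F m (l.erase j) (by
        simpa using h.erase j))

/-- `⨂ (F i ⊗ G i) ≅ (⨂ F i) ⊗ (⨂ G i)`, from right to left. -/
def tensZip (F G : ι → V) :
    ∀ l : List ι, tensL F l ⊗ tensL G l ⟶ tensL (fun i => F i ⊗ G i) l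
  | [] => (λ_ _).hom
  | i :: l => tensorμ (F i) (tensL F l) (G i) (tensL G l) ≫ (_ ◁ tensZip F G l)

end Tensors

/-! ### Operadic categories -/

section OpCat

universe u v

/-- A strict operadic category. The cardinality of `T` is the set `Idx T`, linearly ordered by the
list `elems T`; `fib f i` is the fibre `f⁻¹(i)` and `emb` is the inclusion of its cardinality;
`U c` is the chosen terminal object of the connected component `c`. -/
structure OperadicCategory where
  C : Type u
  [cat : Category.{v} C]
  Idx : C → Type
  [decIdx : ∀ T, DecidableEq (Idx T)]
  elems : ∀ T, List (Idx T)
  elems_nodup : ∀ T, (elems T).Nodup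
  mem_elems : ∀ T i, i ∈ elems T
  idx : ∀ {T S : C}, (T ⟶ S) → Idx T → Idx S
  idx_id : ∀ (T : C) i, idx (𝟙 T) i = i
  idx_comp : ∀ {T S R : C} (f : T ⟶ S) (g : S ⟶ R) i, idx (f ≫ g) i = idx g (idx f i)
  Comp : Type
  comp : C → Comp
  comp_hom : ∀ {T S : C}, (T ⟶ S) → comp T = comp S
  U : Comp → C
  comp_U : ∀ c, comp (U c) = c
  toU : ∀ T, T ⟶ U (comp T)
  toU_unique : ∀ {T : C} (f : T ⟶ U (comp T)), f = toU T
  fib : ∀ {T S : C}, (T ⟶ S) → Idx S → C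
  emb : ∀ {T S : C} (f : T ⟶ S) (i : Idx S), Idx (fib f i) → Idx T
  emb_elems : ∀ {T S : C} (f : T ⟶ S) (i : Idx S),
    (elems (fib f i)).map (emb f i) = (elems T).filter fun j => idx f j = i
  /-- the chosen terminal objects have cardinality one -/
  elems_U : ∀ c, (elems (U c)).length = 1
  /-- the fibres of identities are chosen terminal objects -/
  fib_id : ∀ (T : C) i, fib (𝟙 T) i = U (comp (fib (𝟙 T) i))
  /-- the fibre functors -/
  fibMap : ∀ {T S R : C} (f : T ⟶ S) (g : S ⟶ R) (h : T ⟶ R), f ≫ g = h →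
    ∀ i : Idx R, fib h i ⟶ fib g i
  idx_fibMap : ∀ {T S R : C} (f : T ⟶ S) (g : S ⟶ R) (h : T ⟶ R) (w : f ≫ g = h)
    (i : Idx R) (k : Idx (fib h i)), emb g i (idx (fibMap f g h w i) k) = idx f (emb h i k)
  fibMap_id : ∀ {S R : C} (g : S ⟶ R) (i : Idx R),
    fibMap (𝟙 S) g g (Category.id_comp g) i = 𝟙 (fib g i)
  fibMap_comp : ∀ {T S Q R : C} (f : T ⟶ S) (a : S ⟶ Q) (b : T ⟶ Q) (h : T ⟶ R) (g : S ⟶ R)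
    (c : Q ⟶ R) (wb : f ≫ a = b) (wh : f ≫ g = h) (wg : a ≫ c = g) (wh' : b ≫ c = h) (i : Idx R),
    fibMap f g h wh i ≫ fibMap a c g wg i = fibMap b c h wh' i
  fib_toU : ∀ {T : C} {c : Comp} (f : T ⟶ U c) (i : Idx (U c)), fib f i = T
  fibMap_toU : ∀ {T S : C} {c : Comp} (f : T ⟶ S) (g : S ⟶ U c) (h : T ⟶ U c) (w : f ≫ g = h)
    (i : Idx (U c)), HEq (fibMap f g h w i) f
  /-- the fibres of an induced map between fibres are fibres of the original map -/
  fib_fibMap : ∀ {T S R : C} (f : T ⟶ S) (g : S ⟶ R) (h : T ⟶ R) (w : f ≫ g = h)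
    (i : Idx R) (k : Idx (fib g i)), fib (fibMap f g h w i) k = fib f (emb g i k)
  /-- compatibility of the fibre functors of a composite -/
  fibMap_fibMap : ∀ {T S Q R : C} (f : T ⟶ S) (a : S ⟶ Q) (b : T ⟶ Q) (h : T ⟶ R) (g : S ⟶ R)
    (c : Q ⟶ R) (wb : f ≫ a = b) (wh : f ≫ g = h) (wg : a ≫ c = g) (wh' : b ≫ c = h)
    (i : Idx R) (k : Idx (fib c i)),
    HEq (fibMap (fibMap f g h wh i) (fibMap a c g wg i) (fibMap b c h wh' i)
      (fibMap_comp f a b h g c wb wh wg wh' i) k) (fibMap f a b wb (emb c i k))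

attribute [instance] OperadicCategory.cat OperadicCategory.decIdx

end OpCat

namespace OperadicCategory

variable {O : OperadicCategory}

theorem emb_nodup {T S : O.C} (f : T ⟶ S) (i : O.Idx S) :
    ((O.elems (O.fib f i)).map (O.emb f i)).Nodup := by
  rw [O.emb_elems]; exact (O.elems_nodup T).filter _

theorem idx_emb {T S : O.C} (f : T ⟶ S) (i : O.Idx S) (k : O.Idx (O.fib f i)) :
    O.idx f (O.emb f i k) = i := by
  have h : O.emb f i k ∈ (O.elems (O.fib f i)).map (O.emb f i) :=
    List.mem_map_of_mem (O.mem_elems _ k)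
  rw [O.emb_elems] at h
  simpa using (List.mem_filter.1 h).2

/-- Regrouping `|S|` by the fibres of `g : S ⟶ R`. -/
theorem elems_perm {S R : O.C} (g : S ⟶ R) :
    (O.elems S).Perm
      ((O.elems R).flatMap fun i => (O.elems (O.fib g i)).map (O.emb g i)) := by
  refine (List.perm_ext_iff_of_nodup (O.elems_nodup S) ?_).2 fun j => ?_
  · rw [List.nodup_flatMap]
    refine ⟨fun i _ => emb_nodup g i, (O.elems_nodup R).imp ?_⟩
    intro i i' hne x hx hx'
    dsimp only at hx hx'
    rw [O.emb_elems] at hx hx'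
    apply hne
    have h1 := (List.mem_filter.1 hx).2
    have h2 := (List.mem_filter.1 hx').2
    simp only [decide_eq_true_eq] at h1 h2
    rw [← h1, h2]
  · simp only [List.mem_flatMap, O.emb_elems, List.mem_filter, O.mem_elems, true_and,
      decide_eq_true_eq, exists_eq', iff_self]

end OperadicCategory

/-! ### Operads over an operadic category -/

section Operads

universe u v vV uV

/-- The underlying data of an `O`-operad in `V`: a collection with units and structure maps. -/
structure OperadData (O : OperadicCategory.{u, v}) (V : Type uV) [Category.{vV} V]
    [MonoidalCategory V] where
  obj : O.C → V
  unit : ∀ c, 𝟙_ V ⟶ obj (O.U c)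
  mul : ∀ {T S : O.C} (f : T ⟶ S),
    tensL (fun i => obj (O.fib f i)) (O.elems S) ⊗ obj S ⟶ obj T

namespace OperadData

variable {O : OperadicCategory.{u, v}} {V : Type uV} [Category.{vV} V] [MonoidalCategory V]
  (P Q : OperadData O V)

/-- `P(f) = ⨂_{i ∈ |S|} P(f⁻¹(i))` -/
def fam {T S : O.C} (f : T ⟶ S) : V := tensL (fun i => P.obj (O.fib f i)) (O.elems S)

/-- `P(T) ≅ P(!_T)` for the morphism `!_T` from `T` to the chosen terminal object. -/
def toFam {Z : V} {ι : Type*} (F : ι → V) (hF : ∀ i, F i = Z) :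
    ∀ l : List ι, l.length = 1 → (Z ⟶ tensL F l)
  | [i], _ => (ρ_ Z).inv ≫ (eqToHom (hF i).symm ▷ _)

/-- The canonical isomorphism `P(f) ≅ ⨂_{i ∈ |R|} P(f_i)` for `f : T ⟶ S` over `R`. -/
def regroup [SymmetricCategory V] {T S R : O.C} (f : T ⟶ S) (g : S ⟶ R) (h : T ⟶ R)
    (w : f ≫ g = h) :
    P.fam f ⟶ tensL (fun i => P.fam (O.fibMap f g h w i)) (O.elems R) :=
  tensReorder _ ((O.elems R).flatMap fun i => (O.elems (O.fib g i)).map (O.emb g i)) (O.elems S)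
      (OperadicCategory.elems_perm g) ≫
    tensUnflatten _ _ _ ≫
    tensMap (fun i => eqToHom (by
      rw [tensL_map]; unfold fam; congr 1; funext k; rw [O.fib_fibMap])) _

/-- The axioms of an operad. -/
structure IsOperad [SymmetricCategory V] : Prop where
  assoc : ∀ {T S R : O.C} (f : T ⟶ S) (g : S ⟶ R) (h : T ⟶ R) (w : f ≫ g = h),
    (P.fam f ◁ P.mul g) ≫ P.mul f =
      (α_ (P.fam f) (P.fam g) (P.obj R)).inv ≫
        (((P.regroup f g h w ▷ P.fam g) ≫ tensZip _ _ (O.elems R) ≫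
          tensMap (fun i => P.mul (O.fibMap f g h w i)) (O.elems R)) ▷ P.obj R) ≫ P.mul h
  unit_left : ∀ T : O.C,
    (λ_ (P.obj T)).inv ≫
      (tensUnit (F := fun i => P.obj (O.fib (𝟙 T) i))
        (fun i => P.unit (O.comp (O.fib (𝟙 T) i)) ≫ eqToHom (by rw [← O.fib_id])) (O.elems T) ▷
          P.obj T) ≫ P.mul (𝟙 T) = 𝟙 (P.obj T)
  unit_right : ∀ T : O.C,
    (ρ_ (P.obj T)).inv ≫
      (toFam (fun i => P.obj (O.fib (O.toU T) i)) (fun i => by rw [O.fib_toU]) _ (O.elems_U _) ⊗ₘ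
        P.unit (O.comp T)) ≫ P.mul (O.toU T) = 𝟙 (P.obj T)

variable {P Q}

/-- A collection of maps commutes with the structure operations. -/
structure Commutes (P Q : OperadData O V) (φ : ∀ T, P.obj T ⟶ Q.obj T) : Prop where
  unit : ∀ c, P.unit c ≫ φ (O.U c) = Q.unit c
  mul : ∀ {T S : O.C} (f : T ⟶ S),
    P.mul f ≫ φ T = (tensMap (fun i => φ (O.fib f i)) (O.elems S) ⊗ₘ φ S) ≫ Q.mul f

/-- `φ` is a morphism of operads: its source and target are operads, and `φ` commutes with the
structure operations. -/
structure IsOperadHom [SymmetricCategory V] (P Q : OperadData O V)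
    (φ : ∀ T, P.obj T ⟶ Q.obj T) : Prop where
  source : P.IsOperad
  target : Q.IsOperad
  commutes : Commutes P Q φ

/-- Contraction of a tensor power of the unit. -/
def unitPow {ι : Type*} : ∀ l : List ι, tensL (fun _ => 𝟙_ V) l ⟶ 𝟙_ V
  | [] => 𝟙 _
  | _ :: l => (λ_ _).hom ≫ unitPow l

/-- The operad `𝟏` with all components the unit of `V`. -/
def one (O : OperadicCategory.{u, v}) (V : Type uV) [Category.{vV} V] [MonoidalCategory V] :
    OperadData O V where
  obj _ := 𝟙_ V
  unit _ := 𝟙 _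
  mul {_ S} _ := (unitPow (O.elems S) ▷ _) ≫ (λ_ _).hom

end OperadData

/-- A strict operadic functor. -/
structure OperadicFunctor (O P : OperadicCategory.{u, v}) where
  F : O.C ⥤ P.C
  idxMap : ∀ T, O.Idx T → P.Idx (F.obj T)
  idxMap_elems : ∀ T, (O.elems T).map (idxMap T) = P.elems (F.obj T)
  idxMap_idx : ∀ {T S : O.C} (f : T ⟶ S) (i : O.Idx T),
    idxMap S (O.idx f i) = P.idx (F.map f) (idxMap T i)
  fib_eq : ∀ {T S : O.C} (f : T ⟶ S) (i : O.Idx S),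
    F.obj (O.fib f i) = P.fib (F.map f) (idxMap S i)
  fibMap_eq : ∀ {T S R : O.C} (f : T ⟶ S) (g : S ⟶ R) (h : T ⟶ R) (w : f ≫ g = h) (i : O.Idx R),
    HEq (F.map (O.fibMap f g h w i))
      (P.fibMap (F.map f) (F.map g) (F.map h) (by rw [← F.map_comp, w]) (idxMap R i))
  compMap : O.Comp → P.Comp
  U_eq : ∀ c, F.obj (O.U c) = P.U (compMap c)

/-- The restriction of a `P`-operad along an operadic functor. -/
def OperadData.restrict {O P : OperadicCategory.{u, v}} (F : OperadicFunctor O P) {V : Type uV}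
    [Category.{vV} V] [MonoidalCategory V] (Q : OperadData P V) : OperadData O V where
  obj T := Q.obj (F.F.obj T)
  unit c := Q.unit (F.compMap c) ≫ eqToHom (by rw [F.U_eq])
  mul {T S} f := (eqToHom (by rw [← F.idxMap_elems, tensL_map]; congr 1; funext i
                              rw [F.fib_eq]) ▷ Q.obj (F.F.obj S)) ≫ Q.mul (F.F.map f)

end Operads

/-! ### Levelled families: finite sequences of levels, each a finite sequence of labelled entries -/

/-- A finite sequence of levels; a level has a flag in `A` and a sequence of entries with labels
in `B`. -/
abbrev LevFam (A B : Type) := List (A × List B)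

namespace LevFam

variable {A B A' B' A'' B'' : Type}

abbrev Lev (X : LevFam A B) := Fin X.length

/-- The entries `(d, x)`: level `d`, position `x` in the level. -/
abbrev Pos (X : LevFam A B) := Σ d : Fin X.length, Fin (X.get d).2.length

def flag (X : LevFam A B) (d : X.Lev) : A := (X.get d).1

def label (X : LevFam A B) (p : X.Pos) : B := (X.get p.1).2.get p.2

/-- The entries of level `d`. -/
def row (X : LevFam A B) (d : X.Lev) : List X.Pos := (List.finRange _).map (Sigma.mk d)

/-- All entries, level by level. -/
def positions (X : LevFam A B) : List X.Pos := (List.finRange X.length).flatMap X.row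

theorem mem_row {X : LevFam A B} {d : X.Lev} {p : X.Pos} : p ∈ X.row d ↔ p.1 = d := by
  rcases p with ⟨e, x⟩
  constructor
  · intro h
    obtain ⟨y, -, hy⟩ := List.mem_map.1 h
    exact (congrArg Sigma.fst hy).symm
  · intro h
    cases h
    exact List.mem_map_of_mem (List.mem_finRange x)

theorem row_nodup (X : LevFam A B) (d : X.Lev) : (X.row d).Nodup :=
  (List.nodup_finRange _).map fun x y h => by simpa using h

theorem mem_positions {X : LevFam A B} (p : X.Pos) : p ∈ X.positions :=
  List.mem_flatMap.2 ⟨p.1, List.mem_finRange _, mem_row.2 rfl⟩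

theorem positions_nodup (X : LevFam A B) : X.positions.Nodup := by
  unfold positions
  rw [List.nodup_flatMap]
  refine ⟨fun d _ => X.row_nodup d, (List.nodup_finRange _).imp ?_⟩
  intro d d' hne p hp hp'
  exact hne ((mem_row.1 hp).symm.trans (mem_row.1 hp'))

/-- A map of levels together with a map of entries over it, both order preserving (the latter on
each level). -/
@[ext]
structure Map (X : LevFam A B) (Y : LevFam A' B') where
  lev : X.Lev → Y.Lev
  pos : X.Pos → Y.Pos
  pos_fst : ∀ p, (pos p).1 = lev p.1
  lev_mono : ∀ d e, d ≤ e → lev d ≤ lev e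
  pos_mono : ∀ p q : X.Pos, p.1 = q.1 → p.2.val ≤ q.2.val → (pos p).2.val ≤ (pos q).2.val

namespace Map

def id (X : LevFam A B) : Map X X := ⟨_root_.id, _root_.id, fun _ => rfl, fun _ _ h => h,
  fun _ _ _ h => h⟩

def comp {X : LevFam A B} {Y : LevFam A' B'} {Z : LevFam A'' B''} (f : Map X Y) (g : Map Y Z) :
    Map X Z where
  lev := g.lev ∘ f.lev
  pos := g.pos ∘ f.pos
  pos_fst p := by simp [g.pos_fst, f.pos_fst]
  lev_mono d e h := g.lev_mono _ _ (f.lev_mono _ _ h)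
  pos_mono p q h h' := g.pos_mono _ _ (by rw [f.pos_fst, f.pos_fst, h]) (f.pos_mono _ _ h h')

end Map

/-! #### Subfamilies -/

section Sub

variable (fa : A → A') (fb : B → B') (X : LevFam A B) (P : X.Lev → Bool) (Q : X.Pos → Bool)

/-- The levels selected by `P`. -/
def selLev : List X.Lev := (List.finRange X.length).filter P

/-- The entries of level `d` selected by `Q`. -/
def selPos (d : X.Lev) : List X.Pos := (X.row d).filter Q

/-- The family of the selected levels and entries, relabelled along `fa`, `fb`. -/
def sub : LevFam A' B' :=
  (X.selLev P).map fun d => (fa (X.flag d), (X.selPos Q d).map fun p => fb (X.label p))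

variable {X P Q}

theorem mem_selLev {d : X.Lev} : d ∈ X.selLev P ↔ P d = true := by simp [selLev]

theorem mem_selPos {d : X.Lev} {p : X.Pos} : p ∈ X.selPos Q d ↔ p.1 = d ∧ Q p = true := by
  simp [selPos, mem_row]

theorem selLev_nodup : (X.selLev P).Nodup := (List.nodup_finRange _).filter _

theorem selPos_nodup (d : X.Lev) : (X.selPos Q d).Nodup := (X.row_nodup d).filter _

variable {fa fb}

/-- The inclusion of the selected levels. -/
def incLev (k : (X.sub fa fb P Q).Lev) : X.Lev := (X.selLev P).get (k.cast (by simp [sub]))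

theorem get_sub (k : (X.sub fa fb P Q).Lev) : (X.sub fa fb P Q).get k =
    (fa (X.flag (incLev k)), (X.selPos Q (incLev k)).map fun p => fb (X.label p)) := by
  have key : ∀ {α β : Type} (l : List α) (f : α → β) (k : Fin (l.map f).length),
      (l.map f).get k = f (l.get (k.cast (by simp))) := by
    intro α β l f k
    simp
  exact key _ _ k

/-- The inclusion of the selected entries. -/
def incPos (p : (X.sub fa fb P Q).Pos) : X.Pos :=
  (X.selPos Q (incLev p.1)).get (p.2.cast (by rw [get_sub]; simp))

theorem incLev_mem (k : (X.sub fa fb P Q).Lev) : incLev k ∈ X.selLev P := List.get_mem _ _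

theorem incPos_mem (p : (X.sub fa fb P Q).Pos) : incPos p ∈ X.selPos Q (incLev p.1) :=
  List.get_mem _ _

theorem incPos_fst (p : (X.sub fa fb P Q).Pos) : (incPos p).1 = incLev p.1 :=
  (mem_selPos.1 (incPos_mem p)).1

theorem incLev_sel (k : (X.sub fa fb P Q).Lev) : P (incLev k) = true := mem_selLev.1 (incLev_mem k)

theorem incPos_sel (p : (X.sub fa fb P Q).Pos) : Q (incPos p) = true :=
  (mem_selPos.1 (incPos_mem p)).2

theorem incLev_injective : Function.Injective (incLev : (X.sub fa fb P Q).Lev → X.Lev) := by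
  intro k k' h
  have := (selLev_nodup (X := X) (P := P)).injective_get h
  simpa [Fin.ext_iff] using this

theorem pos_ext {X : LevFam A B} {p q : X.Pos} (h : p.1 = q.1) (h' : p.2.val = q.2.val) :
    p = q := by
  rcases p with ⟨d, x⟩
  rcases q with ⟨e, y⟩
  cases h
  simp only [Fin.val_inj] at h'
  rw [h']

theorem incPos_injective : Function.Injective (incPos : (X.sub fa fb P Q).Pos → X.Pos) := by
  rintro ⟨k, x⟩ ⟨k', x'⟩ h
  have h1 : k = k' := incLev_injective (by rw [← incPos_fst ⟨k, x⟩, ← incPos_fst ⟨k', x'⟩, h])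
  subst h1
  have := (selPos_nodup (X := X) (Q := Q) (incLev k)).injective_get h
  refine pos_ext rfl ?_
  simpa [Fin.ext_iff] using this

variable (fa fb)

/-- The selected level with underlying level `d`. -/
def outLev (d : X.Lev) (h : P d = true) : (X.sub fa fb P Q).Lev :=
  ⟨(X.selLev P).idxOf d, by
    have := List.idxOf_lt_length_of_mem (mem_selLev.2 h)
    simpa [sub] using this⟩

theorem incLev_outLev (d : X.Lev) (h : P d = true) :
    incLev (outLev fa fb (Q := Q) d h) = d := by
  simp [incLev, outLev]

/-- The selected entry with underlying entry `p`. -/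
def outPos (p : X.Pos) (h : P p.1 = true) (h' : Q p = true) : (X.sub fa fb P Q).Pos :=
  ⟨outLev fa fb p.1 h, ⟨(X.selPos Q p.1).idxOf p, by
    have := List.idxOf_lt_length_of_mem (mem_selPos.2 ⟨rfl, h'⟩)
    rw [get_sub, incLev_outLev]
    simpa using this⟩⟩

theorem incLev_outPos (p : X.Pos) (h : P p.1 = true) (h' : Q p = true) :
    incLev (outPos fa fb p h h').1 = p.1 := incLev_outLev fa fb p.1 h

theorem incPos_outPos (p : X.Pos) (h : P p.1 = true) (h' : Q p = true) :
    incPos (outPos fa fb p h h') = p := by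
  have key : ∀ (d : X.Lev) (hd : d = p.1) (n : ℕ) (hn : n < (X.selPos Q d).length),
      n = (X.selPos Q p.1).idxOf p → (X.selPos Q d).get ⟨n, hn⟩ = p := by
    rintro d rfl n hn rfl
    simp
  exact key _ (incLev_outLev fa fb p.1 h) _ _ rfl

variable {fa fb}

theorem sel_pairwise : (X.selLev P).Pairwise (· < ·) :=
  (List.pairwise_lt_finRange _).filter _

theorem incLev_lt {k l : (X.sub fa fb P Q).Lev} (h : k < l) : incLev k < incLev l :=
  List.pairwise_iff_get.1 (sel_pairwise (X := X) (P := P)) _ _ h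

theorem row_pairwise (X : LevFam A B) (d : X.Lev) :
    (X.row d).Pairwise (fun p q => p.2.val < q.2.val) := by
  rw [row, List.pairwise_map]
  exact List.pairwise_lt_finRange _

theorem incPos_lt {p q : (X.sub fa fb P Q).Pos} (h : p.1 = q.1) (h' : p.2.val < q.2.val) :
    (incPos p).2.val < (incPos q).2.val := by
  rcases p with ⟨k, x⟩
  rcases q with ⟨l, y⟩
  cases h
  exact List.pairwise_iff_get.1 ((row_pairwise X (incLev k)).filter Q) _ _ h'

/-- The inclusion of a subfamily. -/
def inc (fa : A → A') (fb : B → B') (X : LevFam A B) (P : X.Lev → Bool) (Q : X.Pos → Bool) :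
    Map (X.sub fa fb P Q) X where
  lev := incLev
  pos := incPos
  pos_fst := incPos_fst
  lev_mono d e h := by
    rcases h.eq_or_lt with rfl | h
    · exact le_rfl
    · exact (incLev_lt h).le
  pos_mono p q h h' := by
    rcases h'.eq_or_lt with h' | h'
    · rw [pos_ext h h']
    · exact (incPos_lt h h').le

end Sub

/-- The restriction of a map to subfamilies. -/
def Map.restrict {C D C' D' : Type} {X : LevFam A B} {Y : LevFam C D} (f : Map X Y)
    (fa : A → A') (fb : B → B') (fc : C → C') (fd : D → D')
    {P : X.Lev → Bool} {Q : X.Pos → Bool} {P' : Y.Lev → Bool} {Q' : Y.Pos → Bool}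
    (hP : ∀ d, P d = true → P' (f.lev d) = true)
    (hQ : ∀ p, P p.1 = true → Q p = true → Q' (f.pos p) = true) :
    Map (X.sub fa fb P Q) (Y.sub fc fd P' Q') where
  lev k := outLev fc fd (f.lev (incLev k)) (hP _ (incLev_sel k))
  pos p := outPos fc fd (f.pos (incPos p))
    (by rw [f.pos_fst, incPos_fst]; exact hP _ (incLev_sel _))
    (hQ _ (by rw [incPos_fst]; exact incLev_sel _) (incPos_sel p))
  pos_fst p := by
    apply incLev_injective
    rw [← incPos_fst, incPos_outPos, incLev_outLev, f.pos_fst, incPos_fst]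
  lev_mono d e h := by
    by_contra hlt
    have := incLev_lt (not_le.1 hlt)
    rw [incLev_outLev, incLev_outLev] at this
    exact absurd (f.lev_mono _ _ ((inc fa fb X P Q).lev_mono _ _ h)) (not_le.2 this)
  pos_mono p q h h' := by
    by_contra hlt
    have hfst : (incPos p).1 = (incPos q).1 := by rw [incPos_fst, incPos_fst, h]
    have := incPos_lt (by
      apply incLev_injective
      rw [incLev_outPos, incLev_outPos, f.pos_fst, f.pos_fst, hfst]) (not_le.1 hlt)
    rw [incPos_outPos, incPos_outPos] at this
    exact absurd (f.pos_mono _ _ hfst ((inc fa fb X P Q).pos_mono _ _ h h')) (not_le.2 this)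

end LevFam

namespace LevFam

variable {A B A' B' A'' B'' : Type}

section Sub

variable {fa : A → A'} {fb : B → B'} {X : LevFam A B} {P : X.Lev → Bool} {Q : X.Pos → Bool}

theorem length_sub : (X.sub fa fb P Q).length = (X.selLev P).length := by simp [sub]

theorem map_incLev : (List.finRange (X.sub fa fb P Q).length).map incLev = X.selLev P := by
  apply List.ext_get
  · rw [List.length_map, List.length_finRange, length_sub]
  · intro n h1 h2
    simp [incLev]

theorem map_incPos (k : (X.sub fa fb P Q).Lev) :
    ((X.sub fa fb P Q).row k).map incPos = X.selPos Q (incLev k) := by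
  apply List.ext_get
  · rw [row, List.length_map, List.length_map, List.length_finRange, get_sub]
    simp
  · intro n h1 h2
    simp [incPos, row]

theorem flag_sub (k : (X.sub fa fb P Q).Lev) :
    (X.sub fa fb P Q).flag k = fa (X.flag (incLev k)) := by rw [flag, get_sub]

theorem label_sub (p : (X.sub fa fb P Q).Pos) :
    (X.sub fa fb P Q).label p = fb (X.label (incPos p)) := by
  have key : ∀ (a : A' × List B') (k : X.Lev)
      (h : a = (fa (X.flag k), (X.selPos Q k).map fun p => fb (X.label p)))
      (n : ℕ) (h1 : n < a.2.length) (h2 : n < (X.selPos Q k).length),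
      a.2.get ⟨n, h1⟩ = fb (X.label ((X.selPos Q k).get ⟨n, h2⟩)) := by
    rintro a k rfl n h1 h2
    simp
  exact key _ _ (get_sub p.1) _ p.2.2 _

theorem map_positions : (X.sub fa fb P Q).positions.map incPos =
    X.positions.filter fun p => P p.1 && Q p := by
  have h2 : ∀ d, (X.row d).filter (fun p => P p.1 && Q p) = if P d then X.selPos Q d else [] := by
    intro d
    split_ifs with h
    · apply List.filter_congr
      intro p hp
      rw [mem_row.1 hp, h, Bool.true_and]
    · apply List.filter_eq_nil_iff.2
      intro p hp
      rw [mem_row.1 hp]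
      simp [h]
  have h3 : ∀ l : List X.Lev,
      (l.filter P).flatMap (X.selPos Q) = l.flatMap fun d => if P d then X.selPos Q d else [] := by
    intro l
    induction l with
    | nil => rfl
    | cons d l ih =>
      by_cases hd : P d = true
      · rw [List.filter_cons_of_pos hd, List.flatMap_cons, List.flatMap_cons, ih, if_pos hd]
      · rw [List.filter_cons_of_neg hd, List.flatMap_cons, ih, if_neg hd, List.nil_append]
  have h1 : (X.sub fa fb P Q).positions.map incPos = (X.selLev P).flatMap (X.selPos Q) := by
    rw [← map_incLev (fa := fa) (fb := fb) (Q := Q), positions, List.map_flatMap, List.flatMap_map]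
    congr 1
    funext k
    exact map_incPos k
  rw [h1, positions, List.filter_flatMap, selLev, h3]
  simp only [h2]

end Sub

theorem Map.heq_of_val {X X' : LevFam A B} {Y : LevFam A' B'} (e : X = X') {f : Map X Y}
    {g : Map X' Y} (h : ∀ (k : X.Lev) (k' : X'.Lev), k.val = k'.val → f.lev k = g.lev k')
    (h' : ∀ (p : X.Pos) (p' : X'.Pos), p.1.val = p'.1.val → p.2.val = p'.2.val →
      f.pos p = g.pos p') : HEq f g := by
  subst e
  apply heq_of_eq
  ext1
  · funext k; exact h k k rfl
  · funext p; exact h' p p rfl rfl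

theorem Map.heq_of_comp {X X' : LevFam A B} {Y Y' : LevFam A' B'} {X₀ : LevFam A'' B''}
    {A₃ B₃ : Type} {Y₀ : LevFam A₃ B₃} (eX : X = X') (eY : Y = Y') {f : Map X Y} {g : Map X' Y'}
    {jX : Map X X₀} {jX' : Map X' X₀} {jY : Map Y Y₀} {jY' : Map Y' Y₀} (hX : HEq jX jX')
    (hY : HEq jY jY') (hl : Function.Injective jY'.lev) (hp : Function.Injective jY'.pos)
    (f₀ : Map X₀ Y₀) (h : f.comp jY = jX.comp f₀) (h' : g.comp jY' = jX'.comp f₀) : HEq f g := by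
  subst eX eY
  cases hX
  cases hY
  have h2 := h.trans h'.symm
  apply heq_of_eq
  ext1
  · funext k
    exact hl (congrFun (congrArg Map.lev h2) k)
  · funext p
    exact hp (congrFun (congrArg Map.pos h2) p)

section SubSub

variable {fa : A → A'} {fb : B → B'} {X : LevFam A B} {P : X.Lev → Bool} {Q : X.Pos → Bool}
  {fa' : A' → A''} {fb' : B' → B''} {P' : (X.sub fa fb P Q).Lev → Bool}
  {Q' : (X.sub fa fb P Q).Pos → Bool} {P₂ : X.Lev → Bool} {Q₂ : X.Pos → Bool}

theorem map_selLev (hP : ∀ k, P' k = P₂ (incLev k)) (hP' : ∀ d, P₂ d = true → P d = true) :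
    ((X.sub fa fb P Q).selLev P').map incLev = X.selLev P₂ := by
  rw [selLev, show P' = P₂ ∘ incLev from funext hP, ← List.filter_map, map_incLev, selLev,
    List.filter_filter, selLev]
  apply List.filter_congr
  intro d _
  have := hP' d
  cases h1 : P₂ d <;> simp_all

theorem map_selPos (hQ : ∀ p, Q' p = Q₂ (incPos p))
    (hQ' : ∀ p, P₂ p.1 = true → Q₂ p = true → Q p = true) (k : (X.sub fa fb P Q).Lev)
    (hk : P₂ (incLev k) = true) :
    ((X.sub fa fb P Q).selPos Q' k).map incPos = X.selPos Q₂ (incLev k) := by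
  rw [selPos, show Q' = Q₂ ∘ incPos from funext hQ, ← List.filter_map, map_incPos, selPos,
    List.filter_filter, selPos]
  apply List.filter_congr
  intro p hp
  have := hQ' p (by rw [mem_row.1 hp]; exact hk)
  cases h1 : Q₂ p <;> simp_all

variable (fa' fb')

/-- A subfamily of a subfamily is a subfamily. -/
theorem sub_sub (hP : ∀ k, P' k = P₂ (incLev k)) (hP' : ∀ d, P₂ d = true → P d = true)
    (hQ : ∀ p, Q' p = Q₂ (incPos p)) (hQ' : ∀ p, P₂ p.1 = true → Q₂ p = true → Q p = true) :
    (X.sub fa fb P Q).sub fa' fb' P' Q' = X.sub (fa' ∘ fa) (fb' ∘ fb) P₂ Q₂ := by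
  change List.map _ _ = List.map _ _
  rw [← map_selLev hP hP', List.map_map]
  apply List.map_congr_left
  intro k hk
  have hk' : P₂ (incLev k) = true := by rw [← hP]; exact mem_selLev.1 hk
  rw [Function.comp, ← map_selPos hQ hQ' k hk', flag_sub, List.map_map]
  congr 1
  apply List.map_congr_left
  intro p _
  simp [label_sub]

theorem inc_inc (hP : ∀ k, P' k = P₂ (incLev k)) (hP' : ∀ d, P₂ d = true → P d = true)
    (hQ : ∀ p, Q' p = Q₂ (incPos p)) (hQ' : ∀ p, P₂ p.1 = true → Q₂ p = true → Q p = true) :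
    HEq ((inc fa' fb' (X.sub fa fb P Q) P' Q').comp (inc fa fb X P Q))
      (inc (fa' ∘ fa) (fb' ∘ fb) X P₂ Q₂) := by
  have get_eq : ∀ {α β : Type} (l : List α) (l' : List β) (f : α → β), l.map f = l' →
      ∀ (n n' : ℕ) (h : n < l.length) (h' : n' < l'.length), n = n' →
      f (l.get ⟨n, h⟩) = l'.get ⟨n', h'⟩ := by
    rintro α β l l' f rfl n n' h h' rfl
    simp
  have hlev : ∀ (k : ((X.sub fa fb P Q).sub fa' fb' P' Q').Lev)
      (k' : (X.sub (fa' ∘ fa) (fb' ∘ fb) P₂ Q₂).Lev), k.val = k'.val →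
      incLev (incLev k) = incLev k' :=
    fun k k' hk => get_eq _ _ _ (map_selLev hP hP') _ _ _ _ hk
  apply Map.heq_of_val (sub_sub fa' fb' hP hP' hQ hQ')
  · exact hlev
  · intro p p' h1 h2
    have h3 := hlev _ _ h1
    have h4 : P₂ (incLev (incLev p.1)) = true := by rw [← hP]; exact incLev_sel _
    have h5 := map_selPos hQ hQ' (incLev p.1) h4
    rw [h3] at h5
    exact get_eq _ _ _ h5 _ _ _ _ h2

end SubSub

section All

variable {X : LevFam A B} {P : X.Lev → Bool} {Q : X.Pos → Bool}

theorem selLev_all (hP : ∀ d, P d = true) : X.selLev P = List.finRange X.length := by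
  simp [selLev, hP]

theorem selPos_all (hQ : ∀ p, Q p = true) (d : X.Lev) : X.selPos Q d = X.row d := by
  simp [selPos, hQ]

theorem sub_all (hP : ∀ d, P d = true) (hQ : ∀ p, Q p = true) : X.sub id id P Q = X := by
  rw [sub, selLev_all hP]
  apply List.ext_get
  · simp
  · intro n h1 h2
    simp only [List.get_eq_getElem, List.getElem_map, List.getElem_finRange, selPos_all hQ, row,
      List.map_map, flag, label, id]
    refine Prod.ext rfl ?_
    apply List.ext_get <;> simp

theorem inc_all (hP : ∀ d, P d = true) (hQ : ∀ p, Q p = true) :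
    HEq (inc id id X P Q) (Map.id X) := by
  have get_eq : ∀ {α : Type} (l l' : List α), l = l' →
      ∀ (n n' : ℕ) (h : n < l.length) (h' : n' < l'.length), n = n' →
      l.get ⟨n, h⟩ = l'.get ⟨n', h'⟩ := by
    rintro α l l' rfl n n' h h' rfl
    rfl
  have hlev : ∀ (k : (X.sub id id P Q).Lev) (k' : X.Lev), k.val = k'.val → incLev k = k' := by
    intro k k' h
    have h5 := get_eq _ _ (selLev_all hP) k.val k'.val
      (by rw [← length_sub (fa := id) (fb := id) (Q := Q)]; exact k.2) (by simp) h
    refine h5.trans ?_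
    simp
  apply Map.heq_of_val (sub_all hP hQ)
  · exact hlev
  · rintro p ⟨d, x⟩ h1 h2
    have h3 : incLev p.1 = d := hlev _ _ h1
    have h4 := selPos_all (X := X) hQ (incLev p.1)
    have hb : ∀ e, incLev p.1 = e → p.2.val < (X.selPos Q e).length := by
      rintro e rfl
      exact (p.2.cast (by rw [get_sub]; simp) : Fin (X.selPos Q (incLev p.1)).length).2
    rw [h3] at h4
    have h5 := get_eq _ _ h4 p.2.val x.val (hb d h3) (by simp [row]) h2
    change incPos p = _
    have h6 : incPos p = (X.selPos Q d).get ⟨p.2.val, hb d h3⟩ := get_eq _ _ (by rw [h3]) _ _ _ _ rfl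
    rw [h6, h5]
    simp [row, Map.id]

end All

end LevFam

namespace LevFam

variable {A B A' B' A'' B'' : Type}

/-! #### Fibres of maps -/

section Fibres

variable {X : LevFam A B} {Y : LevFam A' B'} {Z : LevFam A'' B''}

/-- The fibre of a map over an entry `i`: the levels over the level of `i`, and in them the entries
over `i`. -/
abbrev fib (f : Map X Y) (i : Y.Pos) : LevFam A B :=
  X.sub id id (fun d => decide (f.lev d = i.1)) (fun q => decide (f.pos q = i))

/-- The map between fibres induced by `f`, where `h = f ≫ g`. -/
def fibMap (f : Map X Y) (g : Map Y Z) (h : Map X Z) (w : f.comp g = h) (i : Z.Pos) :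
    Map (fib h i) (fib g i) :=
  f.restrict id id id id (by subst w; exact fun _ h => h) (by subst w; exact fun _ _ h => h)

/-- The inclusion of a fibre. -/
abbrev fibInc (f : Map X Y) (i : Y.Pos) : Map (fib f i) X := inc id id X _ _

@[simp] theorem lev_incLev {f : Map X Y} {i : Y.Pos} (k : (fib f i).Lev) :
    f.lev (incLev k) = i.1 := by simpa using incLev_sel k

@[simp] theorem pos_incPos {f : Map X Y} {i : Y.Pos} (k : (fib f i).Pos) :
    f.pos (incPos k) = i := by simpa using incPos_sel k

theorem restrict_inc {C D C' D' : Type} {W : LevFam C D} (f : Map X W)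
    (fa : A → A') (fb : B → B') (fc : C → C') (fd : D → D')
    {P : X.Lev → Bool} {Q : X.Pos → Bool} {P' : W.Lev → Bool} {Q' : W.Pos → Bool}
    (hP : ∀ d, P d = true → P' (f.lev d) = true)
    (hQ : ∀ p, P p.1 = true → Q p = true → Q' (f.pos p) = true) :
    (f.restrict fa fb fc fd hP hQ).comp (inc fc fd W P' Q') = (inc fa fb X P Q).comp f := by
  ext1
  · funext k; exact incLev_outLev _ _ _ (hP _ (incLev_sel k))
  · funext k
    exact incPos_outPos _ _ _ (by rw [f.pos_fst, incPos_fst]; exact hP _ (incLev_sel k.1))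
      (hQ _ (by rw [incPos_fst]; exact incLev_sel k.1) (incPos_sel k))

theorem fibMap_inc (f : Map X Y) (g : Map Y Z) (h : Map X Z) (w : f.comp g = h) (i : Z.Pos) :
    (fibMap f g h w i).comp (fibInc g i) = (fibInc h i).comp f := restrict_inc _ _ _ _ _ _ _

theorem incPos_fibMap (f : Map X Y) (g : Map Y Z) (h : Map X Z) (w : f.comp g = h) (i : Z.Pos)
    (k : (fib h i).Pos) : incPos ((fibMap f g h w i).pos k) = f.pos (incPos k) :=
  congrFun (congrArg Map.pos (fibMap_inc f g h w i)) k

theorem incLev_fibMap (f : Map X Y) (g : Map Y Z) (h : Map X Z) (w : f.comp g = h) (i : Z.Pos)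
    (k : (fib h i).Lev) : incLev ((fibMap f g h w i).lev k) = f.lev (incLev k) :=
  congrFun (congrArg Map.lev (fibMap_inc f g h w i)) k

theorem map_eq_of_comp {j : Map Y Z} (hl : Function.Injective j.lev)
    (hp : Function.Injective j.pos) {f g : Map X Y} (h : f.comp j = g.comp j) : f = g := by
  ext1
  · funext k; exact hl (congrFun (congrArg Map.lev h) k)
  · funext k; exact hp (congrFun (congrArg Map.pos h) k)

theorem id_comp (g : Map Y Z) : (Map.id Y).comp g = g := rfl

theorem fibMap_id (g : Map Y Z) (i : Z.Pos) :
    fibMap (Map.id Y) g g (id_comp g) i = Map.id (fib g i) := by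
  apply map_eq_of_comp (j := fibInc g i) incLev_injective incPos_injective
  rw [fibMap_inc]; rfl

theorem fibMap_comp {W : LevFam A'' B''} (f : Map X Y) (a : Map Y Z) (b : Map X Z) (h : Map X W)
    (g : Map Y W) (c : Map Z W) (wb : f.comp a = b) (wh : f.comp g = h) (wg : a.comp c = g)
    (wh' : b.comp c = h) (i : W.Pos) :
    (fibMap f g h wh i).comp (fibMap a c g wg i) = fibMap b c h wh' i := by
  apply map_eq_of_comp (j := fibInc c i) incLev_injective incPos_injective
  rw [fibMap_inc]
  change (fibMap f g h wh i).comp ((fibMap a c g wg i).comp (fibInc c i)) = _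
  rw [fibMap_inc]
  change ((fibMap f g h wh i).comp (fibInc g i)).comp a = _
  rw [fibMap_inc, ← wb]; rfl

section
variable {f : Map X Y} {i : Y.Pos}

theorem fib_all (hl : ∀ d, f.lev d = i.1) (hp : ∀ q, f.pos q = i) : fib f i = X :=
  sub_all (by simpa using hl) (by simpa using hp)

theorem fibInc_all (hl : ∀ d, f.lev d = i.1) (hp : ∀ q, f.pos q = i) :
    HEq (fibInc f i) (Map.id X) :=
  inc_all (by simpa using hl) (by simpa using hp)

end

theorem fibMap_all {f : Map X Y} {g : Map Y Z} {h : Map X Z} (w : f.comp g = h) {i : Z.Pos}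
    (hl : ∀ d, g.lev d = i.1) (hp : ∀ q, g.pos q = i) : HEq (fibMap f g h w i) f := by
  have hl' : ∀ d, h.lev d = i.1 := by subst w; exact fun d => hl _
  have hp' : ∀ d, h.pos d = i := by subst w; exact fun d => hp _
  exact Map.heq_of_comp (fib_all hl' hp') (fib_all hl hp) (fibInc_all hl' hp') (fibInc_all hl hp)
    (fun _ _ h => h) (fun _ _ h => h) f (fibMap_inc f g h w i) rfl

theorem fib_conditions (f : Map X Y) (g : Map Y Z) (h : Map X Z) (w : f.comp g = h)
    (i : Z.Pos) (k : (fib g i).Pos) :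
    (∀ l : (fib h i).Lev, decide ((fibMap f g h w i).lev l = k.1) =
      decide (f.lev (incLev l) = (incPos k).1)) ∧
    (∀ d, decide (f.lev d = (incPos k).1) = true → decide (h.lev d = i.1) = true) ∧
    (∀ q : (fib h i).Pos, decide ((fibMap f g h w i).pos q = k) =
      decide (f.pos (incPos q) = incPos k)) ∧
    (∀ q, decide (f.lev q.1 = (incPos k).1) = true → decide (f.pos q = incPos k) = true →
      decide (h.pos q = i) = true) := by
  refine ⟨?_, ?_, ?_, ?_⟩
  · intro l
    rw [incPos_fst, ← incLev_fibMap f g h w]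
    simp [incLev_injective.eq_iff]
  · intro d hd
    subst w
    simp only [decide_eq_true_eq] at hd ⊢
    simp [Map.comp, hd, incPos_fst]
  · intro q
    rw [← incPos_fibMap f g h w]
    simp [incPos_injective.eq_iff]
  · intro q _ hd
    subst w
    simp only [decide_eq_true_eq] at hd ⊢
    simp [Map.comp, hd]

theorem fib_fibMap (f : Map X Y) (g : Map Y Z) (h : Map X Z) (w : f.comp g = h)
    (i : Z.Pos) (k : (fib g i).Pos) : fib (fibMap f g h w i) k = fib f (incPos k) := by
  obtain ⟨h1, h2, h3, h4⟩ := fib_conditions f g h w i k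
  exact sub_sub id id h1 h2 h3 h4

theorem fibInc_fibMap (f : Map X Y) (g : Map Y Z) (h : Map X Z) (w : f.comp g = h)
    (i : Z.Pos) (k : (fib g i).Pos) :
    HEq ((fibInc (fibMap f g h w i) k).comp (fibInc h i)) (fibInc f (incPos k)) := by
  obtain ⟨h1, h2, h3, h4⟩ := fib_conditions f g h w i k
  exact inc_inc id id h1 h2 h3 h4

theorem fibMap_fibMap {C D : Type} {W : LevFam C D} (f : Map X Y) (a : Map Y Z) (b : Map X Z)
    (h : Map X W) (g : Map Y W) (c : Map Z W) (wb : f.comp a = b) (wh : f.comp g = h)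
    (wg : a.comp c = g) (wh' : b.comp c = h) (i : W.Pos) (k : (fib c i).Pos)
    (w : (fibMap f g h wh i).comp (fibMap a c g wg i) = fibMap b c h wh' i) :
    HEq (fibMap (fibMap f g h wh i) (fibMap a c g wg i) (fibMap b c h wh' i) w k)
      (fibMap f a b wb (incPos k)) := by
  have e1 := fibInc_fibMap b c h wh' i k
  have e2 := fibInc_fibMap a c g wg i k
  refine Map.heq_of_comp (fib_fibMap b c h wh' i k) (fib_fibMap a c g wg i k)
    e1 e2 incLev_injective incPos_injective f ?_ (fibMap_inc f a b wb _)
  change ((fibMap (fibMap f g h wh i) (fibMap a c g wg i) (fibMap b c h wh' i) w k).comp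
    (fibInc _ k)).comp (fibInc g i) = _
  rw [fibMap_inc]
  change (fibInc _ k).comp ((fibMap f g h wh i).comp (fibInc g i)) = _
  rw [fibMap_inc]; rfl

theorem filter_single {α : Type} [DecidableEq α] (a : α) (p : α → Bool)
    (hp : ∀ b, p b = decide (b = a)) : ∀ l : List α, l.Nodup → a ∈ l → l.filter p = [a]
  | b :: l, hn, h => by
    rcases List.nodup_cons.1 hn with ⟨hb, hl⟩
    by_cases e : b = a
    · subst e
      rw [List.filter_cons_of_pos (by simp [hp]), List.filter_eq_nil_iff.2]
      intro c hc
      simp only [hp, decide_eq_true_eq]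
      rintro rfl
      exact hb hc
    · rw [List.filter_cons_of_neg (by simp [hp, e])]
      exact filter_single a p hp l hl (by simpa [Ne.symm e] using h)

theorem fib_id (X : LevFam A B) (i : X.Pos) :
    fib (Map.id X) i = [(X.flag i.1, [X.label i])] := by
  have h1 : X.selLev (fun d => decide ((Map.id X).lev d = i.1)) = [i.1] :=
    filter_single _ _ (fun _ => rfl) _ (List.nodup_finRange _) (List.mem_finRange _)
  have h2 : X.selPos (fun q => decide ((Map.id X).pos q = i)) i.1 = [i] :=
    filter_single _ _ (fun _ => rfl) _ (X.row_nodup _) (mem_row.2 rfl)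
  rw [fib, sub, h1, List.map_singleton, h2]
  rfl

theorem map_incPos_fib (f : Map X Y) (i : Y.Pos) :
    (fib f i).positions.map incPos = X.positions.filter fun q => decide (f.pos q = i) := by
  rw [map_positions]
  apply List.filter_congr
  intro q _
  by_cases h : f.pos q = i
  · simp [h, ← f.pos_fst]
  · simp [h]

end Fibres

end LevFam

/-! ### The operadic category of 2-ordinals coloured by `ℕ` -/

/-- A 2-ordinal with a colour in `ℕ` for each leaf, for each vertex of height one the list of the
colours of its leaves, and a colour of the root. -/
structure Omega where
  fam : LevFam Unit ℕ
  out : ℕ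

namespace Omega

/-- A map of 2-ordinals preserving the colour of the root. -/
@[ext]
structure Hom (T S : Omega) where
  map : LevFam.Map T.fam S.fam
  out : T.out = S.out

instance : Category Omega where
  Hom := Hom
  id T := ⟨.id _, rfl⟩
  comp f g := ⟨f.map.comp g.map, f.out.trans g.out⟩

theorem Hom.heq {T T' S S' : Omega} (e : T = T') (e' : S = S') {f : Hom T S} {g : Hom T' S'}
    (h : HEq f.map g.map) : HEq f g := by
  subst e e'
  exact heq_of_eq (Hom.ext (eq_of_heq h))

theorem ext' {T S : Omega} (h : T.fam = S.fam) (h' : T.out = S.out) : T = S := by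
  cases T; cases S; cases h; cases h'; rfl

/-- The fibre over a leaf has that leaf's colour as its root colour. -/
def fib {T S : Omega} (f : T ⟶ S) (i : S.fam.Pos) : Omega :=
  ⟨LevFam.fib f.map i, S.fam.label i⟩

/-- The chosen terminal objects: one leaf, of the colour of the root. -/
def U (n : ℕ) : Omega := ⟨[((), [n])], n⟩

instance (n : ℕ) : Unique (U n).fam.Lev := inferInstanceAs (Unique (Fin 1))

theorem label_U {n : ℕ} (p : (U n).fam.Pos) : (U n).fam.label p = n := by
  rcases p with ⟨⟨d, hd⟩, x, hx⟩
  have h1 : d = 0 := Nat.lt_one_iff.1 hd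
  subst h1
  have h3 : x = 0 := Nat.lt_one_iff.1 hx
  subst h3
  rfl

theorem pos_U {n : ℕ} (p q : (U n).fam.Pos) : p = q := by
  rcases p with ⟨⟨d, hd⟩, x, hx⟩
  rcases q with ⟨⟨e, he⟩, y, hy⟩
  have h1 : d = 0 := Nat.lt_one_iff.1 hd
  have h2 : e = 0 := Nat.lt_one_iff.1 he
  subst h1 h2
  have h3 : x = 0 := Nat.lt_one_iff.1 hx
  have h4 : y = 0 := Nat.lt_one_iff.1 hy
  subst h3 h4
  rfl

def toU (T : Omega) : T ⟶ U T.out where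
  map :=
    { lev _ := default
      pos _ := ⟨⟨0, Nat.one_pos⟩, ⟨0, Nat.one_pos⟩⟩
      pos_fst _ := Subsingleton.elim _ _
      lev_mono _ _ _ := le_rfl
      pos_mono _ _ _ _ := le_rfl }
  out := rfl

end Omega

/-- The operadic category of `ℕ`-coloured 2-ordinals. -/
def OmegaOC : OperadicCategory where
  C := Omega
  Idx T := T.fam.Pos
  elems T := T.fam.positions
  elems_nodup T := LevFam.positions_nodup _
  mem_elems T := LevFam.mem_positions
  idx f := LevFam.Map.pos (Omega.Hom.map f)
  idx_id _ _ := rfl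
  idx_comp _ _ _ := rfl
  Comp := ℕ
  comp := Omega.out
  comp_hom f := Omega.Hom.out f
  U := Omega.U
  comp_U _ := rfl
  toU := Omega.toU
  toU_unique f := Omega.Hom.ext <| by
    ext1
    · funext k; exact Subsingleton.elim _ _
    · funext p; exact Omega.pos_U _ _
  fib := Omega.fib
  emb f i := LevFam.incPos
  emb_elems f i := LevFam.map_incPos_fib (Omega.Hom.map f) i
  elems_U _ := rfl
  fib_id T i := Omega.ext' (LevFam.fib_id T.fam i) rfl
  fibMap f g h w i := ⟨LevFam.fibMap _ _ _ (congrArg Omega.Hom.map w) i, rfl⟩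
  idx_fibMap f g h w i k := LevFam.incPos_fibMap _ _ _ (congrArg Omega.Hom.map w) i k
  fibMap_id g i := Omega.Hom.ext (LevFam.fibMap_id (Omega.Hom.map g) i)
  fibMap_comp f a b h g c wb wh wg wh' i := Omega.Hom.ext
    (LevFam.fibMap_comp (Omega.Hom.map f) (Omega.Hom.map a) (Omega.Hom.map b) (Omega.Hom.map h) (Omega.Hom.map g) (Omega.Hom.map c) (congrArg Omega.Hom.map wb)
      (congrArg Omega.Hom.map wh) (congrArg Omega.Hom.map wg) (congrArg Omega.Hom.map wh') i)
  fib_toU f i := Omega.ext' (LevFam.fib_all (fun _ => Subsingleton.elim _ _)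
    fun _ => Omega.pos_U _ _) ((Omega.label_U i).trans (Omega.Hom.out f).symm)
  fibMap_toU f g h w i := Omega.Hom.heq
    (Omega.ext' (LevFam.fib_all (fun _ => Subsingleton.elim _ _) fun _ => Omega.pos_U _ _)
      ((Omega.label_U i).trans (Omega.Hom.out h).symm))
    (Omega.ext' (LevFam.fib_all (fun _ => Subsingleton.elim _ _) fun _ => Omega.pos_U _ _)
      ((Omega.label_U i).trans (Omega.Hom.out g).symm))
    (LevFam.fibMap_all (congrArg Omega.Hom.map w) (fun _ => Subsingleton.elim _ _)
      fun _ => Omega.pos_U _ _)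
  fib_fibMap f g h w i k := Omega.ext'
    (LevFam.fib_fibMap (Omega.Hom.map f) (Omega.Hom.map g) (Omega.Hom.map h) (congrArg Omega.Hom.map w) i k) (LevFam.label_sub k)
  fibMap_fibMap f a b h g c wb wh wg wh' i k := Omega.Hom.heq
    (Omega.ext' (LevFam.fib_fibMap (Omega.Hom.map b) (Omega.Hom.map c) (Omega.Hom.map h) (congrArg Omega.Hom.map wh') i k)
      (LevFam.label_sub k))
    (Omega.ext' (LevFam.fib_fibMap (Omega.Hom.map a) (Omega.Hom.map c) (Omega.Hom.map g) (congrArg Omega.Hom.map wg) i k)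
      (LevFam.label_sub k))
    (LevFam.fibMap_fibMap (Omega.Hom.map f) (Omega.Hom.map a) (Omega.Hom.map b) (Omega.Hom.map h) (Omega.Hom.map g) (Omega.Hom.map c) (congrArg Omega.Hom.map wb)
      (congrArg Omega.Hom.map wh) (congrArg Omega.Hom.map wg) (congrArg Omega.Hom.map wh') i k
      (LevFam.fibMap_comp _ _ _ _ _ _ (congrArg Omega.Hom.map wb) _ _ _ i))

namespace LevFam

variable {A B A' B' A'' B'' : Type}

/-! #### Regrouping levels and entries along a map -/

section Regroup

theorem eq_flatMap_filter {α β : Type} [DecidableEq β] (r : β → β → Prop)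
    (hr : ∀ a b, r a b → ¬ r b a) (φ : α → β) : ∀ (m : List β) (l : List α), m.Pairwise r →
    l.Pairwise (fun a b => φ a = φ b ∨ r (φ a) (φ b)) → (∀ a ∈ l, φ a ∈ m) →
    l = m.flatMap fun b => l.filter fun a => decide (φ a = b)
  | [], l, _, _, h => by
    cases l with
    | nil => rfl
    | cons a l => exact absurd (h a List.mem_cons_self) (by simp)
  | b :: m, l, hm, hl, h => by
    have hm' := List.pairwise_cons.1 hm
    have key : ∀ l : List α, l.Pairwise (fun a b => φ a = φ b ∨ r (φ a) (φ b)) →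
        (∀ a ∈ l, φ a ∈ b :: m) →
        l = l.filter (fun a => decide (φ a = b)) ++ l.filter (fun a => decide (φ a ≠ b)) := by
      intro l
      induction l with
      | nil => intros; rfl
      | cons a l ih =>
        intro hl h
        have hl' := List.pairwise_cons.1 hl
        have ih' := ih hl'.2 fun a ha => h a (List.mem_cons_of_mem _ ha)
        by_cases hab : φ a = b
        · rw [List.filter_cons_of_pos (by simpa using hab),
            List.filter_cons_of_neg (by simpa using hab), List.cons_append, ← ih']
        · have hra : r b (φ a) := hm'.1 _ (by simpa [hab] using h a List.mem_cons_self)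
          have : ∀ c ∈ a :: l, φ c ≠ b := by
            intro c hc e
            rcases List.mem_cons.1 hc with rfl | hc
            · exact hab e
            · rcases hl'.1 c hc with e' | e'
              · exact hab (e'.trans e)
              · exact hr _ _ hra (e ▸ e')
          rw [List.filter_eq_nil_iff.2 (by simpa using this), List.nil_append,
            List.filter_eq_self.2 (by simpa using this)]
    have ih := eq_flatMap_filter r hr φ m (l.filter fun a => decide (φ a ≠ b)) hm'.2
      (hl.filter _) (by
        intro a ha
        have h1 := List.mem_filter.1 ha
        simpa [by simpa using h1.2] using h a h1.1)
    rw [List.flatMap_cons]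
    conv_lhs => rw [key l hl h, ih]
    congr 1
    have hirr : ∀ a, ¬ r a a := fun a ha => hr a a ha ha
    rw [List.flatMap_def, List.flatMap_def]
    congr 1
    apply List.map_congr_left
    intro c hc
    rw [List.filter_filter]
    apply List.filter_congr
    intro a _
    by_cases hac : φ a = c
    · have : φ a ≠ b := by
        rintro e
        exact hirr b (by simpa [← hac, e] using hm'.1 c hc)
      simp [hac, hac ▸ this]
    · simp [hac]

variable {X : LevFam A B} {Y : LevFam A' B'} (f : Map X Y)

/-- The levels over level `c`. -/
abbrev overLev (c : Y.Lev) : List X.Lev := X.selLev fun d => decide (f.lev d = c)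

theorem finRange_eq : List.finRange X.length = (List.finRange Y.length).flatMap (overLev f) :=
  eq_flatMap_filter (· < ·) (fun _ _ h => not_lt.2 h.le) f.lev _ _ (List.pairwise_lt_finRange _)
    ((List.pairwise_lt_finRange _).imp fun h => (f.lev_mono _ _ h.le).eq_or_lt)
    fun _ _ => List.mem_finRange _

/-- The entries of level `d` over the entry `p`. -/
abbrev overPos (d : X.Lev) (p : Y.Pos) : List X.Pos := X.selPos (fun q => decide (f.pos q = p)) d

theorem row_eq (d : X.Lev) : X.row d = (Y.row (f.lev d)).flatMap (overPos f d) := by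
  refine eq_flatMap_filter (fun p q => p.2.val < q.2.val) (fun _ _ h => not_lt.2 h.le) f.pos _ _
    (row_pairwise Y _) ?_ fun q hq => by rw [mem_row, f.pos_fst, mem_row.1 hq]
  refine (row_pairwise X d).imp_of_mem fun {p q} hp hq h => ?_
  have e : p.1 = q.1 := (mem_row.1 hp).trans (mem_row.1 hq).symm
  rcases (f.pos_mono p q e h.le).eq_or_lt with h' | h'
  · exact Or.inl (pos_ext (by rw [f.pos_fst, f.pos_fst, e]) h')
  · exact Or.inr h'

end Regroup

end LevFam

/-! ### Trees with levels -/

/-- A sequence of levels of vertices (label: colour and number of inputs) forms a forest of `p`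
planar trees with `n` leaves, when the outputs of the vertices of each level are attached, in
order, to the inputs of the previous level. -/
def IsTree : ℕ → LevFam Bool (Bool × ℕ) → ℕ → Prop
  | p, [], n => p = n
  | p, L :: X, n => L.2.length = p ∧ IsTree (L.2.map Prod.snd).sum X n

namespace IsTree

open LevFam

/-- The same condition for the list of pairs (number of vertices, total number of inputs). -/
def Chain : ℕ → List (ℕ × ℕ) → ℕ → Prop
  | p, [], n => p = n
  | p, L :: X, n => L.1 = p ∧ Chain L.2 X n

theorem iff_chain : ∀ (p : ℕ) (X : LevFam Bool (Bool × ℕ)) (n : ℕ),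
    IsTree p X n ↔ Chain p (X.map fun L => (L.2.length, (L.2.map Prod.snd).sum)) n
  | _, [], _ => Iff.rfl
  | _, _ :: X, n => and_congr_right fun _ => iff_chain _ X n

theorem Chain.append {m n : ℕ} {l' : List (ℕ × ℕ)} (h' : Chain m l' n) :
    ∀ {p : ℕ} {l : List (ℕ × ℕ)}, Chain p l m → Chain p (l ++ l') n
  | _, [], h => by cases h; exact h'
  | _, _ :: _, h => ⟨h.1, Chain.append h' h.2⟩

theorem Chain.split : ∀ {p n : ℕ} {l l' : List (ℕ × ℕ)}, Chain p (l ++ l') n →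
    ∃ m, Chain p l m ∧ Chain m l' n
  | p, _, [], _, h => ⟨p, rfl, h⟩
  | _, _, _ :: _, _, h => by
    obtain ⟨m, h1, h2⟩ := Chain.split h.2
    exact ⟨m, ⟨h.1, h1⟩, h2⟩

theorem Chain.sum {ι κ : Type} (W A : ι → κ → ℕ) (v : ι → ℕ) (s : List ι) :
    ∀ (l : List κ) (u : ι → ℕ),
    (∀ i ∈ s, Chain (u i) (l.map fun k => (W i k, A i k)) (v i)) →
    Chain (s.map u).sum (l.map fun k => ((s.map (W · k)).sum, (s.map (A · k)).sum)) (s.map v).sum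
  | [], _, h => congrArg List.sum (List.map_congr_left fun i hi => h i hi)
  | k :: l, _, h => ⟨congrArg List.sum (List.map_congr_left fun i hi => (h i hi).1),
      Chain.sum W A v s l (A · k) fun i hi => (h i hi).2⟩

/-- The number of vertices and the total number of inputs of a level. -/
def stat (X : LevFam Bool (Bool × ℕ)) (l : List X.Pos) : ℕ × ℕ :=
  (l.length, (l.map fun q => (X.label q).2).sum)

variable {X Y : LevFam Bool (Bool × ℕ)}

theorem stat_sub {P : X.Lev → Bool} {Q : X.Pos → Bool} :
    (X.sub id id P Q).map (fun L => (L.2.length, (L.2.map Prod.snd).sum)) =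
      (X.selLev P).map fun d => stat X (X.selPos Q d) := by
  simp [sub, stat, Function.comp_def]

theorem stat_self :
    X.map (fun L => (L.2.length, (L.2.map Prod.snd).sum)) =
      (List.finRange X.length).map fun d => stat X (X.row d) := by
  have h := stat_sub (X := X) (P := fun _ => true) (Q := fun _ => true)
  rw [sub_all (fun _ => rfl) (fun _ => rfl), selLev_all fun _ => rfl] at h
  rw [h]
  apply List.map_congr_left
  intro d _
  rw [selPos_all fun _ => rfl]

theorem stat_flatMap {ι : Type} (g : ι → List X.Pos) : ∀ s : List ι, stat X (s.flatMap g) =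
    ((s.map fun i => (stat X (g i)).1).sum, (s.map fun i => (stat X (g i)).2).sum)
  | [] => rfl
  | i :: s => by
    have := stat_flatMap g s
    simp only [stat, Prod.mk.injEq] at this
    simp [stat, this]

/-- Substituting trees into the vertices of a tree. -/
theorem subst {p n : ℕ} (f : Map X Y) (hf : ∀ i, IsTree 1 (LevFam.fib f i) (Y.label i).2)
    (hY : IsTree p Y n) : IsTree p X n := by
  have h1 : ∀ c : Y.Lev, Chain (stat Y (Y.row c)).1
      ((overLev f c).map fun d => stat X (X.row d)) (stat Y (Y.row c)).2 := by
    intro c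
    have h2 := Chain.sum (fun i d => (stat X (overPos f d i)).1)
      (fun i d => (stat X (overPos f d i)).2) (fun i => (Y.label i).2) (Y.row c) (overLev f c)
      (fun _ => 1) (by
        intro i hi
        have := (iff_chain _ _ _).1 (hf i)
        rw [stat_sub, mem_row.1 hi] at this
        exact this)
    have h3 : (overLev f c).map (fun d => stat X (X.row d)) = (overLev f c).map fun d =>
        (((Y.row c).map fun i => (stat X (overPos f d i)).1).sum,
          ((Y.row c).map fun i => (stat X (overPos f d i)).2).sum) := by
      apply List.map_congr_left
      intro d hd
      have hd' : f.lev d = c := by simpa [mem_selLev] using hd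
      rw [row_eq f d, stat_flatMap, hd']
    rw [h3]
    simpa [stat] using h2
  have h4 : ∀ (l : List Y.Lev) (p : ℕ), Chain p (l.map fun c => stat Y (Y.row c)) n →
      Chain p ((l.flatMap (overLev f)).map fun d => stat X (X.row d)) n := by
    intro l
    induction l with
    | nil => intro p h; exact h
    | cons c l ih =>
      intro p h
      rw [List.flatMap_cons, List.map_append]
      have h5 := h1 c
      rw [h.1] at h5
      exact Chain.append (ih _ h.2) h5
  rw [iff_chain, stat_self] at hY ⊢
  rw [finRange_eq f]
  exact h4 _ _ hY

/-- A tree with levels has a root vertex. -/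
theorem exists_pos {n : ℕ} (h : IsTree 1 X n) (d : X.Lev) : Nonempty X.Pos := by
  cases X with
  | nil => exact d.elim0
  | cons L X => exact ⟨⟨0, Nat.succ_pos _⟩, ⟨0, by
      have h1 : L.2.length = 1 := h.1
      show 0 < L.2.length
      omega⟩⟩

end IsTree

/-- A planar tree with levels, listed from the root. A level is either horizontal (flag `true`), or
not; a vertex has a colour (`true` for white) and a number of inputs; white vertices are not on
horizontal levels. A vertex which is not white is horizontal if its level is, and vertical
otherwise. -/
structure LTree where
  fam : LevFam Bool (Bool × ℕ)
  arity : ℕ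
  tree : IsTree 1 fam arity
  hor : ∀ p : fam.Pos, fam.flag p.1 = true → (fam.label p).1 = false

namespace LTree

open LevFam

/-- The vertex is white. -/
def white (T : LTree) (p : T.fam.Pos) : Bool := (T.fam.label p).1

def ar (T : LTree) (p : T.fam.Pos) : ℕ := (T.fam.label p).2

/-- A morphism contracts, for each vertex of the target, a subtree with the same number of
leaves, consisting of vertices on adjacent levels (the empty subtree if a level of vertices with
one input is introduced). In the order horizontal, vertical, white, the type of a vertex of the
target is at least that of the vertices contracted to it; introduced vertices are white. -/
@[ext]
structure Hom (T S : LTree) where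
  map : Map T.fam S.fam
  arity : T.arity = S.arity
  fib_tree : ∀ i, IsTree 1 (LevFam.fib map i) (S.ar i)
  hor : ∀ d, S.fam.flag (map.lev d) = true → T.fam.flag d = true
  white : ∀ q, T.white q = true → S.white (map.pos q) = true
  empty : ∀ c, (∀ d, map.lev d ≠ c) → S.fam.flag c = false ∧ ∀ i, i.1 = c → S.white i = true

theorem ext' {T S : LTree} (h : T.fam = S.fam) (h' : T.arity = S.arity) : T = S := by
  cases T; cases S; cases h; cases h'; rfl

theorem ar_sub {T : LTree} {P Q} (k : (T.fam.sub id id P Q).Pos) :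
    ((T.fam.sub id id P Q).label k).2 = T.ar (incPos k) := by rw [label_sub]; rfl

def Hom.id (T : LTree) : Hom T T where
  map := .id _
  arity := rfl
  fib_tree i := by rw [fib_id]; exact ⟨rfl, by simp [IsTree, ar]⟩
  hor _ h := h
  white _ h := h
  empty c h := absurd rfl (h c)

def Hom.comp {T S R : LTree} (f : Hom T S) (g : Hom S R) : Hom T R where
  map := f.map.comp g.map
  arity := f.arity.trans g.arity
  fib_tree i := by
    refine IsTree.subst (LevFam.fibMap f.map g.map _ rfl i) (fun k => ?_) (g.fib_tree i)
    rw [fib_fibMap, ar_sub]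
    exact f.fib_tree _
  hor d h := f.hor d (g.hor _ h)
  white q h := g.white _ (f.white q h)
  empty c h := by
    by_cases hc : ∀ e, g.map.lev e ≠ c
    · exact g.empty c hc
    · push Not at hc
      obtain ⟨e, he⟩ := hc
      have key : ∀ e, g.map.lev e = c → S.fam.flag e = false ∧ ∀ i, i.1 = e → S.white i = true := by
        intro e he
        refine f.empty e fun d hd => h d ?_
        simp [Map.comp, hd, he]
      constructor
      · by_contra hf
        have h1 := g.hor e (by rw [he]; simpa using hf)
        rw [(key e he).1] at h1
        exact absurd h1 (by simp)
      · intro i hi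
        subst hi
        obtain ⟨k⟩ := IsTree.exists_pos (g.fib_tree i)
          (outLev _root_.id _root_.id e (by simpa using he))
        rw [← pos_incPos k]
        refine g.white _ ((key (incPos k).1 ?_).2 _ rfl)
        rw [← g.map.pos_fst, pos_incPos]

instance : Category LTree where
  Hom := Hom
  id := Hom.id
  comp := Hom.comp

theorem Hom.heq {T T' S S' : LTree} (e : T = T') (e' : S = S') {f : Hom T S} {g : Hom T' S'}
    (h : HEq f.map g.map) : HEq f g := by
  subst e e'
  exact heq_of_eq (Hom.ext (eq_of_heq h))

theorem comp_map {T S R : LTree} {f : T ⟶ S} {g : S ⟶ R} {h : T ⟶ R} (w : f ≫ g = h) :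
    (Hom.map f).comp (Hom.map g) = Hom.map h := congrArg Hom.map w

/-- The fibre over a vertex: the subtree contracted to this vertex. -/
abbrev fib {T S : LTree} (f : T ⟶ S) (i : S.fam.Pos) : LTree where
  fam := LevFam.fib (Hom.map f) i
  arity := S.ar i
  tree := Hom.fib_tree f i
  hor p h := by
    rw [flag_sub, ← incPos_fst] at h
    rw [label_sub]
    exact T.hor _ h

section
variable {T S : LTree} (f : T ⟶ S) (i : S.fam.Pos)

theorem white_fib (k : (fib f i).fam.Pos) : (fib f i).white k = T.white (incPos k) := by
  rw [white, label_sub]; rfl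

theorem ar_fib (k : (fib f i).fam.Pos) : (fib f i).ar k = T.ar (incPos k) := by
  rw [ar, label_sub]; rfl

theorem flag_fib (k : (fib f i).fam.Lev) : (fib f i).fam.flag k = T.fam.flag (incLev k) :=
  flag_sub k

end

def fibMap {T S R : LTree} (f : T ⟶ S) (g : S ⟶ R) (h : T ⟶ R) (w : f ≫ g = h)
    (i : R.fam.Pos) : fib h i ⟶ fib g i where
  map := LevFam.fibMap (Hom.map f) (Hom.map g) (Hom.map h) (comp_map w) i
  arity := rfl
  fib_tree k := by
    rw [LevFam.fib_fibMap, ar_fib]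
    exact Hom.fib_tree f _
  hor d hd := by
    rw [flag_fib] at hd ⊢
    rw [incLev_fibMap] at hd
    exact Hom.hor f _ hd
  white q hq := by
    rw [white_fib] at hq ⊢
    rw [incPos_fibMap]
    exact Hom.white f _ hq
  empty c hc := by
    have h1 := Hom.empty f (incLev c) (by
      intro d hd
      have hd' : (Hom.map h).lev d = i.1 := by
        subst w
        change (Hom.map g).lev ((Hom.map f).lev d) = _
        rw [hd]
        exact lev_incLev c
      refine hc (outLev id id d (by simpa using hd')) (incLev_injective ?_)
      rw [incLev_fibMap, incLev_outLev, hd])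
    rw [flag_fib]
    refine ⟨h1.1, fun k hk => ?_⟩
    rw [white_fib]
    exact h1.2 _ (by rw [incPos_fst, hk])

/-- The chosen terminal objects: corollas with a white vertex. -/
def U (n : ℕ) : LTree where
  fam := [(false, [(true, n)])]
  arity := n
  tree := ⟨rfl, by simp [IsTree]⟩
  hor := by
    rintro ⟨⟨d, hd⟩, x⟩ h
    have h1 : d = 0 := Nat.lt_one_iff.1 hd
    subst h1
    cases h

instance (n : ℕ) : Unique (U n).fam.Lev := inferInstanceAs (Unique (Fin 1))

theorem flag_U {n : ℕ} (d : (U n).fam.Lev) : (U n).fam.flag d = false := by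
  rw [Unique.eq_default d]; rfl

theorem label_U {n : ℕ} (p : (U n).fam.Pos) : (U n).fam.label p = (true, n) := by
  rcases p with ⟨⟨d, hd⟩, x, hx⟩
  have h1 : d = 0 := Nat.lt_one_iff.1 hd
  subst h1
  have h3 : x = 0 := Nat.lt_one_iff.1 hx
  subst h3
  rfl

theorem pos_U {n : ℕ} (p q : (U n).fam.Pos) : p = q := by
  rcases p with ⟨⟨d, hd⟩, x, hx⟩
  rcases q with ⟨⟨e, he⟩, y, hy⟩
  have h1 : d = 0 := Nat.lt_one_iff.1 hd
  have h2 : e = 0 := Nat.lt_one_iff.1 he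
  subst h1 h2
  have h3 : x = 0 := Nat.lt_one_iff.1 hx
  have h4 : y = 0 := Nat.lt_one_iff.1 hy
  subst h3 h4
  rfl

def toU (T : LTree) : T ⟶ U T.arity where
  map :=
    { lev _ := default
      pos _ := ⟨⟨0, Nat.one_pos⟩, ⟨0, Nat.one_pos⟩⟩
      pos_fst _ := Subsingleton.elim _ _
      lev_mono _ _ _ := le_rfl
      pos_mono _ _ _ _ := le_rfl }
  arity := rfl
  fib_tree i := by
    rw [LevFam.fib_all (fun _ => Subsingleton.elim _ _) fun _ => pos_U _ _, ar, label_U]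
    exact T.tree
  hor d h := by rw [flag_U] at h; exact absurd h (by simp)
  white q _ := by rw [LTree.white, label_U]
  empty c _ := ⟨flag_U c, fun i _ => by rw [LTree.white, label_U]⟩

/-- The white vertices. -/
abbrev Idx (T : LTree) := {p : T.fam.Pos // T.white p = true}

/-- The white vertices, level by level. -/
def elems (T : LTree) : List T.Idx :=
  (T.fam.positions.filter T.white).pmap Subtype.mk fun _ h => (List.mem_filter.1 h).2

theorem map_val_elems (T : LTree) : T.elems.map Subtype.val = T.fam.positions.filter T.white := by
  simp [elems, List.map_pmap]

theorem map_val_injective (T : LTree) :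
    Function.Injective (List.map (Subtype.val : T.Idx → T.fam.Pos)) :=
  List.map_injective_iff.2 Subtype.val_injective

/-- The vertex in `T` of a white vertex of a fibre. -/
def emb {T S : LTree} (f : T ⟶ S) (i : S.fam.Pos) (k : (fib f i).Idx) : T.Idx :=
  ⟨incPos k.1, (white_fib f i k.1).symm.trans k.2⟩

theorem emb_elems {T S : LTree} (f : T ⟶ S) (i : S.Idx) :
    (fib f i.1).elems.map (emb f i.1) = T.elems.filter fun j =>
      decide ((⟨(Hom.map f).pos j.1, Hom.white f _ j.2⟩ : S.Idx) = i) := by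
  apply T.map_val_injective
  have h1 : ((fib f i.1).elems.map (emb f i.1)).map Subtype.val =
      ((fib f i.1).elems.map Subtype.val).map incPos := by
    rw [List.map_map, List.map_map]; rfl
  rw [h1, map_val_elems]
  have h2 : (fib f i.1).white = T.white ∘ incPos := funext (white_fib f i.1)
  rw [h2, ← List.filter_map]
  rw [map_incPos_fib]
  have h3 : (fun j : T.Idx => decide ((⟨(Hom.map f).pos j.1, Hom.white f _ j.2⟩ : S.Idx) = i)) =
      (fun q => decide ((Hom.map f).pos q = i.1)) ∘ Subtype.val := by
    funext j; simp [Subtype.ext_iff]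
  rw [h3, ← List.filter_map, map_val_elems, List.filter_filter, List.filter_filter]
  apply List.filter_congr
  intro q _
  rw [Bool.and_comm]

theorem fib_U {T : LTree} {n : ℕ} (f : T ⟶ U n) (i : (U n).fam.Pos) : fib f i = T :=
  ext' (LevFam.fib_all (fun _ => Subsingleton.elim _ _) fun _ => pos_U _ _)
    ((congrArg Prod.snd (label_U i)).trans (Hom.arity f).symm)

theorem fib_fibMap {T S R : LTree} (f : T ⟶ S) (g : S ⟶ R) (h : T ⟶ R) (w : f ≫ g = h)
    (i : R.fam.Pos) (k : (fib g i).fam.Pos) :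
    fib (fibMap f g h w i) k = fib f (incPos k) :=
  ext' (LevFam.fib_fibMap (Hom.map f) (Hom.map g) (Hom.map h) (congrArg Hom.map w) i k) (ar_sub k)

end LTree

/-- The operadic category of trees with levels. -/
def LTrOC : OperadicCategory where
  C := LTree
  Idx := LTree.Idx
  elems := LTree.elems
  elems_nodup T := by
    refine List.Nodup.of_map Subtype.val ?_
    rw [LTree.map_val_elems]
    exact (LevFam.positions_nodup _).filter _
  mem_elems T i := by
    have h : i.1 ∈ T.elems.map Subtype.val := by
      rw [LTree.map_val_elems]
      exact List.mem_filter.2 ⟨LevFam.mem_positions _, i.2⟩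
    obtain ⟨j, hj, hji⟩ := List.mem_map.1 h
    rwa [← Subtype.ext hji]
  idx f j := ⟨(LTree.Hom.map f).pos j.1, LTree.Hom.white f _ j.2⟩
  idx_id _ _ := rfl
  idx_comp _ _ _ := rfl
  Comp := ℕ
  comp := LTree.arity
  comp_hom f := LTree.Hom.arity f
  U := LTree.U
  comp_U _ := rfl
  toU := LTree.toU
  toU_unique f := LTree.Hom.ext <| by
    ext1
    · funext k; exact Subsingleton.elim _ _
    · funext p; exact LTree.pos_U _ _
  fib f i := LTree.fib f i.1
  emb f i := LTree.emb f i.1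
  emb_elems := LTree.emb_elems
  elems_U n := by
    rw [← List.length_map Subtype.val, LTree.map_val_elems]
    rfl
  fib_id T i := by
    refine LTree.ext' ((LevFam.fib_id T.fam i.1).trans ?_) rfl
    have h1 : T.fam.flag i.1.1 = false := by
      by_contra h
      have h2 := T.hor i.1 (by simpa using h)
      have h3 := i.2
      rw [LTree.white, h2] at h3
      exact absurd h3 (by simp)
    have h2 : T.fam.label i.1 = (true, T.ar i.1) := Prod.ext i.2 rfl
    rw [h1, h2]
    rfl
  fibMap f g h w i := LTree.fibMap f g h w i.1
  idx_fibMap f g h w i k := Subtype.ext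
    (LevFam.incPos_fibMap _ _ _ (congrArg LTree.Hom.map w) i.1 k.1)
  fibMap_id g i := LTree.Hom.ext (LevFam.fibMap_id (LTree.Hom.map g) i.1)
  fibMap_comp f a b h g c wb wh wg wh' i := LTree.Hom.ext
    (LevFam.fibMap_comp _ _ _ _ _ _ (congrArg LTree.Hom.map wb) (congrArg LTree.Hom.map wh)
      (congrArg LTree.Hom.map wg) (congrArg LTree.Hom.map wh') i.1)
  fib_toU f i := LTree.fib_U f i.1
  fibMap_toU f g h w i := LTree.Hom.heq (LTree.fib_U h i.1) (LTree.fib_U g i.1)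
    (LevFam.fibMap_all (congrArg LTree.Hom.map w) (fun _ => Subsingleton.elim _ _)
      fun _ => LTree.pos_U _ _)
  fib_fibMap f g h w i k := LTree.fib_fibMap f g h w i.1 k.1
  fibMap_fibMap f a b h g c wb wh wg wh' i k := LTree.Hom.heq
    (LTree.fib_fibMap b c h wh' i.1 k.1) (LTree.fib_fibMap a c g wg i.1 k.1)
    (LevFam.fibMap_fibMap _ _ _ _ _ _ (congrArg LTree.Hom.map wb) (congrArg LTree.Hom.map wh)
      (congrArg LTree.Hom.map wg) (congrArg LTree.Hom.map wh') i.1 k.1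
      (LevFam.fibMap_comp _ _ _ _ _ _ (congrArg LTree.Hom.map wb) _ _ _ i.1))

namespace LTree

open LevFam

def nonHor (T : LTree) (d : T.fam.Lev) : Bool := !T.fam.flag d

abbrev omegaFam (T : LTree) : LevFam Unit ℕ :=
  T.fam.sub (fun _ : Bool => ()) (Prod.snd : Bool × ℕ → ℕ) T.nonHor T.white

/-- The 2-ordinal of the levels which are not horizontal and the white vertices on them; the
colours are the numbers of inputs, respectively the number of leaves of the tree. -/
abbrev omega (T : LTree) : Omega where
  fam := T.omegaFam
  out := T.arity

abbrev omegaInc (T : LTree) : Map T.omegaFam T.fam :=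
  inc (fun _ : Bool => ()) (Prod.snd : Bool × ℕ → ℕ) T.fam T.nonHor T.white

theorem omegaInc_lev (T : LTree) : Function.Injective T.omegaInc.lev :=
  incLev_injective (fa := fun _ : Bool => ()) (fb := (Prod.snd : Bool × ℕ → ℕ))

theorem omegaInc_pos (T : LTree) : Function.Injective T.omegaInc.pos :=
  incPos_injective (fa := fun _ : Bool => ()) (fb := (Prod.snd : Bool × ℕ → ℕ))

theorem not_flag_of_white {T : LTree} {p : T.fam.Pos} (h : T.white p = true) :
    T.nonHor p.1 = true := by
  rw [nonHor]
  have h1 := T.hor p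
  rw [white] at h
  cases h2 : T.fam.flag p.1
  · rfl
  · rw [h1 h2] at h; exact absurd h (by simp)

theorem nonHor_map {T S : LTree} (f : T ⟶ S) (d : T.fam.Lev) (h : T.nonHor d = true) :
    S.nonHor ((Hom.map f).lev d) = true := by
  rw [nonHor] at h ⊢
  have h1 := Hom.hor f d
  cases h2 : S.fam.flag ((Hom.map f).lev d)
  · rfl
  · rw [h1 h2] at h; exact absurd h (by simp)

def omegaMap {T S : LTree} (f : T ⟶ S) : T.omega ⟶ S.omega where
  map := (Hom.map f).restrict (fun _ : Bool => ()) (Prod.snd : Bool × ℕ → ℕ)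
    (fun _ : Bool => ()) (Prod.snd : Bool × ℕ → ℕ) (nonHor_map f) (fun q _ h => Hom.white f q h)
  out := Hom.arity f

theorem omegaMap_inc {T S : LTree} (f : T ⟶ S) :
    (omegaMap f).map.comp S.omegaInc = T.omegaInc.comp (Hom.map f) :=
  restrict_inc (Hom.map f) (fun _ : Bool => ()) (Prod.snd : Bool × ℕ → ℕ)
    (fun _ : Bool => ()) (Prod.snd : Bool × ℕ → ℕ) (nonHor_map f) (fun q _ h => Hom.white f q h)

/-- The functor from trees with levels to 2-ordinals. -/
def omegaFunctor : LTree ⥤ Omega where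
  obj := omega
  map := omegaMap
  map_id T := Omega.Hom.ext <| map_eq_of_comp (j := T.omegaInc) T.omegaInc_lev T.omegaInc_pos <|
    omegaMap_inc (𝟙 T)
  map_comp {T S R} f g := Omega.Hom.ext <|
      map_eq_of_comp (j := R.omegaInc) R.omegaInc_lev R.omegaInc_pos <| by
    rw [omegaMap_inc]
    change T.omegaInc.comp ((Hom.map f).comp (Hom.map g)) =
      (omegaMap f).map.comp ((omegaMap g).map.comp R.omegaInc)
    rw [omegaMap_inc]
    change (T.omegaInc.comp (Hom.map f)).comp (Hom.map g) =
      ((omegaMap f).map.comp S.omegaInc).comp (Hom.map g)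
    rw [omegaMap_inc]

def omegaIdx (T : LTree) (i : T.Idx) : T.omegaFam.Pos :=
  outPos (fun _ : Bool => ()) (Prod.snd : Bool × ℕ → ℕ) (P := T.nonHor) (Q := T.white) i.1 (not_flag_of_white i.2) i.2

theorem incPos_omegaIdx (T : LTree) (i : T.Idx) : T.omegaInc.pos (T.omegaIdx i) = i.1 :=
  incPos_outPos (fun _ : Bool => ()) (Prod.snd : Bool × ℕ → ℕ) (P := T.nonHor) (Q := T.white) i.1 (not_flag_of_white i.2) i.2

theorem omegaIdx_elems (T : LTree) : T.elems.map T.omegaIdx = T.omegaFam.positions := by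
  apply List.map_injective_iff.2 T.omegaInc_pos
  have h' : T.omegaFam.positions.map T.omegaInc.pos = _ := map_positions
  rw [h', List.map_map]
  have h : (T.omegaInc.pos ∘ T.omegaIdx) = (Subtype.val : T.Idx → _) := funext T.incPos_omegaIdx
  rw [h, map_val_elems]
  apply List.filter_congr
  intro p _
  cases h : T.white p
  · simp
  · rw [not_flag_of_white h]; rfl

section
variable {T S : LTree} (f : T ⟶ S) (i : S.Idx)

abbrev selP (d : T.fam.Lev) : Bool := decide ((Hom.map f).lev d = i.1.1) && T.nonHor d
abbrev selQ (q : T.fam.Pos) : Bool := decide ((Hom.map f).pos q = i.1) && T.white q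

theorem fib_omega_conditions :
    (∀ k : (fib f i.1).fam.Lev, (fib f i.1).nonHor k = selP f i (incLev k)) ∧
    (∀ d, selP f i d = true → decide ((Hom.map f).lev d = i.1.1) = true) ∧
    (∀ q, (fib f i.1).white q = selQ f i (incPos q)) ∧
    (∀ q : T.fam.Pos, selP f i q.1 = true → selQ f i q = true →
      decide ((Hom.map f).pos q = i.1) = true) := by
  refine ⟨fun k => ?_, fun d h => (Bool.and_eq_true_iff.1 h).1, fun q => ?_,
    fun q _ h => (Bool.and_eq_true_iff.1 h).1⟩
  · rw [nonHor, flag_fib, selP, lev_incLev, nonHor]; simp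
  · rw [white_fib, selQ, pos_incPos]; simp

theorem omega_fib_conditions :
    (∀ k : T.omegaFam.Lev, decide ((omegaMap f).map.lev k = (S.omegaIdx i).1) =
      selP f i (incLev k)) ∧
    (∀ d, selP f i d = true → T.nonHor d = true) ∧
    (∀ q : T.omegaFam.Pos, decide ((omegaMap f).map.pos q = S.omegaIdx i) =
      selQ f i (incPos q)) ∧
    (∀ q : T.fam.Pos, selP f i q.1 = true → selQ f i q = true → T.white q = true) := by
  refine ⟨fun k => ?_, fun d h => (Bool.and_eq_true_iff.1 h).2, fun q => ?_,
    fun q _ h => (Bool.and_eq_true_iff.1 h).2⟩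
  · have h1 : S.omegaInc.lev ((omegaMap f).map.lev k) = (Hom.map f).lev (incLev k) :=
      congrFun (congrArg Map.lev (omegaMap_inc f)) k
    have h2 : S.omegaInc.lev (S.omegaIdx i).1 = i.1.1 := by
      rw [← incPos_omegaIdx, S.omegaInc.pos_fst]
    have h3 := incLev_sel k
    rw [selP, h3, ← h1, ← h2, Bool.and_true]
    exact decide_eq_decide.2 (S.omegaInc_lev.eq_iff).symm
  · have h1 : S.omegaInc.pos ((omegaMap f).map.pos q) = (Hom.map f).pos (incPos q) :=
      congrFun (congrArg Map.pos (omegaMap_inc f)) q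
    have h3 := incPos_sel q
    rw [selQ, h3, ← h1, ← S.incPos_omegaIdx i, Bool.and_true]
    exact decide_eq_decide.2 (S.omegaInc_pos.eq_iff).symm

theorem omega_fib_fam :
    (fib f i.1).omega.fam = LevFam.fib (omegaMap f).map (S.omegaIdx i) := by
  obtain ⟨h1, h2, h3, h4⟩ := fib_omega_conditions f i
  obtain ⟨k1, k2, k3, k4⟩ := omega_fib_conditions f i
  exact (sub_sub (fun _ : Bool => ()) (Prod.snd : Bool × ℕ → ℕ) h1 h2 h3 h4).trans (sub_sub id id k1 k2 k3 k4).symm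

theorem omega_fib_inc :
    HEq ((fib f i.1).omegaInc.comp (fibInc (Hom.map f) i.1))
      ((fibInc (omegaMap f).map (S.omegaIdx i)).comp T.omegaInc) := by
  obtain ⟨h1, h2, h3, h4⟩ := fib_omega_conditions f i
  obtain ⟨k1, k2, k3, k4⟩ := omega_fib_conditions f i
  exact (inc_inc (fun _ : Bool => ()) (Prod.snd : Bool × ℕ → ℕ) h1 h2 h3 h4).trans (inc_inc id id k1 k2 k3 k4).symm

theorem omega_fib : (fib f i.1).omega = Omega.fib (omegaMap f) (S.omegaIdx i) := by
  refine Omega.ext' (omega_fib_fam f i) ?_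
  exact ((label_sub (fa := fun _ : Bool => ()) (fb := (Prod.snd : Bool × ℕ → ℕ)) (S.omegaIdx i)).trans
    (congrArg (fun p => (S.fam.label p).2) (S.incPos_omegaIdx i))).symm

end

end LTree

/-- The operadic functor from trees with levels to coloured 2-ordinals. -/
def omegaOF : OperadicFunctor LTrOC OmegaOC where
  F := LTree.omegaFunctor
  idxMap := LTree.omegaIdx
  idxMap_elems := LTree.omegaIdx_elems
  idxMap_idx {T S} f i := LTree.omegaInc_pos S <| by
    have h := congrFun (congrArg LevFam.Map.pos (LTree.omegaMap_inc f)) (LTree.omegaIdx T i)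
    refine (LTree.incPos_omegaIdx S ⟨_, LTree.Hom.white f _ i.2⟩).trans (Eq.trans ?_ h.symm)
    exact congrArg (LTree.Hom.map f).pos (LTree.incPos_omegaIdx T i).symm
  fib_eq f i := LTree.omega_fib f i
  fibMap_eq {T S R} f g h w i := by
    refine Omega.Hom.heq (LTree.omega_fib h i) (LTree.omega_fib g i) ?_
    refine LevFam.Map.heq_of_comp (LTree.omega_fib_fam h i) (LTree.omega_fib_fam g i)
      (LTree.omega_fib_inc h i) (LTree.omega_fib_inc g i)
      ((LTree.omegaInc_lev S).comp LevFam.incLev_injective)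
      ((LTree.omegaInc_pos S).comp LevFam.incPos_injective) (LTree.Hom.map f) ?_ ?_
    · have h1 := LTree.omegaMap_inc (LTree.fibMap f g h w i.1)
      have h2 := LevFam.fibMap_inc (LTree.Hom.map f) (LTree.Hom.map g) (LTree.Hom.map h)
        (LTree.comp_map w) i.1
      refine (congrArg (fun m => LevFam.Map.comp m (LevFam.fibInc (LTree.Hom.map g) i.1)) h1).trans
        ?_
      exact congrArg (LevFam.Map.comp (LTree.fib h i.1).omegaInc) h2
    · have h1 := LTree.omegaMap_inc f
      have h2 := LevFam.fibMap_inc (LTree.omegaMap f).map (LTree.omegaMap g).map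
        (LTree.omegaMap h).map
        (by rw [← w]; exact (congrArg Omega.Hom.map (LTree.omegaFunctor.map_comp f g)).symm)
        (LTree.omegaIdx R i)
      refine (congrArg (fun m => LevFam.Map.comp m S.omegaInc) h2).trans ?_
      exact congrArg (LevFam.Map.comp (LevFam.fibInc (LTree.omegaMap h).map (LTree.omegaIdx R i))) h1
  compMap := id
  U_eq _ := rfl

/-! ### Strict duoidal enriched categories -/

section Duoidal

universe vV uV vD uD

/-- A strict monoidal structure on a `V`-category. -/
structure StrictMonoidalStr (V : Type uV) [Category.{vV} V] [MonoidalCategory V]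
    [SymmetricCategory V] (D : Type uD) [Category.{vD} D] [EnrichedOrdinaryCategory V D] where
  unit : D
  mul : D → D → D
  mul_assoc : ∀ X Y Z, mul (mul X Y) Z = mul X (mul Y Z)
  one_mul : ∀ X, mul unit X = X
  mul_one : ∀ X, mul X unit = X
  homMul : ∀ X X' Y Y' : D, (X ⟶[V] X') ⊗ (Y ⟶[V] Y') ⟶ (mul X Y ⟶[V] mul X' Y')
  homMul_id : ∀ X Y : D,
    (λ_ (𝟙_ V)).inv ≫ (eId V X ⊗ₘ eId V Y) ≫ homMul X X Y Y = eId V (mul X Y)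
  homMul_comp : ∀ X X' X'' Y Y' Y'' : D,
    (homMul X X' Y Y' ⊗ₘ homMul X' X'' Y' Y'') ≫ eComp V (mul X Y) (mul X' Y') (mul X'' Y'') =
      tensorμ (X ⟶[V] X') (Y ⟶[V] Y') (X' ⟶[V] X'') (Y' ⟶[V] Y'') ≫
        (eComp V X X' X'' ⊗ₘ eComp V Y Y' Y'') ≫ homMul X X'' Y Y''
  homMul_assoc : ∀ X X' Y Y' Z Z' : D,
    (homMul X X' Y Y' ▷ (Z ⟶[V] Z')) ≫ homMul (mul X Y) (mul X' Y') Z Z' =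
      (α_ (X ⟶[V] X') (Y ⟶[V] Y') (Z ⟶[V] Z')).hom ≫ ((X ⟶[V] X') ◁ homMul Y Y' Z Z') ≫
        homMul X X' (mul Y Z) (mul Y' Z') ≫ eqToHom (by rw [mul_assoc, mul_assoc])
  homMul_one : ∀ X X' : D,
    (ρ_ (X ⟶[V] X')).inv ≫ ((X ⟶[V] X') ◁ eId V unit) ≫ homMul X X' unit unit =
      eqToHom (by rw [mul_one, mul_one])
  one_homMul : ∀ X X' : D,
    (λ_ (X ⟶[V] X')).inv ≫ (eId V unit ▷ (X ⟶[V] X')) ≫ homMul unit unit X X' =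
      eqToHom (by rw [one_mul, one_mul])

namespace StrictMonoidalStr

variable {V : Type uV} [Category.{vV} V] [MonoidalCategory V] [SymmetricCategory V]
  {D : Type uD} [Category.{vD} D] [EnrichedOrdinaryCategory V D] (h : StrictMonoidalStr V D)
  {ι κ : Type}

/-- The product of two morphisms of the underlying category. -/
def tens {X X' Y Y' : D} (f : X ⟶ X') (g : Y ⟶ Y') : h.mul X Y ⟶ h.mul X' Y' :=
  (eHomEquiv V).symm ((λ_ (𝟙_ V)).inv ≫ (eHomEquiv V f ⊗ₘ eHomEquiv V g) ≫ h.homMul X X' Y Y')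

/-- `X i₁ ⊠ X i₂ ⊠ ⋯` for a list `[i₁, i₂, …]`; the unit for the empty list. -/
def prod : List ι → (ι → D) → D
  | [], _ => h.unit
  | i :: l, X => h.mul (X i) (prod l X)

/-- `⋯ ⊠ X i₂ ⊠ X i₁` for a list `[i₁, i₂, …]`. -/
def rprod : List ι → (ι → D) → D
  | [], _ => h.unit
  | i :: l, X => h.mul (rprod l X) (X i)

theorem prod_congr {X Y : ι → D} : ∀ {l : List ι}, (∀ i ∈ l, X i = Y i) → h.prod l X = h.prod l Y
  | [], _ => rfl
  | i :: l, e => by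
    rw [prod, prod, e i List.mem_cons_self, prod_congr fun j hj => e j (List.mem_cons_of_mem _ hj)]

theorem rprod_congr {X Y : ι → D} :
    ∀ {l : List ι}, (∀ i ∈ l, X i = Y i) → h.rprod l X = h.rprod l Y
  | [], _ => rfl
  | i :: l, e => by
    rw [rprod, rprod, e i List.mem_cons_self,
      rprod_congr fun j hj => e j (List.mem_cons_of_mem _ hj)]

theorem prod_map (g : κ → ι) (X : ι → D) :
    ∀ l : List κ, h.prod (l.map g) X = h.prod l fun k => X (g k)
  | [] => rfl
  | k :: l => by rw [List.map_cons, prod, prod, prod_map g X l]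

theorem rprod_map (g : κ → ι) (X : ι → D) :
    ∀ l : List κ, h.rprod (l.map g) X = h.rprod l fun k => X (g k)
  | [] => rfl
  | k :: l => by rw [List.map_cons, rprod, rprod, rprod_map g X l]

theorem prod_append (X : ι → D) (l' : List ι) :
    ∀ l : List ι, h.prod (l ++ l') X = h.mul (h.prod l X) (h.prod l' X)
  | [] => (h.one_mul _).symm
  | i :: l => by rw [List.cons_append, prod, prod, prod_append X l' l, h.mul_assoc]

theorem rprod_append (X : ι → D) (l' : List ι) :
    ∀ l : List ι, h.rprod (l ++ l') X = h.mul (h.rprod l' X) (h.rprod l X)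
  | [] => (h.mul_one _).symm
  | i :: l => by rw [List.cons_append, rprod, rprod, rprod_append X l' l, h.mul_assoc]

theorem prod_flatMap (X : ι → D) (r : κ → List ι) :
    ∀ m : List κ, h.prod (m.flatMap r) X = h.prod m fun k => h.prod (r k) X
  | [] => rfl
  | k :: m => by rw [List.flatMap_cons, prod_append, prod, prod_flatMap X r m]

theorem prod_flatten (X : ι → D) : ∀ m : List (List ι),
    h.prod m.flatten X = h.prod m fun l => h.prod l X
  | [] => rfl
  | l :: m => by rw [List.flatten_cons, prod_append, prod, prod_flatten X m]

theorem rprod_flatMap (X : ι → D) (r : κ → List ι) :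
    ∀ m : List κ, h.rprod (m.flatMap r) X = h.rprod m fun k => h.rprod (r k) X
  | [] => rfl
  | k :: m => by rw [List.flatMap_cons, rprod_append, rprod, rprod_flatMap X r m]

theorem prod_filter (p : ι → Bool) (X : ι → D) :
    ∀ l : List ι, h.prod (l.filter p) X = h.prod l fun i => bif p i then X i else h.unit
  | [] => rfl
  | i :: l => by
    rw [prod, List.filter_cons]
    cases p i
    · exact (prod_filter p X l).trans (h.one_mul _).symm
    · exact congrArg (h.mul (X i)) (prod_filter p X l)

theorem rprod_filter (p : ι → Bool) (X : ι → D) :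
    ∀ l : List ι, h.rprod (l.filter p) X = h.rprod l fun i => bif p i then X i else h.unit
  | [] => rfl
  | i :: l => by
    rw [rprod, List.filter_cons]
    cases p i
    · exact (rprod_filter p X l).trans (h.mul_one _).symm
    · exact congrArg (h.mul · (X i)) (rprod_filter p X l)

theorem prod_unit : ∀ l : List ι, h.prod l (fun _ => h.unit) = h.unit
  | [] => rfl
  | _ :: l => by rw [prod, prod_unit l, h.one_mul]

theorem rprod_unit : ∀ l : List ι, h.rprod l (fun _ => h.unit) = h.unit
  | [] => rfl
  | _ :: l => by rw [rprod, rprod_unit l, h.one_mul]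

theorem rprod_get (Z : ι → D) (l : List ι) :
    h.rprod l Z = h.rprod (List.finRange l.length) fun d => Z (l.get d) := by
  rw [← h.rprod_map l.get Z, List.map_get_finRange]

theorem prod_get (Z : ι → D) (l : List ι) :
    h.prod l Z = h.prod (List.finRange l.length) fun d => Z (l.get d) := by
  rw [← h.prod_map l.get Z, List.map_get_finRange]

/-- The product of a family of morphisms. -/
def prodMap {X Y : ι → D} : ∀ l : List ι, (∀ i ∈ l, X i ⟶ Y i) → (h.prod l X ⟶ h.prod l Y)
  | [], _ => 𝟙 _
  | i :: l, φ => h.tens (φ i List.mem_cons_self)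
      (prodMap l fun j hj => φ j (List.mem_cons_of_mem _ hj))

/-- The product of a family of morphisms, in the reversed order. -/
def rprodMap {X Y : ι → D} : ∀ l : List ι, (∀ i ∈ l, X i ⟶ Y i) → (h.rprod l X ⟶ h.rprod l Y)
  | [], _ => 𝟙 _
  | i :: l, φ => h.tens (rprodMap l fun j hj => φ j (List.mem_cons_of_mem _ hj))
      (φ i List.mem_cons_self)

/-- The products as `V`-functors. -/
def eProd (X Y : ι → D) : ∀ l : List ι,
    tensL (fun i => X i ⟶[V] Y i) l ⟶ (h.prod l X ⟶[V] h.prod l Y)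
  | [] => eId V _
  | _ :: l => (_ ◁ eProd X Y l) ≫ h.homMul _ _ _ _

/-- The products in the reversed order as `V`-functors. -/
def eRprod (X Y : ι → D) : ∀ l : List ι,
    tensL (fun i => X i ⟶[V] Y i) l ⟶ (h.rprod l X ⟶[V] h.rprod l Y)
  | [] => eId V _
  | _ :: l => (_ ◁ eRprod X Y l) ≫ (β_ _ _).hom ≫ h.homMul _ _ _ _

end StrictMonoidalStr

/-- A strict duoidal `V`-category `(D, ⊠₀, ⊠₁, e, v)`. -/
structure StrictDuoidal (V : Type uV) [Category.{vV} V] [MonoidalCategory V]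
    [SymmetricCategory V] (D : Type uD) [Category.{vD} D] [EnrichedOrdinaryCategory V D] where
  /-- `(D, ⊠₀, e)` -/
  h0 : StrictMonoidalStr V D
  /-- `(D, ⊠₁, v)` -/
  h1 : StrictMonoidalStr V D
  /-- the interchange `(X ⊠₁ Y) ⊠₀ (Z ⊠₁ W) ⟶ (X ⊠₀ Z) ⊠₁ (Y ⊠₀ W)` -/
  ζ : ∀ X Y Z W : D, h0.mul (h1.mul X Y) (h1.mul Z W) ⟶ h1.mul (h0.mul X Z) (h0.mul Y W)
  δ : h0.unit ⟶ h1.mul h0.unit h0.unit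
  μ : h0.mul h1.unit h1.unit ⟶ h1.unit
  ε : h0.unit ⟶ h1.unit
  /-- `V`-naturality of the interchange -/
  ζ_natural : ∀ X X' Y Y' Z Z' W W' : D,
    (h1.homMul X X' Y Y' ⊗ₘ h1.homMul Z Z' W W') ≫
        h0.homMul (h1.mul X Y) (h1.mul X' Y') (h1.mul Z W) (h1.mul Z' W') ≫
        eHomWhiskerLeft V _ (ζ X' Y' Z' W') =
      tensorμ (X ⟶[V] X') (Y ⟶[V] Y') (Z ⟶[V] Z') (W ⟶[V] W') ≫
        (h0.homMul X X' Z Z' ⊗ₘ h0.homMul Y Y' W W') ≫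
        h1.homMul (h0.mul X Z) (h0.mul X' Z') (h0.mul Y W) (h0.mul Y' W') ≫
        eHomWhiskerRight V (ζ X Y Z W) _
  ζ_assoc₀ : ∀ A B C D' E F : D,
    h0.tens (ζ A B C D') (𝟙 (h1.mul E F)) ≫ ζ (h0.mul A C) (h0.mul B D') E F =
      eqToHom (h0.mul_assoc _ _ _) ≫ h0.tens (𝟙 (h1.mul A B)) (ζ C D' E F) ≫
        ζ A B (h0.mul C E) (h0.mul D' F) ≫ eqToHom (by rw [h0.mul_assoc, h0.mul_assoc])
  ζ_assoc₁ : ∀ A B C D' E F : D,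
    ζ (h1.mul A B) C (h1.mul D' E) F ≫ h1.tens (ζ A B D' E) (𝟙 (h0.mul C F)) =
      eqToHom (by rw [h1.mul_assoc, h1.mul_assoc]) ≫ ζ A (h1.mul B C) D' (h1.mul E F) ≫
        h1.tens (𝟙 (h0.mul A D')) (ζ B C E F) ≫ eqToHom (h1.mul_assoc _ _ _).symm
  δ_ζ : ∀ A B : D, h0.tens δ (𝟙 (h1.mul A B)) ≫ ζ h0.unit h0.unit A B =
    eqToHom (by rw [h0.one_mul, h0.one_mul, h0.one_mul])
  ζ_δ : ∀ A B : D, h0.tens (𝟙 (h1.mul A B)) δ ≫ ζ A B h0.unit h0.unit =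
    eqToHom (by rw [h0.mul_one, h0.mul_one, h0.mul_one])
  ζ_μ_left : ∀ A B : D, ζ h1.unit A h1.unit B ≫ h1.tens μ (𝟙 (h0.mul A B)) =
    eqToHom (by rw [h1.one_mul, h1.one_mul, h1.one_mul])
  ζ_μ_right : ∀ A B : D, ζ A h1.unit B h1.unit ≫ h1.tens (𝟙 (h0.mul A B)) μ =
    eqToHom (by rw [h1.mul_one, h1.mul_one, h1.mul_one])
  /-- `v` is a monoid for `⊠₀` -/
  μ_assoc : h0.tens μ (𝟙 h1.unit) ≫ μ =
    eqToHom (h0.mul_assoc _ _ _) ≫ h0.tens (𝟙 h1.unit) μ ≫ μ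
  ε_μ : h0.tens ε (𝟙 h1.unit) ≫ μ = eqToHom (h0.one_mul _)
  μ_ε : h0.tens (𝟙 h1.unit) ε ≫ μ = eqToHom (h0.mul_one _)
  /-- `e` is a comonoid for `⊠₁` -/
  δ_assoc : δ ≫ h1.tens δ (𝟙 h0.unit) =
    δ ≫ h1.tens (𝟙 h0.unit) δ ≫ eqToHom (h1.mul_assoc _ _ _).symm
  δ_ε : δ ≫ h1.tens (𝟙 h0.unit) ε = eqToHom (h1.mul_one _).symm
  ε_δ : δ ≫ h1.tens ε (𝟙 h0.unit) = eqToHom (h1.one_mul _).symm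

namespace StrictDuoidal

variable {V : Type uV} [Category.{vV} V] [MonoidalCategory V] [SymmetricCategory V]
  {D : Type uD} [Category.{vD} D] [EnrichedOrdinaryCategory V D] (d : StrictDuoidal V D)
  {ι κ : Type}

/-- The unit of `⊠₀`. -/
abbrev e : D := d.h0.unit

/-- The unit of `⊠₁`. -/
abbrev v : D := d.h1.unit

/-- The square comparing the two maps `e ⊠₁ e ⟶ e` given by the counit `e ⟶ v` commutes. -/
def Square : Prop :=
  d.h1.tens (𝟙 d.e) d.ε ≫ eqToHom (d.h1.mul_one d.e) =
    d.h1.tens d.ε (𝟙 d.e) ≫ eqToHom (d.h1.one_mul d.e)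

/-- The comultiplication of `e` iterated along a list (the counit for the empty list). -/
def eProd1 : ∀ l : List ι, d.e ⟶ d.h1.prod l fun _ => d.e
  | [] => d.ε
  | _ :: l => d.δ ≫ d.h1.tens (𝟙 d.e) (eProd1 l)

/-- The product of maps out of `e`, precomposed with the iterated comultiplication. -/
def eTo (l : List ι) {X : ι → D} (φ : ∀ i ∈ l, d.e ⟶ X i) : d.e ⟶ d.h1.prod l X :=
  d.eProd1 l ≫ d.h1.prodMap l φ

/-- The interchange for `⊠₁`-products of families. -/
def inter₂ (X Y : ι → D) : ∀ l : List ι,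
    d.h0.mul (d.h1.prod l X) (d.h1.prod l Y) ⟶ d.h1.prod l fun i => d.h0.mul (X i) (Y i)
  | [] => d.μ
  | _ :: l => d.ζ _ _ _ _ ≫ d.h1.tens (𝟙 _) (inter₂ X Y l)

/-- The interchange for an array of objects. -/
def inter (G : κ → ι → D) (t : List ι) : ∀ s : List κ,
    d.h0.rprod s (fun k => d.h1.prod t (G k)) ⟶ d.h1.prod t fun i => d.h0.rprod s fun k => G k i
  | [] => d.eProd1 t
  | _ :: s => d.h0.tens (inter G t s) (𝟙 _) ≫ d.inter₂ _ _ t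

/-- The multiplication of `v` iterated along a list (the unit for the empty list). -/
def vRprod0 : ∀ l : List ι, d.h0.rprod l (fun _ => d.v) ⟶ d.v
  | [] => d.ε
  | _ :: l => d.h0.tens (vRprod0 l) (𝟙 d.v) ≫ d.μ

/-- `e ⊠₁ ⋯ ⊠₁ e`; it is `e` for a level without vertices. -/
def hpow : ℕ → D
  | 0 => d.e
  | 1 => d.e
  | n + 2 => d.h1.mul d.e (hpow (n + 1))

/-- The iterated comultiplication of `e`. -/
def expand : ∀ n, d.e ⟶ d.hpow n
  | 0 => 𝟙 _
  | 1 => 𝟙 _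
  | n + 2 => d.δ ≫ d.h1.tens (𝟙 d.e) (expand (n + 1))

/-- `e ⊠₁ ⋯ ⊠₁ e ⟶ e`, the counit `e ⟶ v` applied to all factors but the first. -/
def shrink : ∀ n, d.hpow n ⟶ d.e
  | 0 => 𝟙 _
  | 1 => 𝟙 _
  | n + 2 => d.h1.tens (𝟙 d.e) (shrink (n + 1) ≫ d.ε) ≫ eqToHom (d.h1.mul_one d.e)

/-- The map from `e ⊠₁ ⋯ ⊠₁ e` given by a family of maps out of `e`. -/
def hpowTo {X : ι → D} : ∀ l : List ι, (∀ i ∈ l, d.e ⟶ X i) → (d.hpow l.length ⟶ d.h1.prod l X)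
  | [], _ => d.ε
  | [i], φ => φ i List.mem_cons_self ≫ eqToHom (d.h1.mul_one (X i)).symm
  | i :: j :: l, φ => d.h1.tens (φ i List.mem_cons_self)
      (hpowTo (j :: l) fun k hk => φ k (List.mem_cons_of_mem _ hk))

end StrictDuoidal

/-! ### 1-operads -/

/-- The underlying data of a 1-operad; for `ks = []` the structure map is the action
`v ⊠₀ A(0) ⟶ A(0)`. -/
structure OneOperadData {V : Type uV} [Category.{vV} V] [MonoidalCategory V]
    [SymmetricCategory V] {D : Type uD} [Category.{vD} D] [EnrichedOrdinaryCategory V D]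
    (d : StrictDuoidal V D) where
  obj : ℕ → D
  γ : ∀ ks : List ℕ, d.h0.mul (d.h1.prod ks obj) (obj ks.length) ⟶ obj ks.sum
  j : d.e ⟶ obj 1

/-- A 1-operad in a strict duoidal category. -/
structure OneOperad {V : Type uV} [Category.{vV} V] [MonoidalCategory V]
    [SymmetricCategory V] {D : Type uD} [Category.{vD} D] [EnrichedOrdinaryCategory V D]
    (d : StrictDuoidal V D) extends OneOperadData d where
  assoc : ∀ kss : List (List ℕ),
    d.h0.tens (d.inter₂ (fun ks => d.h1.prod ks obj) (fun ks => obj ks.length) kss ≫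
        d.h1.prodMap kss fun ks _ => γ ks) (𝟙 (obj kss.length)) ≫
      eqToHom (by rw [d.h1.prod_map, List.length_map]) ≫ γ (kss.map List.sum) =
    eqToHom (d.h0.mul_assoc _ _ _) ≫
      d.h0.tens (𝟙 _) (eqToHom (by rw [d.h1.prod_map, List.length_map]) ≫
        γ (kss.map List.length)) ≫
      eqToHom (by rw [d.h1.prod_flatten, List.length_flatten]) ≫
      γ kss.flatten ≫ eqToHom (by rw [List.sum_flatten])
  unit_left : ∀ n : ℕ,
    d.h0.tens (d.eTo (List.replicate n 1) (X := obj) fun i hi =>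
        j ≫ eqToHom (by rw [List.eq_of_mem_replicate hi])) (𝟙 (obj n)) ≫
      eqToHom (by rw [List.length_replicate]) ≫ γ (List.replicate n 1) =
    eqToHom (by rw [d.h0.one_mul]; simp)
  unit_right : ∀ k : ℕ,
    d.h0.tens (𝟙 (obj k)) j ≫ eqToHom (by
        rw [StrictMonoidalStr.prod, StrictMonoidalStr.prod, d.h1.mul_one]; rfl) ≫ γ [k] =
      eqToHom (by rw [d.h0.mul_one]; simp)

section

variable {V : Type uV} [Category.{vV} V] [MonoidalCategory V] [SymmetricCategory V]
  {D : Type uD} [Category.{vD} D] [EnrichedOrdinaryCategory V D] {d : StrictDuoidal V D}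

/-- Morphisms of 1-operads. -/
structure OneOperadData.Hom (A B : OneOperadData d) where
  map : ∀ n, A.obj n ⟶ B.obj n
  γ : ∀ ks, A.γ ks ≫ map ks.sum =
    d.h0.tens (d.h1.prodMap ks fun k _ => map k) (map ks.length) ≫ B.γ ks
  j : A.j ≫ map 1 = B.j

/-- The 1-operad `UAss` with all components `v`. -/
def uAss (d : StrictDuoidal V D) : OneOperadData d where
  obj _ := d.v
  γ ks := eqToHom (by rw [d.h1.prod_unit]) ≫ d.μ
  j := d.ε

end

/-- A multiplicative 1-operad. -/
structure MultOneOperad {V : Type uV} [Category.{vV} V] [MonoidalCategory V]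
    [SymmetricCategory V] {D : Type uD} [Category.{vD} D] [EnrichedOrdinaryCategory V D]
    (d : StrictDuoidal V D) extends OneOperad d where
  α : (uAss d).Hom toOneOperadData

/-- Morphisms of multiplicative 1-operads. -/
structure MultOneOperad.Hom {V : Type uV} [Category.{vV} V] [MonoidalCategory V]
    [SymmetricCategory V] {D : Type uD} [Category.{vD} D] [EnrichedOrdinaryCategory V D]
    {d : StrictDuoidal V D} (A B : MultOneOperad d) where
  hom : A.toOneOperadData.Hom B.toOneOperadData
  α : ∀ n, A.α.map n ≫ hom.map n = B.α.map n

end Duoidal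

namespace StrictDuoidal

universe vV uV vD uD

open LevFam

variable {V : Type uV} [Category.{vV} V] [MonoidalCategory V] [SymmetricCategory V]
  {D : Type uD} [Category.{vD} D] [EnrichedOrdinaryCategory V D] (d : StrictDuoidal V D)
  {A B A' B' : Type}

/-! ### Powers of collections -/

/-- The power of a levelled family: a level with entries `b₁, …, bₖ` contributes
`val b₁ ⊠₁ ⋯ ⊠₁ val bₖ`, a level marked by `hor` contributes `e`; the contributions of the levels
are multiplied by `⊠₀` in the reversed order. -/
def pow (hor : A → Bool) (val : B → D) (X : LevFam A B) : D :=
  d.h0.rprod X fun L => bif hor L.1 then d.e else d.h1.prod L.2 val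

variable (hor : A → Bool) (val : B → D)

theorem prod_row (X : LevFam A B) (c : X.Lev) :
    d.h1.prod (X.get c).2 val = d.h1.prod (X.row c) fun q => val (X.label q) := by
  rw [row, d.h1.prod_map, d.h1.prod_get]; rfl

theorem rprod_lev (X : LevFam A B) (F : A → D) (G : X.Lev → D)
    (hG : ∀ c, G c = bif hor (X.flag c) then F (X.flag c) else
      d.h1.prod (X.row c) fun q => val (X.label q)) :
    d.h0.rprod X (fun L => bif hor L.1 then F L.1 else d.h1.prod L.2 val) =
      d.h0.rprod (List.finRange X.length) G := by
  rw [d.h0.rprod_get]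
  apply d.h0.rprod_congr
  intro c _
  rw [hG, ← prod_row]
  rfl

theorem pow_eq (X : LevFam A B) : d.pow hor val X = d.h0.rprod (List.finRange X.length) fun c =>
    bif hor (X.flag c) then d.e else d.h1.prod (X.row c) fun q => val (X.label q) :=
  d.rprod_lev hor val X (fun _ => d.e) _ fun _ => rfl

variable {X : LevFam A B} {Y : LevFam A' B'} (f : Map X Y) (horY : A' → Bool)

theorem pow_fib (i : Y.Pos) : d.pow hor val (fib f i) = d.h0.rprod (overLev f i.1) fun c =>
    bif hor (X.flag c) then d.e else d.h1.prod (overPos f c i) fun q => val (X.label q) := by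
  unfold pow fib sub
  rw [d.h0.rprod_map]
  apply d.h0.rprod_congr
  intro c _
  simp only [d.h1.prod_map, id]

theorem pow_over : d.pow hor val X = d.h0.rprod (List.finRange Y.length) fun c =>
    d.h0.rprod (overLev f c) fun l =>
      bif hor (X.flag l) then d.e else d.h1.prod (X.row l) fun q => val (X.label q) := by
  rw [d.pow_eq, finRange_eq f, d.h0.rprod_flatMap]

/-- The comultiplication over one level of the target. -/
def comulLev (c : Y.Lev) (hh : horY (Y.flag c) = true → ∀ l, f.lev l = c → hor (X.flag l) = true) :
    (d.h0.rprod (overLev f c) fun l =>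
      bif hor (X.flag l) then d.e else d.h1.prod (X.row l) fun q => val (X.label q)) ⟶
    bif horY (Y.flag c) then d.e else d.h1.prod (Y.row c) fun i => d.pow hor val (fib f i) :=
  if hc : horY (Y.flag c) = true then
    eqToHom (by
      rw [hc, cond_true]
      refine (d.h0.rprod_congr ?_).trans (d.h0.rprod_unit (overLev f c))
      intro l hl
      rw [hh hc l (by simpa using mem_selLev.1 hl), cond_true])
  else
    d.h0.rprodMap (overLev f c) (Y := fun l => d.h1.prod (Y.row c) fun i =>
        bif hor (X.flag l) then d.e else d.h1.prod (overPos f l i) fun q => val (X.label q))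
      (fun l hl =>
        if hl' : hor (X.flag l) = true then
          eqToHom (by rw [hl', cond_true]) ≫ d.eProd1 (Y.row c) ≫
            eqToHom (by rw [hl']; rfl)
        else eqToHom (by
          have hlc : f.lev l = c := by simpa using mem_selLev.1 hl
          rw [Bool.not_eq_true] at hl'
          rw [hl', cond_false]
          simp only [cond_false]
          rw [← d.h1.prod_flatMap, row_eq f l, hlc])) ≫
    d.inter _ (Y.row c) (overLev f c) ≫
    eqToHom (by
      rw [Bool.not_eq_true] at hc
      rw [hc, cond_false]
      apply d.h1.prod_congr
      intro i hi
      rw [d.pow_fib, mem_row.1 hi])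

/-- The comultiplication: the interchange from the power of `X` to the power of `Y` with entries
the powers of the fibres of `f`. -/
def comul (hh : ∀ l, horY (Y.flag (f.lev l)) = true → hor (X.flag l) = true) :
    d.pow hor val X ⟶ d.h0.rprod (List.finRange Y.length) fun c =>
      bif horY (Y.flag c) then d.e else d.h1.prod (Y.row c) fun i => d.pow hor val (fib f i) :=
  eqToHom (d.pow_over hor val f) ≫ d.h0.rprodMap (List.finRange Y.length) fun c _ =>
    d.comulLev hor val f horY c fun hc l hl => hh l (by rw [hl]; exact hc)

/-! ### The endomorphism operad for coloured 2-ordinals -/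

/-- The power `E^T`. -/
def powOmega (E : ℕ → D) (T : Omega) : D := d.pow (fun _ => false) E T.fam

theorem powOmega_eq (E : ℕ → D) (T : Omega) :
    d.powOmega E T = d.h0.rprod (List.finRange T.fam.length) fun c =>
      d.h1.prod (T.fam.row c) fun i => E (T.fam.label i) := d.pow_eq _ _ _

/-- The map induced by maps on the fibres, from the power of the source of `f` to the power of
its target. -/
def endOmegaMap (E : ℕ → D) {T S : Omega} (f : T ⟶ S) :
    tensL (fun i => d.powOmega E (Omega.fib f i) ⟶[V] E (S.fam.label i)) S.fam.positions ⟶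
      (d.powOmega E T ⟶[V] d.powOmega E S) :=
  tensUnflatten _ S.fam.row (List.finRange S.fam.length) ≫
    tensMap (fun c => d.h1.eProd _ _ (S.fam.row c)) _ ≫
    d.h0.eRprod _ _ (List.finRange S.fam.length) ≫
    eHomWhiskerRight V (d.comul (fun _ => false) E (Omega.Hom.map f) (fun _ => false)
      fun _ h => h) _ ≫
    eHomWhiskerLeft V _ (eqToHom (d.powOmega_eq E S).symm)

theorem powOmega_U (E : ℕ → D) (n : ℕ) : d.powOmega E (Omega.U n) = E n := by
  change d.h0.mul d.h0.unit (d.h1.mul (E n) d.h1.unit) = E n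
  rw [d.h0.one_mul, d.h1.mul_one]

/-- The endomorphism operad of a collection, for coloured 2-ordinals. -/
def endOmega (E : ℕ → D) : OperadData OmegaOC V where
  obj T := d.powOmega E T ⟶[V] E (Omega.out T)
  unit n := eHomEquiv V (eqToHom (d.powOmega_U E n))
  mul {T S} f := (d.endOmegaMap E f ▷ _) ≫ eComp V _ _ _ ≫
    eHomWhiskerLeft V _ (eqToHom (by rw [Omega.Hom.out f]))

/-! ### The endomorphism collection for trees with levels -/

/-- A white vertex of arity `n` contributes `E n`, a vertical vertex contributes `v`. -/
def vert (E : ℕ → D) (b : Bool × ℕ) : D := bif b.1 then E b.2 else d.v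

theorem vert_white (E : ℕ → D) {b : Bool × ℕ} (h : b.1 = true) : d.vert E b = E b.2 := by
  rw [vert, h, cond_true]

theorem vert_vertical (E : ℕ → D) {b : Bool × ℕ} (h : ¬ b.1 = true) : d.vert E b = d.v := by
  rw [Bool.not_eq_true] at h
  rw [vert, h, cond_false]

/-- The power `E^β`. -/
def powTree (E : ℕ → D) (T : LTree) : D :=
  d.h0.rprod T.fam fun L => bif L.1 then d.hpow L.2.length else d.h1.prod L.2 (d.vert E)

/-- The reduced power, with `e` for each horizontal level. -/
def powRed (E : ℕ → D) (X : LevFam Bool (Bool × ℕ)) : D := d.pow id (d.vert E) X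

/-- The canonical map from the reduced power. -/
def expandTree (E : ℕ → D) (T : LTree) : d.powRed E T.fam ⟶ d.powTree E T :=
  d.h0.rprodMap T.fam fun L _ =>
    if h : L.1 = true then eqToHom (by rw [id, h, cond_true]) ≫ d.expand L.2.length ≫
      eqToHom (by rw [h, cond_true])
    else eqToHom (by rw [Bool.not_eq_true] at h; rw [id, h, cond_false, cond_false])

/-- The map to the reduced power given by `e ⊠₁ ⋯ ⊠₁ e ⟶ e`. -/
def shrinkTree (E : ℕ → D) (T : LTree) : d.powTree E T ⟶ d.powRed E T.fam :=
  d.h0.rprodMap T.fam fun L _ =>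
    if h : L.1 = true then eqToHom (by rw [h, cond_true]) ≫ d.shrink L.2.length ≫
      eqToHom (by rw [id, h, cond_true])
    else eqToHom (by rw [Bool.not_eq_true] at h; rw [id, h, cond_false, cond_false])

theorem powOmega_omega (E : ℕ → D) (T : LTree) :
    d.powOmega E T.omega = d.powRed E T.fam := by
  have h1 : d.powOmega E T.omega = d.h0.rprod (T.fam.selLev T.nonHor) fun c =>
      d.h1.prod (T.fam.selPos T.white c) fun q => E (T.fam.label q).2 := by
    unfold powOmega pow
    refine (d.h0.rprod_map _ _ _).trans ?_
    apply d.h0.rprod_congr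
    intro c _
    simp only [d.h1.prod_map, cond_false]
  rw [h1, powRed, d.pow_eq, selLev, d.h0.rprod_filter]
  apply d.h0.rprod_congr
  intro c _
  rw [selPos, d.h1.prod_filter, LTree.nonHor]
  cases T.fam.flag c <;> rfl

/-- The map `θ`. -/
def theta (E : ℕ → D) (T : LTree) : d.powOmega E T.omega ⟶ d.powTree E T :=
  eqToHom (d.powOmega_omega E T) ≫ d.expandTree E T

theorem powTree_U (E : ℕ → D) (n : ℕ) : d.powTree E (LTree.U n) = E n := by
  change d.h0.mul d.h0.unit (d.h1.mul (E n) d.h1.unit) = E n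
  rw [d.h0.one_mul, d.h1.mul_one]

/-- The reduced power of a forest without white vertices maps to `v`. -/
def collapse (E : ℕ → D) (X : LevFam Bool (Bool × ℕ)) (hX : ∀ L ∈ X, ∀ b ∈ L.2, b.1 = false) :
    d.powRed E X ⟶ d.v :=
  d.h0.rprodMap (Y := fun _ => d.v) X (fun L hL =>
    if h : L.1 = true then eqToHom (by rw [id, h, cond_true]) ≫ d.ε
    else eqToHom (by
      rw [Bool.not_eq_true] at h
      rw [id, h, cond_false]
      refine (d.h1.prod_congr fun b hb => ?_).trans (d.h1.prod_unit L.2)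
      rw [vert, hX L hL b hb, cond_false])) ≫ d.vRprod0 X

section Mul

variable (E : ℕ → D) {T S : LTree} (f : T ⟶ S)

theorem fib_not_white (i : S.fam.Pos) (hi : ¬ S.white i = true) :
    ∀ L ∈ (LTree.fib f i).fam, ∀ b ∈ L.2, b.1 = false := by
  intro L hL b hb
  obtain ⟨c, -, rfl⟩ := List.mem_map.1 hL
  obtain ⟨q, hq, rfl⟩ := List.mem_map.1 hb
  have h2 : (LTree.Hom.map f).pos q = i := by simpa using (mem_selPos.1 hq).2
  by_contra h
  refine hi ?_
  rw [← h2]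
  exact LTree.Hom.white f q (Bool.not_eq_false _ ▸ h)

/-- The white vertices among the given ones. -/
def whites (S : LTree) (l : List S.fam.Pos) : List S.Idx :=
  l.filterMap fun p => if h : S.white p = true then some ⟨p, h⟩ else none

theorem elems_eq_whites (S : LTree) :
    S.elems = (List.finRange S.fam.length).flatMap fun c => whites S (S.fam.row c) := by
  have h1 : ∀ l : List S.fam.Pos, (whites S l).map Subtype.val = l.filter S.white := by
    intro l
    induction l with
    | nil => rfl
    | cons p l ih =>
      unfold whites at ih ⊢
      by_cases h : S.white p = true
      · rw [List.filterMap_cons, dif_pos h, List.filter_cons_of_pos h, ← ih]; rfl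
      · rw [List.filterMap_cons, dif_neg h, List.filter_cons_of_neg h, ← ih]
  apply S.map_val_injective
  rw [LTree.map_val_elems, positions, List.filter_flatMap, List.map_flatMap]
  congr 1
  funext c
  exact (h1 _).symm

/-- The `⊠₁`-product of maps on the fibres over the given vertices; over vertical vertices the
map from the power of the fibre to `v` is inserted. -/
def endTreeRow : ∀ l : List S.fam.Pos,
    tensL (fun i : S.Idx => d.powTree E (LTree.fib f i.1) ⟶[V] E (S.ar i.1)) (whites S l) ⟶
      (d.h1.prod l (fun i => d.powRed E (LTree.fib f i).fam) ⟶[V]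
        d.h1.prod l fun i => d.vert E (S.fam.label i))
  | [] => eId V _
  | i :: l =>
    if h : S.white i = true then
      eqToHom (by unfold whites; rw [List.filterMap_cons, dif_pos h]; rfl) ≫
        ((eHomWhiskerRight V (d.expandTree E (LTree.fib f i)) (E (S.ar i)) ≫
          eHomWhiskerLeft V _ (eqToHom (d.vert_white E h).symm)) ⊗ₘ endTreeRow l) ≫
        d.h1.homMul _ _ _ _
    else
      eqToHom (by unfold whites; rw [List.filterMap_cons, dif_neg h]) ≫ (λ_ _).inv ≫
        (eHomEquiv V (d.collapse E _ (fib_not_white f i h) ≫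
          eqToHom (d.vert_vertical E h).symm) ⊗ₘ endTreeRow l) ≫ d.h1.homMul _ _ _ _

/-- The maps on the fibres over the vertices of one level. -/
def endTreeLev (c : S.fam.Lev) :
    tensL (fun i : S.Idx => d.powTree E (LTree.fib f i.1) ⟶[V] E (S.ar i.1))
        (whites S (S.fam.row c)) ⟶
      ((bif id (S.fam.flag c) then d.e else
          d.h1.prod (S.fam.row c) fun i => d.powRed E (LTree.fib f i).fam) ⟶[V]
        (bif S.fam.flag c then d.hpow (S.fam.row c).length else
          d.h1.prod (S.fam.row c) fun i => d.vert E (S.fam.label i))) :=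
  if h : S.fam.flag c = true then
    eqToHom (by
      have : whites S (S.fam.row c) = [] := by
        rw [whites, List.filterMap_eq_nil_iff]
        intro i hi
        rw [dif_neg]
        rw [LTree.white, S.hor i (by rw [mem_row.1 hi]; exact h)]
        simp
      rw [this]; rfl) ≫
    eHomEquiv V (eqToHom (by rw [id, h, cond_true]) ≫ d.expand (S.fam.row c).length ≫
      eqToHom (by rw [h, cond_true]))
  else
    d.endTreeRow E f (S.fam.row c) ≫
      eqToHom (by rw [Bool.not_eq_true] at h; rw [id, h, cond_false, cond_false])

theorem powTree_eq (S : LTree) : d.powTree E S = d.h0.rprod (List.finRange S.fam.length) fun c =>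
    bif S.fam.flag c then d.hpow (S.fam.row c).length else
      d.h1.prod (S.fam.row c) fun i => d.vert E (S.fam.label i) := by
  rw [powTree, d.h0.rprod_get]
  apply d.h0.rprod_congr
  intro c _
  rw [← prod_row, row, List.length_map, List.length_finRange]
  rfl

/-- The map induced by maps on the fibres over white vertices, from the power of the source of
`f` to the power of its target. -/
def endTreeMap :
    tensL (fun i : S.Idx => d.powTree E (LTree.fib f i.1) ⟶[V] E (S.ar i.1)) S.elems ⟶
      (d.powTree E T ⟶[V] d.powTree E S) :=
  eqToHom (by rw [elems_eq_whites]) ≫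
    tensUnflatten _ (fun c => whites S (S.fam.row c)) (List.finRange S.fam.length) ≫
    tensMap (fun c => d.endTreeLev E f c) _ ≫
    d.h0.eRprod _ _ (List.finRange S.fam.length) ≫
    eHomWhiskerRight V (d.shrinkTree E T ≫
      d.comul id (d.vert E) (LTree.Hom.map f) id (LTree.Hom.hor f)) _ ≫
    eHomWhiskerLeft V _ (eqToHom (d.powTree_eq E S).symm)

end Mul

/-- The endomorphism collection for trees with levels, with its structure operations. -/
def endTree (E : ℕ → D) : OperadData LTrOC V where
  obj T := d.powTree E T ⟶[V] E (LTree.arity T)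
  unit n := eHomEquiv V (eqToHom (d.powTree_U E n))
  mul {T S} f := (d.endTreeMap E f ▷ _) ≫ eComp V _ _ _ ≫
    eHomWhiskerLeft V _ (eqToHom (by rw [LTree.Hom.arity f]))

/-- The map `Λ`. -/
def Lambda (E : ℕ → D) (T : LTree) :
    (d.endTree E).obj T ⟶ ((d.endOmega E).restrict omegaOF).obj T :=
  eHomWhiskerRight V (d.theta E T) (E T.arity)

/-! ### The action on a multiplicative 1-operad -/

variable {d}

/-- The iterated structure map of a 1-operad along a sequence of levels. -/
def _root_.OneOperadData.γTree (O : OneOperadData d) : ∀ (p : ℕ) (X : LevFam Bool (Bool × ℕ)) (n : ℕ),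
    IsTree p X n →
      (d.h0.mul (d.h0.rprod X fun L => d.h1.prod L.2 fun b => O.obj b.2) (O.obj p) ⟶ O.obj n)
  | p, [], n, h => eqToHom (by cases h; exact d.h0.one_mul _)
  | p, L :: X, n, h => eqToHom (d.h0.mul_assoc _ _ _) ≫
      d.h0.tens (𝟙 _) (eqToHom (by
        rw [d.h1.prod_map, List.length_map, h.1]) ≫ O.γ (L.2.map Prod.snd)) ≫
      γTree O _ X n h.2

/-- The map of powers given by the unit `α` of a multiplicative 1-operad. -/
def _root_.MultOneOperad.ω (O : MultOneOperad d) (X : LevFam Bool (Bool × ℕ)) :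
    (d.h0.rprod X fun L =>
      bif L.1 then d.hpow L.2.length else d.h1.prod L.2 (d.vert O.obj)) ⟶
    d.h0.rprod X fun L => d.h1.prod L.2 fun b => O.obj b.2 :=
  d.h0.rprodMap X fun L _ =>
    if h : L.1 = true then eqToHom (by rw [h, cond_true]) ≫
      d.hpowTo L.2 fun b _ => d.ε ≫ O.α.map b.2
    else eqToHom (by rw [Bool.not_eq_true] at h; rw [h, cond_false]) ≫
      d.h1.prodMap L.2 fun b _ =>
        if hb : b.1 = true then eqToHom (d.vert_white O.obj hb)
        else eqToHom (d.vert_vertical O.obj hb) ≫ O.α.map b.2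

/-- The map `A^β ⟶ A(n)`. -/
def _root_.MultOneOperad.act (O : MultOneOperad d) (T : LTree) :
    d.powTree O.obj T ⟶ O.obj T.arity :=
  O.ω T.fam ≫ eqToHom (d.h0.mul_one _).symm ≫ d.h0.tens (𝟙 _) O.j ≫ O.γTree 1 T.fam T.arity T.tree

/-- The map `Ψ`. -/
def _root_.MultOneOperad.Psi (O : MultOneOperad d) (T : LTree) :
    (OperadData.one LTrOC V).obj T ⟶ (d.endTree O.obj).obj T := eHomEquiv V (O.act T)

/-- The map of powers induced by a map of collections. -/
def powTreeMap (d : StrictDuoidal V D) {E E' : ℕ → D} (φ : ∀ n, E n ⟶ E' n) (T : LTree) :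
    d.powTree E T ⟶ d.powTree E' T :=
  d.h0.rprodMap T.fam fun L _ =>
    if h : L.1 = true then eqToHom (by rw [h, cond_true, cond_true])
    else eqToHom (by rw [Bool.not_eq_true] at h; rw [h, cond_false]) ≫
      d.h1.prodMap L.2 (X := d.vert E) (Y := d.vert E') (fun b _ =>
        if hb : b.1 = true then
          eqToHom (d.vert_white E hb) ≫ φ b.2 ≫ eqToHom (d.vert_white E' hb).symm
        else eqToHom ((d.vert_vertical E hb).trans (d.vert_vertical E' hb).symm)) ≫
      eqToHom (by rw [Bool.not_eq_true] at h; rw [h, cond_false])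

end StrictDuoidal

-- Two kinds of coherence data are first removed from the problem: the symmetries and associators of
-- `V`, and the equalities of objects in the strict products of `D`. What then remains is a calculus
-- of interchange maps, in which the theorem rests on a few identities.
--
-- Elements. A lax symmetric monoidal functor `L` from `V` to types (`LaxSym`) provides elements of
-- the objects of `V`, and on elements every regrouping of tensor factors is a mere reindexing.
-- Equality of maps out of a tensor product of different factors can be tested on elements. Indeed
-- `Formal.lax` sends `Z` to the maps into `Z` from tensor products over arbitrary lists, modulo
-- symmetries of the source, and by coherence (`IsSym.eq_id`) such a symmetry is the identity if the
-- list has no repetitions. This gives `hom_ext₃` and reduces the operad axioms to elements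
-- (`IsOperad.of_elements`).
--
-- Arrows. Elements of the hom objects of `D` are bundled with their source and target (`GArr`),
-- with a composition that is defined everywhere. Transports along equalities of objects become
-- invisible, and `D` turns into a `DuoAlg`, a strict duoidal category given by equations without
-- casts. There the interchange `chi` of an array is natural and compatible with cutting the array
-- into blocks of rows or of columns. Applied to the levels and vertices lying over each level of
-- the target, it gives the interchange `com f` along a map `f`, which is coassociative
-- (`com_coassoc`). This yields the associativity of the endomorphism operad of 2-ordinals
-- (`com_assoc`), and of its restriction to trees.
--
-- The map `Λ`. Rows of copies of `e` and columns of copies of `v` can be deleted from the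
-- interchange by the unit and counit laws. Since the comultiplication `expand` of a horizontal
-- level followed by `shrink` is the identity, `Λ` commutes with the structure operations without
-- any condition (`Lambda_commutes`). If the square commutes, then `shrink` followed by `expand` is
-- the identity too, `Λ` is invertible, and the operad axioms are reflected along it.
--
-- The maps `Ξ` and `Ψ`. By the associativity of a 1-operad, its action along a tree is the
-- interchange, followed by the actions of the fibres of a map, followed by the action along the
-- target (`tree_blocks`). Since `α` is a morphism from `UAss`, a fibre without white vertices acts
-- by the multiplication of `v` followed by `α` (`tree_α`); this is what the operations of the
-- endomorphism objects insert at a vertical vertex. Deleting rows and columns then gives `xi_map`,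
-- the compatibility of `Ξ` with the operations. For `Ψ` it follows by cancelling the invertible
-- `Λ`. Naturality holds because a morphism of multiplicative 1-operads passes through `γ`, `j` and
-- `α` one level at a time (`tree_map`, `ω_comp`).

universe u v w vV uV vD uD

/-! ### Generalized elements: lax symmetric monoidal functors to types -/

/-- A lax symmetric monoidal functor from `V` to types. -/
structure LaxSym (V : Type uV) [Category.{vV} V] [MonoidalCategory V] [SymmetricCategory V] where
  E : V → Type w
  map : ∀ {X Y : V}, (X ⟶ Y) → E X → E Y
  one : E (𝟙_ V)
  tens : ∀ {X Y : V}, E X → E Y → E (X ⊗ Y)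
  map_id : ∀ {X : V} (x : E X), map (𝟙 X) x = x
  map_comp : ∀ {X Y Z : V} (f : X ⟶ Y) (g : Y ⟶ Z) (x : E X), map (f ≫ g) x = map g (map f x)
  map_tens : ∀ {X X' Y Y' : V} (f : X ⟶ X') (g : Y ⟶ Y') (x : E X) (y : E Y),
    map (f ⊗ₘ g) (tens x y) = tens (map f x) (map g y)
  map_assoc : ∀ {X Y Z : V} (x : E X) (y : E Y) (z : E Z),
    map (α_ X Y Z).hom (tens (tens x y) z) = tens x (tens y z)
  map_left : ∀ {X : V} (x : E X), map (λ_ X).hom (tens one x) = x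
  map_right : ∀ {X : V} (x : E X), map (ρ_ X).hom (tens x one) = x
  map_braid : ∀ {X Y : V} (x : E X) (y : E Y), map (β_ X Y).hom (tens x y) = tens y x

namespace LaxSym

variable {V : Type uV} [Category.{vV} V] [MonoidalCategory V] [SymmetricCategory V]
  (L : LaxSym.{w} V) {ι κ : Type}

theorem map_iso_inv {X Y : V} (f : X ≅ Y) {x : L.E X} {y : L.E Y} (h : L.map f.hom x = y) :
    L.map f.inv y = x := by
  rw [← h, ← L.map_comp, f.hom_inv_id, L.map_id]

theorem map_assoc_inv {X Y Z : V} (x : L.E X) (y : L.E Y) (z : L.E Z) :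
    L.map (α_ X Y Z).inv (L.tens x (L.tens y z)) = L.tens (L.tens x y) z :=
  L.map_iso_inv _ (L.map_assoc x y z)

theorem map_left_inv {X : V} (x : L.E X) : L.map (λ_ X).inv x = L.tens L.one x :=
  L.map_iso_inv _ (L.map_left x)

theorem map_right_inv {X : V} (x : L.E X) : L.map (ρ_ X).inv x = L.tens x L.one :=
  L.map_iso_inv _ (L.map_right x)

theorem map_whiskerLeft {X Y Y' : V} (g : Y ⟶ Y') (x : L.E X) (y : L.E Y) :
    L.map (X ◁ g) (L.tens x y) = L.tens x (L.map g y) := by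
  rw [← id_tensorHom, L.map_tens, L.map_id]

theorem map_whiskerRight {X X' Y : V} (f : X ⟶ X') (x : L.E X) (y : L.E Y) :
    L.map (f ▷ Y) (L.tens x y) = L.tens (L.map f x) y := by
  rw [← tensorHom_id, L.map_tens, L.map_id]

theorem map_tensorμ {X Y Z W : V} (x : L.E X) (y : L.E Y) (z : L.E Z) (t : L.E W) :
    L.map (tensorμ X Y Z W) (L.tens (L.tens x y) (L.tens z t)) =
      L.tens (L.tens x z) (L.tens y t) := by
  simp only [tensorμ, L.map_comp, L.map_assoc, L.map_whiskerLeft, L.map_assoc_inv,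
    L.map_whiskerRight, L.map_braid]

/-- The tensor product of a family of elements. -/
def tensl {F : ι → V} (x : ∀ i, L.E (F i)) : ∀ l : List ι, L.E (tensL F l)
  | [] => L.one
  | i :: l => L.tens (x i) (tensl x l)

theorem map_tensMap {F G : ι → V} (φ : ∀ i, F i ⟶ G i) (x : ∀ i, L.E (F i)) :
    ∀ l : List ι, L.map (tensMap φ l) (L.tensl x l) = L.tensl (fun i => L.map (φ i) (x i)) l
  | [] => L.map_id _
  | i :: l => (L.map_tens (φ i) (tensMap φ l) (x i) (L.tensl x l)).trans
      (congrArg (L.tens _) (map_tensMap φ x l))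

theorem map_tensUnit {F : ι → V} (η : ∀ i, 𝟙_ V ⟶ F i) :
    ∀ l : List ι, L.map (tensUnit η l) L.one = L.tensl (fun i => L.map (η i) L.one) l
  | [] => L.map_id _
  | i :: l => by
    refine (L.map_comp (λ_ (𝟙_ V)).inv (η i ⊗ₘ tensUnit η l) L.one).trans ?_
    rw [L.map_left_inv, L.map_tens, map_tensUnit η l]
    rfl

theorem map_eqToHom_tensl {F : ι → V} (x : ∀ i, L.E (F i)) {l l' : List ι} (h : l = l')
    (e : tensL F l = tensL F l') : L.map (eqToHom e) (L.tensl x l) = L.tensl x l' := by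
  subst h; exact L.map_id _

theorem map_eqToHom_tens_right {X Y Y' : V} (x : L.E X) (y : L.E Y) (e : Y = Y')
    (e' : X ⊗ Y = X ⊗ Y') :
    L.map (eqToHom e') (L.tens x y) = L.tens x (L.map (eqToHom e) y) := by
  subst e; simp [L.map_id]

/-- Reindexing of a tensor product along a map of lists. -/
theorem map_eqToHom_tensl_map {F : ι → V} {G : κ → V} (x : ∀ i, L.E (F i)) (y : ∀ i, L.E (G i))
    (g : κ → ι) (hxy : ∀ k, HEq (y k) (x (g k))) (hFG : ∀ k, G k = F (g k)) : ∀ (l : List κ) (l' : List ι),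
    l.map g = l' → ∀ e : tensL G l = tensL F l', L.map (eqToHom e) (L.tensl y l) = L.tensl x l' := by
  have : G = fun k => F (g k) := funext hFG
  subst this
  have : y = fun k => x (g k) := funext fun k => eq_of_heq (hxy k)
  subst this
  rintro l _ rfl
  induction l with
  | nil => intro _; exact L.map_id _
  | cons k l ih =>
    intro e
    have h := L.map_eqToHom_tens_right (x (g k)) (L.tensl (fun k => x (g k)) l)
      (tensL_map g F l).symm e
    refine h.trans ?_
    rw [ih]; rfl

theorem map_tensSplit {F : ι → V} (x : ∀ i, L.E (F i)) (l' : List ι) : ∀ l : List ι,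
    L.map (tensSplit F l' l) (L.tensl x (l ++ l')) = L.tens (L.tensl x l) (L.tensl x l')
  | [] => L.map_left_inv _
  | i :: l => by
    refine (L.map_comp (F i ◁ tensSplit F l' l) (α_ _ _ _).inv
      (L.tens (x i) (L.tensl x (l ++ l')))).trans ?_
    rw [L.map_whiskerLeft, map_tensSplit x l' l, L.map_assoc_inv]; rfl

theorem map_tensUnflatten {F : ι → V} (x : ∀ i, L.E (F i)) (r : κ → List ι) : ∀ m : List κ,
    L.map (tensUnflatten F r m) (L.tensl x (m.flatMap r)) =
      L.tensl (F := fun k => tensL F (r k)) (fun k => L.tensl x (r k)) m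
  | [] => L.map_id _
  | k :: m => by
    refine (L.map_comp _ _ _).trans ?_
    rw [L.map_eqToHom_tensl x (List.flatMap_cons)]
    refine (L.map_comp (tensSplit F (m.flatMap r) (r k)) (_ ◁ tensUnflatten F r m) _).trans ?_
    rw [L.map_tensSplit, L.map_whiskerLeft, map_tensUnflatten x r m]
    rfl

theorem map_tensPull [DecidableEq ι] {F : ι → V} (x : ∀ i, L.E (F i)) (j : ι) :
    ∀ (l : List ι) (h : j ∈ l),
      L.map (tensPull F j l h) (L.tensl x l) = L.tens (x j) (L.tensl x (l.erase j))
  | i :: l, h => by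
    unfold tensPull
    split_ifs with hij
    · subst hij
      exact L.map_eqToHom_tensl (l := i :: l) (l' := i :: (i :: l).erase i) x (by simp) _
    · have hj : j ∈ l := by simpa [Ne.symm hij] using h
      refine (L.map_comp (F i ◁ tensPull F j l hj) _ (L.tens (x i) (L.tensl x l))).trans ?_
      rw [L.map_whiskerLeft, map_tensPull x j l]
      simp only [L.map_comp, L.map_assoc_inv, L.map_whiskerRight, L.map_braid, L.map_assoc]
      refine L.map_eqToHom_tensl (l := j :: i :: l.erase j) (l' := j :: (i :: l).erase j) x ?_ _
      rw [List.erase_cons_tail (by simpa using hij)]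

/-- The symmetry of `V` only exchanges the two arguments of `L.tens`; hence a permutation of the
factors changes nothing but the order in which the elements are listed. -/
theorem map_tensReorder [DecidableEq ι] {F : ι → V} (x : ∀ i, L.E (F i)) :
    ∀ (m l : List ι) (h : l.Perm m), L.map (tensReorder F m l h) (L.tensl x l) = L.tensl x m
  | [], l, h => L.map_eqToHom_tensl x (List.perm_nil.1 h) _
  | j :: m, l, h => by
    refine (L.map_comp (tensPull F j l _) (F j ◁ tensReorder F m (l.erase j) _) _).trans ?_
    rw [L.map_tensPull, L.map_whiskerLeft, map_tensReorder x m]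
    rfl

theorem map_tensZip {F G : ι → V} (x : ∀ i, L.E (F i)) (y : ∀ i, L.E (G i)) : ∀ l : List ι,
    L.map (tensZip F G l) (L.tens (L.tensl x l) (L.tensl y l)) =
      L.tensl (F := fun i => F i ⊗ G i) (fun i => L.tens (x i) (y i)) l
  | [] => L.map_left _
  | i :: l => by
    refine (L.map_comp (tensorμ (F i) (tensL F l) (G i) (tensL G l)) (_ ◁ tensZip F G l)
      (L.tens (L.tens (x i) (L.tensl x l)) (L.tens (y i) (L.tensl y l)))).trans ?_
    rw [L.map_tensorμ, L.map_whiskerLeft, map_tensZip x y l]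
    rfl

end LaxSym

/-! ### Elements with formal degrees -/

section Formal

variable {V : Type uV} [Category.{vV} V] [MonoidalCategory V] [SymmetricCategory V] {ι : Type}
  (F : ι → V)

/-- The maps between tensor products of families that are generated by the symmetry. -/
inductive IsSym : ∀ {s t : List ι}, (tensL F s ⟶ tensL F t) → Prop
  | nil : IsSym (s := []) (t := []) (𝟙 (𝟙_ V))
  | cons (i : ι) {s t : List ι} {φ : tensL F s ⟶ tensL F t} (h : IsSym φ) :
      IsSym (s := i :: s) (t := i :: t) (F i ◁ φ)
  | swap (i j : ι) (s : List ι) : IsSym (s := i :: j :: s) (t := j :: i :: s)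
      ((α_ (F i) (F j) (tensL F s)).inv ≫ ((β_ (F i) (F j)).hom ▷ tensL F s) ≫
        (α_ (F j) (F i) (tensL F s)).hom)
  | trans {s t u : List ι} {φ : tensL F s ⟶ tensL F t} {ψ : tensL F t ⟶ tensL F u}
      (h : IsSym φ) (h' : IsSym ψ) : IsSym (φ ≫ ψ)

namespace IsSym

variable {F}

theorem id : ∀ s : List ι, IsSym F (𝟙 (tensL F s))
  | [] => nil
  | i :: s => by
    have h : F i ◁ 𝟙 (tensL F s) = 𝟙 (tensL F (i :: s)) := whiskerLeft_id _ _
    rw [← h]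
    exact cons i (id s)

theorem eqToHom {s t : List ι} (h : s = t) (e : tensL F s = tensL F t) :
    IsSym F (eqToHom e) := by
  subst h; exact id s

theorem perm {s t : List ι} {φ : tensL F s ⟶ tensL F t} (h : IsSym F φ) : s.Perm t := by
  induction h with
  | nil => exact .nil
  | cons i _ ih => exact ih.cons i
  | swap i j s => exact .swap _ _ _
  | trans _ _ h1 h2 => exact h1.trans h2

/-- Each generator has an inverse of the same kind, a swap because the braiding is a symmetry. This
makes the relation in `formalSetoid` symmetric. -/
theorem symm {s t : List ι} {φ : tensL F s ⟶ tensL F t} (h : IsSym F φ) :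
    ∃ ψ : tensL F t ⟶ tensL F s, IsSym F ψ ∧ ψ ≫ φ = 𝟙 _ := by
  induction h with
  | nil => exact ⟨𝟙 (𝟙_ V), nil, Category.id_comp _⟩
  | cons i _ ih =>
    obtain ⟨ψ, h1, h2⟩ := ih
    refine ⟨F i ◁ ψ, cons i h1, ?_⟩
    refine (whiskerLeft_comp _ _ _).symm.trans ?_
    rw [h2]
    exact whiskerLeft_id _ _
  | swap i j s =>
    refine ⟨_, swap j i s, ?_⟩
    change ((α_ (F j) (F i) (tensL F s)).inv ≫ ((β_ (F j) (F i)).hom ▷ tensL F s) ≫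
      (α_ (F i) (F j) (tensL F s)).hom) ≫ (α_ (F i) (F j) (tensL F s)).inv ≫
      ((β_ (F i) (F j)).hom ▷ tensL F s) ≫ (α_ (F j) (F i) (tensL F s)).hom =
      𝟙 (F j ⊗ F i ⊗ tensL F s)
    simp [← comp_whiskerRight_assoc]
  | trans _ _ ih1 ih2 =>
    obtain ⟨ψ, h1, h2⟩ := ih1
    obtain ⟨ψ', h1', h2'⟩ := ih2
    refine ⟨ψ' ≫ ψ, h1'.trans h1, ?_⟩
    rw [Category.assoc, reassoc_of% h2, h2']

/-- With `append_right` and `append`, this is what makes the tensor product of elements with degrees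
well defined: a symmetry of one block extends to the concatenation, and `tensSplit` intertwines the
extension with the tensor product. -/
theorem append_left {s s' : List ι} {φ : tensL F s ⟶ tensL F s'} (h : IsSym F φ) (t : List ι) :
    ∃ χ : tensL F (s ++ t) ⟶ tensL F (s' ++ t), IsSym F χ ∧
      χ ≫ tensSplit F t s' = tensSplit F t s ≫ φ ▷ tensL F t := by
  induction h with
  | nil =>
    refine ⟨𝟙 _, id _, (Category.id_comp _).trans ?_⟩
    exact ((congrArg (fun z => tensSplit F t [] ≫ z) (id_whiskerRight (𝟙_ V) (tensL F t))).trans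
      (Category.comp_id _)).symm
  | @cons i s s' φ _ ih =>
    obtain ⟨χ, h1, h2⟩ := ih
    refine ⟨F i ◁ χ, cons i h1, ?_⟩
    have key : ∀ {A X X' Y Y' T : V} (χ : X ⟶ X') (σ : X ⟶ Y ⊗ T) (σ' : X' ⟶ Y' ⊗ T) (φ : Y ⟶ Y'),
        χ ≫ σ' = σ ≫ φ ▷ T → A ◁ χ ≫ A ◁ σ' ≫ (α_ A Y' T).inv =
          (A ◁ σ ≫ (α_ A Y T).inv) ≫ (A ◁ φ) ▷ T := by
      intro A X X' Y Y' T χ σ σ' φ h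
      rw [← whiskerLeft_comp_assoc, h]
      simp
    exact key χ _ _ φ h2
  | swap i j s =>
    refine ⟨_, swap i j (s ++ t), ?_⟩
    have key : ∀ {A B X S T : V} (σ : X ⟶ S ⊗ T),
        ((α_ A B X).inv ≫ (β_ A B).hom ▷ X ≫ (α_ B A X).hom) ≫
          B ◁ (A ◁ σ ≫ (α_ A S T).inv) ≫ (α_ B (A ⊗ S) T).inv =
        (A ◁ (B ◁ σ ≫ (α_ B S T).inv) ≫ (α_ A (B ⊗ S) T).inv) ≫
          ((α_ A B S).inv ≫ (β_ A B).hom ▷ S ≫ (α_ B A S).hom) ▷ T := by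
      intro A B X S T σ
      -- The swap slides past the splitting of the tail by naturality; the rest is coherence of
      -- associators.
      have h : (α_ A B X).inv ≫ (β_ A B).hom ▷ X ≫ (α_ B A X).hom ≫ B ◁ A ◁ σ =
          A ◁ B ◁ σ ≫ (α_ A B (S ⊗ T)).inv ≫ (β_ A B).hom ▷ (S ⊗ T) ≫ (α_ B A (S ⊗ T)).hom := by
        rw [← associator_naturality_right, ← whisker_exchange_assoc,
          associator_inv_naturality_right_assoc]
      simp only [Category.assoc, MonoidalCategory.whiskerLeft_comp]
      rw [reassoc_of% h]
      monoidal
    exact key _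
  | @trans s₁ s₂ s₃ φ φ' _ _ ih1 ih2 =>
    obtain ⟨χ, h1, h2⟩ := ih1
    obtain ⟨χ', h1', h2'⟩ := ih2
    refine ⟨_, h1.trans h1', ?_⟩
    rw [Category.assoc, h2', reassoc_of% h2, comp_whiskerRight]

theorem append_right {t t' : List ι} {ψ : tensL F t ⟶ tensL F t'} (h : IsSym F ψ) :
    ∀ s : List ι, ∃ χ : tensL F (s ++ t) ⟶ tensL F (s ++ t'), IsSym F χ ∧
      χ ≫ tensSplit F t' s = tensSplit F t s ≫ tensL F s ◁ ψ
  | [] => ⟨ψ, h, leftUnitor_inv_naturality ψ⟩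
  | i :: s => by
    obtain ⟨χ, h1, h2⟩ := append_right h s
    refine ⟨F i ◁ χ, cons i h1, ?_⟩
    have key : ∀ {A X X' S T T' : V} (χ : X ⟶ X') (σ : X ⟶ S ⊗ T) (σ' : X' ⟶ S ⊗ T') (ψ : T ⟶ T'),
        χ ≫ σ' = σ ≫ S ◁ ψ → A ◁ χ ≫ A ◁ σ' ≫ (α_ A S T').inv =
          (A ◁ σ ≫ (α_ A S T).inv) ≫ (A ⊗ S) ◁ ψ := by
      intro A X X' S T T' χ σ σ' ψ h
      rw [← whiskerLeft_comp_assoc, h]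
      simp
    exact key χ _ _ ψ h2

theorem append {s s' : List ι} {φ : tensL F s ⟶ tensL F s'} (h : IsSym F φ) {t t' : List ι}
    {ψ : tensL F t ⟶ tensL F t'} (h' : IsSym F ψ) :
    ∃ χ : tensL F (s ++ t) ⟶ tensL F (s' ++ t'), IsSym F χ ∧
      χ ≫ tensSplit F t' s' = tensSplit F t s ≫ (φ ⊗ₘ ψ) := by
  obtain ⟨χ, h1, h2⟩ := append_left h t
  obtain ⟨χ', h1', h2'⟩ := append_right h' s'
  refine ⟨_, h1.trans h1', ?_⟩
  rw [Category.assoc, h2', reassoc_of% h2, MonoidalCategory.tensorHom_def]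

/-- Interchanging two blocks. -/
theorem braid (t : List ι) : ∀ s : List ι, ∃ χ : tensL F (s ++ t) ⟶ tensL F (t ++ s),
    IsSym F χ ∧ χ ≫ tensSplit F s t = tensSplit F t s ≫ (β_ _ _).hom
  | [] => by
    refine ⟨CategoryTheory.eqToHom (by rw [List.append_nil]; rfl), eqToHom (by simp) _, ?_⟩
    -- Splitting off an empty block at the end is the right unitor; the claim then becomes the
    -- compatibility of the braiding with the unit.
    have h : ∀ t : List ι, CategoryTheory.eqToHom (by rw [List.append_nil]) ≫ tensSplit F [] t =
        (ρ_ (tensL F t)).inv := by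
      intro t
      induction t with
      | nil =>
        change 𝟙 _ ≫ (λ_ (𝟙_ V)).inv = (ρ_ (𝟙_ V)).inv
        simp [unitors_inv_equal]
      | cons i t ih =>
        have e : (CategoryTheory.eqToHom (by rw [List.append_nil]) :
            tensL F (i :: t) ⟶ tensL F (i :: t ++ [])) = F i ◁ CategoryTheory.eqToHom
              (show tensL F t = tensL F (t ++ []) by rw [List.append_nil]) := by
          rw [whiskerLeft_eqToHom]; rfl
        rw [e]
        refine (whiskerLeft_comp_assoc (F i) _ (tensSplit F [] t)
          (α_ (F i) (tensL F t) (𝟙_ V)).inv).symm.trans ?_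
        rw [ih]
        exact (rightUnitor_tensor_inv (F i) (tensL F t)).symm
    refine (h t).trans ?_
    exact (leftUnitor_inv_braiding (tensL F t)).symm
  | i :: s => by
    obtain ⟨χ, h1, h2⟩ := braid t s
    -- The single factor `F i` is moved past the block `t` by successive swaps; by the hexagon
    -- identity this is the braiding of `F i` with the whole block.
    have h : ∀ t : List ι, ∃ χ : tensL F (i :: (t ++ s)) ⟶ tensL F (t ++ i :: s), IsSym F χ ∧
        χ ≫ tensSplit F (i :: s) t = F i ◁ tensSplit F s t ≫ (α_ _ _ _).inv ≫
          (β_ _ _).hom ▷ _ ≫ (α_ _ _ _).hom := by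
      intro t
      induction t with
      | nil =>
        refine ⟨𝟙 _, id _, ?_⟩
        refine (Category.id_comp _).trans ?_
        change (λ_ (F i ⊗ tensL F s)).inv = F i ◁ (λ_ (tensL F s)).inv ≫
          (α_ (F i) (𝟙_ V) (tensL F s)).inv ≫ (β_ (F i) (𝟙_ V)).hom ▷ tensL F s ≫
          (α_ (𝟙_ V) (F i) (tensL F s)).hom
        simp
      | cons j t ih =>
        obtain ⟨χ, h1, h2⟩ := ih
        refine ⟨_, (swap i j (t ++ s)).trans (cons j h1), ?_⟩
        have key : ∀ {A B X X' S T : V} (χ : A ⊗ X ⟶ X') (σ : X ⟶ T ⊗ S) (σ' : X' ⟶ T ⊗ A ⊗ S),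
            χ ≫ σ' = A ◁ σ ≫ (α_ _ _ _).inv ≫ (β_ A T).hom ▷ S ≫ (α_ _ _ _).hom →
            (((α_ A B X).inv ≫ (β_ A B).hom ▷ X ≫ (α_ B A X).hom) ≫ B ◁ χ) ≫ B ◁ σ' ≫
              (α_ B T (A ⊗ S)).inv =
            A ◁ (B ◁ σ ≫ (α_ B T S).inv) ≫ (α_ A (B ⊗ T) S).inv ≫ (β_ A (B ⊗ T)).hom ▷ S ≫
              (α_ (B ⊗ T) A S).hom := by
          intro A B X X' S T χ σ σ' h
          simp only [Category.assoc]
          have h' : (α_ A B X).inv ≫ (β_ A B).hom ▷ X ≫ (α_ B A X).hom ≫ B ◁ A ◁ σ =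
              A ◁ B ◁ σ ≫ (α_ A B (T ⊗ S)).inv ≫ (β_ A B).hom ▷ (T ⊗ S) ≫
                (α_ B A (T ⊗ S)).hom := by
            rw [← associator_naturality_right, ← whisker_exchange_assoc,
              associator_inv_naturality_right_assoc]
          rw [← whiskerLeft_comp_assoc, h, BraidedCategory.braiding_tensor_right_hom]
          simp only [MonoidalCategory.whiskerLeft_comp, Category.assoc]
          rw [reassoc_of% h']
          monoidal
        exact key χ _ _ h2
    obtain ⟨χ', h1', h2'⟩ := h t
    refine ⟨_, (cons i h1).trans h1', (Category.assoc (F i ◁ χ) χ' _).trans ?_⟩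
    refine (congrArg (fun z => F i ◁ χ ≫ z) h2').trans ?_
    have key : ∀ {A X X' S T : V} (χ : X ⟶ X') (σ : X ⟶ S ⊗ T) (σ' : X' ⟶ T ⊗ S),
        χ ≫ σ' = σ ≫ (β_ S T).hom → A ◁ χ ≫ A ◁ σ' ≫ (α_ _ _ _).inv ≫ (β_ A T).hom ▷ S ≫
          (α_ _ _ _).hom = (A ◁ σ ≫ (α_ A S T).inv) ≫ (β_ (A ⊗ S) T).hom := by
      intro A X X' S T χ σ σ' h
      rw [← whiskerLeft_comp_assoc, h, BraidedCategory.braiding_tensor_left_hom]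
      simp
    exact key χ _ _ h2

/-- `l` with `j` inserted, and the symmetry moving `j` to the front. -/
inductive _root_.IsPull (F : ι → V) (j : ι) :
    ∀ l m : List ι, (tensL F m ⟶ F j ⊗ tensL F l) → Prop
  | here (l : List ι) : IsPull F j l (j :: l) (𝟙 (F j ⊗ tensL F l))
  | there (i : ι) {l m : List ι} {p : tensL F m ⟶ F j ⊗ tensL F l} (h : IsPull F j l m p) :
      IsPull F j (i :: l) (i :: m) (F i ◁ p ≫ (α_ (F i) (F j) (tensL F l)).inv ≫
        (β_ (F i) (F j)).hom ▷ tensL F l ≫ (α_ (F j) (F i) (tensL F l)).hom)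

theorem _root_.IsPull.mem {j : ι} {l m : List ι} {p : tensL F m ⟶ F j ⊗ tensL F l}
    (h : IsPull F j l m p) : j ∈ m := by
  induction h with
  | here l => exact List.mem_cons_self
  | there i _ ih => exact List.mem_cons_of_mem _ ih

theorem slide {A B X Y : V} (σ : X ⟶ Y) :
    (α_ A B X).inv ≫ (β_ A B).hom ▷ X ≫ (α_ B A X).hom ≫ B ◁ A ◁ σ =
      A ◁ B ◁ σ ≫ (α_ A B Y).inv ≫ (β_ A B).hom ▷ Y ≫ (α_ B A Y).hom := by
  rw [← associator_naturality_right, ← whisker_exchange_assoc,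
    associator_inv_naturality_right_assoc]

theorem swap_swap (A B X : V) :
    (α_ A B X).inv ≫ (β_ A B).hom ▷ X ≫ (α_ B A X).hom ≫ (α_ B A X).inv ≫
      (β_ B A).hom ▷ X ≫ (α_ A B X).hom = 𝟙 _ := by
  simp [← comp_whiskerRight_assoc]

/-- The braid relation settles the case of `pull` in which the two swapped factors both differ from
the one that is pulled out. -/
theorem yang_baxter_whisker (A B J R : V) :
    (α_ A B (J ⊗ R)).inv ≫ (β_ A B).hom ▷ (J ⊗ R) ≫ (α_ B A (J ⊗ R)).hom ≫
      B ◁ ((α_ A J R).inv ≫ (β_ A J).hom ▷ R ≫ (α_ J A R).hom) ≫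
      (α_ B J (A ⊗ R)).inv ≫ (β_ B J).hom ▷ (A ⊗ R) ≫ (α_ J B (A ⊗ R)).hom =
    A ◁ ((α_ B J R).inv ≫ (β_ B J).hom ▷ R ≫ (α_ J B R).hom) ≫
      (α_ A J (B ⊗ R)).inv ≫ (β_ A J).hom ▷ (B ⊗ R) ≫ (α_ J A (B ⊗ R)).hom ≫
      J ◁ ((α_ A B R).inv ≫ (β_ A B).hom ▷ R ≫ (α_ B A R).hom) := by
  have h := congrArg (fun z => A ◁ (α_ B J R).inv ≫ (α_ A (B ⊗ J) R).inv ≫ z ▷ R ≫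
    (α_ J (B ⊗ A) R).hom ≫ J ◁ (α_ B A R).hom) (BraidedCategory.yang_baxter A B J)
  refine Eq.trans ?_ (h.trans ?_) <;> monoidal

/-- An `IsPull` singles out one occurrence of `j`. A symmetry carries it to an occurrence in `t`,
and pulling it to the front commutes with the symmetry up to a symmetry of the remaining factors.
This is the induction step for `eq_id`. -/
theorem pull {s t : List ι} {φ : tensL F s ⟶ tensL F t} (h : IsSym F φ) (hs : s.Nodup) {j : ι}
    {s' : List ι} {p : tensL F s ⟶ F j ⊗ tensL F s'} (hp : IsPull F j s' s p) :
    ∃ (t' : List ι) (q : tensL F t ⟶ F j ⊗ tensL F t') (φ' : tensL F s' ⟶ tensL F t'),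
      IsPull F j t' t q ∧ IsSym F φ' ∧ φ ≫ q = p ≫ F j ◁ φ' := by
  induction h generalizing s' with
  | nil => cases hp
  | @cons i s t φ h ih =>
    cases hp with
    | here =>
      refine ⟨t, 𝟙 _, φ, .here t, h, (Category.comp_id _).trans (Category.id_comp _).symm⟩
    | @there _ l _ p hp =>
      obtain ⟨t', q, φ', h1, h2, h3⟩ := ih (List.nodup_cons.1 hs).2 hp
      refine ⟨i :: t', _, F i ◁ φ', .there i h1, cons i h2, ?_⟩
      have key : ∀ {A B S T S' T' : V} (φ : S ⟶ T) (q : T ⟶ B ⊗ T') (p : S ⟶ B ⊗ S') (φ' : S' ⟶ T'),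
          φ ≫ q = p ≫ B ◁ φ' → A ◁ φ ≫ A ◁ q ≫ (α_ A B T').inv ≫ (β_ A B).hom ▷ T' ≫
            (α_ B A T').hom = (A ◁ p ≫ (α_ A B S').inv ≫ (β_ A B).hom ▷ S' ≫ (α_ B A S').hom) ≫
              B ◁ A ◁ φ' := by
        intro A B S T S' T' φ q p φ' h
        simp only [Category.assoc]
        rw [slide, ← whiskerLeft_comp_assoc, h, whiskerLeft_comp_assoc]
      exact key φ q p φ' h3
  | swap a b s =>
    have hab : a ≠ b := fun e => (List.nodup_cons.1 hs).1 (e ▸ List.mem_cons_self)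
    cases hp with
    | here =>
      refine ⟨b :: s, _, 𝟙 _, .there b (.here s), id _, ?_⟩
      have key : ∀ A B X : V, ((α_ A B X).inv ≫ (β_ A B).hom ▷ X ≫ (α_ B A X).hom) ≫
          B ◁ 𝟙 (A ⊗ X) ≫ (α_ B A X).inv ≫ (β_ B A).hom ▷ X ≫ (α_ A B X).hom =
          𝟙 (A ⊗ B ⊗ X) ≫ A ◁ 𝟙 (B ⊗ X) := by
        intro A B X
        simpa using swap_swap A B X
      exact key _ _ _
    | @there _ l _ p hp =>
      cases hp with
      | here =>
        refine ⟨a :: s, _, 𝟙 _, .here _, id _, ?_⟩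
        have key : ∀ A B X : V, ((α_ A B X).inv ≫ (β_ A B).hom ▷ X ≫ (α_ B A X).hom) ≫
            𝟙 (B ⊗ A ⊗ X) = (A ◁ 𝟙 (B ⊗ X) ≫ (α_ A B X).inv ≫ (β_ A B).hom ▷ X ≫
              (α_ B A X).hom) ≫ B ◁ 𝟙 (A ⊗ X) := by
          intro A B X
          simp
        exact key _ _ _
      | @there _ l _ p hp =>
        refine ⟨b :: a :: l, _, _, .there b (.there a hp), swap a b l, ?_⟩
        have key : ∀ {A B J S R : V} (p : S ⟶ J ⊗ R),
            ((α_ A B S).inv ≫ (β_ A B).hom ▷ S ≫ (α_ B A S).hom) ≫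
              B ◁ (A ◁ p ≫ (α_ A J R).inv ≫ (β_ A J).hom ▷ R ≫ (α_ J A R).hom) ≫
              (α_ B J (A ⊗ R)).inv ≫ (β_ B J).hom ▷ (A ⊗ R) ≫ (α_ J B (A ⊗ R)).hom =
            (A ◁ (B ◁ p ≫ (α_ B J R).inv ≫ (β_ B J).hom ▷ R ≫ (α_ J B R).hom) ≫
              (α_ A J (B ⊗ R)).inv ≫ (β_ A J).hom ▷ (B ⊗ R) ≫ (α_ J A (B ⊗ R)).hom) ≫
              J ◁ ((α_ A B R).inv ≫ (β_ A B).hom ▷ R ≫ (α_ B A R).hom) := by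
          intro A B J S R p
          rw [MonoidalCategory.whiskerLeft_comp, Category.assoc, Category.assoc, Category.assoc,
            Category.assoc, reassoc_of% slide p, yang_baxter_whisker,
            ← whiskerLeft_comp_assoc, Category.assoc]
          simp
        exact key p
  | @trans s t u φ ψ hφ hψ ih1 ih2 =>
    obtain ⟨t', q, φ', h1, h2, h3⟩ := ih1 hs hp
    obtain ⟨u', r, ψ', h1', h2', h3'⟩ := ih2 (hφ.perm.nodup_iff.1 hs) h1
    refine ⟨u', r, φ' ≫ ψ', h1', h2.trans h2', ?_⟩
    rw [Category.assoc, h3', reassoc_of% h3, MonoidalCategory.whiskerLeft_comp]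

/-- Coherence: a symmetry of a tensor product of different factors is the identity. -/
theorem eq_id : ∀ {s : List ι} {φ : tensL F s ⟶ tensL F s}, IsSym F φ → s.Nodup → φ = 𝟙 _
  | [], φ, h, _ => by
    -- For the empty list all intermediate lists are empty too, by `perm`, so that only identities
    -- are composed.
    have key : ∀ {s t : List ι} {φ : tensL F s ⟶ tensL F t}, IsSym F φ → ∀ hs : s = [],
        ∀ ht : t = [], φ = CategoryTheory.eqToHom (by rw [hs, ht]) := by
      intro s t φ h
      induction h with
      | nil => intros; rfl
      | cons => intro h; cases h
      | swap => intro h; cases h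
      | trans h1 h2 ih1 ih2 =>
        intro hs ht
        have := h1.perm.symm
        rw [hs] at this
        rw [ih1 hs this.eq_nil, ih2 this.eq_nil ht, eqToHom_trans]
    exact key h rfl rfl
  | j :: s, φ, h, hs => by
    -- In the target `j` must again be the first entry, as it does not occur in `s`. Hence `φ` is a
    -- symmetry of the tail, whiskered with `F j`.
    obtain ⟨t', q, φ', h1, h2, h3⟩ := h.pull hs (.here s)
    cases h1 with
    | here =>
      have h4 := eq_id h2 (List.nodup_cons.1 hs).2
      subst h4
      refine (Category.comp_id _).symm.trans (h3.trans ((Category.id_comp _).trans ?_))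
      exact whiskerLeft_id _ _
    | there _ h1 => exact absurd h1.mem (List.nodup_cons.1 hs).1

end IsSym

end Formal

/-! ### The lax symmetric monoidal functor of elements with formal degrees -/

section Formal

variable {V : Type uV} [Category.{vV} V] [MonoidalCategory V] [SymmetricCategory V] {ι : Type}
  (F : ι → V)

/-- Two maps out of tensor products of families are identified if they differ by a symmetry. -/
instance formalSetoid (Z : V) : Setoid (Σ s : List ι, tensL F s ⟶ Z) where
  r x y := ∃ φ : tensL F x.1 ⟶ tensL F y.1, IsSym F φ ∧ x.2 = φ ≫ y.2
  iseqv :=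
    { refl := fun x => ⟨𝟙 _, .id _, (Category.id_comp _).symm⟩
      symm := by
        rintro x y ⟨φ, h, e⟩
        obtain ⟨ψ, h1, h2⟩ := h.symm
        exact ⟨ψ, h1, by rw [e, reassoc_of% h2]⟩
      trans := by
        rintro x y z ⟨φ, h, e⟩ ⟨ψ, h', e'⟩
        exact ⟨φ ≫ ψ, h.trans h', by rw [e, e', Category.assoc]⟩ }

namespace Formal

variable {F}

def mk {Z : V} (s : List ι) (x : tensL F s ⟶ Z) : Quotient (formalSetoid F Z) :=
  Quotient.mk _ ⟨s, x⟩

theorem sound {Z : V} {s t : List ι} {x : tensL F s ⟶ Z} {y : tensL F t ⟶ Z}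
    {φ : tensL F s ⟶ tensL F t} (h : IsSym F φ) (e : x = φ ≫ y) : mk s x = mk t y :=
  Quotient.sound ⟨φ, h, e⟩

/-- The symmetry relating two representatives of the same degree is the identity by coherence. With
a repeated factor, its self-symmetry could relate different maps. -/
theorem exact {Z : V} {s : List ι} (hs : s.Nodup) {x y : tensL F s ⟶ Z} (h : mk s x = mk s y) :
    x = y := by
  obtain ⟨φ, h1, h2⟩ := Quotient.exact h
  have h3 : x = φ ≫ y := h2
  rw [h3, h1.eq_id hs, Category.id_comp]

/-- Degrees are concatenated; independence of the representatives is `IsSym.append`. -/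
def tens {X Y : V} : Quotient (formalSetoid F X) → Quotient (formalSetoid F Y) →
    Quotient (formalSetoid F (X ⊗ Y)) :=
  Quotient.lift₂ (fun x y => mk (x.1 ++ y.1) (tensSplit F y.1 x.1 ≫ (x.2 ⊗ₘ y.2))) (by
    rintro ⟨s, x⟩ ⟨t, y⟩ ⟨s', x'⟩ ⟨t', y'⟩ ⟨φ, h, e⟩ ⟨ψ, h', e'⟩
    obtain ⟨χ, h1, h2⟩ := h.append h'
    dsimp only at h h' e e' h1 h2 χ ⊢
    refine sound h1 ?_
    rw [reassoc_of% h2, e, e', MonoidalCategory.tensorHom_comp_tensorHom])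

omit [SymmetricCategory V] in
theorem tensSplit_assoc (t u : List ι) : ∀ s : List ι,
    (eqToHom (by rw [List.append_assoc]) : tensL F (s ++ (t ++ u)) ⟶ tensL F ((s ++ t) ++ u)) ≫
      tensSplit F u (s ++ t) ≫ (tensSplit F t s ▷ tensL F u) ≫ (α_ _ _ _).hom =
    tensSplit F (t ++ u) s ≫ (tensL F s ◁ tensSplit F u t)
  | [] => by
    change 𝟙 _ ≫ tensSplit F u t ≫ (λ_ (tensL F t)).inv ▷ tensL F u ≫ (α_ (𝟙_ V) _ _).hom =
      (λ_ (tensL F (t ++ u))).inv ≫ 𝟙_ V ◁ tensSplit F u t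
    simp
  | i :: s => by
    have e : (eqToHom (by rw [List.append_assoc]) :
        tensL F (i :: s ++ (t ++ u)) ⟶ tensL F ((i :: s ++ t) ++ u)) = F i ◁ eqToHom
          (show tensL F (s ++ (t ++ u)) = tensL F ((s ++ t) ++ u) by rw [List.append_assoc]) := by
      rw [whiskerLeft_eqToHom]; rfl
    rw [e]
    have key : ∀ {A X Y ST S TU T U : V} (e : X ⟶ Y) (p : Y ⟶ ST ⊗ U) (q : ST ⟶ S ⊗ T)
        (p' : X ⟶ S ⊗ TU) (q' : TU ⟶ T ⊗ U),
        e ≫ p ≫ q ▷ U ≫ (α_ S T U).hom = p' ≫ S ◁ q' →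
        A ◁ e ≫ (A ◁ p ≫ (α_ A ST U).inv) ≫ (A ◁ q ≫ (α_ A S T).inv) ▷ U ≫ (α_ (A ⊗ S) T U).hom =
          (A ◁ p' ≫ (α_ A S TU).inv) ≫ (A ⊗ S) ◁ q' := by
      intro A X Y ST S TU T U e p q p' q' h
      have h' := congrArg (fun z => A ◁ z ≫ (α_ A S (T ⊗ U)).inv) h
      refine Eq.trans ?_ (h'.trans ?_) <;> monoidal
    exact key _ _ _ _ _ (tensSplit_assoc t u s)

omit [SymmetricCategory V] in
theorem tensSplit_nil (t : List ι) :
    (eqToHom (by rw [List.append_nil]) : tensL F t ⟶ tensL F (t ++ [])) ≫ tensSplit F [] t =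
      (ρ_ (tensL F t)).inv := by
  induction t with
  | nil =>
    change 𝟙 _ ≫ (λ_ (𝟙_ V)).inv = (ρ_ (𝟙_ V)).inv
    simp [unitors_inv_equal]
  | cons i t ih =>
    have e : (eqToHom (by rw [List.append_nil]) :
        tensL F (i :: t) ⟶ tensL F (i :: t ++ [])) = F i ◁ eqToHom
          (show tensL F t = tensL F (t ++ []) by rw [List.append_nil]) := by
      rw [whiskerLeft_eqToHom]; rfl
    rw [e]
    refine (whiskerLeft_comp_assoc (F i) _ (tensSplit F [] t)
      (α_ (F i) (tensL F t) (𝟙_ V)).inv).symm.trans ?_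
    rw [ih]
    exact (rightUnitor_tensor_inv (F i) (tensL F t)).symm

variable (F)

/-- Elements with degrees in the given family, as a lax symmetric monoidal functor. -/
def lax : LaxSym.{vV} V where
  E Z := Quotient (formalSetoid F Z)
  map f := Quotient.map (fun x => ⟨x.1, x.2 ≫ f⟩) (by
    rintro ⟨s, x⟩ ⟨t, y⟩ ⟨φ, h, e⟩
    dsimp only at h e φ
    exact ⟨φ, h, by simp [e]⟩)
  one := mk [] (𝟙 (𝟙_ V))
  tens := tens
  map_id := by
    rintro X ⟨s, x⟩
    exact congrArg (mk s) (Category.comp_id x)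
  map_comp := by
    rintro X Y Z f g ⟨s, x⟩
    exact congrArg (mk s) (Category.assoc x f g).symm
  map_tens := by
    rintro X X' Y Y' f g ⟨s, x⟩ ⟨t, y⟩
    refine congrArg (mk (s ++ t)) ?_
    simp
  map_assoc := by
    rintro X Y Z ⟨s, x⟩ ⟨t, y⟩ ⟨u, z⟩
    -- The two degrees are equal lists, and the transport between them is a symmetry.
    refine (sound (.eqToHom (List.append_assoc s t u).symm (by rw [List.append_assoc])) ?_).symm
    dsimp only
    have h := tensSplit_assoc (F := F) t u s
    have h' := congrArg (fun p => p ≫ (x ⊗ₘ (y ⊗ₘ z))) h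
    refine Eq.trans ?_ (h'.symm.trans ?_)
    · rw [Category.assoc, ← id_tensorHom, MonoidalCategory.tensorHom_comp_tensorHom,
        Category.id_comp]
    · have a1 : ((tensSplit F t s ≫ (x ⊗ₘ y)) ⊗ₘ z) =
          tensSplit F t s ▷ tensL F u ≫ ((x ⊗ₘ y) ⊗ₘ z) := by
        rw [← tensorHom_id, MonoidalCategory.tensorHom_comp_tensorHom, Category.id_comp]
      rw [a1]
      simp only [Category.assoc, associator_naturality]
  map_left := by
    rintro X ⟨s, x⟩
    refine congrArg (mk s) ?_
    change ((λ_ (tensL F s)).inv ≫ (𝟙 (𝟙_ V) ⊗ₘ x)) ≫ (λ_ X).hom = x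
    simp
  map_right := by
    rintro X ⟨s, x⟩
    refine (sound (.eqToHom (List.append_nil s).symm (by rw [List.append_nil])) ?_).symm
    change x = eqToHom _ ≫ (tensSplit F [] s ≫ (x ⊗ₘ 𝟙 (𝟙_ V))) ≫ (ρ_ X).hom
    have h := tensSplit_nil (F := F) s
    have key : ∀ {A : V} (x : A ⟶ X), x = (ρ_ A).inv ≫ (x ⊗ₘ 𝟙 (𝟙_ V)) ≫ (ρ_ X).hom := by
      intro A x
      simp
    refine (key x).trans ((congrArg (fun p => p ≫ (x ⊗ₘ 𝟙 (𝟙_ V)) ≫ (ρ_ X).hom) h).symm.trans ?_)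
    refine (Category.assoc _ _ _).trans (congrArg (fun z => _ ≫ z) ?_)
    exact (Category.assoc _ _ _).symm
  map_braid := by
    rintro X Y ⟨s, x⟩ ⟨t, y⟩
    -- Here the quotient is needed: the degrees `s ++ t` and `t ++ s` are different lists,
    -- identified by the interchange of the two blocks.
    obtain ⟨χ, h1, h2⟩ := IsSym.braid (F := F) t s
    refine sound h1 ?_
    dsimp only
    rw [reassoc_of% h2]
    simp

/-- The generic elements. -/
def gen (i : ι) : (lax F).E (F i) := mk [i] (ρ_ (F i)).hom

/-- As in the Yoneda lemma, this element is universal for its degree: its image under a map `f` is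
the class of `f`. -/
theorem tensl_gen : ∀ s : List ι, (lax F).tensl (gen F) s = mk s (𝟙 (tensL F s))
  | [] => rfl
  | i :: s => by
    rw [LaxSym.tensl, tensl_gen s]
    refine congrArg (mk (i :: s)) ?_
    change (F i ◁ (λ_ (tensL F s)).inv ≫ (α_ (F i) (𝟙_ V) (tensL F s)).inv) ≫
      ((ρ_ (F i)).hom ⊗ₘ 𝟙 (tensL F s)) = 𝟙 (F i ⊗ tensL F s)
    simp

/-- Maps out of a tensor product of different factors are determined by their values on
elements. -/
theorem hom_ext {Z : V} {s : List ι} (hs : s.Nodup) (f g : tensL F s ⟶ Z)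
    (h : (lax F).map f ((lax F).tensl (gen F) s) = (lax F).map g ((lax F).tensl (gen F) s)) :
    f = g := by
  rw [tensl_gen] at h
  have h' : mk s (𝟙 _ ≫ f) = mk s (𝟙 _ ≫ g) := h
  simpa using exact hs h'

end Formal

/-! ### Equality of maps tested on elements -/

variable {ι₁ ι₂ : Type}

omit [SymmetricCategory V] in
theorem tensSplit_isIso (F : ι → V) (t : List ι) : ∀ s : List ι, IsIso (tensSplit F t s)
  | [] => inferInstanceAs (IsIso (λ_ (tensL F t)).inv)
  | i :: s => by
    have := tensSplit_isIso F t s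
    exact inferInstanceAs (IsIso ((F i ◁ tensSplit F t s) ≫ (α_ (F i) (tensL F s) _).inv))

/-- The source has the shape of the associativity axiom of an operad: operations over `S`,
operations over `R`, and one last factor. The three groups of factors are made into one family over
a sum type, so that no index is repeated, and `Formal.hom_ext` applies. -/
theorem hom_ext₃ {F₁ : ι₁ → V} {F₂ : ι₂ → V} {Z W : V} {l₁ : List ι₁} {l₂ : List ι₂}
    (h₁ : l₁.Nodup) (h₂ : l₂.Nodup) (f g : tensL F₁ l₁ ⊗ (tensL F₂ l₂ ⊗ Z) ⟶ W)
    (h : ∀ (L : LaxSym.{vV} V) (x : ∀ i, L.E (F₁ i)) (y : ∀ i, L.E (F₂ i)) (z : L.E Z),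
      L.map f (L.tens (L.tensl x l₁) (L.tens (L.tensl y l₂) z)) =
        L.map g (L.tens (L.tensl x l₁) (L.tens (L.tensl y l₂) z))) : f = g := by
  let F : ι₁ ⊕ (ι₂ ⊕ Unit) → V := Sum.elim F₁ (Sum.elim F₂ fun _ => Z)
  let m₁ : List (ι₁ ⊕ (ι₂ ⊕ Unit)) := l₁.map Sum.inl
  let m₂ : List (ι₁ ⊕ (ι₂ ⊕ Unit)) := l₂.map fun i => Sum.inr (Sum.inl i)
  let u : ι₁ ⊕ (ι₂ ⊕ Unit) := Sum.inr (Sum.inr ())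
  have e₁ : tensL F m₁ = tensL F₁ l₁ := tensL_map Sum.inl F l₁
  have e₂ : tensL F m₂ = tensL F₂ l₂ := tensL_map (fun i => Sum.inr (Sum.inl i)) F l₂
  -- The isomorphism from the tensor product over the combined list; it may be cancelled.
  let θ : tensL F (m₁ ++ (m₂ ++ [u])) ⟶ tensL F₁ l₁ ⊗ (tensL F₂ l₂ ⊗ Z) :=
    tensSplit F _ m₁ ≫ (eqToHom e₁ ⊗ₘ (tensSplit F _ m₂ ≫ (eqToHom e₂ ⊗ₘ (ρ_ Z).hom)))
  have i₁ := tensSplit_isIso F (m₂ ++ [u]) m₁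
  have i₂ := tensSplit_isIso F [u] m₂
  have i₃ : IsIso θ := by
    have : IsIso (tensSplit F [u] m₂ ≫ (eqToHom e₂ ⊗ₘ (ρ_ Z).hom)) := by
      exact IsIso.comp_isIso' i₂ (inferInstanceAs (IsIso (eqToHom e₂ ⊗ₘ (ρ_ Z).hom)))
    exact IsIso.comp_isIso
  have hs : (m₁ ++ (m₂ ++ [u])).Nodup := by
    refine List.Nodup.append (h₁.map Sum.inl_injective) (List.Nodup.append
      (h₂.map (Sum.inr_injective.comp Sum.inl_injective)) (by simp) ?_) ?_
    · rintro (a | a | a) <;> simp [m₂, u]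
    · rintro (a | a | a) <;> simp [m₁, m₂, u]
  rw [← cancel_epi θ]
  apply Formal.hom_ext F hs
  have hx := (Formal.lax F).map_eqToHom_tensl_map (Formal.gen F)
    (fun i => Formal.gen F (Sum.inl i)) Sum.inl (fun _ => HEq.rfl) (fun _ => rfl) l₁ m₁ rfl
  have hy := (Formal.lax F).map_eqToHom_tensl_map (Formal.gen F)
    (fun i => Formal.gen F (Sum.inr (Sum.inl i))) (fun i => Sum.inr (Sum.inl i))
    (fun _ => HEq.rfl) (fun _ => rfl) l₂ m₂ rfl
  have inv : ∀ {X Y : V} (e : X = Y) (x : (Formal.lax F).E X) (y : (Formal.lax F).E Y),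
      (Formal.lax F).map (eqToHom e.symm) y = x → (Formal.lax F).map (eqToHom e) x = y := by
    rintro X _ rfl x y h
    simpa [LaxSym.map_id] using h.symm
  -- The generic element of the combined list is sent to the tensor product of the generic elements
  -- of its parts, an element to which `h` applies.
  have hθ : (Formal.lax F).map θ ((Formal.lax F).tensl (Formal.gen F) (m₁ ++ (m₂ ++ [u]))) =
      (Formal.lax F).tens ((Formal.lax F).tensl (fun i => Formal.gen F (Sum.inl i)) l₁)
        ((Formal.lax F).tens ((Formal.lax F).tensl (fun i => Formal.gen F (Sum.inr (Sum.inl i))) l₂)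
          (Formal.gen F u)) := by
    rw [LaxSym.map_comp, LaxSym.map_tensSplit, LaxSym.map_tens, LaxSym.map_comp,
      LaxSym.map_tensSplit]
    congr 1
    · exact inv e₁ _ _ (hx e₁.symm)
    · refine ((Formal.lax F).map_tens _ _ _ _).trans ?_
      congr 1
      · exact inv e₂ _ _ (hy e₂.symm)
      · exact (Formal.lax F).map_right _
  refine (LaxSym.map_comp _ θ f _).trans (Eq.trans ?_ (LaxSym.map_comp _ θ g _).symm)
  rw [hθ]
  exact h _ _ _ _

theorem hom_ext₂ {F₁ : ι₁ → V} {Z W : V} {l₁ : List ι₁}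
    (h₁ : l₁.Nodup) (f g : tensL F₁ l₁ ⊗ Z ⟶ W)
    (h : ∀ (L : LaxSym.{vV} V) (x : ∀ i, L.E (F₁ i)) (z : L.E Z),
      L.map f (L.tens (L.tensl x l₁) z) = L.map g (L.tens (L.tensl x l₁) z)) : f = g := by
  -- The case of `hom_ext₃` with an empty second list, up to a unitor.
  have key : (tensL F₁ l₁ ◁ (λ_ Z).hom) ≫ f = (tensL F₁ l₁ ◁ (λ_ Z).hom) ≫ g := by
    refine hom_ext₃ (F₂ := fun _ : Empty => Z) (l₂ := []) h₁ List.nodup_nil _ _ ?_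
    intro L x y z
    refine (L.map_comp (X := tensL F₁ l₁ ⊗ (𝟙_ V ⊗ Z)) _ f _).trans (Eq.trans ?_
      (L.map_comp (X := tensL F₁ l₁ ⊗ (𝟙_ V ⊗ Z)) _ g _).symm)
    have e := (L.map_whiskerLeft (λ_ Z).hom (L.tensl x l₁) (L.tens L.one z)).trans
      (congrArg _ (L.map_left z))
    exact (congrArg (L.map f) e).trans ((h L x z).trans (congrArg (L.map g) e).symm)
  exact (cancel_epi _).1 key

theorem hom_ext₁ {Z W : V} (f g : Z ⟶ W)
    (h : ∀ (L : LaxSym.{vV} V) (z : L.E Z), L.map f z = L.map g z) : f = g := by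
  have key : (λ_ Z).hom ≫ f = (λ_ Z).hom ≫ g := by
    refine hom_ext₂ (F₁ := fun _ : Empty => Z) (l₁ := []) List.nodup_nil _ _ ?_
    intro L x z
    refine (L.map_comp (λ_ Z).hom f (L.tens L.one z)).trans (Eq.trans ?_
      (L.map_comp (λ_ Z).hom g (L.tens L.one z)).symm)
    rw [L.map_left]
    exact h L z
  exact (cancel_epi _).1 key

end Formal

/-! ### Operads in terms of elements -/

namespace LaxSym

variable {V : Type uV} [Category.{vV} V] [MonoidalCategory V] [SymmetricCategory V]
  (L : LaxSym.{w} V) {ι κ : Type}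

theorem map_eqToHom_symm {X Y : V} (e : X = Y) {x : L.E X} {y : L.E Y}
    (h : L.map (eqToHom e.symm) y = x) : L.map (eqToHom e) x = y := by
  subst e
  simpa [L.map_id] using h.symm

theorem map_eqToHom_map_tensl {F : ι → V} {G : κ → V} (x : ∀ i, L.E (F i)) (g : κ → ι)
    (hFG : ∀ k, F (g k) = G k) (l : List κ) (e : tensL F (l.map g) = tensL G l) :
    L.map (eqToHom e) (L.tensl x (l.map g)) =
      L.tensl (F := G) (fun k => L.map (eqToHom (hFG k)) (x (g k))) l := by
  have : G = fun k => F (g k) := funext fun k => (hFG k).symm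
  subst this
  apply L.map_eqToHom_symm
  apply L.map_eqToHom_tensl_map x _ g _ (fun _ => rfl) _ _ rfl
  intro k
  rw [eqToHom_refl, L.map_id]

end LaxSym

namespace OperadData

variable {O : OperadicCategory.{u, v}} {V : Type uV} [Category.{vV} V] [MonoidalCategory V]
  [SymmetricCategory V] (L : LaxSym.{w} V) (P Q : OperadData O V)

/-- The structure operations on elements. -/
def emul {T S : O.C} (f : T ⟶ S) (x : ∀ i, L.E (P.obj (O.fib f i))) (y : L.E (P.obj S)) :
    L.E (P.obj T) :=
  L.map (P.mul f) (L.tens (L.tensl x (O.elems S)) y)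

/-- The axioms of an operad, on elements. -/
structure IsElOperad : Prop where
  assoc : ∀ {T S R : O.C} (f : T ⟶ S) (g : S ⟶ R) (h : T ⟶ R) (w : f ≫ g = h)
    (x : ∀ i, L.E (P.obj (O.fib f i))) (y : ∀ i, L.E (P.obj (O.fib g i))) (z : L.E (P.obj R)),
    P.emul L f x (P.emul L g y z) = P.emul L h (fun i => P.emul L (O.fibMap f g h w i)
      (fun k => L.map (eqToHom (by rw [O.fib_fibMap])) (x (O.emb g i k))) (y i)) z
  unit_left : ∀ (T : O.C) (y : L.E (P.obj T)),
    P.emul L (𝟙 T) (fun i => L.map (P.unit (O.comp (O.fib (𝟙 T) i)) ≫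
      eqToHom (by rw [← O.fib_id])) L.one) y = y
  unit_right : ∀ (T : O.C) (y : L.E (P.obj T)),
    P.emul L (O.toU T) (fun i => L.map (eqToHom (by rw [O.fib_toU])) y)
      (L.map (P.unit (O.comp T)) L.one) = y

variable {P Q}

/-- The permutation that groups `|S|` by the fibres of `g` disappears on elements. What survives is
the reindexing along `O.emb` and the transport along `O.fib_fibMap`. -/
theorem map_regroup {T S R : O.C} (f : T ⟶ S) (g : S ⟶ R) (h : T ⟶ R) (w : f ≫ g = h)
    (x : ∀ i, L.E (P.obj (O.fib f i))) :
    L.map (P.regroup f g h w) (L.tensl x (O.elems S)) =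
      L.tensl (F := fun i => P.fam (O.fibMap f g h w i)) (fun i => L.tensl (fun k =>
        L.map (eqToHom (by rw [O.fib_fibMap])) (x (O.emb g i k))) (O.elems (O.fib g i)))
        (O.elems R) := by
  unfold regroup
  refine (L.map_comp _ _ _).trans ((congrArg _ (L.map_tensReorder x _ _ _)).trans ?_)
  refine (L.map_comp _ _ _).trans ((congrArg _ (L.map_tensUnflatten x _ _)).trans
    ((L.map_tensMap _ _ _).trans ?_))
  congr 1
  funext i
  exact L.map_eqToHom_map_tensl x _ (fun k => by rw [O.fib_fibMap]) _ _

theorem map_assoc_right {T S R : O.C} (f : T ⟶ S) (g : S ⟶ R) (h : T ⟶ R) (w : f ≫ g = h)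
    (x : ∀ i, L.E (P.obj (O.fib f i))) (y : ∀ i, L.E (P.obj (O.fib g i))) (z : L.E (P.obj R)) :
    L.map ((α_ (P.fam f) (P.fam g) (P.obj R)).inv ≫
        (((P.regroup f g h w ▷ P.fam g) ≫ tensZip _ _ (O.elems R) ≫
          tensMap (fun i => P.mul (O.fibMap f g h w i)) (O.elems R)) ▷ P.obj R) ≫ P.mul h)
      (L.tens (L.tensl x (O.elems S)) (L.tens (L.tensl y (O.elems R)) z)) =
    P.emul L h (fun i => P.emul L (O.fibMap f g h w i)
      (fun k => L.map (eqToHom (by rw [O.fib_fibMap])) (x (O.emb g i k))) (y i)) z := by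
  refine (L.map_comp (α_ (P.fam f) (P.fam g) (P.obj R)).inv _ _).trans ?_
  erw [L.map_assoc_inv]
  rw [L.map_comp]
  erw [L.map_whiskerRight]
  rw [emul]
  congr 2
  rw [L.map_comp]
  refine (congrArg _ ((L.map_whiskerRight (P.regroup f g h w) _ _).trans
    (congrArg (fun z => L.tens z _) (map_regroup L f g h w x)))).trans ?_
  refine (L.map_comp (tensZip (fun i => P.fam (O.fibMap f g h w i)) (fun i => P.obj (O.fib g i))
    (O.elems R)) _ _).trans ?_
  exact (congrArg _ (L.map_tensZip _ _ _)).trans (L.map_tensMap _ _ _)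

theorem map_assoc_left {T S R : O.C} (f : T ⟶ S) (g : S ⟶ R)
    (x : ∀ i, L.E (P.obj (O.fib f i))) (y : ∀ i, L.E (P.obj (O.fib g i))) (z : L.E (P.obj R)) :
    L.map ((P.fam f ◁ P.mul g) ≫ P.mul f)
      (L.tens (L.tensl x (O.elems S)) (L.tens (L.tensl y (O.elems R)) z)) =
    P.emul L f x (P.emul L g y z) :=
  (L.map_comp (P.fam f ◁ P.mul g) _ _).trans
    (congrArg (L.map (P.mul f)) (L.map_whiskerLeft (P.mul g) _ _))

theorem map_unit_left (T : O.C) (y : L.E (P.obj T)) :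
    L.map ((λ_ (P.obj T)).inv ≫
      (tensUnit (F := fun i => P.obj (O.fib (𝟙 T) i))
        (fun i => P.unit (O.comp (O.fib (𝟙 T) i)) ≫ eqToHom (by rw [← O.fib_id])) (O.elems T) ▷
          P.obj T) ≫ P.mul (𝟙 T)) y =
    P.emul L (𝟙 T) (fun i => L.map (P.unit (O.comp (O.fib (𝟙 T) i)) ≫
      eqToHom (by rw [← O.fib_id])) L.one) y := by
  rw [L.map_comp, L.map_left_inv, L.map_comp, L.map_whiskerRight, L.map_tensUnit]
  rfl

theorem map_toFam {Z : V} {ι : Type} (F : ι → V) (hF : ∀ i, F i = Z) (z : L.E Z) :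
    ∀ (l : List ι) (h : l.length = 1), L.map (toFam F hF l h) z =
      L.tensl (fun i => L.map (eqToHom (hF i).symm) z) l
  | [i], _ => by
    refine (L.map_comp (ρ_ Z).inv (eqToHom (hF i).symm ▷ _) z).trans ?_
    rw [L.map_right_inv, L.map_whiskerRight]
    rfl

theorem map_unit_right (T : O.C) (y : L.E (P.obj T)) :
    L.map ((ρ_ (P.obj T)).inv ≫
      (toFam (fun i => P.obj (O.fib (O.toU T) i)) (fun i => by rw [O.fib_toU]) _ (O.elems_U _) ⊗ₘ
        P.unit (O.comp T)) ≫ P.mul (O.toU T)) y =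
    P.emul L (O.toU T) (fun i => L.map (eqToHom (by rw [O.fib_toU])) y)
      (L.map (P.unit (O.comp T)) L.one) := by
  rw [L.map_comp, L.map_right_inv, L.map_comp, L.map_tens, map_toFam]
  rfl

/-- The sources in the axioms are tensor products over the lists `O.elems`, which have no
repetitions; thus `hom_ext₃` and `hom_ext₁` apply. -/
theorem IsOperad.of_elements (h : ∀ L : LaxSym.{vV} V, P.IsElOperad L) : P.IsOperad where
  assoc f g h' w := hom_ext₃ (O.elems_nodup _) (O.elems_nodup _) _ _ fun L x y z =>
    (map_assoc_left L f g x y z).trans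
      (((h L).assoc f g h' w x y z).trans (map_assoc_right L f g h' w x y z).symm)
  unit_left T := hom_ext₁ _ _ fun L y =>
    (map_unit_left L T y).trans (((h L).unit_left T y).trans (L.map_id y).symm)
  unit_right T := hom_ext₁ _ _ fun L y =>
    (map_unit_right L T y).trans (((h L).unit_right T y).trans (L.map_id y).symm)

theorem Commutes.of_elements (φ : ∀ T, P.obj T ⟶ Q.obj T)
    (hu : ∀ c, P.unit c ≫ φ (O.U c) = Q.unit c)
    (hm : ∀ (L : LaxSym.{vV} V) {T S : O.C} (f : T ⟶ S) (x : ∀ i, L.E (P.obj (O.fib f i)))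
      (y : L.E (P.obj S)), L.map (φ T) (P.emul L f x y) =
        Q.emul L f (fun i => L.map (φ _) (x i)) (L.map (φ S) y)) : Commutes P Q φ where
  unit := hu
  mul f := hom_ext₂ (O.elems_nodup _) _ _ fun L x y => by
    rw [L.map_comp, L.map_comp, L.map_tens, L.map_tensMap]
    exact hm L f x y

theorem Commutes.elements {φ : ∀ T, P.obj T ⟶ Q.obj T} (h : Commutes P Q φ) {T S : O.C}
    (f : T ⟶ S) (x : ∀ i, L.E (P.obj (O.fib f i))) (y : L.E (P.obj S)) :
    L.map (φ T) (P.emul L f x y) = Q.emul L f (fun i => L.map (φ _) (x i)) (L.map (φ S) y) := by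
  have h1 := congrArg (fun z => L.map z (L.tens (L.tensl x (O.elems S)) y)) (h.mul f)
  simp only [L.map_comp, L.map_tens, L.map_tensMap] at h1
  exact h1

theorem map_eqToHom_natural {φ : ∀ T, P.obj T ⟶ Q.obj T} {T T' : O.C} (e : T = T')
    (x : L.E (P.obj T)) : L.map (φ T') (L.map (eqToHom (by rw [e])) x) =
      L.map (eqToHom (by rw [e])) (L.map (φ T) x) := by
  subst e
  simp [L.map_id]

/-- Operad structures can be reflected along a collection of isomorphisms. -/
theorem IsElOperad.of_iso {φ : ∀ T, P.obj T ⟶ Q.obj T} (h : Commutes P Q φ)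
    (hφ : ∀ T, IsIso (φ T)) (hQ : Q.IsElOperad L) : P.IsElOperad L := by
  -- Isomorphisms are injective on elements, so each axiom may be checked after applying `φ`.
  have inj : ∀ T (x y : L.E (P.obj T)), L.map (φ T) x = L.map (φ T) y → x = y := by
    intro T x y e
    have e' := congrArg (L.map (inv (φ T))) e
    simpa only [← L.map_comp, IsIso.hom_inv_id, L.map_id] using e'
  refine ⟨?_, ?_, ?_⟩
  · intro T S R f g k w x y z
    apply inj
    rw [h.elements, h.elements, h.elements, hQ.assoc f g k w]
    congr 1
    funext i
    rw [h.elements]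
    congr 1
    funext k
    exact (map_eqToHom_natural L (O.fib_fibMap _ _ _ _ _ _).symm _).symm
  · intro T y
    apply inj
    rw [h.elements]
    refine Eq.trans ?_ (hQ.unit_left T _)
    congr 1
    funext i
    rw [L.map_comp, L.map_comp, map_eqToHom_natural L (O.fib_id T i).symm,
      ← L.map_comp (P.unit _) (φ _), h.unit]
  · intro T y
    apply inj
    rw [h.elements]
    refine Eq.trans ?_ (hQ.unit_right T _)
    congr 1
    · funext i
      exact map_eqToHom_natural L (O.fib_toU _ i).symm y
    · rw [← L.map_comp, h.unit]

/-! #### The operad with all components the unit -/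

/-- The unit is the tensor product over the empty list, which needs no generic elements. For the
operad `𝟏` it therefore suffices to compute with `L.one`, instead of arbitrary elements of the unit.
-/
theorem unit_ext {W : V} (f g : 𝟙_ V ⟶ W)
    (h : ∀ L : LaxSym.{vV} V, L.map f L.one = L.map g L.one) : f = g := by
  have h' := h (Formal.lax (fun _ : Empty => 𝟙_ V))
  exact Formal.hom_ext (fun _ : Empty => 𝟙_ V) (s := []) List.nodup_nil f g h'

omit [SymmetricCategory V] in
theorem tensUnit_isIso {ι : Type} : ∀ l : List ι,
    IsIso (tensUnit (F := fun _ : ι => 𝟙_ V) (fun _ => 𝟙 _) l)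
  | [] => inferInstanceAs (IsIso (𝟙 (𝟙_ V)))
  | _ :: l => by
    have := tensUnit_isIso l
    exact inferInstanceAs (IsIso ((λ_ (𝟙_ V)).inv ≫ (𝟙 (𝟙_ V) ⊗ₘ tensUnit (fun _ => 𝟙 _) l)))

theorem unit_ext₂ {ι : Type} {l : List ι} {Z W : V} {k : 𝟙_ V ⟶ Z} (hk : IsIso k)
    (f g : tensL (fun _ : ι => 𝟙_ V) l ⊗ Z ⟶ W)
    (h : ∀ L : LaxSym.{vV} V, L.map f (L.tens (L.tensl (fun _ => L.one) l) (L.map k L.one)) =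
      L.map g (L.tens (L.tensl (fun _ => L.one) l) (L.map k L.one))) : f = g := by
  have := tensUnit_isIso (V := V) l
  have key : ((λ_ (𝟙_ V)).inv ≫ (tensUnit (fun _ => 𝟙 _) l ⊗ₘ k)) ≫ f =
      ((λ_ (𝟙_ V)).inv ≫ (tensUnit (fun _ => 𝟙 _) l ⊗ₘ k)) ≫ g := by
    apply unit_ext
    intro L
    have h' := h L
    simp only [L.map_comp, L.map_left_inv, L.map_tens, L.map_tensUnit, L.map_id]
    exact h'
  exact (cancel_epi _).1 key

variable (V) in
theorem unitPow_one {ι : Type} : ∀ l : List ι,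
    L.map (unitPow (V := V) l) (L.tensl (fun _ => L.one) l) = L.one
  | [] => L.map_id _
  | i :: l => by
    refine (L.map_comp (λ_ (tensL (fun _ : ι => 𝟙_ V) l)).hom (unitPow l)
      (L.tens L.one (L.tensl (fun _ => L.one) l))).trans ?_
    rw [L.map_left, unitPow_one l]

theorem emul_one {T S : O.C} (f : T ⟶ S) :
    (one O V).emul L f (fun _ => L.one) L.one = L.one := by
  refine (L.map_comp (unitPow (O.elems S) ▷ 𝟙_ V) (λ_ (𝟙_ V)).hom _).trans ?_
  refine (congrArg _ (L.map_whiskerRight (unitPow (O.elems S)) _ _)).trans ?_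
  exact (congrArg (fun z => L.map _ (L.tens z L.one)) (unitPow_one V L _)).trans (L.map_left _)

/-- All factors of the source are units of `V`, so that only the values at `L.one` matter: a map out
of `𝟏` is a family of elements of `Q` that is closed under the operations and contains the units. -/
theorem Commutes.of_one {φ : ∀ T, (one O V).obj T ⟶ Q.obj T}
    (hu : ∀ c, φ (O.U c) = Q.unit c)
    (hm : ∀ (L : LaxSym.{vV} V) {T S : O.C} (f : T ⟶ S), L.map (φ T) L.one =
        Q.emul L f (fun _ => L.map (φ _) L.one) (L.map (φ S) L.one)) :
    Commutes (one O V) Q φ where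
  unit c := (Category.id_comp _).trans (hu c)
  mul {T S} f := by
    refine unit_ext₂ (k := 𝟙 (𝟙_ V)) inferInstance _ _ fun L => ?_
    rw [L.map_id]
    refine (L.map_comp ((one O V).mul f) (φ T) _).trans ?_
    refine (congrArg (L.map (φ T)) (emul_one (O := O) L f)).trans ?_
    refine Eq.trans ?_ (L.map_comp (tensMap (fun i => φ (O.fib f i)) (O.elems S) ⊗ₘ φ S) (Q.mul f)
      (L.tens (L.tensl (fun _ => L.one) (O.elems S)) L.one)).symm
    refine ((hm L f).trans ?_).trans (congrArg _ ((L.map_tens _ (φ S) _ L.one).trans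
      (congrArg (fun z => L.tens z _) (L.map_tensMap _ _ _)))).symm
    rfl

theorem one_isOperad : (one O V).IsOperad where
  assoc {T S R} f g h w := by
    have := tensUnit_isIso (V := V) (O.elems R)
    -- The isomorphism `k` identifies the unit with the remaining factors, those over `R` and the
    -- last one.
    refine unit_ext₂ (k := (λ_ (𝟙_ V)).inv ≫ (tensUnit (F := fun _ => 𝟙_ V) (fun _ => 𝟙 _)
      (O.elems R) ⊗ₘ 𝟙 _)) inferInstance _ _ fun L => ?_
    have e : L.map ((λ_ (𝟙_ V)).inv ≫ (tensUnit (F := fun _ => 𝟙_ V) (fun _ => 𝟙 _)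
      (O.elems R) ⊗ₘ 𝟙 _)) L.one = L.tens (L.tensl (fun _ => L.one) (O.elems R)) L.one := by
      simp only [L.map_comp, L.map_left_inv, L.map_tens, L.map_tensUnit, L.map_id]
    rw [e]
    refine (map_assoc_left (P := one O V) L f g (fun _ => L.one) (fun _ => L.one) L.one).trans
      (Eq.trans ?_ (map_assoc_right (P := one O V) L f g h w (fun _ => L.one) (fun _ => L.one)
        L.one).symm)
    have e' : ∀ e : 𝟙_ V = 𝟙_ V, L.map (eqToHom e) L.one = L.one := fun e => L.map_id _
    have e1 := emul_one (O := O) L g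
    have e2 := emul_one (O := O) L f
    have e3 := emul_one (O := O) L h
    have e4 := fun i => emul_one (O := O) L (O.fibMap f g h w i)
    refine (congrArg ((one O V).emul L f fun _ => L.one) e1).trans (e2.trans (e3.symm.trans ?_))
    congr 1
    funext i
    refine (e4 i).symm.trans ?_
    congr 1
    funext k
    exact (e' _).symm
  unit_left T := unit_ext _ _ fun L => by
    refine (map_unit_left (P := one O V) L T L.one).trans (Eq.trans ?_ (L.map_id _).symm)
    refine Eq.trans ?_ (emul_one (O := O) L (𝟙 T))
    congr 1
    funext i
    refine (L.map_comp _ _ _).trans ?_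
    exact (L.map_id _).trans (L.map_id _)
  unit_right T := unit_ext _ _ fun L => by
    refine (map_unit_right (P := one O V) L T L.one).trans (Eq.trans ?_ (L.map_id _).symm)
    refine Eq.trans ?_ (emul_one (O := O) L (O.toU T))
    congr 1
    · funext i
      exact L.map_id _
    · exact L.map_id _

end OperadData

/-! ### Untyped strict duoidal categories -/

/-- A monoid structure. -/
structure Mon (M : Type*) where
  one : M
  mul : M → M → M
  assoc : ∀ a b c, mul (mul a b) c = mul a (mul b c)
  one_mul : ∀ a, mul one a = a
  mul_one : ∀ a, mul a one = a

namespace Mon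

variable {M : Type*} (m : Mon M) {ι κ : Type*}

/-- `a i₁ * a i₂ * ⋯` -/
def prod : List ι → (ι → M) → M
  | [], _ => m.one
  | i :: l, a => m.mul (a i) (prod l a)

/-- `⋯ * a i₂ * a i₁` -/
def rprod : List ι → (ι → M) → M
  | [], _ => m.one
  | i :: l, a => m.mul (rprod l a) (a i)

@[simp] theorem prod_nil (a : ι → M) : m.prod [] a = m.one := rfl
@[simp] theorem rprod_nil (a : ι → M) : m.rprod [] a = m.one := rfl
theorem prod_cons (i : ι) (l : List ι) (a : ι → M) :
    m.prod (i :: l) a = m.mul (a i) (m.prod l a) := rfl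
theorem rprod_cons (i : ι) (l : List ι) (a : ι → M) :
    m.rprod (i :: l) a = m.mul (m.rprod l a) (a i) := rfl
@[simp] theorem prod_single (i : ι) (a : ι → M) : m.prod [i] a = a i := m.mul_one _
@[simp] theorem rprod_single (i : ι) (a : ι → M) : m.rprod [i] a = a i := m.one_mul _

theorem prod_congr {a b : ι → M} : ∀ {l : List ι}, (∀ i ∈ l, a i = b i) → m.prod l a = m.prod l b
  | [], _ => rfl
  | i :: l, e => by
    rw [prod, prod, e i List.mem_cons_self, prod_congr fun j hj => e j (List.mem_cons_of_mem _ hj)]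

theorem rprod_congr {a b : ι → M} :
    ∀ {l : List ι}, (∀ i ∈ l, a i = b i) → m.rprod l a = m.rprod l b
  | [], _ => rfl
  | i :: l, e => by
    rw [rprod, rprod, e i List.mem_cons_self,
      rprod_congr fun j hj => e j (List.mem_cons_of_mem _ hj)]

theorem prod_map (g : κ → ι) (a : ι → M) : ∀ l : List κ, m.prod (l.map g) a = m.prod l (a ∘ g)
  | [] => rfl
  | k :: l => by rw [List.map_cons, prod, prod, prod_map g a l]; rfl

theorem rprod_map (g : κ → ι) (a : ι → M) : ∀ l : List κ, m.rprod (l.map g) a = m.rprod l (a ∘ g)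
  | [] => rfl
  | k :: l => by rw [List.map_cons, rprod, rprod, rprod_map g a l]; rfl

theorem prod_append (a : ι → M) (l' : List ι) :
    ∀ l : List ι, m.prod (l ++ l') a = m.mul (m.prod l a) (m.prod l' a)
  | [] => (m.one_mul _).symm
  | i :: l => by rw [List.cons_append, prod, prod, prod_append a l' l, m.assoc]

theorem rprod_append (a : ι → M) (l' : List ι) :
    ∀ l : List ι, m.rprod (l ++ l') a = m.mul (m.rprod l' a) (m.rprod l a)
  | [] => (m.mul_one _).symm
  | i :: l => by rw [List.cons_append, rprod, rprod, rprod_append a l' l, m.assoc]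

theorem prod_flatMap (a : ι → M) (r : κ → List ι) :
    ∀ l : List κ, m.prod (l.flatMap r) a = m.prod l fun k => m.prod (r k) a
  | [] => rfl
  | k :: l => by rw [List.flatMap_cons, prod_append, prod, prod_flatMap a r l]

theorem rprod_flatMap (a : ι → M) (r : κ → List ι) :
    ∀ l : List κ, m.rprod (l.flatMap r) a = m.rprod l fun k => m.rprod (r k) a
  | [] => rfl
  | k :: l => by rw [List.flatMap_cons, rprod_append, rprod, rprod_flatMap a r l]

@[simp] theorem prod_one : ∀ l : List ι, m.prod l (fun _ => m.one) = m.one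
  | [] => rfl
  | _ :: l => by rw [prod, prod_one l, m.one_mul]

theorem prod_filter (p : ι → Bool) (a : ι → M) : ∀ l : List ι,
    m.prod (l.filter p) a = m.prod l fun i => if p i then a i else m.one
  | [] => rfl
  | i :: l => by
    rw [prod, List.filter_cons]
    cases p i
    · exact (prod_filter p a l).trans (m.one_mul _).symm
    · exact congrArg (m.mul (a i)) (prod_filter p a l)

theorem rprod_filter (p : ι → Bool) (a : ι → M) : ∀ l : List ι,
    m.rprod (l.filter p) a = m.rprod l fun i => if p i then a i else m.one
  | [] => rfl
  | i :: l => by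
    rw [rprod, List.filter_cons]
    cases p i
    · exact (rprod_filter p a l).trans (m.mul_one _).symm
    · exact congrArg (m.mul · (a i)) (rprod_filter p a l)

end Mon

/-- A strict tensor product on the objects and the arrows of a category. -/
structure Tens {D A : Type*} (src tgt : A → D) (id : D → A) (comp : A → A → A) where
  o : Mon D
  t : Mon A
  src_one : src t.one = o.one
  tgt_one : tgt t.one = o.one
  src_mul : ∀ a b, src (t.mul a b) = o.mul (src a) (src b)
  tgt_mul : ∀ a b, tgt (t.mul a b) = o.mul (tgt a) (tgt b)
  id_one : id o.one = t.one
  id_mul : ∀ X Y, id (o.mul X Y) = t.mul (id X) (id Y)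
  comp_one : comp t.one t.one = t.one
  mul_comp : ∀ {a a' b b'}, tgt a = src a' → tgt b = src b' →
    t.mul (comp a a') (comp b b') = comp (t.mul a b) (t.mul a' b')

namespace Tens

variable {D A : Type*} {src tgt : A → D} {id : D → A} {comp : A → A → A}
  (h : Tens src tgt id comp) {ι : Type*}

theorem src_prod (a : ι → A) : ∀ l : List ι,
    src (h.t.prod l a) = h.o.prod l fun i => src (a i)
  | [] => h.src_one
  | i :: l => by rw [Mon.prod, h.src_mul, src_prod a l]; rfl

theorem tgt_prod (a : ι → A) : ∀ l : List ι,
    tgt (h.t.prod l a) = h.o.prod l fun i => tgt (a i)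
  | [] => h.tgt_one
  | i :: l => by rw [Mon.prod, h.tgt_mul, tgt_prod a l]; rfl

theorem src_rprod (a : ι → A) : ∀ l : List ι,
    src (h.t.rprod l a) = h.o.rprod l fun i => src (a i)
  | [] => h.src_one
  | i :: l => by rw [Mon.rprod, h.src_mul, src_rprod a l]; rfl

theorem tgt_rprod (a : ι → A) : ∀ l : List ι,
    tgt (h.t.rprod l a) = h.o.rprod l fun i => tgt (a i)
  | [] => h.tgt_one
  | i :: l => by rw [Mon.rprod, h.tgt_mul, tgt_rprod a l]; rfl

theorem id_prod (X : ι → D) : ∀ l : List ι, id (h.o.prod l X) = h.t.prod l fun i => id (X i)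
  | [] => h.id_one
  | i :: l => by rw [Mon.prod, h.id_mul, id_prod X l]; rfl

theorem id_rprod (X : ι → D) : ∀ l : List ι, id (h.o.rprod l X) = h.t.rprod l fun i => id (X i)
  | [] => h.id_one
  | i :: l => by rw [Mon.rprod, h.id_mul, id_rprod X l]; rfl

theorem prod_comp {a b : ι → A} : ∀ {l : List ι}, (∀ i ∈ l, tgt (a i) = src (b i)) →
    h.t.prod l (fun i => comp (a i) (b i)) = comp (h.t.prod l a) (h.t.prod l b)
  | [], _ => h.comp_one.symm
  | i :: l, e => by
    have e' := fun j hj => e j (List.mem_cons_of_mem i hj)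
    rw [Mon.prod, prod_comp e', h.mul_comp (e i List.mem_cons_self)]
    · rfl
    · rw [h.tgt_prod, h.src_prod]; exact h.o.prod_congr e'

theorem rprod_comp {a b : ι → A} : ∀ {l : List ι}, (∀ i ∈ l, tgt (a i) = src (b i)) →
    h.t.rprod l (fun i => comp (a i) (b i)) = comp (h.t.rprod l a) (h.t.rprod l b)
  | [], _ => h.comp_one.symm
  | i :: l, e => by
    have e' := fun j hj => e j (List.mem_cons_of_mem i hj)
    rw [Mon.rprod, rprod_comp e', h.mul_comp _ (e i List.mem_cons_self)]
    · rfl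
    · rw [h.tgt_rprod, h.src_rprod]; exact h.o.rprod_congr e'

end Tens

/-- A strict duoidal category, with one set of arrows and a composition that is defined
everywhere. -/
structure DuoAlg (D A : Type*) where
  src : A → D
  tgt : A → D
  id : D → A
  comp : A → A → A
  src_id : ∀ X, src (id X) = X
  tgt_id : ∀ X, tgt (id X) = X
  src_comp : ∀ a b, src (comp a b) = src a
  tgt_comp : ∀ a b, tgt (comp a b) = tgt b
  assoc : ∀ a b c, comp (comp a b) c = comp a (comp b c)
  id_comp : ∀ {a X}, src a = X → comp (id X) a = a
  comp_id : ∀ {a X}, tgt a = X → comp a (id X) = a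
  h0 : Tens src tgt id comp
  h1 : Tens src tgt id comp
  ζ : D → D → D → D → A
  src_ζ : ∀ X Y Z W, src (ζ X Y Z W) = h0.o.mul (h1.o.mul X Y) (h1.o.mul Z W)
  tgt_ζ : ∀ X Y Z W, tgt (ζ X Y Z W) = h1.o.mul (h0.o.mul X Z) (h0.o.mul Y W)
  ζ_nat : ∀ {a b c e X Y Z W}, tgt a = X → tgt b = Y → tgt c = Z → tgt e = W →
    comp (h0.t.mul (h1.t.mul a b) (h1.t.mul c e)) (ζ X Y Z W) =
      comp (ζ (src a) (src b) (src c) (src e)) (h1.t.mul (h0.t.mul a c) (h0.t.mul b e))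
  δ : A
  μ : A
  ε : A
  src_δ : src δ = h0.o.one
  tgt_δ : tgt δ = h1.o.mul h0.o.one h0.o.one
  src_μ : src μ = h0.o.mul h1.o.one h1.o.one
  tgt_μ : tgt μ = h1.o.one
  src_ε : src ε = h0.o.one
  tgt_ε : tgt ε = h1.o.one
  ζ_assoc₀ : ∀ A B C D' E F,
    comp (h0.t.mul (ζ A B C D') (id (h1.o.mul E F))) (ζ (h0.o.mul A C) (h0.o.mul B D') E F) =
      comp (h0.t.mul (id (h1.o.mul A B)) (ζ C D' E F)) (ζ A B (h0.o.mul C E) (h0.o.mul D' F))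
  ζ_assoc₁ : ∀ A B C D' E F,
    comp (ζ (h1.o.mul A B) C (h1.o.mul D' E) F) (h1.t.mul (ζ A B D' E) (id (h0.o.mul C F))) =
      comp (ζ A (h1.o.mul B C) D' (h1.o.mul E F)) (h1.t.mul (id (h0.o.mul A D')) (ζ B C E F))
  δ_ζ : ∀ A B, comp (h0.t.mul δ (id (h1.o.mul A B))) (ζ h0.o.one h0.o.one A B) = id (h1.o.mul A B)
  ζ_δ : ∀ A B, comp (h0.t.mul (id (h1.o.mul A B)) δ) (ζ A B h0.o.one h0.o.one) = id (h1.o.mul A B)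
  ζ_μ_left : ∀ A B, comp (ζ h1.o.one A h1.o.one B) (h1.t.mul μ (id (h0.o.mul A B))) =
    id (h0.o.mul A B)
  ζ_μ_right : ∀ A B, comp (ζ A h1.o.one B h1.o.one) (h1.t.mul (id (h0.o.mul A B)) μ) =
    id (h0.o.mul A B)
  μ_assoc : comp (h0.t.mul μ (id h1.o.one)) μ = comp (h0.t.mul (id h1.o.one) μ) μ
  ε_μ : comp (h0.t.mul ε (id h1.o.one)) μ = id h1.o.one
  μ_ε : comp (h0.t.mul (id h1.o.one) ε) μ = id h1.o.one
  δ_assoc : comp δ (h1.t.mul δ (id h0.o.one)) = comp δ (h1.t.mul (id h0.o.one) δ)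
  δ_ε : comp δ (h1.t.mul (id h0.o.one) ε) = id h0.o.one
  ε_δ : comp δ (h1.t.mul ε (id h0.o.one)) = id h0.o.one

/-! ### Coherence of the interchange of two families -/

namespace DuoAlg

attribute [simp] src_id tgt_id src_comp tgt_comp src_ζ tgt_ζ src_δ tgt_δ src_μ tgt_μ src_ε tgt_ε

variable {D A : Type*} (d : DuoAlg D A) {ι κ ι' κ' : Type*}

local infixl:65 " ⨟ " => d.comp
local infixl:70 " ⊠₀ " => d.h0.t.mul
local infixl:70 " ⊠₁ " => d.h1.t.mul
local infixl:70 " ⊙₀ " => d.h0.o.mul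
local infixl:70 " ⊙₁ " => d.h1.o.mul

@[simp] theorem src_mul₀ (a b : A) : d.src (d.h0.t.mul a b) = d.h0.o.mul (d.src a) (d.src b) :=
  d.h0.src_mul a b
@[simp] theorem src_rprod₀ (a : ι → A) (l : List ι) :
    d.src (d.h0.t.rprod l a) = d.h0.o.rprod l fun i => d.src (a i) := d.h0.src_rprod a l
@[simp] theorem tgt_mul₀ (a b : A) : d.tgt (d.h0.t.mul a b) = d.h0.o.mul (d.tgt a) (d.tgt b) :=
  d.h0.tgt_mul a b
@[simp] theorem tgt_rprod₀ (a : ι → A) (l : List ι) :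
    d.tgt (d.h0.t.rprod l a) = d.h0.o.rprod l fun i => d.tgt (a i) := d.h0.tgt_rprod a l
@[simp] theorem src_one₁ : d.src d.h1.t.one = d.h1.o.one := d.h1.src_one
@[simp] theorem src_mul₁ (a b : A) : d.src (d.h1.t.mul a b) = d.h1.o.mul (d.src a) (d.src b) :=
  d.h1.src_mul a b
@[simp] theorem src_prod₁ (a : ι → A) (l : List ι) :
    d.src (d.h1.t.prod l a) = d.h1.o.prod l fun i => d.src (a i) := d.h1.src_prod a l
@[simp] theorem tgt_prod₁ (a : ι → A) (l : List ι) :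
    d.tgt (d.h1.t.prod l a) = d.h1.o.prod l fun i => d.tgt (a i) := d.h1.tgt_prod a l

theorem comp_mul₀ {a a' b b' : A} (h : d.tgt a = d.src a') (h' : d.tgt b = d.src b') :
    a ⊠₀ b ⨟ a' ⊠₀ b' = (a ⨟ a') ⊠₀ (b ⨟ b') := (d.h0.mul_comp h h').symm

theorem comp_mul₁ {a a' b b' : A} (h : d.tgt a = d.src a') (h' : d.tgt b = d.src b') :
    a ⊠₁ b ⨟ a' ⊠₁ b' = (a ⨟ a') ⊠₁ (b ⨟ b') := (d.h1.mul_comp h h').symm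

/-- The interchange of two families. -/
def z2 (X Y : ι → D) : List ι → A
  | [] => d.μ
  | i :: l => d.ζ (X i) (d.h1.o.prod l X) (Y i) (d.h1.o.prod l Y) ⨟ d.id (X i ⊙₀ Y i) ⊠₁ z2 X Y l

/-- The iterated comultiplication. -/
def e1 : List ι → A
  | [] => d.ε
  | _ :: l => d.δ ⨟ d.id d.h0.o.one ⊠₁ e1 l

/-- The interchange for an array. -/
def chi (t : List ι) (G : κ → ι → D) : List κ → A
  | [] => d.e1 t
  | k :: s => chi t G s ⊠₀ d.id (d.h1.o.prod t (G k)) ⨟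
      d.z2 (fun i => d.h0.o.rprod s fun k => G k i) (G k) t

@[simp] theorem src_z2 (X Y : ι → D) : ∀ l : List ι,
    d.src (d.z2 X Y l) = d.h1.o.prod l X ⊙₀ d.h1.o.prod l Y
  | [] => d.src_μ
  | i :: l => by rw [z2, d.src_comp, d.src_ζ]; rfl

@[simp] theorem tgt_z2 (X Y : ι → D) : ∀ l : List ι,
    d.tgt (d.z2 X Y l) = d.h1.o.prod l fun i => X i ⊙₀ Y i
  | [] => d.tgt_μ
  | i :: l => by rw [z2, d.tgt_comp, d.h1.tgt_mul, tgt_z2 X Y l, d.tgt_id]; rfl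

@[simp] theorem src_e1 : ∀ l : List ι, d.src (d.e1 l) = d.h0.o.one
  | [] => d.src_ε
  | i :: l => by rw [e1, d.src_comp, d.src_δ]

@[simp] theorem tgt_e1 : ∀ l : List ι, d.tgt (d.e1 l) = d.h1.o.prod l fun _ => d.h0.o.one
  | [] => d.tgt_ε
  | i :: l => by rw [e1, d.tgt_comp, d.h1.tgt_mul, tgt_e1 l, d.tgt_id]; rfl

@[simp] theorem src_chi (t : List ι) (G : κ → ι → D) : ∀ s : List κ,
    d.src (d.chi t G s) = d.h0.o.rprod s fun k => d.h1.o.prod t (G k)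
  | [] => d.src_e1 t
  | k :: s => by rw [chi, d.src_comp, d.h0.src_mul, src_chi t G s, d.src_id]; rfl

@[simp] theorem tgt_chi (t : List ι) (G : κ → ι → D) : ∀ s : List κ,
    d.tgt (d.chi t G s) = d.h1.o.prod t fun i => d.h0.o.rprod s fun k => G k i
  | [] => d.tgt_e1 t
  | k :: s => by rw [chi, d.tgt_comp, d.tgt_z2]; rfl

/-- Induction over the columns, with the naturality of `ζ` for the first column and the rest. -/
theorem z2_nat {a b : ι → A} {X Y : ι → D} : ∀ {l : List ι}, (∀ i ∈ l, d.tgt (a i) = X i) →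
    (∀ i ∈ l, d.tgt (b i) = Y i) →
    d.h1.t.prod l a ⊠₀ d.h1.t.prod l b ⨟ d.z2 X Y l =
      d.z2 (fun i => d.src (a i)) (fun i => d.src (b i)) l ⨟ d.h1.t.prod l fun i => a i ⊠₀ b i
  | [], _, _ => by
    simp only [Mon.prod_nil, ← d.h1.id_one, ← d.h0.id_mul, z2]
    rw [d.id_comp (by simp), d.comp_id (by simp)]
  | i :: l, ha, hb => by
    have ha' := fun j hj => ha j (List.mem_cons_of_mem i hj)
    have hb' := fun j hj => hb j (List.mem_cons_of_mem i hj)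
    have h1 : d.h1.o.prod l X = d.tgt (d.h1.t.prod l a) := by
      rw [d.h1.tgt_prod]; exact (d.h1.o.prod_congr ha').symm
    have h2 : d.h1.o.prod l Y = d.tgt (d.h1.t.prod l b) := by
      rw [d.h1.tgt_prod]; exact (d.h1.o.prod_congr hb').symm
    have hi := ha i List.mem_cons_self
    have hi' := hb i List.mem_cons_self
    simp only [Mon.prod_cons, z2]
    rw [← d.assoc, d.ζ_nat hi h1.symm hi' h2.symm, d.assoc, d.assoc,
      d.comp_mul₁ (by simp [hi, hi']) (by simp [h1, h2]), z2_nat ha' hb',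
      d.comp_mul₁ (by simp) (by simp), d.comp_id (by simp [hi, hi']), d.id_comp (by simp)]
    simp

/-- Associativity in the direction of `⊠₀`. In both composites naturality brings the binary
interchanges to the front, where `ζ_assoc₀` compares them; for no columns the claim is the
associativity of `μ`. -/
theorem z2_assoc (X Y Z : ι → D) : ∀ l : List ι,
    d.z2 X Y l ⊠₀ d.id (d.h1.o.prod l Z) ⨟ d.z2 (fun i => X i ⊙₀ Y i) Z l =
      d.id (d.h1.o.prod l X) ⊠₀ d.z2 Y Z l ⨟ d.z2 X (fun i => Y i ⊙₀ Z i) l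
  | [] => d.μ_assoc
  | i :: l => by
    simp only [Mon.prod_cons, z2]
    have ih := z2_assoc X Y Z l
    have e1 : d.ζ (X i) (d.h1.o.prod l X) (Y i) (d.h1.o.prod l Y) ⨟
          d.id (X i ⊙₀ Y i) ⊠₁ d.z2 X Y l =
        d.ζ (X i) (d.h1.o.prod l X) (Y i) (d.h1.o.prod l Y) ⨟
          d.id (X i ⊙₀ Y i) ⊠₁ d.z2 X Y l := rfl
    have e2 : (d.ζ (X i) (d.h1.o.prod l X) (Y i) (d.h1.o.prod l Y) ⨟
          d.id (X i ⊙₀ Y i) ⊠₁ d.z2 X Y l) ⊠₀ d.id (Z i ⊙₁ d.h1.o.prod l Z) =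
        d.ζ (X i) (d.h1.o.prod l X) (Y i) (d.h1.o.prod l Y) ⊠₀ d.id (Z i ⊙₁ d.h1.o.prod l Z) ⨟
          (d.id (X i ⊙₀ Y i) ⊠₁ d.z2 X Y l) ⊠₀ (d.id (Z i) ⊠₁ d.id (d.h1.o.prod l Z)) := by
      rw [d.comp_mul₀ (by simp) (by simp), ← d.h1.id_mul, d.id_comp (by simp)]
    have e3 : d.id (X i ⊙₁ d.h1.o.prod l X) ⊠₀ (d.ζ (Y i) (d.h1.o.prod l Y) (Z i) (d.h1.o.prod l Z) ⨟
          d.id (Y i ⊙₀ Z i) ⊠₁ d.z2 Y Z l) =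
        d.id (X i ⊙₁ d.h1.o.prod l X) ⊠₀ d.ζ (Y i) (d.h1.o.prod l Y) (Z i) (d.h1.o.prod l Z) ⨟
          (d.id (X i) ⊠₁ d.id (d.h1.o.prod l X)) ⊠₀ (d.id (Y i ⊙₀ Z i) ⊠₁ d.z2 Y Z l) := by
      rw [d.comp_mul₀ (by simp) (by simp), ← d.h1.id_mul, d.id_comp (by simp)]
    rw [e2, e3, d.assoc, d.assoc, ← d.assoc ((d.id (X i ⊙₀ Y i) ⊠₁ _) ⊠₀ _),
      ← d.assoc ((d.id (X i) ⊠₁ _) ⊠₀ _),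
      d.ζ_nat (by simp) (by simp) (by simp) (by simp),
      d.ζ_nat (by simp) (by simp) (by simp) (by simp)]
    simp only [d.assoc]
    rw [d.comp_mul₁ (by simp) (by simp), d.comp_mul₁ (by simp) (by simp), ih, ← d.assoc, ← d.assoc]
    simp only [d.src_id, d.src_z2]
    rw [d.ζ_assoc₀]
    simp only [← d.h0.id_mul]
    rw [d.id_comp (by simp), d.id_comp (by simp), d.h0.o.assoc]

/-- The iterated comultiplication is the interchange of no rows, so it must be neutral. The first
column is handled by `δ_ζ`, and the empty list by `ε_μ`. -/
theorem z2_unit_left (Y : ι → D) : ∀ l : List ι,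
    d.e1 l ⊠₀ d.id (d.h1.o.prod l Y) ⨟ d.z2 (fun _ => d.h0.o.one) Y l = d.id (d.h1.o.prod l Y)
  | [] => d.ε_μ
  | i :: l => by
    have ih := z2_unit_left Y l
    simp only [Mon.prod_cons, z2, e1]
    have e2 : (d.δ ⨟ d.id d.h0.o.one ⊠₁ d.e1 l) ⊠₀ d.id (Y i ⊙₁ d.h1.o.prod l Y) =
        d.δ ⊠₀ d.id (Y i ⊙₁ d.h1.o.prod l Y) ⨟
          (d.id d.h0.o.one ⊠₁ d.e1 l) ⊠₀ (d.id (Y i) ⊠₁ d.id (d.h1.o.prod l Y)) := by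
      rw [d.comp_mul₀ (by simp) (by simp), ← d.h1.id_mul, d.id_comp (by simp)]
    rw [e2, d.assoc, ← d.assoc ((d.id _ ⊠₁ _) ⊠₀ _),
      d.ζ_nat (by simp) (by simp) (by simp) (by simp)]
    simp only [d.assoc]
    rw [d.comp_mul₁ (by simp) (by simp), ih, ← d.assoc]
    simp only [d.src_id, d.src_e1]
    rw [d.δ_ζ, ← d.h0.id_mul, d.h0.o.one_mul, d.id_comp (by simp), d.id_comp (by simp),
      ← d.h1.id_mul]

theorem z2_unit_right (X : ι → D) : ∀ l : List ι,
    d.id (d.h1.o.prod l X) ⊠₀ d.e1 l ⨟ d.z2 X (fun _ => d.h0.o.one) l = d.id (d.h1.o.prod l X)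
  | [] => d.μ_ε
  | i :: l => by
    have ih := z2_unit_right X l
    simp only [Mon.prod_cons, z2, e1]
    have e2 : d.id (X i ⊙₁ d.h1.o.prod l X) ⊠₀ (d.δ ⨟ d.id d.h0.o.one ⊠₁ d.e1 l) =
        d.id (X i ⊙₁ d.h1.o.prod l X) ⊠₀ d.δ ⨟
          (d.id (X i) ⊠₁ d.id (d.h1.o.prod l X)) ⊠₀ (d.id d.h0.o.one ⊠₁ d.e1 l) := by
      rw [d.comp_mul₀ (by simp) (by simp), ← d.h1.id_mul, d.id_comp (by simp)]
    rw [e2, d.assoc, ← d.assoc ((d.id _ ⊠₁ _) ⊠₀ _),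
      d.ζ_nat (by simp) (by simp) (by simp) (by simp)]
    simp only [d.assoc]
    rw [d.comp_mul₁ (by simp) (by simp), ih, ← d.assoc]
    simp only [d.src_id, d.src_e1]
    rw [d.ζ_δ, ← d.h0.id_mul, d.h0.o.mul_one, d.id_comp (by simp), d.id_comp (by simp),
      ← d.h1.id_mul]

/-- Coassociativity of `δ`; an empty first block is removed by the counit law. -/
theorem e1_append (l' : List ι) : ∀ l : List ι, d.e1 (l ++ l') = d.δ ⨟ d.e1 l ⊠₁ d.e1 l'
  | [] => by
    have h : d.ε ⊠₁ d.e1 l' = d.ε ⊠₁ d.id d.h0.o.one ⨟ d.h1.t.one ⊠₁ d.e1 l' := by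
      rw [d.comp_mul₁ (by simp) (by simp), d.id_comp (by simp), ← d.h1.id_one, d.comp_id (by simp)]
    rw [List.nil_append, e1, h, ← d.assoc, d.ε_δ, d.h1.t.one_mul, d.id_comp (by simp)]
  | i :: l => by
    have h : (d.δ ⨟ d.id d.h0.o.one ⊠₁ d.e1 l) ⊠₁ d.e1 l' =
        d.δ ⊠₁ d.id d.h0.o.one ⨟ d.id d.h0.o.one ⊠₁ (d.e1 l ⊠₁ d.e1 l') := by
      rw [← d.h1.t.assoc, d.comp_mul₁ (by simp) (by simp), d.id_comp (by simp)]
    rw [List.cons_append, e1, e1, h, ← d.assoc, d.δ_assoc, d.assoc, d.comp_mul₁ (by simp) (by simp),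
      d.id_comp (by simp), e1_append l' l]

theorem e1_flatMap (r : κ → List ι) : ∀ m : List κ,
    d.e1 (m.flatMap r) = d.e1 m ⨟ d.h1.t.prod m fun k => d.e1 (r k)
  | [] => by
    rw [List.flatMap_nil, Mon.prod_nil, ← d.h1.id_one, d.comp_id (by simp)]; rfl
  | k :: m => by
    rw [List.flatMap_cons, d.e1_append, e1_flatMap r m, e1, d.assoc, Mon.prod_cons,
      d.comp_mul₁ (by simp) (by simp), d.id_comp (by simp)]

/-- Associativity in the direction of `⊠₁`, from `ζ_assoc₁`; the empty first block is the unit law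
`ζ_μ_left`. -/
theorem z2_append (X Y : ι → D) (l' : List ι) : ∀ l : List ι, d.z2 X Y (l ++ l') =
    d.ζ (d.h1.o.prod l X) (d.h1.o.prod l' X) (d.h1.o.prod l Y) (d.h1.o.prod l' Y) ⨟
      d.z2 X Y l ⊠₁ d.z2 X Y l'
  | [] => by
    have h : d.μ ⊠₁ d.z2 X Y l' =
        d.μ ⊠₁ d.id (d.h1.o.prod l' X ⊙₀ d.h1.o.prod l' Y) ⨟ d.h1.t.one ⊠₁ d.z2 X Y l' := by
      rw [d.comp_mul₁ (by simp) (by simp), d.id_comp (by simp), ← d.h1.id_one, d.comp_id (by simp)]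
    rw [List.nil_append, z2, h, ← d.assoc, Mon.prod_nil, Mon.prod_nil, d.ζ_μ_left,
      d.h1.t.one_mul, d.id_comp (by simp)]
  | i :: l => by
    have ih := z2_append X Y l' l
    have h : (d.ζ (X i) (d.h1.o.prod l X) (Y i) (d.h1.o.prod l Y) ⨟
          d.id (X i ⊙₀ Y i) ⊠₁ d.z2 X Y l) ⊠₁ d.z2 X Y l' =
        d.ζ (X i) (d.h1.o.prod l X) (Y i) (d.h1.o.prod l Y) ⊠₁
          d.id (d.h1.o.prod l' X ⊙₀ d.h1.o.prod l' Y) ⨟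
          d.id (X i ⊙₀ Y i) ⊠₁ (d.z2 X Y l ⊠₁ d.z2 X Y l') := by
      rw [← d.h1.t.assoc, d.comp_mul₁ (by simp) (by simp), d.id_comp (by simp)]
    rw [List.cons_append, z2, z2, h, ← d.assoc, Mon.prod_cons, Mon.prod_cons, d.ζ_assoc₁, d.assoc,
      d.comp_mul₁ (by simp) (by simp), d.id_comp (by simp), ih, d.h1.o.prod_append,
      d.h1.o.prod_append]

theorem z2_flatMap (X Y : ι → D) (r : κ → List ι) : ∀ m : List κ, d.z2 X Y (m.flatMap r) =
    d.z2 (fun k => d.h1.o.prod (r k) X) (fun k => d.h1.o.prod (r k) Y) m ⨟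
      d.h1.t.prod m fun k => d.z2 X Y (r k)
  | [] => by
    rw [List.flatMap_nil, Mon.prod_nil, ← d.h1.id_one, d.comp_id (by simp)]; rfl
  | k :: m => by
    rw [List.flatMap_cons, d.z2_append, z2_flatMap X Y r m, z2, d.assoc, Mon.prod_cons,
      d.comp_mul₁ (by simp) (by simp), d.id_comp (by simp), d.h1.o.prod_flatMap,
      d.h1.o.prod_flatMap]

theorem z2_single (X Y : ι → D) (i : ι) : d.z2 X Y [i] = d.id (X i ⊙₀ Y i) := by
  rw [z2, z2, Mon.prod_nil, Mon.prod_nil, d.ζ_μ_right]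

theorem e1_single (i : ι) : d.e1 [i] = d.id d.h0.o.one := by rw [e1, e1, d.δ_ε]

theorem z2_map (g : κ → ι) (X Y : ι → D) : ∀ l : List κ,
    d.z2 X Y (l.map g) = d.z2 (fun k => X (g k)) (fun k => Y (g k)) l
  | [] => rfl
  | k :: l => by rw [List.map_cons, z2, z2, z2_map g X Y l, Mon.prod_map, Mon.prod_map]; rfl

theorem e1_map (g : κ → ι) : ∀ l : List κ, d.e1 (l.map g) = d.e1 l
  | [] => rfl
  | k :: l => by rw [List.map_cons, e1, e1, e1_map g l]

theorem z2_congr {X Y X' Y' : ι → D} : ∀ {l : List ι}, (∀ i ∈ l, X i = X' i) →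
    (∀ i ∈ l, Y i = Y' i) → d.z2 X Y l = d.z2 X' Y' l
  | [], _, _ => rfl
  | i :: l, h, h' => by
    have e := fun j hj => h j (List.mem_cons_of_mem i hj)
    have e' := fun j hj => h' j (List.mem_cons_of_mem i hj)
    rw [z2, z2, z2_congr e e', h i List.mem_cons_self, h' i List.mem_cons_self,
      d.h1.o.prod_congr e, d.h1.o.prod_congr e']

end DuoAlg

namespace DuoAlg

variable {D A : Type*} (d : DuoAlg D A) {ι κ ι' κ' : Type*}

local infixl:65 " ⨟ " => d.comp
local infixl:70 " ⊠₀ " => d.h0.t.mul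
local infixl:70 " ⊠₁ " => d.h1.t.mul
local infixl:70 " ⊙₀ " => d.h0.o.mul
local infixl:70 " ⊙₁ " => d.h1.o.mul

/-! ### The interchange for arrays -/

theorem chi_congr {t : List ι} {G G' : κ → ι → D} : ∀ {s : List κ},
    (∀ k ∈ s, ∀ i ∈ t, G k i = G' k i) → d.chi t G s = d.chi t G' s
  | [], _ => rfl
  | k :: s, h => by
    have e := fun j hj => h j (List.mem_cons_of_mem k hj)
    have e' := h k List.mem_cons_self
    rw [chi, chi, chi_congr e, d.h1.o.prod_congr e',
      d.z2_congr (fun i hi => d.h0.o.rprod_congr fun k hk => e k hk i hi) e']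

theorem chi_map_left (g : ι' → ι) (t : List ι') (G : κ → ι → D) : ∀ s : List κ,
    d.chi (t.map g) G s = d.chi t (fun k i => G k (g i)) s
  | [] => d.e1_map g t
  | k :: s => by rw [chi, chi, chi_map_left g t G s, d.z2_map, Mon.prod_map]; rfl

theorem chi_map_right (g : κ' → κ) (t : List ι) (G : κ → ι → D) : ∀ s : List κ',
    d.chi t G (s.map g) = d.chi t (fun k i => G (g k) i) s
  | [] => rfl
  | k :: s => by
    rw [List.map_cons, chi, chi, chi_map_right g t G s]
    simp only [Mon.rprod_map, Function.comp_def]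

theorem chi_nat {t : List ι} {a : κ → ι → A} {G : κ → ι → D} : ∀ {s : List κ},
    (∀ k ∈ s, ∀ i ∈ t, d.tgt (a k i) = G k i) →
    d.h0.t.rprod s (fun k => d.h1.t.prod t (a k)) ⨟ d.chi t G s =
      d.chi t (fun k i => d.src (a k i)) s ⨟ d.h1.t.prod t fun i => d.h0.t.rprod s fun k => a k i
  | [], _ => by
    simp only [Mon.rprod_nil, ← d.h0.id_one]
    rw [← d.h1.id_prod, d.id_comp (by simp), d.comp_id (by simp)]; rfl
  | k :: s, h => by
    have e := fun j hj => h j (List.mem_cons_of_mem k hj)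
    have e' := h k List.mem_cons_self
    have hs : d.h0.o.rprod s (fun k => d.h1.o.prod t fun i => d.tgt (a k i)) =
        d.h0.o.rprod s fun k => d.h1.o.prod t (G k) :=
      d.h0.o.rprod_congr fun k hk => d.h1.o.prod_congr (e k hk)
    have hk := d.h1.o.prod_congr e'
    simp only [Mon.rprod_cons, chi]
    rw [← d.assoc, d.comp_mul₀ (by simpa using hs) (by simpa using hk), chi_nat e,
      d.comp_id (by simpa using hk)]
    conv_lhs => rw [← d.id_comp (a := d.h1.t.prod t (a k)) rfl]
    rw [← d.comp_mul₀ (by simp) (by simp), d.assoc, d.z2_nat (fun i hi => by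
      simpa using d.h0.o.rprod_congr fun k hk => e k hk i hi) e', d.assoc]
    simp

/-- Induction over `s`. The interchange with the first row is moved past the one with the block `s'`
by `z2_assoc`; an empty `s` is `z2_unit_right`. -/
theorem chi_append (t : List ι) (G : κ → ι → D) (s' : List κ) : ∀ s : List κ,
    d.chi t G (s ++ s') = d.chi t G s' ⊠₀ d.chi t G s ⨟
      d.z2 (fun i => d.h0.o.rprod s' fun k => G k i) (fun i => d.h0.o.rprod s fun k => G k i) t
  | [] => by
    have h : d.chi t G s' ⊠₀ d.e1 t =
        d.chi t G s' ⊠₀ d.id d.h0.o.one ⨟ d.id (d.h1.o.prod t fun i => d.h0.o.rprod s' fun k => G k i) ⊠₀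
          d.e1 t := by
      rw [d.comp_mul₀ (by simp) (by simp), d.comp_id (by simp), d.id_comp (by simp)]
    simp only [List.nil_append, chi, Mon.rprod_nil]
    rw [h, d.assoc, d.z2_unit_right, d.h0.id_one, d.h0.t.mul_one, d.comp_id (by simp)]
  | k :: s => by
    have h : d.chi t G s' ⊠₀ (d.chi t G s ⊠₀ d.id (d.h1.o.prod t (G k)) ⨟
          d.z2 (fun i => d.h0.o.rprod s fun k => G k i) (G k) t) =
        d.chi t G s' ⊠₀ (d.chi t G s ⊠₀ d.id (d.h1.o.prod t (G k))) ⨟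
          d.id (d.h1.o.prod t fun i => d.h0.o.rprod s' fun k => G k i) ⊠₀
            d.z2 (fun i => d.h0.o.rprod s fun k => G k i) (G k) t := by
      rw [d.comp_mul₀ (by simp) (by simp), d.comp_id (by simp)]
    simp only [List.cons_append, chi, Mon.rprod_cons, Mon.rprod_append]
    rw [chi_append t G s' s, h, d.assoc _ (d.id _ ⊠₀ _), ← d.z2_assoc, ← d.assoc,
      ← d.h0.t.assoc, d.comp_mul₀ (by simp) (by simp), d.comp_id (d.tgt_id _)]

/-- The interchange of an array can be computed in blocks of rows, and by `chi_flatMap_left` in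
blocks of columns. Together with `chi_nat` these two facts carry the proof of `com_coassoc`. -/
theorem chi_flatMap_right (t : List ι) (G : κ → ι → D) (r : κ' → List κ) : ∀ m : List κ',
    d.chi t G (m.flatMap r) = d.h0.t.rprod m (fun c => d.chi t G (r c)) ⨟
      d.chi t (fun c i => d.h0.o.rprod (r c) fun k => G k i) m
  | [] => by rw [Mon.rprod_nil, ← d.h0.id_one, d.id_comp (by simp)]; rfl
  | c :: m => by
    simp only [List.flatMap_cons, Mon.rprod_cons, chi]
    rw [d.chi_append, chi_flatMap_right t G r m, ← d.assoc, d.comp_mul₀ (by simp) (by simp),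
      d.comp_id (by simp)]
    simp only [Mon.rprod_flatMap]

theorem chi_flatMap_left (G : κ → ι → D) (r : ι' → List ι) (m : List ι') : ∀ s : List κ,
    d.chi (m.flatMap r) G s = d.chi m (fun k j => d.h1.o.prod (r j) (G k)) s ⨟
      d.h1.t.prod m fun j => d.chi (r j) G s
  | [] => d.e1_flatMap r m
  | k :: s => by
    simp only [chi]
    rw [chi_flatMap_left G r m s, d.z2_flatMap, d.h1.o.prod_flatMap]
    conv_lhs => rw [← d.id_comp (a := d.id (d.h1.o.prod m _)) (d.src_id _)]
    rw [← d.comp_mul₀ (by simp) (by simp), d.assoc, ← d.assoc (d.h1.t.prod m _ ⊠₀ _), d.h1.id_prod,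
      d.z2_nat (by simp) (by simp), d.assoc, ← d.h1.prod_comp (by simp), ← d.h1.id_prod, d.assoc]
    simp

theorem chi_single_left (i : ι) (G : κ → ι → D) : ∀ s : List κ,
    d.chi [i] G s = d.id (d.h0.o.rprod s fun k => G k i)
  | [] => d.e1_single i
  | k :: s => by
    rw [chi, chi_single_left i G s, d.z2_single, d.h1.o.prod_single, ← d.h0.id_mul,
      d.id_comp (by simp)]; rfl

theorem chi_single_right (t : List ι) (G : κ → ι → D) (k : κ) :
    d.chi t G [k] = d.id (d.h1.o.prod t (G k)) := d.z2_unit_left (G k) t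

/-- The iterated multiplication of the unit of `⊠₁`. -/
theorem chi_nil_left (G : κ → ι → D) : ∀ s : List κ,
    d.chi ([] : List ι) G s = d.chi ([] : List ι') (fun _ _ => d.h0.o.one) s
  | [] => rfl
  | k :: s => by rw [chi, chi, chi_nil_left G s]; rfl

end DuoAlg

/-! ### The interchange along maps of levelled families -/

namespace LevFam

variable {A B A' B' A'' B'' : Type} {M : Type*}

theorem filter_flatMap_eq {α β : Type} {p : α → Bool} {q : β → Bool} {r : α → List β} :
    ∀ {l : List α}, (∀ a ∈ l, ∀ b ∈ r a, q b = p a) →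
    (l.flatMap r).filter q = (l.filter p).flatMap r
  | [], _ => rfl
  | a :: l, h => by
    have ih := filter_flatMap_eq fun a' ha' => h a' (List.mem_cons_of_mem a ha')
    have ha := h a List.mem_cons_self
    rw [List.flatMap_cons, List.filter_append, ih]
    cases hp : p a
    · rw [List.filter_cons_of_neg (by simp [hp]), List.filter_eq_nil_iff.2, List.nil_append]
      intro b hb
      rw [ha b hb, hp]
      simp
    · rw [List.filter_cons_of_pos hp, List.flatMap_cons, List.filter_eq_self.2]
      intro b hb
      rw [ha b hb, hp]

variable {X : LevFam A B} {Y : LevFam A' B'} {Z : LevFam A'' B''}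

theorem mem_overLev {f : Map X Y} {c : Y.Lev} {l : X.Lev} : l ∈ overLev f c ↔ f.lev l = c := by
  rw [mem_selLev, decide_eq_true_eq]

theorem overLev_comp (f : Map X Y) (g : Map Y Z) (c : Z.Lev) :
    overLev (f.comp g) c = (overLev g c).flatMap (overLev f) := by
  refine Eq.trans ?_ (filter_flatMap_eq (q := fun l => decide ((f.comp g).lev l = c)) ?_)
  · rw [overLev, selLev, finRange_eq f]
  · intro b _ l hl
    rw [← mem_overLev.1 hl]; rfl

theorem overPos_comp (f : Map X Y) (g : Map Y Z) (l : X.Lev) (p : Z.Pos) :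
    overPos (f.comp g) l p = (overPos g (f.lev l) p).flatMap (overPos f l) := by
  refine Eq.trans ?_ (filter_flatMap_eq (q := fun q => decide ((f.comp g).pos q = p)) ?_)
  · rw [overPos, selPos, row_eq f l]
  · intro b _ q hq
    have hq' : f.pos q = b := by simpa using (mem_selPos.1 hq).2
    rw [← hq']; rfl

theorem overLev_id (c : X.Lev) : overLev (Map.id X) c = [c] :=
  filter_single _ _ (fun _ => rfl) _ (List.nodup_finRange _) (List.mem_finRange _)

theorem overPos_id (i : X.Pos) : overPos (Map.id X) i.1 i = [i] :=
  filter_single _ _ (fun _ => rfl) _ (X.row_nodup _) (mem_row.2 rfl)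

theorem map_incLev_fib (f : Map X Y) (p : Y.Pos) :
    (List.finRange (fib f p).length).map incLev = overLev f p.1 := map_incLev

theorem map_incPos_row_fib (f : Map X Y) (p : Y.Pos) (b : (fib f p).Lev) :
    ((fib f p).row b).map incPos = overPos f (incLev b) p := map_incPos b

theorem map_overLev_fibMap (f : Map X Y) (g : Map Y Z) (h : Map X Z) (w : f.comp g = h) (p : Z.Pos)
    (b : (fib g p).Lev) :
    (overLev (fibMap f g h w p) b).map incLev = overLev f (incLev b) := by
  refine map_selLev (fun l => ?_) fun l hl => ?_
  · rw [← incLev_fibMap f g h w]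
    simp [incLev_injective.eq_iff]
  · subst w
    simp only [decide_eq_true_eq] at hl ⊢
    simp [Map.comp, hl]

theorem map_overPos_fibMap (f : Map X Y) (g : Map Y Z) (h : Map X Z) (w : f.comp g = h) (p : Z.Pos)
    (i : (fib g p).Pos) (l : (fib h p).Lev) (hl : (fibMap f g h w p).lev l = i.1) :
    (overPos (fibMap f g h w p) l i).map incPos = overPos f (incLev l) (incPos i) := by
  obtain ⟨h1, h2, h3, h4⟩ := fib_conditions f g h w p i
  exact map_selPos (P₂ := fun d => decide (f.lev d = (incPos i).1)) h3 h4 l (by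
    rw [decide_eq_true_eq, incPos_fst, ← hl, incLev_fibMap])

/-- The product `m₀`, in the reversed order, over the levels of the products `m₁` of the entries. -/
def big (m₀ m₁ : Mon M) (X : LevFam A B) (a : X.Pos → M) : M :=
  m₀.rprod (List.finRange X.length) fun c => m₁.prod (X.row c) a

variable {m₀ m₁ : Mon M}

theorem big_congr {a b : X.Pos → M} (h : ∀ p, a p = b p) : big m₀ m₁ X a = big m₀ m₁ X b :=
  congrArg (big m₀ m₁ X) (funext h)

theorem big_sub {fa : A → A'} {fb : B → B'} {P : X.Lev → Bool} {Q : X.Pos → Bool} (a : X.Pos → M) :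
    big m₀ m₁ (X.sub fa fb P Q) (fun p => a (incPos p)) =
      m₀.rprod (X.selLev P) fun d => m₁.prod (X.selPos Q d) a := by
  rw [big, ← map_incLev (fa := fa) (fb := fb) (Q := Q), m₀.rprod_map]
  refine m₀.rprod_congr fun k _ => ?_
  rw [Function.comp, ← map_incPos, m₁.prod_map]; rfl

theorem big_fib (f : Map X Y) (i : Y.Pos) (a : X.Pos → M) :
    big m₀ m₁ (fib f i) (fun p => a (incPos p)) =
      m₀.rprod (overLev f i.1) fun d => m₁.prod (overPos f d i) a := big_sub a

theorem big_over (f : Map X Y) (a : X.Pos → M) :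
    big m₀ m₁ X a = m₀.rprod (List.finRange Y.length) fun c => m₀.rprod (overLev f c) fun l =>
      m₁.prod (Y.row c) fun i => m₁.prod (overPos f l i) a := by
  rw [big, finRange_eq f, m₀.rprod_flatMap]
  refine m₀.rprod_congr fun c _ => m₀.rprod_congr fun l hl => ?_
  rw [row_eq f l, mem_overLev.1 hl, m₁.prod_flatMap]

end LevFam

namespace DuoAlg

open LevFam

variable {D A : Type*} (d : DuoAlg D A) {α β α' β' α'' β'' : Type}
  {X : LevFam α β} {Y : LevFam α' β'} {Z : LevFam α'' β''}

local infixl:65 " ⨟ " => d.comp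

/-- The interchange from the power of `X` to the power of `Y` with entries the powers of the fibres
of `f`. -/
def com (f : Map X Y) (val : X.Pos → D) : A :=
  d.h0.t.rprod (List.finRange Y.length) fun c =>
    d.chi (Y.row c) (fun l i => d.h1.o.prod (overPos f l i) val) (overLev f c)

@[simp] theorem src_big (a : X.Pos → A) :
    d.src (big d.h0.t d.h1.t X a) = big d.h0.o d.h1.o X fun p => d.src (a p) := by simp [big]

@[simp] theorem tgt_big (a : X.Pos → A) :
    d.tgt (big d.h0.t d.h1.t X a) = big d.h0.o d.h1.o X fun p => d.tgt (a p) := by simp [big]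

theorem id_big (a : X.Pos → D) :
    d.id (big d.h0.o d.h1.o X a) = big d.h0.t d.h1.t X fun p => d.id (a p) := by
  rw [big, d.h0.id_rprod]
  exact d.h0.t.rprod_congr fun c _ => d.h1.id_prod _ _

theorem big_comp {a b : X.Pos → A} (h : ∀ p, d.tgt (a p) = d.src (b p)) :
    big d.h0.t d.h1.t X (fun p => a p ⨟ b p) = big d.h0.t d.h1.t X a ⨟ big d.h0.t d.h1.t X b := by
  simp only [big]
  rw [← d.h0.rprod_comp fun c _ => by simpa using d.h1.o.prod_congr fun p _ => h p]
  exact d.h0.t.rprod_congr fun c _ => d.h1.prod_comp fun p _ => h p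

theorem tgt_com (f : Map X Y) (val : X.Pos → D) : d.tgt (d.com f val) =
    big d.h0.o d.h1.o Y fun i => big d.h0.o d.h1.o (fib f i) fun p => val (incPos p) := by
  simp only [com, tgt_rprod₀, tgt_chi, big_fib]
  exact d.h0.o.rprod_congr fun c _ => d.h1.o.prod_congr fun i hi => by rw [mem_row.1 hi]

theorem com_nat (f : Map X Y) {a : X.Pos → A} {val : X.Pos → D} (h : ∀ p, d.tgt (a p) = val p) :
    big d.h0.t d.h1.t X a ⨟ d.com f val = d.com f (fun p => d.src (a p)) ⨟
      big d.h0.t d.h1.t Y fun i => big d.h0.t d.h1.t (fib f i) fun p => a (incPos p) := by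
  obtain rfl : (fun p => d.tgt (a p)) = val := funext h
  simp only [big_over f a, com, big_fib]
  rw [big, ← d.h0.rprod_comp fun c _ => by simp, ← d.h0.rprod_comp fun c _ => by
    simpa using d.h1.o.prod_congr fun i hi => by rw [mem_row.1 hi]]
  refine d.h0.t.rprod_congr fun c _ => ?_
  rw [d.chi_nat fun k _ i _ => by simp]
  simp only [src_prod₁]
  congr 1
  exact d.h1.t.prod_congr fun i hi => by rw [mem_row.1 hi]

/-- The levels and entries of the fibres of `g` and `h` are sublists of those of `Y` and `X`. Thus
the interchange of the induced map of fibres is a part of the array of `f` itself, the form in which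
it can be compared with `com f`. -/
theorem com_fibMap (f : Map X Y) (g : Map Y Z) (h : Map X Z) (w : f.comp g = h) (p : Z.Pos)
    (val : X.Pos → D) : d.com (fibMap f g h w p) (fun q => val (incPos q)) =
      d.h0.t.rprod (overLev g p.1) fun b => d.chi (overPos g b p)
        (fun l i => d.h1.o.prod (overPos f l i) val) (overLev f b) := by
  rw [com, ← map_incLev_fib, d.h0.t.rprod_map]
  refine d.h0.t.rprod_congr fun b _ => ?_
  rw [Function.comp, ← map_incPos_row_fib, ← map_overLev_fibMap f g h w, d.chi_map_left, d.chi_map_right]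
  refine d.chi_congr fun l hl i hi => ?_
  rw [← map_overPos_fibMap f g h w p i l ((mem_overLev.1 hl).trans (mem_row.1 hi).symm),
    d.h1.o.prod_map]; rfl

/-- Over a level `c` of `Z`, both sides interchange one and the same array: the rows are the levels
of `X` over `c`, grouped by the levels `b` of `Y`, and the columns are grouped by the entries `p` of
`c`. One side works block of rows by block of rows, the other interchanges the coarse array of `h`
first and then refines it inside of the columns `p`. -/
theorem com_coassoc (f : Map X Y) (g : Map Y Z) (h : Map X Z) (w : f.comp g = h)
    (val : X.Pos → D) :
    d.com f val ⨟ d.com g (fun i => big d.h0.o d.h1.o (fib f i) fun q => val (incPos q)) =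
      d.com h val ⨟ big d.h0.t d.h1.t Z fun p =>
        d.com (fibMap f g h w p) fun q => val (incPos q) := by
  simp only [d.com_fibMap, big_fib]
  subst w
  have e : d.com f val = d.h0.t.rprod (List.finRange Z.length) fun c =>
      d.h0.t.rprod (overLev g c) fun b => d.chi (Y.row b)
        (fun l i => d.h1.o.prod (overPos f l i) val) (overLev f b) := by
    rw [com, finRange_eq g, d.h0.t.rprod_flatMap]
  rw [e]
  simp only [com, big]
  rw [← d.h0.rprod_comp fun c _ => by
      simp only [tgt_rprod₀, tgt_chi, src_chi]
      refine d.h0.o.rprod_congr fun b hb => ?_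
      rw [row_eq g b, mem_overLev.1 hb, d.h1.o.prod_flatMap]
      refine d.h1.o.prod_congr fun p _ => d.h1.o.prod_congr fun i hi => ?_
      rw [(mem_selPos.1 hi).1],
    ← d.h0.rprod_comp fun c _ => by
      simp only [src_prod₁, tgt_chi, src_rprod₀, src_chi, overLev_comp, d.h0.o.rprod_flatMap]
      refine d.h1.o.prod_congr fun p hp => ?_
      rw [mem_row.1 hp]
      refine d.h0.o.rprod_congr fun b hb => d.h0.o.rprod_congr fun l hl => ?_
      rw [overPos_comp, mem_overLev.1 hl, d.h1.o.prod_flatMap]]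
  refine d.h0.t.rprod_congr fun c _ => ?_
  -- Inside the rows over one `b`, the columns are grouped by `p`: the groups are interchanged
  -- first, and then the columns of each group.
  have e1 : d.h0.t.rprod (overLev g c) (fun b => d.chi (Y.row b)
        (fun l i => d.h1.o.prod (overPos f l i) val) (overLev f b)) =
      d.h0.t.rprod (overLev g c) (fun b => d.chi (Z.row c)
        (fun l p => d.h1.o.prod (overPos (f.comp g) l p) val) (overLev f b)) ⨟
      d.h0.t.rprod (overLev g c) (fun b => d.h1.t.prod (Z.row c) fun p => d.chi (overPos g b p)
        (fun l i => d.h1.o.prod (overPos f l i) val) (overLev f b)) := by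
    rw [← d.h0.rprod_comp fun b hb => by
      simp only [tgt_chi, src_prod₁, src_chi]
      refine d.h1.o.prod_congr fun p _ => d.h0.o.rprod_congr fun l hl => ?_
      rw [overPos_comp, mem_overLev.1 hl, d.h1.o.prod_flatMap]]
    refine d.h0.t.rprod_congr fun b hb => ?_
    rw [row_eq g b, mem_overLev.1 hb, d.chi_flatMap_left]
    congr 1
    refine d.chi_congr fun l hl p _ => ?_
    rw [overPos_comp, mem_overLev.1 hl, d.h1.o.prod_flatMap]
  -- Naturality moves the interchanges within the groups behind the interchange of the blocks; the
  -- latter combines with what precedes it by `chi_flatMap_right`.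
  rw [e1, d.assoc, d.chi_nat fun b hb p _ => by
    simp only [tgt_chi]
    refine d.h1.o.prod_congr fun i hi => ?_
    rw [(mem_selPos.1 hi).1], ← d.assoc]
  congr 1
  · rw [overLev_comp, d.chi_flatMap_right]
    congr 1
    refine d.chi_congr fun b hb p _ => ?_
    rw [src_chi]
    refine d.h0.o.rprod_congr fun l hl => ?_
    rw [overPos_comp, mem_overLev.1 hl, d.h1.o.prod_flatMap]
  · exact d.h1.t.prod_congr fun p hp => by rw [mem_row.1 hp]

theorem com_id (val : X.Pos → D) : d.com (Map.id X) val = d.id (big d.h0.o d.h1.o X val) := by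
  rw [com, big, d.h0.id_rprod]
  refine d.h0.t.rprod_congr fun c _ => ?_
  rw [overLev_id, d.chi_single_right]
  congr 1
  refine d.h1.o.prod_congr fun i hi => ?_
  rw [← mem_row.1 hi, overPos_id, Mon.prod_single]

/-- An array with a single column has nothing to interchange. This is the situation of the map to a
chosen terminal object, in the right unit law. -/
theorem com_single (f : Map X Y) (val : X.Pos → D) {i : Y.Pos}
    (hc : List.finRange Y.length = [i.1]) (hi : Y.row i.1 = [i]) :
    d.com f val = d.id (big d.h0.o d.h1.o X val) := by
  rw [big_over f, com, hc, Mon.rprod_single, Mon.rprod_single, hi, d.chi_single_left]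
  simp

end DuoAlg

/-! ### Generalized arrows of an enriched category -/

/-- An arrow with a generalized element of the object of morphisms; `none` stands for an undefined
composite. -/
structure GArr {V : Type uV} [Category.{vV} V] [MonoidalCategory V] [SymmetricCategory V]
    (L : LaxSym.{w} V) (D : Type uD) [Category.{vD} D] [EnrichedOrdinaryCategory V D] where
  src : D
  tgt : D
  hom : Option (L.E (src ⟶[V] tgt))

namespace GArr

variable {V : Type uV} [Category.{vV} V] [MonoidalCategory V] [SymmetricCategory V]
  {L : LaxSym.{w} V} {D : Type uD} [Category.{vD} D] [EnrichedOrdinaryCategory V D]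

/-- The generalized arrow of a generalized element. -/
def arr {X Y : D} (x : L.E (X ⟶[V] Y)) : GArr L D := ⟨X, Y, some x⟩

/-- The undefined generalized arrow. -/
def undef (X Y : D) : GArr L D := ⟨X, Y, none⟩

/-- Source and target are part of a generalized arrow, so transports along equalities of objects
disappear; with `arr_injective` for the way back, this is the purpose of `GArr`. -/
theorem arr_cast {X X' Y Y' : D} (hX : X = X') (hY : Y = Y') (e : (X ⟶[V] Y) = (X' ⟶[V] Y'))
    (x : L.E (X ⟶[V] Y)) : arr (L.map (eqToHom e) x) = arr x := by
  subst hX hY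
  rw [eqToHom_refl, L.map_id]

theorem arr_injective {X Y : D} {x y : L.E (X ⟶[V] Y)} (h : arr x = arr y) : x = y := by
  simpa [arr] using h

/-- The generalized arrow of an arrow. -/
def ofHom (L : LaxSym.{w} V) {X Y : D} (f : X ⟶ Y) : GArr L D := arr (L.map (eHomEquiv V f) L.one)

noncomputable def id (L : LaxSym.{w} V) (X : D) : GArr L D := arr (L.map (eId V X) L.one)

@[elab_as_elim]
theorem ind {P : GArr L D → Prop} (h : ∀ (X Y : D) (x : L.E (X ⟶[V] Y)), P (arr x))
    (h' : ∀ X Y : D, P (undef X Y)) : ∀ a, P a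
  | ⟨X, Y, some x⟩ => h X Y x
  | ⟨X, Y, none⟩ => h' X Y

@[simp] theorem src_arr {X Y : D} (x : L.E (X ⟶[V] Y)) : (arr x).src = X := rfl
@[simp] theorem tgt_arr {X Y : D} (x : L.E (X ⟶[V] Y)) : (arr x).tgt = Y := rfl
@[simp] theorem src_ofHom {X Y : D} (f : X ⟶ Y) : (ofHom L f).src = X := rfl
@[simp] theorem tgt_ofHom {X Y : D} (f : X ⟶ Y) : (ofHom L f).tgt = Y := rfl
@[simp] theorem src_undef (X Y : D) : (undef X Y : GArr L D).src = X := rfl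
@[simp] theorem tgt_undef (X Y : D) : (undef X Y : GArr L D).tgt = Y := rfl

-- The composite of arrows that do not match is undefined but keeps the outer source and target;
-- therefore the laws for source and target and associativity hold without conditions.
open Classical in
noncomputable def comp (a b : GArr L D) : GArr L D where
  src := a.src
  tgt := b.tgt
  hom := if h : a.tgt = b.src then
      a.hom.bind fun x => b.hom.map fun y =>
        L.map (eComp V a.src a.tgt b.tgt) (L.tens x (L.map (eqToHom (by rw [h])) y))
    else none

@[simp] theorem src_comp (a b : GArr L D) : (comp a b).src = a.src := rfl
@[simp] theorem tgt_comp (a b : GArr L D) : (comp a b).tgt = b.tgt := rfl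

theorem comp_arr {X Y Z : D} (x : L.E (X ⟶[V] Y)) (y : L.E (Y ⟶[V] Z)) :
    comp (arr x) (arr y) = arr (L.map (eComp V X Y Z) (L.tens x y)) := by
  simp only [comp, arr, Option.bind_some, Option.map_some]
  exact congrArg (fun o => (⟨X, Z, o⟩ : GArr L D)) ((dif_pos rfl).trans
    (congrArg (fun z => some (L.map (eComp V X Y Z) (L.tens x z))) (L.map_id y)))

theorem comp_ne {a b : GArr L D} (h : a.tgt ≠ b.src) : comp a b = undef a.src b.tgt := by
  simp [comp, undef, h]

@[simp] theorem comp_undef (a : GArr L D) (Y Z : D) : comp a (undef Y Z) = undef a.src Z := by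
  by_cases h : a.tgt = Y
  · subst h
    rcases a with ⟨X, Y, _ | x⟩ <;> simp [comp, undef]
  · exact comp_ne h

@[simp] theorem undef_comp (a : GArr L D) (X Y : D) : comp (undef X Y) a = undef X a.tgt := by
  by_cases h : Y = a.src
  · subst h
    simp [comp, undef]
  · exact comp_ne h

/-- An undefined factor or a mismatch makes both sides undefined with the same ends; for composable
arrows it is the associativity of the enriched composition. -/
theorem comp_assoc (a b c : GArr L D) : comp (comp a b) c = comp a (comp b c) := by
  induction a using ind with
  | h' X Y => simp
  | h X Y x =>
  induction b using ind with
  | h' Y' Z => simp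
  | h Y' Z y =>
  induction c using ind with
  | h' Z' W => simp
  | h Z' W z =>
  by_cases h : Y = Y'
  · by_cases h' : Z = Z'
    · subst h h'
      rw [comp_arr, comp_arr, comp_arr, comp_arr, ← L.map_whiskerRight, ← L.map_whiskerLeft,
        ← L.map_comp, ← L.map_comp, ← L.map_assoc_inv, ← L.map_comp, e_assoc]
    · rw [comp_ne (a := arr y) (b := arr z) h', comp_undef,
        comp_ne (a := comp (arr x) (arr y)) (b := arr z) h']; rfl
  · rw [comp_ne (a := arr x) (b := arr y) h, undef_comp,
      comp_ne (a := arr x) (b := comp (arr y) (arr z)) h]; rfl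

theorem id_comp {a : GArr L D} {X : D} (h : a.src = X) : comp (id L X) a = a := by
  subst h
  induction a using ind with
  | h' X Y => exact comp_undef _ X Y
  | h X Y x =>
    rw [src_arr, id, comp_arr, ← L.map_whiskerRight, ← L.map_left_inv, ← L.map_comp, ← L.map_comp,
      e_id_comp, L.map_id]

theorem comp_id {a : GArr L D} {X : D} (h : a.tgt = X) : comp a (id L X) = a := by
  subst h
  induction a using ind with
  | h' X Y => exact undef_comp _ X Y
  | h X Y x =>
    rw [tgt_arr, id, comp_arr, ← L.map_whiskerLeft, ← L.map_right_inv, ← L.map_comp, ← L.map_comp,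
      e_comp_id, L.map_id]

theorem ofHom_id (X : D) : ofHom L (𝟙 X) = id L X := by rw [ofHom, eHomEquiv_id]; rfl

theorem ofHom_comp {X Y Z : D} (f : X ⟶ Y) (g : Y ⟶ Z) :
    ofHom L (f ≫ g) = comp (ofHom L f) (ofHom L g) := by
  rw [ofHom, ofHom, ofHom, comp_arr, eHomEquiv_comp, L.map_comp, L.map_comp, L.map_left_inv,
    L.map_tens]

theorem ofHom_eqToHom {X Y : D} (h : X = Y) : ofHom L (eqToHom h) = id L X := by
  subst h
  exact ofHom_id X

theorem ofHom_comp_eqToHom {X Y Y' : D} (f : X ⟶ Y) (h : Y = Y') :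
    ofHom L (f ≫ eqToHom h) = ofHom L f := by
  subst h
  rw [eqToHom_refl, Category.comp_id]

theorem ofHom_eqToHom_comp {X X' Y : D} (f : X ⟶ Y) (h : X' = X) :
    ofHom L (eqToHom h ≫ f) = ofHom L f := by
  subst h
  rw [eqToHom_refl, Category.id_comp]

theorem arr_eHomWhiskerLeft {X Y Y' : D} (f : Y ⟶ Y') (x : L.E (X ⟶[V] Y)) :
    arr (L.map (eHomWhiskerLeft V X f) x) = comp (arr x) (ofHom L f) := by
  rw [ofHom, comp_arr, eHomWhiskerLeft, L.map_comp, L.map_comp, L.map_right_inv,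
    L.map_whiskerLeft]

theorem arr_eHomWhiskerRight {X X' Y : D} (f : X ⟶ X') (x : L.E (X' ⟶[V] Y)) :
    arr (L.map (eHomWhiskerRight V f Y) x) = comp (ofHom L f) (arr x) := by
  rw [ofHom, comp_arr, eHomWhiskerRight, L.map_comp, L.map_comp, L.map_left_inv,
    L.map_whiskerRight]

/-! #### Products -/

def tens (h : StrictMonoidalStr V D) (a b : GArr L D) : GArr L D where
  src := h.mul a.src b.src
  tgt := h.mul a.tgt b.tgt
  hom := a.hom.bind fun x => b.hom.map fun y =>
    L.map (h.homMul a.src a.tgt b.src b.tgt) (L.tens x y)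

section
variable (h : StrictMonoidalStr V D)

theorem tens_arr {X X' Y Y' : D} (x : L.E (X ⟶[V] X')) (y : L.E (Y ⟶[V] Y')) :
    tens h (arr x) (arr y) = arr (L.map (h.homMul X X' Y Y') (L.tens x y)) := rfl

@[simp] theorem src_tens (a b : GArr L D) : (tens h a b).src = h.mul a.src b.src := rfl
@[simp] theorem tgt_tens (a b : GArr L D) : (tens h a b).tgt = h.mul a.tgt b.tgt := rfl

@[simp] theorem tens_undef (a : GArr L D) (Y Z : D) :
    tens h a (undef Y Z) = undef (h.mul a.src Y) (h.mul a.tgt Z) := by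
  rcases a with ⟨X, X', _ | x⟩ <;> simp [tens, undef]

@[simp] theorem undef_tens (a : GArr L D) (Y Z : D) :
    tens h (undef Y Z) a = undef (h.mul Y a.src) (h.mul Z a.tgt) := by
  simp [tens, undef]

theorem tens_assoc (a b c : GArr L D) : tens h (tens h a b) c = tens h a (tens h b c) := by
  induction a using ind with
  | h' X Y => simp [h.mul_assoc]
  | h X Y x =>
  induction b using ind with
  | h' Y' Z => simp [h.mul_assoc]
  | h Y' Z y =>
  induction c using ind with
  | h' Z' W => simp [h.mul_assoc]
  | h Z' W z =>
  rw [tens_arr, tens_arr, tens_arr, tens_arr, ← L.map_whiskerRight, ← L.map_comp, h.homMul_assoc,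
    L.map_comp, L.map_comp, L.map_assoc, L.map_comp, L.map_whiskerLeft,
    arr_cast (h.mul_assoc _ _ _).symm (h.mul_assoc _ _ _).symm]

theorem id_tens (a : GArr L D) : tens h (id L h.unit) a = a := by
  induction a using ind with
  | h' X Y => simp [id, h.one_mul]
  | h X Y x =>
    rw [id, tens_arr, ← L.map_whiskerRight, ← L.map_left_inv, ← L.map_comp, ← L.map_comp,
      h.one_homMul, arr_cast (h.one_mul _).symm (h.one_mul _).symm]

theorem tens_id (a : GArr L D) : tens h a (id L h.unit) = a := by
  induction a using ind with
  | h' X Y => simp [id, h.mul_one]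
  | h X Y x =>
    rw [id, tens_arr, ← L.map_whiskerLeft, ← L.map_right_inv, ← L.map_comp, ← L.map_comp,
      h.homMul_one, arr_cast (h.mul_one _).symm (h.mul_one _).symm]

/-- The conditions exclude the case in which the products of the objects happen to agree although
the factors do not: the right side would be defined and the left side not. -/
theorem tens_comp {a a' b b' : GArr L D} (e : a.tgt = a'.src) (e' : b.tgt = b'.src) :
    tens h (comp a a') (comp b b') = comp (tens h a b) (tens h a' b') := by
  induction a using ind with
  | h' X Y => simp
  | h X Y x =>
  induction b using ind with
  | h' X' Y' => simp
  | h X' Y' y =>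
  induction a' using ind with
  | h' Y Z => simp
  | h Y₁ Z x' =>
  induction b' using ind with
  | h' Y' Z' => simp
  | h Y₁' Z' y' =>
  obtain rfl : Y = Y₁ := e
  obtain rfl : Y' = Y₁' := e'
  rw [comp_arr, comp_arr, tens_arr, tens_arr, tens_arr, comp_arr, ← L.map_tens, ← L.map_tens,
    ← L.map_comp, ← L.map_comp, h.homMul_comp, ← L.map_tensorμ, ← L.map_comp]

theorem id_mul (X Y : D) : id L (h.mul X Y) = tens h (id L X) (id L Y) := by
  rw [id, id, id, tens_arr, ← h.homMul_id, L.map_comp, L.map_comp, L.map_left_inv, L.map_tens]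

theorem ofHom_tens {X X' Y Y' : D} (f : X ⟶ X') (g : Y ⟶ Y') :
    ofHom L (h.tens f g) = tens h (ofHom L f) (ofHom L g) := by
  rw [ofHom, ofHom, ofHom, tens_arr, StrictMonoidalStr.tens, Equiv.apply_symm_apply, L.map_comp,
    L.map_comp, L.map_left_inv, L.map_tens]

variable (L) in
noncomputable def tensStr : Tens (GArr.src : GArr L D → D) GArr.tgt (id L) comp where
  o := ⟨h.unit, h.mul, h.mul_assoc, h.one_mul, h.mul_one⟩
  t := ⟨id L h.unit, tens h, tens_assoc h, id_tens h, tens_id h⟩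
  src_one := rfl
  tgt_one := rfl
  src_mul _ _ := rfl
  tgt_mul _ _ := rfl
  id_one := rfl
  id_mul := id_mul h
  comp_one := id_comp rfl
  mul_comp := tens_comp h

end

end GArr

/-! ### The duoidal structure on generalized arrows -/

namespace StrictDuoidal

open GArr

variable {V : Type uV} [Category.{vV} V] [MonoidalCategory V] [SymmetricCategory V]
  {D : Type uD} [Category.{vD} D] [EnrichedOrdinaryCategory V D] (d : StrictDuoidal V D)
  (L : LaxSym.{w} V)

/-- If all four arrows are defined, this is the `V`-naturality `ζ_natural` evaluated on elements;
otherwise both sides are undefined. -/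
theorem arr_ζ_nat {a b c e : GArr L D} {X Y Z W : D} (ha : a.tgt = X) (hb : b.tgt = Y)
    (hc : c.tgt = Z) (he : e.tgt = W) :
    comp (tens d.h0 (tens d.h1 a b) (tens d.h1 c e)) (ofHom L (d.ζ X Y Z W)) =
      comp (ofHom L (d.ζ a.src b.src c.src e.src)) (tens d.h1 (tens d.h0 a c) (tens d.h0 b e)) := by
  subst ha hb hc he
  induction a using ind with
  | h' X X' => simp
  | h X X' x =>
  induction b using ind with
  | h' Y Y' => simp
  | h Y Y' y =>
  induction c using ind with
  | h' Z Z' => simp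
  | h Z Z' z =>
  induction e using ind with
  | h' W W' => simp
  | h W W' t =>
  simp only [tens_arr, src_arr, tgt_arr]
  rw [← arr_eHomWhiskerLeft, ← arr_eHomWhiskerRight, ← L.map_tens, ← L.map_tens,
    ← L.map_tensorμ x y z t]
  simp only [← L.map_comp, Category.assoc]
  rw [d.ζ_natural]

/-- The generalized arrows of a strict duoidal category. -/
noncomputable def alg : DuoAlg D (GArr L D) where
  src := GArr.src
  tgt := GArr.tgt
  id := GArr.id L
  comp := comp
  src_id _ := rfl
  tgt_id _ := rfl
  src_comp _ _ := rfl
  tgt_comp _ _ := rfl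
  assoc := comp_assoc
  id_comp := id_comp
  comp_id := comp_id
  h0 := tensStr L d.h0
  h1 := tensStr L d.h1
  ζ X Y Z W := ofHom L (d.ζ X Y Z W)
  src_ζ _ _ _ _ := rfl
  tgt_ζ _ _ _ _ := rfl
  ζ_nat := d.arr_ζ_nat L
  δ := ofHom L d.δ
  μ := ofHom L d.μ
  ε := ofHom L d.ε
  src_δ := rfl
  tgt_δ := rfl
  src_μ := rfl
  tgt_μ := rfl
  src_ε := rfl
  tgt_ε := rfl
  ζ_assoc₀ A B C D' E F := by
    have h := congrArg (ofHom L) (d.ζ_assoc₀ A B C D' E F)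
    rw [ofHom_eqToHom_comp, ← Category.assoc (d.h0.tens _ _), ofHom_comp_eqToHom, ofHom_comp,
      ofHom_comp, ofHom_tens, ofHom_tens, ofHom_id, ofHom_id] at h
    exact h
  ζ_assoc₁ A B C D' E F := by
    have h := congrArg (ofHom L) (d.ζ_assoc₁ A B C D' E F)
    rw [ofHom_eqToHom_comp, ← Category.assoc (d.ζ _ _ _ _), ofHom_comp_eqToHom, ofHom_comp,
      ofHom_comp, ofHom_tens, ofHom_tens, ofHom_id, ofHom_id] at h
    exact h
  δ_ζ A B := by
    have h := congrArg (ofHom L) (d.δ_ζ A B)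
    rw [ofHom_comp, ofHom_tens, ofHom_id, ofHom_eqToHom] at h
    exact h.trans (congrArg (GArr.id L) (d.h0.one_mul _))
  ζ_δ A B := by
    have h := congrArg (ofHom L) (d.ζ_δ A B)
    rw [ofHom_comp, ofHom_tens, ofHom_id, ofHom_eqToHom] at h
    exact h.trans (congrArg (GArr.id L) (d.h0.mul_one _))
  ζ_μ_left A B := by
    have h := congrArg (ofHom L) (d.ζ_μ_left A B)
    rw [ofHom_comp, ofHom_tens, ofHom_id, ofHom_eqToHom] at h
    exact h.trans (congrArg (GArr.id L) (congrArg₂ d.h0.mul (d.h1.one_mul _) (d.h1.one_mul _)))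
  ζ_μ_right A B := by
    have h := congrArg (ofHom L) (d.ζ_μ_right A B)
    rw [ofHom_comp, ofHom_tens, ofHom_id, ofHom_eqToHom] at h
    exact h.trans (congrArg (GArr.id L) (congrArg₂ d.h0.mul (d.h1.mul_one _) (d.h1.mul_one _)))
  μ_assoc := by
    have h := congrArg (ofHom L) d.μ_assoc
    rw [ofHom_eqToHom_comp, ofHom_comp, ofHom_comp, ofHom_tens, ofHom_tens, ofHom_id] at h
    exact h
  ε_μ := by
    have h := congrArg (ofHom L) d.ε_μ
    rw [ofHom_comp, ofHom_tens, ofHom_id, ofHom_eqToHom] at h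
    exact h.trans (congrArg (GArr.id L) (d.h0.one_mul _))
  μ_ε := by
    have h := congrArg (ofHom L) d.μ_ε
    rw [ofHom_comp, ofHom_tens, ofHom_id, ofHom_eqToHom] at h
    exact h.trans (congrArg (GArr.id L) (d.h0.mul_one _))
  δ_assoc := by
    have h := congrArg (ofHom L) d.δ_assoc
    rw [← Category.assoc d.δ (d.h1.tens _ _) (eqToHom _), ofHom_comp_eqToHom, ofHom_comp,
      ofHom_comp, ofHom_tens, ofHom_tens, ofHom_id] at h
    exact h
  δ_ε := by
    have h := congrArg (ofHom L) d.δ_ε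
    rw [ofHom_comp, ofHom_tens, ofHom_id, ofHom_eqToHom] at h
    exact h
  ε_δ := by
    have h := congrArg (ofHom L) d.ε_δ
    rw [ofHom_comp, ofHom_tens, ofHom_id, ofHom_eqToHom] at h
    exact h

end StrictDuoidal

/-! ### Products, comultiplications and operations of 2-ordinals as generalized arrows -/

namespace GArr

variable {V : Type uV} [Category.{vV} V] [MonoidalCategory V] [SymmetricCategory V]
  {L : LaxSym.{w} V} {D : Type uD} [Category.{vD} D] [EnrichedOrdinaryCategory V D]
  (h : StrictMonoidalStr V D) {ι κ : Type}

theorem prod_eq (X : ι → D) : ∀ l : List ι, (tensStr L h).o.prod l X = h.prod l X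
  | [] => rfl
  | i :: l => congrArg (h.mul (X i)) (prod_eq X l)

theorem rprod_eq (X : ι → D) : ∀ l : List ι, (tensStr L h).o.rprod l X = h.rprod l X
  | [] => rfl
  | i :: l => congrArg (h.mul · (X i)) (rprod_eq X l)

theorem ofHom_prodMap {X Y : ι → D} {a : ι → GArr L D} : ∀ {l : List ι} {φ : ∀ i ∈ l, X i ⟶ Y i},
    (∀ i hi, ofHom L (φ i hi) = a i) → ofHom L (h.prodMap l φ) = (tensStr L h).t.prod l a
  | [], _, _ => ofHom_id _
  | i :: l, φ, hφ => by
    refine (ofHom_tens h (φ i List.mem_cons_self) _).trans ?_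
    rw [hφ, ofHom_prodMap fun j hj => hφ j _]; rfl

theorem ofHom_rprodMap {X Y : ι → D} {a : ι → GArr L D} : ∀ {l : List ι} {φ : ∀ i ∈ l, X i ⟶ Y i},
    (∀ i hi, ofHom L (φ i hi) = a i) → ofHom L (h.rprodMap l φ) = (tensStr L h).t.rprod l a
  | [], _, _ => ofHom_id _
  | i :: l, φ, hφ => by
    refine (ofHom_tens h _ (φ i List.mem_cons_self)).trans ?_
    rw [hφ, ofHom_rprodMap fun j hj => hφ j _]; rfl

theorem arr_eHomWhiskerLeft_eqToHom {X Y Y' : D} (e : Y = Y') (x : L.E (X ⟶[V] Y)) :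
    arr (L.map (eHomWhiskerLeft V X (eqToHom e)) x) = arr x := by
  rw [arr_eHomWhiskerLeft, ofHom_eqToHom]
  exact comp_id rfl

theorem arr_eProd {X Y : ι → D} (x : ∀ i, L.E (X i ⟶[V] Y i)) : ∀ l : List ι,
    arr (L.map (h.eProd X Y l) (L.tensl x l)) = (tensStr L h).t.prod l fun i => arr (x i)
  | [] => rfl
  | i :: l => by
    rw [Mon.prod_cons, ← arr_eProd x l]
    refine (congrArg arr (L.map_comp _ _ _)).trans ?_
    exact congrArg (fun z => arr (L.map _ z)) (L.map_whiskerLeft _ _ _)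

theorem arr_eRprod {X Y : ι → D} (x : ∀ i, L.E (X i ⟶[V] Y i)) : ∀ l : List ι,
    arr (L.map (h.eRprod X Y l) (L.tensl x l)) = (tensStr L h).t.rprod l fun i => arr (x i)
  | [] => rfl
  | i :: l => by
    rw [Mon.rprod_cons, ← arr_eRprod x l]
    refine (congrArg arr ((L.map_comp _ _ _).trans (L.map_comp _ _ _))).trans ?_
    refine (congrArg (fun z => arr (L.map _ (L.map _ z))) (L.map_whiskerLeft _ _ _)).trans ?_
    exact congrArg (fun z => arr (L.map _ z)) (L.map_braid _ _)

end GArr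

namespace StrictDuoidal

open GArr LevFam

variable {V : Type uV} [Category.{vV} V] [MonoidalCategory V] [SymmetricCategory V]
  {D : Type uD} [Category.{vD} D] [EnrichedOrdinaryCategory V D] (d : StrictDuoidal V D)
  (L : LaxSym.{w} V) {ι κ : Type}

theorem prod_alg (l : List ι) (X : ι → D) : d.h1.prod l X = (d.alg L).h1.o.prod l X :=
  (prod_eq d.h1 X l).symm

theorem rprod_alg (l : List ι) (X : ι → D) : d.h0.rprod l X = (d.alg L).h0.o.rprod l X :=
  (rprod_eq d.h0 X l).symm

theorem ofHom_inter₂ (X Y : ι → D) : ∀ l : List ι,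
    ofHom L (d.inter₂ X Y l) = (d.alg L).z2 X Y l
  | [] => rfl
  | i :: l => by
    refine (ofHom_comp (d.ζ _ _ _ _) (d.h1.tens (𝟙 _) (d.inter₂ X Y l))).trans ?_
    rw [ofHom_tens, ofHom_inter₂ X Y l, ofHom_id, d.prod_alg L, d.prod_alg L]
    rfl

theorem ofHom_eProd1 : ∀ l : List ι, ofHom L (d.eProd1 l) = (d.alg L).e1 l
  | [] => rfl
  | i :: l => by
    refine (ofHom_comp d.δ (d.h1.tens (𝟙 d.e) (d.eProd1 l))).trans ?_
    rw [ofHom_tens, ofHom_eProd1 l, ofHom_id]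
    rfl

theorem ofHom_inter (G : κ → ι → D) (t : List ι) : ∀ s : List κ,
    ofHom L (d.inter G t s) = (d.alg L).chi t G s
  | [] => d.ofHom_eProd1 L t
  | k :: s => by
    refine (ofHom_comp (d.h0.tens (d.inter G t s) (𝟙 _)) (d.inter₂ _ _ t)).trans ?_
    rw [ofHom_tens, ofHom_inter G t s, ofHom_id, ofHom_inter₂, d.prod_alg L]
    simp only [d.rprod_alg L]
    rfl

variable {A B A' B' : Type} {X : LevFam A B} {Y : LevFam A' B'}

/-- A horizontal level of the source enters the array as a row of copies of `e`, by the iterated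
comultiplication. Over a horizontal level of the target all levels are horizontal, so that the
product there is `e` and the map is the identity. -/
theorem ofHom_comul (hor : A → Bool) (val : B → D) (f : Map X Y) (horY : A' → Bool)
    (hh : ∀ l, horY (Y.flag (f.lev l)) = true → hor (X.flag l) = true) :
    ofHom L (d.comul hor val f horY hh) =
      (d.alg L).h0.t.rprod (List.finRange Y.length) fun c =>
        bif horY (Y.flag c) then (d.alg L).id d.e else
          (d.alg L).comp ((d.alg L).h0.t.rprod (overLev f c) fun l =>
            bif hor (X.flag l) then (d.alg L).e1 (Y.row c) else
              (d.alg L).id ((d.alg L).h1.o.prod (X.row l) fun q => val (X.label q)))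
          ((d.alg L).chi (Y.row c) (fun l i => bif hor (X.flag l) then d.e else
            (d.alg L).h1.o.prod (overPos f l i) fun q => val (X.label q)) (overLev f c)) := by
  rw [comul, ofHom_eqToHom_comp]
  refine ofHom_rprodMap _ fun c _ => ?_
  rw [comulLev]
  split_ifs with hc
  · rw [ofHom_eqToHom, hc, cond_true]
    refine congrArg (GArr.id L) ((d.h0.rprod_congr ?_).trans (d.h0.rprod_unit (overLev f c)))
    intro l hl
    rw [hh l (by rw [mem_overLev.1 hl]; exact hc), cond_true]
  · refine Eq.trans ?_ (cond_eq_ite .. ▸ (if_neg hc).symm)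
    rw [ofHom_comp, ofHom_comp_eqToHom, ofHom_inter]
    simp only [d.prod_alg L]
    refine congrArg₂ (d.alg L).comp (ofHom_rprodMap _ fun l hl => ?_) rfl
    split_ifs with hl'
    · rw [ofHom_eqToHom_comp, ofHom_comp_eqToHom, ofHom_eProd1, hl', cond_true]
    · rw [Bool.not_eq_true] at hl'
      rw [ofHom_eqToHom, hl', cond_false, cond_false, d.prod_alg L]
      rfl

theorem ofHom_comul_false (val : B → D) (f : Map X Y) (hh) :
    ofHom L (d.comul (fun _ => false) val f (fun _ => false) hh) =
      (d.alg L).com f fun q => val (X.label q) := by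
  rw [ofHom_comul, DuoAlg.com]
  refine (d.alg L).h0.t.rprod_congr fun c _ => ?_
  simp only [cond_false]
  rw [← (d.alg L).h0.id_rprod, (d.alg L).id_comp]
  rw [DuoAlg.src_chi]
  refine (d.alg L).h0.o.rprod_congr fun l hl => ?_
  rw [row_eq f l, mem_overLev.1 hl, (d.alg L).h1.o.prod_flatMap]

theorem powOmega_alg (E : ℕ → D) (T : Omega) : d.powOmega E T =
    big (d.alg L).h0.o (d.alg L).h1.o T.fam fun i => E (T.fam.label i) := by
  rw [powOmega_eq, d.rprod_alg L]
  simp only [d.prod_alg L]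
  rfl

theorem arr_endOmegaMap (E : ℕ → D) {T S : Omega} (f : T ⟶ S)
    (x : ∀ i, L.E (d.powOmega E (Omega.fib f i) ⟶[V] E (S.fam.label i))) :
    arr (L.map (d.endOmegaMap E f) (L.tensl x S.fam.positions)) =
      (d.alg L).comp ((d.alg L).com (Omega.Hom.map f) fun q => E (T.fam.label q))
        (big (d.alg L).h0.t (d.alg L).h1.t S.fam fun i => arr (x i)) := by
  refine (congrArg arr ((L.map_comp _ _ _).trans ((L.map_comp _ _ _).trans ((L.map_comp _ _ _).trans
    (L.map_comp _ _ _))))).trans ?_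
  refine (arr_eHomWhiskerLeft_eqToHom _ _).trans ((arr_eHomWhiskerRight _ _).trans ?_)
  refine congrArg₂ (d.alg L).comp (d.ofHom_comul_false L _ _ _) ?_
  refine (congrArg (fun z => arr (L.map _ (L.map _ z))) (L.map_tensUnflatten x S.fam.row _)).trans ?_
  refine (congrArg (fun z => arr (L.map _ z)) (L.map_tensMap _ _ _)).trans ?_
  refine (arr_eRprod d.h0 _ _).trans ((d.alg L).h0.t.rprod_congr fun c _ => ?_)
  exact arr_eProd d.h1 _ _

/-- The products, the precomposition and the enriched composition all become operations on
generalized arrows. The order that results, interchange, operations of the fibres, operation of the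
target, is the one used in `com_assoc`. -/
theorem arr_endOmega (E : ℕ → D) {T S : Omega} (f : T ⟶ S)
    (x : ∀ i, L.E (d.powOmega E (Omega.fib f i) ⟶[V] E (S.fam.label i)))
    (y : L.E (d.powOmega E S ⟶[V] E S.out)) :
    arr (OperadData.emul L (d.endOmega E) (O := OmegaOC) f x y) =
      (d.alg L).comp ((d.alg L).comp ((d.alg L).com (Omega.Hom.map f) fun q => E (T.fam.label q))
        (big (d.alg L).h0.t (d.alg L).h1.t S.fam fun i => arr (x i))) (arr y) := by
  refine (congrArg arr ((L.map_comp _ _ _).trans (L.map_comp _ _ _))).trans ?_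
  refine (arr_eHomWhiskerLeft_eqToHom _ _).trans ?_
  refine (congrArg (fun z => arr (L.map _ z)) (L.map_whiskerRight (d.endOmegaMap E f) _ y)).trans ?_
  exact (comp_arr _ y).symm.trans (congrArg (comp · _) (d.arr_endOmegaMap L E f x))

end StrictDuoidal

/-! ### Associativity of the operations of endomorphism objects -/

namespace LevFam

variable {A B A' B' A'' B'' : Type} {M : Type*} {X : LevFam A B} {Y : LevFam A' B'}
  {Z : LevFam A'' B''} {m₀ m₁ : Mon M}

theorem big_fib_fibMap (f : Map X Y) (g : Map Y Z) (h : Map X Z) (w : f.comp g = h) (p : Z.Pos)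
    (k : (fib g p).Pos) (a : X.Pos → M) :
    (big m₀ m₁ (fib (fibMap f g h w p) k) fun q => a (incPos (incPos q))) =
      big m₀ m₁ (fib f (incPos k)) fun q => a (incPos q) := by
  rw [big_fib f, big_fib (fibMap f g h w p) k fun q => a (incPos q), incPos_fst,
    ← map_overLev_fibMap f g h w, m₀.rprod_map]
  refine m₀.rprod_congr fun l hl => ?_
  rw [Function.comp, ← map_overPos_fibMap f g h w p k l (mem_overLev.1 hl), m₁.prod_map]
  rfl

theorem big_heq {X' : LevFam A B} (e : X = X') {j : Map X Z} {j' : Map X' Z} (h : HEq j j')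
    (a : Z.Pos → M) : big m₀ m₁ X (fun p => a (j.pos p)) = big m₀ m₁ X' fun p => a (j'.pos p) := by
  subst e
  rw [eq_of_heq h]

end LevFam

namespace DuoAlg

open LevFam

variable {D A : Type*} (d : DuoAlg D A) {α β α' β' α'' β'' : Type}
  {X : LevFam α β} {Y : LevFam α' β'} {Z : LevFam α'' β''}

local infixl:65 " ⨟ " => d.comp

/-- The structure operations of endomorphism operads are associative. -/
theorem com_assoc (f : Map X Y) (g : Map Y Z) (h : Map X Z) (w : f.comp g = h)
    {x : Y.Pos → A} {y : Z.Pos → A} {val : X.Pos → D} {valY : Y.Pos → D} (z : A)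
    (hx : ∀ i, d.src (x i) = big d.h0.o d.h1.o (fib f i) fun q => val (incPos q))
    (hx' : ∀ i, d.tgt (x i) = valY i)
    (hy : ∀ p, d.src (y p) = big d.h0.o d.h1.o (fib g p) fun q => valY (incPos q)) :
    d.com f val ⨟ big d.h0.t d.h1.t Y x ⨟ (d.com g valY ⨟ big d.h0.t d.h1.t Z y ⨟ z) =
      d.com h val ⨟ big d.h0.t d.h1.t Z (fun p =>
        d.com (fibMap f g h w p) (fun q => val (incPos q)) ⨟
          big d.h0.t d.h1.t (fib g p) (fun q => x (incPos q)) ⨟ y p) ⨟ z := by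
  obtain rfl : (fun i => d.tgt (x i)) = valY := funext hx'
  rw [d.big_comp fun p => by simp [hy], d.big_comp fun p => by
    rw [d.tgt_com, d.src_big]
    refine big_congr fun k => ?_
    rw [hx, big_fib_fibMap]]
  have e := d.com_coassoc f g h w val
  simp only [← hx] at e
  simp only [d.assoc]
  -- Naturality of `com g` exchanges it with the operations `x`; the two interchanges are then
  -- adjacent, and coassociativity applies.
  rw [← d.assoc (big _ _ Y x), d.com_nat g fun _ => rfl, ← d.assoc (d.com h val), ← e]
  simp only [d.assoc]

theorem com_heq {X' : LevFam α β} {Y' : LevFam α' β'} (eX : X = X') (eY : Y = Y') {f : Map X Y}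
    {f' : Map X' Y'} (h : HEq f f') (E : β → D) :
    d.com f (fun q => E (X.label q)) = d.com f' fun q => E (X'.label q) := by
  subst eX eY
  rw [eq_of_heq h]

end DuoAlg

/-! ### White vertices of a tree and leaves of its 2-ordinal -/

namespace LTree

open LevFam

def omegaVertex (T : LTree) (p : T.omegaFam.Pos) : T.Idx := ⟨T.omegaInc.pos p, incPos_sel p⟩

theorem omegaVertex_omegaIdx (T : LTree) (i : T.Idx) : T.omegaVertex (T.omegaIdx i) = i :=
  Subtype.ext (T.incPos_omegaIdx i)

theorem omegaIdx_omegaVertex (T : LTree) (p : T.omegaFam.Pos) : T.omegaIdx (T.omegaVertex p) = p :=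
  T.omegaInc_pos (T.incPos_omegaIdx _)

theorem label_omega (T : LTree) (p : T.omegaFam.Pos) :
    T.omegaFam.label p = T.ar (T.omegaInc.pos p) :=
  label_sub (fa := fun _ : Bool => ()) (fb := (Prod.snd : Bool × ℕ → ℕ)) p

/-- The extension of a family by a default value. -/
def extend {M : Type*} (T : LTree) (o : M) (a : T.Idx → M) (p : T.fam.Pos) : M :=
  if h : T.white p = true then a ⟨p, h⟩ else o

theorem extend_omega {M : Type*} (T : LTree) (o : M) (a : T.Idx → M) (p : T.omegaFam.Pos) :
    T.extend o a (T.omegaInc.pos p) = a (T.omegaVertex p) := dif_pos _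

theorem extend_val {M : Type*} (T : LTree) (o : M) (a : T.Idx → M) (i : T.Idx) :
    T.extend o a i.1 = a i := dif_pos _

theorem big_omega_fib {M : Type*} {m₀ m₁ : Mon M} {T S : LTree} (f : T ⟶ S) (i : S.Idx)
    (a : T.fam.Pos → M) :
    (big m₀ m₁ (fib f i.1).omegaFam fun q => a (incPos ((fib f i.1).omegaInc.pos q))) =
      big m₀ m₁ (LevFam.fib (omegaMap f).map (S.omegaIdx i)) fun q =>
        a (T.omegaInc.pos (incPos q)) :=
  big_heq (omega_fib_fam f i) (omega_fib_inc f i) a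

end LTree

/-! ### The restricted endomorphism operad of 2-ordinals -/

namespace StrictDuoidal

open GArr LevFam OperadData

variable {V : Type uV} [Category.{vV} V] [MonoidalCategory V] [SymmetricCategory V]
  {D : Type uD} [Category.{vD} D] [EnrichedOrdinaryCategory V D] (d : StrictDuoidal V D)
  (L : LaxSym.{w} V) (E : ℕ → D)

/-- The restriction to trees with levels of the endomorphism operad for coloured 2-ordinals. -/
abbrev endOmegaTree : OperadData LTrOC V := (d.endOmega E).restrict omegaOF

/-- The elements are indexed by white vertices and the product by leaves. The bijection between them
and the equalities `LTree.omega_fib` of the fibres only cause transports, which generalized arrows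
do not see. The value `o` fills the other vertices and never occurs in the product. -/
theorem arr_endOmegaTree {T S : LTree} (f : T ⟶ S)
    (x : ∀ i : S.Idx, L.E ((d.endOmegaTree E).obj (LTree.fib f i.1)))
    (y : L.E ((d.endOmegaTree E).obj S)) (o : GArr L D) :
    arr (X := d.powOmega E T.omega) (Y := E T.arity)
        ((d.endOmegaTree E).emul L (O := LTrOC) f x y) =
      (d.alg L).comp ((d.alg L).comp
        ((d.alg L).com (LTree.omegaMap f).map fun q => E (T.omegaFam.label q))
        (big (d.alg L).h0.t (d.alg L).h1.t S.omegaFam fun p => S.extend o (fun i =>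
          arr (X := d.powOmega E (LTree.fib f i.1).omega) (Y := E (S.ar i.1)) (x i))
            (S.omegaInc.pos p)))
        (arr (X := d.powOmega E S.omega) (Y := E S.arity) y) := by
  have h : ∀ p, (d.endOmegaTree E).obj (LTree.fib f (S.omegaVertex p).1) =
      (d.endOmega E).obj (Omega.fib (LTree.omegaMap f) p) := by
    intro p
    rw [← congrArg (Omega.fib (LTree.omegaMap f)) (S.omegaIdx_omegaVertex p),
      ← LTree.omega_fib f (S.omegaVertex p)]
    rfl
  have e := d.arr_endOmega L E (LTree.omegaMap f)
    (fun p => L.map (eqToHom (h p)) (x (S.omegaVertex p))) y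
  refine Eq.trans (congrArg arr ?_) (e.trans ?_)
  · refine (L.map_comp _ _ _).trans ?_
    refine congrArg (L.map _) ((L.map_whiskerRight _ _ _).trans ?_)
    refine congrArg (fun z => L.tens z y) ?_
    refine L.map_eqToHom_tensl_map _ _ S.omegaIdx (fun k => ?_) (fun k => ?_) _ _
      S.omegaIdx_elems _
    · have h1 : ∀ {Y Z : V} (e : Y = Z) (z : L.E Y), HEq z (L.map (eqToHom e) z) := by
        rintro Y _ rfl z
        rw [eqToHom_refl, L.map_id]
      refine HEq.trans ?_ (h1 (h _) _)
      rw [S.omegaVertex_omegaIdx]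
      rfl
    · exact congrArg (d.endOmega E).obj (LTree.omega_fib f k)
  · congr 2
    refine big_congr fun p => ?_
    rw [S.extend_omega]
    have e1 : (LTree.fib f (S.omegaVertex p).1).omega = Omega.fib (LTree.omegaMap f) p := by
      rw [LTree.omega_fib f (S.omegaVertex p), S.omegaIdx_omegaVertex]
    exact arr_cast (congrArg (d.powOmega E) e1) (congrArg (fun Z => E (Omega.out Z)) e1) _ _

/-- This is `com_assoc` for the maps of the underlying 2-ordinals; it remains to compare the fibres
of a map of trees with those of the map of 2-ordinals. -/
theorem endOmegaTree_assoc {T S R : LTree} (f : T ⟶ S) (g : S ⟶ R) (h : T ⟶ R) (w : f ≫ g = h)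
    (x : ∀ i : S.Idx, L.E ((d.endOmegaTree E).obj (LTree.fib f i.1)))
    (y : ∀ i : R.Idx, L.E ((d.endOmegaTree E).obj (LTree.fib g i.1)))
    (z : L.E ((d.endOmegaTree E).obj R)) :
    (d.endOmegaTree E).emul L (O := LTrOC) f x ((d.endOmegaTree E).emul L (O := LTrOC) g y z) =
      (d.endOmegaTree E).emul L (O := LTrOC) h (fun i => (d.endOmegaTree E).emul L (O := LTrOC)
        (LTree.fibMap f g h w i.1) (fun k => L.map (eqToHom (by
          exact congrArg (d.endOmegaTree E).obj (LTree.fib_fibMap f g h w i.1 k.1).symm))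
          (x (LTree.emb g i.1 k))) (y i)) z := by
  refine arr_injective (X := d.powOmega E T.omega) (Y := E T.arity) ?_
  have o : GArr L D := GArr.id L d.e
  refine (d.arr_endOmegaTree L E f x _ o).trans (Eq.trans (congrArg ((d.alg L).comp _)
    (d.arr_endOmegaTree L E g y z o)) (Eq.trans ?_ (d.arr_endOmegaTree L E h _ z o).symm))
  have wΩ : (LTree.omegaMap f).map.comp (LTree.omegaMap g).map = (LTree.omegaMap h).map := by
    rw [← w]
    exact (congrArg Omega.Hom.map (LTree.omegaFunctor.map_comp f g)).symm
  refine Eq.trans ((d.alg L).com_assoc _ _ _ wΩ (valY := fun q => E (S.omegaFam.label q)) _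
    (fun i => ?_) (fun i => ?_) fun p => ?_) ?_
  · obtain ⟨i, rfl⟩ : ∃ j, S.omegaIdx j = i := ⟨_, S.omegaIdx_omegaVertex i⟩
    rw [S.incPos_omegaIdx, S.extend_val]
    refine (d.powOmega_alg L E _).trans ?_
    rw [LTree.omega_fib f i]
    exact big_congr fun q => congrArg E (label_sub q)
  · rw [S.extend_omega, S.label_omega]
    rfl
  · obtain ⟨i, rfl⟩ : ∃ j, R.omegaIdx j = p := ⟨_, R.omegaIdx_omegaVertex p⟩
    rw [R.incPos_omegaIdx, R.extend_val]
    refine (d.powOmega_alg L E _).trans ?_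
    rw [LTree.omega_fib g i]
    exact big_congr fun q => congrArg E (label_sub q)
  · refine congrArg (fun u => (d.alg L).comp ((d.alg L).comp _ u) _) (big_congr fun p => ?_)
    obtain ⟨i, rfl⟩ : ∃ j, R.omegaIdx j = p := ⟨_, R.omegaIdx_omegaVertex p⟩
    rw [R.incPos_omegaIdx, R.extend_val, R.extend_val]
    refine Eq.trans ?_ (d.arr_endOmegaTree L E (LTree.fibMap f g h w i.1) _ (y i) o).symm
    refine congrArg₂ (d.alg L).comp (congrArg₂ (d.alg L).comp ?_ ?_) rfl
    -- The operadic functor commutes with induced maps of fibres up to the equality of the fibres,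
    -- which `com_heq` absorbs.
    · have h1 := (omegaOF.fibMap_eq f g h w i)
      have h2 : HEq (LTree.omegaMap (LTree.fibMap f g h w i.1)).map
          (LevFam.fibMap (LTree.omegaMap f).map (LTree.omegaMap g).map (LTree.omegaMap h).map wΩ
            (R.omegaIdx i)) := by
        have key : ∀ {T T' S S' : Omega} (_ : T = T') (_ : S = S') {f : T ⟶ S} {g : T' ⟶ S'},
            HEq f g → HEq (Omega.Hom.map f) (Omega.Hom.map g) := by
          rintro T _ S _ rfl rfl f g h
          rw [eq_of_heq h]
        exact key (LTree.omega_fib h i) (LTree.omega_fib g i) h1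
      refine Eq.trans ?_ ((d.alg L).com_heq (LTree.omega_fib_fam h i) (LTree.omega_fib_fam g i)
        h2 E).symm
      refine congrArg ((d.alg L).com _) (funext fun q => congrArg E (label_sub q).symm)
    · refine (LTree.big_omega_fib g i _).symm.trans (big_congr fun q => ?_)
      rw [LTree.extend_omega]
      refine (S.extend_val o _ (LTree.emb g i.1 ((LTree.fib g i.1).omegaVertex q))).trans ?_
      have e := LTree.fib_fibMap f g h w i.1 ((LTree.fib g i.1).omegaVertex q).1
      exact (arr_cast (congrArg (fun T : LTree => d.powOmega E T.omega) e.symm)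
        (congrArg (fun T : LTree => E T.arity) e.symm) _ _).symm

theorem arr_unit_endOmega (n : ℕ) :
    arr (X := d.powOmega E (Omega.U n)) (Y := E n)
      (L.map ((d.endOmegaTree E).unit n) L.one) = GArr.id L (E n) := by
  refine (congrArg arr ?_).trans
    ((ofHom_eqToHom (d.powOmega_U E n)).trans (congrArg (GArr.id L) (d.powOmega_U E n)))
  exact (L.map_comp _ _ _).trans (L.map_id _)

theorem arr_unit_endOmegaTree (n : ℕ) {T : LTree} (e : LTree.U n = T)
    (e' : (d.endOmegaTree E).obj (LTree.U n) = (d.endOmegaTree E).obj T) :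
    arr (X := d.powOmega E T.omega) (Y := E T.arity)
      (L.map ((d.endOmegaTree E).unit n ≫ eqToHom e') L.one) = GArr.id L (E n) := by
  subst e
  exact (congrArg arr ((L.map_comp _ _ _).trans (L.map_id _))).trans (d.arr_unit_endOmega L E n)

theorem endOmegaTree_unit_left (T : LTree) (y : L.E ((d.endOmegaTree E).obj T)) :
    (d.endOmegaTree E).emul L (O := LTrOC) (𝟙 T) (fun i : T.Idx => L.map ((d.endOmegaTree E).unit
      (LTree.fib (𝟙 T) i.1).arity ≫ eqToHom (congrArg (d.endOmegaTree E).obj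
        (LTrOC.fib_id T i).symm)) L.one) y = y := by
  refine arr_injective (X := d.powOmega E T.omega) (Y := E T.arity) ?_
  have o : GArr L D := GArr.id L d.e
  refine (d.arr_endOmegaTree L E (𝟙 T) _ y o).trans ?_
  have h1 : (LTree.omegaMap (𝟙 T)).map = Map.id T.omegaFam :=
    congrArg Omega.Hom.map (LTree.omegaFunctor.map_id T)
  rw [h1, DuoAlg.com_id]
  have h2 : (big (d.alg L).h0.t (d.alg L).h1.t T.omegaFam fun p => T.extend o (fun i =>
      arr (X := d.powOmega E (LTree.fib (𝟙 T) i.1).omega) (Y := E (T.ar i.1))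
        (L.map ((d.endOmegaTree E).unit (LTree.fib (𝟙 T) i.1).arity ≫
          eqToHom (congrArg (d.endOmegaTree E).obj (LTrOC.fib_id T i).symm)) L.one))
        (T.omegaInc.pos p)) = (d.alg L).id (big (d.alg L).h0.o (d.alg L).h1.o T.omegaFam fun q =>
          E (T.omegaFam.label q)) := by
    rw [DuoAlg.id_big]
    refine big_congr fun p => ?_
    rw [T.extend_omega, T.label_omega]
    exact d.arr_unit_endOmegaTree L E _ (LTrOC.fib_id T (T.omegaVertex p)).symm _
  refine (congrArg (fun u => (d.alg L).comp ((d.alg L).comp _ u) _) h2).trans ?_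
  rw [(d.alg L).id_comp (by simp)]
  exact (d.alg L).id_comp (d.powOmega_alg L E T.omega)

theorem endOmegaTree_unit_right (T : LTree) (y : L.E ((d.endOmegaTree E).obj T)) :
    (d.endOmegaTree E).emul L (O := LTrOC) (LTree.toU T) (fun i => L.map (eqToHom
      (congrArg (d.endOmegaTree E).obj (LTrOC.fib_toU (LTree.toU T) i).symm)) y)
      (L.map ((d.endOmegaTree E).unit T.arity) L.one) = y := by
  refine arr_injective (X := d.powOmega E T.omega) (Y := E T.arity) ?_
  have o : GArr L D := GArr.id L d.e
  refine (d.arr_endOmegaTree L E (LTree.toU T) _ _ o).trans ?_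
  -- The 2-ordinal of a white corolla has one level with one leaf, so that a product over it is its
  -- single factor.
  let i : (LTree.U T.arity).omegaFam.Pos := ⟨⟨0, Nat.one_pos⟩, ⟨0, Nat.one_pos⟩⟩
  have h : ∀ {M : Type _} (m₀ m₁ : Mon M) (a : (LTree.U T.arity).omegaFam.Pos → M),
      big m₀ m₁ (LTree.U T.arity).omegaFam a = a i :=
    fun m₀ m₁ a => (m₀.one_mul _).trans (m₁.mul_one _)
  rw [h, LTree.extend_omega, (d.alg L).com_single (i := i) _ _ rfl rfl]
  have e := LTree.fib_U (LTree.toU T) ((LTree.U T.arity).omegaVertex i).1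
  refine (congrArg₂ (d.alg L).comp (congrArg ((d.alg L).comp _) (arr_cast
    (congrArg (fun T : LTree => d.powOmega E T.omega) e.symm)
    (congrArg (fun T : LTree => E T.arity) e.symm) _ _)) (d.arr_unit_endOmega L E _)).trans ?_
  exact ((d.alg L).comp_id (a := (d.alg L).comp _ (arr (X := d.powOmega E T.omega)
    (Y := E T.arity) y)) ((d.alg L).tgt_comp _ _)).trans
    ((d.alg L).id_comp (a := arr (X := d.powOmega E T.omega) (Y := E T.arity) y)
      (d.powOmega_alg L E T.omega))

theorem endOmegaTree_isElOperad : (d.endOmegaTree E).IsElOperad L where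
  assoc := d.endOmegaTree_assoc L E
  unit_left := d.endOmegaTree_unit_left L E
  unit_right := d.endOmegaTree_unit_right L E

end StrictDuoidal

/-! ### Deleting rows and columns from the interchange -/

namespace DuoAlg

variable {D A : Type*} (d : DuoAlg D A) {ι κ : Type*}

local infixl:65 " ⨟ " => d.comp

/-- Deleting entries is a concatenation of blocks of length one and zero; in this form
`chi_flatMap_right` and `chi_flatMap_left` apply to it. -/
theorem flatMap_filter {α : Type*} (p : α → Bool) : ∀ l : List α,
    (l.flatMap fun a => bif p a then [a] else []) = l.filter p
  | [] => rfl
  | a :: l => by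
    rw [List.flatMap_cons, flatMap_filter p l]
    cases h : p a <;> simp [h]

/-- A row of copies of `e` entered through the iterated comultiplication is the interchange of an
empty block of rows. -/
theorem chi_filter_right (t : List ι) {G : κ → ι → D} (p : κ → Bool) {s : List κ}
    (h : ∀ k ∈ s, ∀ i ∈ t, p k = false → G k i = d.h0.o.one) :
    d.h0.t.rprod s (fun k => bif p k then d.id (d.h1.o.prod t (G k)) else d.e1 t) ⨟ d.chi t G s =
      d.chi t G (s.filter p) := by
  rw [← flatMap_filter, d.chi_flatMap_right]
  refine congrArg₂ d.comp (d.h0.t.rprod_congr fun k _ => ?_) (d.chi_congr fun k hk i hi => ?_)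
  · cases p k
    · rfl
    · exact (d.chi_single_right t G k).symm
  · cases hp : p k
    · exact h k hk i hi hp
    · exact (d.h0.o.rprod_single k fun k => G k i).symm

/-- A column of copies of `v` is an empty block of columns, whose interchange is the iterated
multiplication of `v`. -/
theorem chi_filter_left {t : List ι} {G : κ → ι → D} (p : ι → Bool) {s : List κ}
    (h : ∀ k ∈ s, ∀ i ∈ t, p i = false → G k i = d.h1.o.one) :
    d.chi t G s ⨟ d.h1.t.prod t (fun i => bif p i then d.id (d.h0.o.rprod s fun k => G k i) else
      d.chi ([] : List ι) G s) = d.chi (t.filter p) G s := by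
  rw [← flatMap_filter, d.chi_flatMap_left]
  refine congrArg₂ d.comp (d.chi_congr fun k hk i hi => ?_) (d.h1.t.prod_congr fun i _ => ?_)
  · cases hp : p i
    · exact h k hk i hi hp
    · exact (d.h1.o.prod_single i (G k)).symm
  · cases p i
    · rfl
    · exact (d.chi_single_left i G s).symm

/-- The interchange followed by maps that are the multiplication of the unit of `⊠₁` outside of
`p`. -/
theorem chi_filter_left_prod {t : List ι} {G : κ → ι → D} (p : ι → Bool) {s : List κ} {y : ι → A}
    (h : ∀ k ∈ s, ∀ i ∈ t, p i = false → G k i = d.h1.o.one)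
    (hy : ∀ i ∈ t, p i = true → d.src (y i) = d.h0.o.rprod s fun k => G k i) :
    d.chi t G s ⨟ d.h1.t.prod t (fun i => bif p i then y i else d.chi ([] : List ι) G s) =
      d.chi (t.filter p) G s ⨟ d.h1.t.prod (t.filter p) y := by
  -- The entries in `p` are postponed, while the multiplications of `v` stay next to the
  -- interchange, as in `chi_filter_left`.
  have e : d.h1.t.prod t (fun i => bif p i then y i else d.chi ([] : List ι) G s) =
      d.h1.t.prod t (fun i => bif p i then d.id (d.h0.o.rprod s fun k => G k i) else
        d.chi ([] : List ι) G s) ⨟ d.h1.t.prod t (fun i => if p i then y i else d.h1.t.one) := by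
    have hs : ∀ i ∈ t, d.tgt (bif p i then d.id (d.h0.o.rprod s fun k => G k i) else
        d.chi ([] : List ι) G s) = d.src (if p i then y i else d.h1.t.one) := by
      intro i hi
      cases hp : p i
      · simp
      · simp [hy i hi hp]
    rw [← d.h1.prod_comp hs]
    refine d.h1.t.prod_congr fun i hi => ?_
    cases hp : p i
    · rw [cond_false, cond_false, ← d.h1.id_one]
      exact (d.comp_id (by simp)).symm
    · exact (d.id_comp (hy i hi hp)).symm
  rw [e, ← d.assoc, d.chi_filter_left p h, d.h1.t.prod_filter]

/-- Each counit cancels one comultiplication, and the counit at the end of `e1` remains. Thus a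
counit on every factor of a horizontal level amounts to a single counit for the level. -/
theorem e1_counit : ∀ t : List ι, d.e1 t ⨟ d.h1.t.prod t (fun _ => d.ε) = d.ε
  | [] => by
    rw [Mon.prod_nil, ← d.h1.id_one]
    exact d.comp_id (by simp [e1])
  | i :: t => by
    have h : d.h1.t.mul d.ε d.ε = d.h1.t.mul d.ε (d.id d.h0.o.one) ⨟ d.h1.t.mul d.h1.t.one d.ε := by
      rw [d.comp_mul₁ (by simp) (by simp), d.id_comp (by simp), ← d.h1.id_one, d.comp_id (by simp)]
    rw [e1, Mon.prod_cons, d.assoc, d.comp_mul₁ (by simp) (by simp), d.id_comp (by simp),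
      e1_counit t, h, ← d.assoc, d.ε_δ, d.h1.t.one_mul, d.id_comp (by simp)]

/-- By `e1_counit` a row of copies of `v` entered by `ε` may be entered by the iterated
comultiplication with `ε` in each column. Naturality moves these counits past the interchange, and
the row of copies of `e` left behind is deleted by `chi_filter_right`. -/
theorem chi_filter_counit (t : List ι) {G : κ → ι → D} (p : κ → Bool) {s : List κ}
    (h : ∀ k ∈ s, ∀ i ∈ t, p k = false → G k i = d.h1.o.one) :
    d.h0.t.rprod s (fun k => bif p k then d.id (d.h1.o.prod t (G k)) else d.ε) ⨟ d.chi t G s =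
      d.chi t G (s.filter p) ⨟ d.h1.t.prod t fun i =>
        d.h0.t.rprod s fun k => bif p k then d.id (G k i) else d.ε := by
  -- The array at the sources of the counits: `e` in the rows to be deleted.
  let G' : κ → ι → D := fun k i => bif p k then G k i else d.h0.o.one
  have e : d.h0.t.rprod s (fun k => bif p k then d.id (d.h1.o.prod t (G k)) else d.ε) =
      d.h0.t.rprod s (fun k => bif p k then d.id (d.h1.o.prod t (G' k)) else d.e1 t) ⨟
        d.h0.t.rprod s (fun k => d.h1.t.prod t fun i => bif p k then d.id (G k i) else d.ε) := by
    rw [← d.h0.rprod_comp fun k _ => by cases hp : p k <;> simp [G', hp]]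
    refine d.h0.t.rprod_congr fun k _ => ?_
    cases hp : p k
    · exact (d.e1_counit t).symm
    · simp only [cond_true, ← d.h1.id_prod, G', hp]
      exact (d.id_comp (by simp)).symm
  rw [e, d.assoc, d.chi_nat fun k hk i hi => by
    cases hp : p k
    · simp [h k hk i hi hp]
    · simp, ← d.assoc]
  refine congrArg₂ d.comp ?_ rfl
  have e' : d.chi t (fun k i => d.src (bif p k then d.id (G k i) else d.ε)) s = d.chi t G' s :=
    d.chi_congr fun k _ i _ => by cases hp : p k <;> simp [G', hp]
  rw [e', d.chi_filter_right t p fun k _ i _ hp => by simp [G', hp]]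
  refine d.chi_congr fun k hk i _ => ?_
  simp [G', List.of_mem_filter hk]

end DuoAlg

/-! ### The interchange along a map of 2-ordinals, in terms of trees -/

namespace LTree

open LevFam

variable {T S : LTree} (f : T ⟶ S)

theorem map_overLev_omega (c : S.omegaFam.Lev) :
    (overLev (omegaMap f).map c).map T.omegaInc.lev =
      (overLev (Hom.map f) (S.omegaInc.lev c)).filter T.nonHor := by
  refine (map_selLev (P₂ := fun l => T.nonHor l &&
    decide ((Hom.map f).lev l = S.omegaInc.lev c)) (fun k => ?_)
    fun l h => (Bool.and_eq_true_iff.1 h).1).trans ?_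
  · have h1 : S.omegaInc.lev ((omegaMap f).map.lev k) = (Hom.map f).lev (incLev k) :=
      congrFun (congrArg Map.lev (omegaMap_inc f)) k
    have h2 : T.nonHor (incLev k) = true := incLev_sel k
    rw [h2, ← h1, Bool.true_and]
    exact decide_eq_decide.2 S.omegaInc_lev.eq_iff.symm
  · rw [overLev, selLev, selLev, List.filter_filter]

theorem map_overPos_omega (l : T.omegaFam.Lev) (i : S.omegaFam.Pos) :
    (overPos (omegaMap f).map l i).map T.omegaInc.pos =
      (overPos (Hom.map f) (T.omegaInc.lev l) (S.omegaInc.pos i)).filter T.white := by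
  refine (map_selPos (P₂ := T.nonHor) (Q₂ := fun q => T.white q &&
    decide ((Hom.map f).pos q = S.omegaInc.pos i)) (fun k => ?_)
    (fun q _ h => (Bool.and_eq_true_iff.1 h).1) l (incLev_sel l)).trans ?_
  · have h1 : S.omegaInc.pos ((omegaMap f).map.pos k) = (Hom.map f).pos (incPos k) :=
      congrFun (congrArg Map.pos (omegaMap_inc f)) k
    have h2 : T.white (incPos k) = true := incPos_sel k
    rw [h2, ← h1, Bool.true_and]
    exact decide_eq_decide.2 S.omegaInc_pos.eq_iff.symm
  · rw [overPos, selPos, selPos, List.filter_filter]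
    rfl

end LTree

namespace DuoAlg

open LevFam

variable {D A : Type*} (d : DuoAlg D A) {T S : LTree} (f : T ⟶ S)

local infixl:65 " ⨟ " => d.comp

/-- Levels and leaves of the 2-ordinals are sublists of the levels and vertices of the trees.
Written with filtered lists, the interchange has the form in which the deletion lemmas produce it.
-/
theorem com_omega (val : T.fam.Pos → D) :
    d.com (LTree.omegaMap f).map (fun q => val (T.omegaInc.pos q)) =
      d.h0.t.rprod (S.fam.selLev S.nonHor) fun c => d.chi (S.fam.selPos S.white c)
        (fun l i => d.h1.o.prod ((overPos (LTree.Hom.map f) l i).filter T.white) val)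
        ((overLev (LTree.Hom.map f) c).filter T.nonHor) := by
  have h : (List.finRange S.omegaFam.length).map S.omegaInc.lev = S.fam.selLev S.nonHor := map_incLev
  rw [com, ← h, Mon.rprod_map]
  refine d.h0.t.rprod_congr fun c _ => ?_
  have h' : (S.omegaFam.row c).map S.omegaInc.pos = S.fam.selPos S.white (S.omegaInc.lev c) :=
    map_incPos (fa := fun _ : Bool => ()) (fb := (Prod.snd : Bool × ℕ → ℕ)) (P := S.nonHor)
      (Q := S.white) c
  rw [Function.comp, ← h', ← LTree.map_overLev_omega f, d.chi_map_left, d.chi_map_right]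
  refine d.chi_congr fun l _ i _ => ?_
  rw [← LTree.map_overPos_omega f, Mon.prod_map]
  rfl

/-- The comultiplication for 2-ordinals followed by maps on the fibres, in terms of trees. -/
theorem com_omega_big (val : T.fam.Pos → D) {z : S.fam.Pos → A}
    (hz : ∀ i, S.white i = true → d.src (z i) = d.h0.o.rprod ((overLev (LTree.Hom.map f) i.1).filter
      T.nonHor) fun l => d.h1.o.prod ((overPos (LTree.Hom.map f) l i).filter T.white) val) :
    d.com (LTree.omegaMap f).map (fun q => val (T.omegaInc.pos q)) ⨟
        big d.h0.t d.h1.t S.omegaFam (fun p => z (S.omegaInc.pos p)) =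
      d.h0.t.rprod (List.finRange S.fam.length) fun c => bif S.fam.flag c then d.id d.h0.o.one else
        d.chi ((S.fam.row c).filter S.white)
          (fun l i => d.h1.o.prod ((overPos (LTree.Hom.map f) l i).filter T.white) val)
          ((overLev (LTree.Hom.map f) c).filter T.nonHor) ⨟
        d.h1.t.prod ((S.fam.row c).filter S.white) z := by
  refine (congrArg₂ d.comp (d.com_omega f val) (big_sub z)).trans ?_
  rw [← d.h0.rprod_comp fun c _ => ?_, selLev, Mon.rprod_filter]
  · refine d.h0.t.rprod_congr fun c _ => ?_
    rw [LTree.nonHor, ← d.h0.id_one]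
    cases S.fam.flag c <;> rfl
  · rw [tgt_chi, src_prod₁]
    refine d.h1.o.prod_congr fun i hi => ?_
    have h := mem_selPos.1 hi
    rw [hz i h.2, h.1]

end DuoAlg

/-! ### Comultiplication and contraction of horizontal levels, fibres without white vertices -/

namespace StrictDuoidal

open GArr LevFam OperadData

variable {V : Type uV} [Category.{vV} V] [MonoidalCategory V] [SymmetricCategory V]
  {D : Type uD} [Category.{vD} D] [EnrichedOrdinaryCategory V D] (d : StrictDuoidal V D)
  (L : LaxSym.{w} V) (E : ℕ → D)

theorem _root_.Mon.rprod_get {M α : Type*} (m : Mon M) (X : List α) (a : α → M) :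
    m.rprod X a = m.rprod (List.finRange X.length) fun c => a (X.get c) := by
  conv_lhs => rw [← List.map_get_finRange X, m.rprod_map]
  rfl

theorem ofHom_expandTree (T : LTree) : ofHom L (d.expandTree E T) =
    (d.alg L).h0.t.rprod (List.finRange T.fam.length) fun c => bif T.fam.flag c then
      ofHom L (d.expand (T.fam.row c).length) else
      GArr.id L ((d.alg L).h1.o.prod (T.fam.row c) fun q => d.vert E (T.fam.label q)) := by
  refine (ofHom_rprodMap (a := fun K => bif K.1 then ofHom L (d.expand K.2.length) else
    GArr.id L (d.h1.prod K.2 (d.vert E))) _ fun K _ => ?_).trans ?_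
  · split_ifs with h
    · rw [ofHom_eqToHom_comp, ofHom_comp_eqToHom, h]
      rfl
    · rw [Bool.not_eq_true] at h
      rw [ofHom_eqToHom, h]
      rfl
  · refine (Mon.rprod_get _ _ _).trans ((d.alg L).h0.t.rprod_congr fun c _ => ?_)
    rw [← d.prod_alg L, ← d.prod_row, row, List.length_map, List.length_finRange]
    rfl

theorem ofHom_shrinkTree (T : LTree) : ofHom L (d.shrinkTree E T) =
    (d.alg L).h0.t.rprod (List.finRange T.fam.length) fun c => bif T.fam.flag c then
      ofHom L (d.shrink (T.fam.row c).length) else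
      GArr.id L ((d.alg L).h1.o.prod (T.fam.row c) fun q => d.vert E (T.fam.label q)) := by
  refine (ofHom_rprodMap (a := fun K => bif K.1 then ofHom L (d.shrink K.2.length) else
    GArr.id L (d.h1.prod K.2 (d.vert E))) _ fun K _ => ?_).trans ?_
  · split_ifs with h
    · rw [ofHom_eqToHom_comp, ofHom_comp_eqToHom, h]
      rfl
    · rw [Bool.not_eq_true] at h
      rw [ofHom_eqToHom, h]
      rfl
  · refine (Mon.rprod_get _ _ _).trans ((d.alg L).h0.t.rprod_congr fun c _ => ?_)
    rw [← d.prod_alg L, ← d.prod_row, row, List.length_map, List.length_finRange]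
    rfl

theorem ofHom_vRprod0 {ι : Type} : ∀ l : List ι, ofHom L (d.vRprod0 l) =
    (d.alg L).chi ([] : List ι) (fun _ _ => d.e) l
  | [] => rfl
  | i :: l => by
    refine (ofHom_comp (d.h0.tens (d.vRprod0 l) (𝟙 d.v)) d.μ).trans ?_
    rw [ofHom_tens, ofHom_vRprod0 l, ofHom_id, DuoAlg.chi]
    rfl

/-- Horizontal levels enter through `ε`, the unit of the monoid `v`, and so drop out of the iterated
multiplication. -/
theorem ofHom_collapse (X : LevFam Bool (Bool × ℕ)) (hX : ∀ K ∈ X, ∀ b ∈ K.2, b.1 = false) :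
    ofHom L (d.collapse E X hX) = (d.alg L).chi ([] : List Unit) (fun _ _ => d.e)
      (X.filter fun K => !K.1) := by
  refine (ofHom_comp _ _).trans ?_
  rw [ofHom_vRprod0, (d.alg L).chi_nil_left (ι' := Unit)]
  refine Eq.trans ?_ ((d.alg L).chi_filter_right ([] : List Unit) (fun K : Bool × List (Bool × ℕ) =>
    !K.1) (by simp))
  refine congrArg₂ (d.alg L).comp (ofHom_rprodMap _ fun K _ => ?_) rfl
  split_ifs with h
  · rw [ofHom_eqToHom_comp, h]
    rfl
  · rw [Bool.not_eq_true] at h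
    refine (ofHom_eqToHom _).trans (Eq.trans (congrArg (GArr.id L) (a₂ := d.v) ?_) ?_)
    · rw [_root_.id, h, cond_false]
      refine (d.h1.prod_congr fun b hb => ?_).trans (d.h1.prod_unit K.2)
      rw [vert, hX K (by assumption) b hb, cond_false]
    · rw [h]
      rfl

/-- An interchange without columns does not depend on the array. The free choice of `G` lets the map
be recognized as the multiplication in `chi_filter_left`. -/
theorem ofHom_collapse_fib {T S : LTree} (f : T ⟶ S) (i : S.fam.Pos) (hX) {ι : Type} (G) :
    ofHom L (d.collapse E (LTree.fib f i).fam hX) = (d.alg L).chi ([] : List ι) G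
      ((overLev (LTree.Hom.map f) i.1).filter T.nonHor) := by
  rw [ofHom_collapse, (d.alg L).chi_nil_left (ι' := Unit) G]
  change (d.alg L).chi [] _ (List.filter _ (List.map _ _)) = _
  rw [List.filter_map, (d.alg L).chi_map_right]
  rfl

theorem ofHom_expand_succ (n : ℕ) : ofHom L (d.expand (n + 2)) = (d.alg L).comp (d.alg L).δ
    ((d.alg L).h1.t.mul ((d.alg L).id d.e) (ofHom L (d.expand (n + 1)))) := by
  refine (ofHom_comp d.δ (d.h1.tens (𝟙 d.e) (d.expand (n + 1)))).trans ?_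
  rw [ofHom_tens, ofHom_id]
  rfl

theorem ofHom_shrink_succ (n : ℕ) : ofHom L (d.shrink (n + 2)) = (d.alg L).h1.t.mul
    ((d.alg L).id d.e) ((d.alg L).comp (ofHom L (d.shrink (n + 1))) (d.alg L).ε) := by
  refine (ofHom_comp_eqToHom (d.h1.tens (𝟙 d.e) (d.shrink (n + 1) ≫ d.ε)) _).trans ?_
  rw [ofHom_tens, ofHom_id, ofHom_comp]
  rfl

/-- Induction, with the counit law `δ_ε` at each step. This direction does not depend on the
comparison of the two maps `e ⊠₁ e ⟶ e`. -/
theorem ofHom_expand_shrink : ∀ n, (d.alg L).comp (ofHom L (d.expand n)) (ofHom L (d.shrink n)) =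
    (d.alg L).id d.e
  | 0 => ((ofHom_comp (d.expand 0) (d.shrink 0)).symm.trans
      (congrArg (ofHom L) (Category.comp_id _))).trans (ofHom_id _)
  | 1 => ((ofHom_comp (d.expand 1) (d.shrink 1)).symm.trans
      (congrArg (ofHom L) (Category.comp_id _))).trans (ofHom_id _)
  | n + 2 => by
    rw [ofHom_expand_succ, ofHom_shrink_succ, (d.alg L).assoc,
      (d.alg L).comp_mul₁ (((d.alg L).tgt_id _).trans ((d.alg L).src_id _).symm) rfl,
      (d.alg L).id_comp ((d.alg L).src_id _),
      ← (d.alg L).assoc, ofHom_expand_shrink (n + 1), (d.alg L).id_comp (X := d.e) (d.alg L).src_ε]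
    exact (d.alg L).δ_ε

theorem ofHom_expandTree_shrinkTree (T : LTree) :
    (d.alg L).comp (ofHom L (d.expandTree E T)) (ofHom L (d.shrinkTree E T)) =
      (d.alg L).id (d.powRed E T.fam) := by
  rw [ofHom_expandTree, ofHom_shrinkTree]
  refine Eq.trans ?_ (congrArg (d.alg L).id (d.pow_eq _ _ _)).symm
  rw [d.rprod_alg L, (d.alg L).h0.id_rprod, ← (d.alg L).h0.rprod_comp fun c _ => by cases T.fam.flag c <;> rfl]
  refine (d.alg L).h0.t.rprod_congr fun c _ => ?_
  rw [_root_.id]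
  cases T.fam.flag c
  · rw [cond_false, cond_false, d.prod_alg L]
    exact (d.alg L).id_comp ((d.alg L).src_id _)
  · exact d.ofHom_expand_shrink L _

end StrictDuoidal

/-! ### The operations of the endomorphism collection of trees on elements -/

namespace StrictDuoidal

open GArr LevFam OperadData

variable {V : Type uV} [Category.{vV} V] [MonoidalCategory V] [SymmetricCategory V]
  {D : Type uD} [Category.{vD} D] [EnrichedOrdinaryCategory V D] (d : StrictDuoidal V D)
  (L : LaxSym.{w} V) (E : ℕ → D) {T S : LTree} (f : T ⟶ S)

/-- The entries that are inserted by the structure operations for the vertices that are not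
white. -/
noncomputable def mulEntry (z : S.fam.Pos → GArr L D) (i : S.fam.Pos) : GArr L D :=
  bif S.white i then z i else (d.alg L).chi ([] : List S.fam.Pos)
    (fun l i => (d.alg L).h1.o.prod (overPos (LTree.Hom.map f) l i) fun q => d.vert E (T.fam.label q))
    ((overLev (LTree.Hom.map f) i.1).filter T.nonHor)

theorem arr_endTreeRow (x : ∀ i : S.Idx, L.E (d.powTree E (LTree.fib f i.1) ⟶[V] E (S.ar i.1)))
    (o : GArr L D) : ∀ l : List S.fam.Pos,
    arr (L.map (d.endTreeRow E f l) (L.tensl x (whites S l))) =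
      (d.alg L).h1.t.prod l (d.mulEntry L E f (S.extend o fun i =>
        (d.alg L).comp (ofHom L (d.theta E (LTree.fib f i.1))) (arr (x i))))
  | [] => rfl
  | i :: l => by
    have ih := arr_endTreeRow x o l
    rw [Mon.prod_cons, ← ih, mulEntry, endTreeRow]
    split_ifs with h
    · have e : whites S (i :: l) = ⟨i, h⟩ :: whites S l := by
        unfold whites
        rw [List.filterMap_cons, dif_pos h]
      refine (congrArg arr ((L.map_comp _ _ _).trans (L.map_comp _ _ _))).trans ?_
      refine (congrArg (fun u => arr (L.map _ (L.map _ u))) (L.map_eqToHom_tensl x e _)).trans ?_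
      refine (congrArg (fun u => arr (L.map _ u)) (L.map_tens _ _ _ _)).trans ?_
      refine (tens_arr d.h1 _ _).symm.trans (congrArg₂ (tens d.h1) ?_ rfl)
      rw [h, cond_true, LTree.extend, dif_pos h, theta, ofHom_eqToHom_comp]
      refine (congrArg arr (L.map_comp _ _ _)).trans ((arr_eHomWhiskerLeft_eqToHom _ _).trans ?_)
      exact arr_eHomWhiskerRight _ _
    · have e : whites S (i :: l) = whites S l := by
        unfold whites
        rw [List.filterMap_cons, dif_neg h]
      refine (congrArg arr ((L.map_comp _ _ _).trans ((L.map_comp _ _ _).trans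
        (L.map_comp _ _ _)))).trans ?_
      refine (congrArg (fun u => arr (L.map _ (L.map _ (L.map _ u))))
        (L.map_eqToHom_tensl x e _)).trans ?_
      refine (congrArg (fun u => arr (L.map _ (L.map _ u))) (L.map_left_inv _)).trans ?_
      refine (congrArg (fun u => arr (L.map _ u)) (L.map_tens _ _ _ _)).trans ?_
      refine (tens_arr d.h1 _ _).symm.trans (congrArg₂ (tens d.h1) ?_ rfl)
      rw [Bool.not_eq_true] at h
      rw [h, cond_false, ← d.ofHom_collapse_fib L E f i (fib_not_white f i (by simp [h]))]
      exact ofHom_comp_eqToHom _ _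

theorem arr_endTreeLev (x : ∀ i : S.Idx, L.E (d.powTree E (LTree.fib f i.1) ⟶[V] E (S.ar i.1)))
    (o : GArr L D) (c : S.fam.Lev) :
    arr (L.map (d.endTreeLev E f c) (L.tensl x (whites S (S.fam.row c)))) =
      bif S.fam.flag c then ofHom L (d.expand (S.fam.row c).length) else
      (d.alg L).h1.t.prod (S.fam.row c) (d.mulEntry L E f (S.extend o fun i =>
        (d.alg L).comp (ofHom L (d.theta E (LTree.fib f i.1))) (arr (x i)))) := by
  rw [endTreeLev]
  split_ifs with h
  · have e : whites S (S.fam.row c) = [] := by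
      rw [whites, List.filterMap_eq_nil_iff]
      intro i hi
      rw [dif_neg]
      rw [LTree.white, S.hor i (by rw [mem_row.1 hi]; exact h)]
      simp
    refine (congrArg arr (L.map_comp _ _ _)).trans ?_
    refine (congrArg (fun u => arr (L.map _ u)) (L.map_eqToHom_tensl x e _)).trans ?_
    exact ((ofHom_eqToHom_comp _ _).trans (ofHom_comp_eqToHom _ _)).trans
      (cond_eq_ite .. ▸ (if_pos h).symm)
  · refine (congrArg arr (L.map_comp _ _ _)).trans ?_
    rw [← d.arr_endTreeRow L E f x o]
    rw [Bool.not_eq_true] at h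
    exact (arr_cast (by rw [_root_.id, h, cond_false]) (by rw [h, cond_false]) _ _).trans
      (cond_eq_ite .. ▸ (if_neg (by simp [h])).symm)

/-- To be compared with `arr_endOmegaTree`: here `shrinkTree` comes first, the horizontal levels of
`S` are comultiplied by `expand`, and the vertices that are not white carry the multiplication of
`v` in `mulEntry`. -/
theorem arr_endTree (x : ∀ i : S.Idx, L.E ((d.endTree E).obj (LTree.fib f i.1)))
    (y : L.E ((d.endTree E).obj S)) (o : GArr L D) :
    arr (X := d.powTree E T) (Y := E T.arity) ((d.endTree E).emul L (O := LTrOC) f x y) =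
      (d.alg L).comp ((d.alg L).comp ((d.alg L).comp (ofHom L (d.shrinkTree E T))
        (ofHom L (d.comul id (d.vert E) (LTree.Hom.map f) id (LTree.Hom.hor f))))
        ((d.alg L).h0.t.rprod (List.finRange S.fam.length) fun c =>
          bif S.fam.flag c then ofHom L (d.expand (S.fam.row c).length) else
          (d.alg L).h1.t.prod (S.fam.row c) (d.mulEntry L E f (S.extend o fun i =>
            (d.alg L).comp (ofHom L (d.theta E (LTree.fib f i.1)))
              (arr (X := d.powTree E (LTree.fib f i.1)) (Y := E (S.ar i.1)) (x i))))))
        (arr (X := d.powTree E S) (Y := E S.arity) y) := by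
  refine (congrArg arr ((L.map_comp _ _ _).trans (L.map_comp _ _ _))).trans ?_
  refine (arr_eHomWhiskerLeft_eqToHom _ _).trans ?_
  refine (congrArg (fun z => arr (L.map _ z)) (L.map_whiskerRight (d.endTreeMap E f) _ y)).trans ?_
  refine (comp_arr _ y).symm.trans (congrArg (comp · _) ?_)
  refine (congrArg arr ((L.map_comp _ _ _).trans ((L.map_comp _ _ _).trans ((L.map_comp _ _ _).trans
    ((L.map_comp _ _ _).trans (L.map_comp _ _ _)))))).trans ?_
  refine (arr_eHomWhiskerLeft_eqToHom _ _).trans ((arr_eHomWhiskerRight _ _).trans ?_)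
  refine congrArg₂ (d.alg L).comp (ofHom_comp _ _) ?_
  refine (congrArg (fun z => arr (L.map _ (L.map _ (L.map _ z))))
    (L.map_eqToHom_tensl x (elems_eq_whites S) _)).trans ?_
  refine (congrArg (fun z => arr (L.map _ (L.map _ z))) (L.map_tensUnflatten x _ _)).trans ?_
  refine (congrArg (fun z => arr (L.map _ z)) (L.map_tensMap _ _ _)).trans ?_
  refine (arr_eRprod d.h0 _ _).trans ((d.alg L).h0.t.rprod_congr fun c _ => ?_)
  exact d.arr_endTreeLev L E f x o c

end StrictDuoidal

/-! ### Compatibility of `Λ` with the operations -/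

namespace StrictDuoidal

open GArr LevFam OperadData

variable {V : Type uV} [Category.{vV} V] [MonoidalCategory V] [SymmetricCategory V]
  {D : Type uD} [Category.{vD} D] [EnrichedOrdinaryCategory V D] (d : StrictDuoidal V D)
  (L : LaxSym.{w} V) (E : ℕ → D) {T S : LTree} (f : T ⟶ S)

theorem ofHom_theta (T : LTree) : ofHom L (d.theta E T) = ofHom L (d.expandTree E T) :=
  ofHom_eqToHom_comp _ _

theorem prod_vert {T : LTree} (l : List T.fam.Pos) :
    (d.alg L).h1.o.prod l (fun q => d.vert E (T.fam.label q)) =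
      (d.alg L).h1.o.prod (l.filter T.white) fun q => E (T.ar q) := by
  rw [Mon.prod_filter]
  refine (d.alg L).h1.o.prod_congr fun q _ => ?_
  rw [vert, LTree.white]
  cases (T.fam.label q).1 <;> rfl

/-- White vertices are sent to white vertices, so that only factors `v` lie over a vertex that is
not white. -/
theorem prod_vert_overPos {l : T.fam.Lev} {i : S.fam.Pos} (hi : S.white i = false) :
    (d.alg L).h1.o.prod (overPos (LTree.Hom.map f) l i) (fun q => d.vert E (T.fam.label q)) =
      (d.alg L).h1.o.one := by
  rw [prod_vert, List.filter_eq_nil_iff.2 fun q hq => ?_]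
  · rfl
  · have h := (mem_selPos.1 hq).2
    rw [decide_eq_true_eq] at h
    intro hw
    have := LTree.Hom.white f q hw
    rw [h, hi] at this
    exact absurd this (by simp)

theorem prod_vert_row (l : T.fam.Lev) :
    (d.alg L).h1.o.prod (T.fam.row l) (fun q => d.vert E (T.fam.label q)) =
      (d.alg L).h1.o.prod (S.fam.row ((LTree.Hom.map f).lev l)) fun i =>
        (d.alg L).h1.o.prod (overPos (LTree.Hom.map f) l i) fun q => d.vert E (T.fam.label q) := by
  rw [row_eq (LTree.Hom.map f) l, Mon.prod_flatMap]

theorem powRed_fib (i : S.fam.Pos) : d.powRed E (LTree.fib f i).fam =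
    (d.alg L).h0.o.rprod ((overLev (LTree.Hom.map f) i.1).filter T.nonHor) fun l =>
      (d.alg L).h1.o.prod (overPos (LTree.Hom.map f) l i) fun q => d.vert E (T.fam.label q) := by
  rw [Mon.rprod_filter]
  refine (d.pow_fib id (d.vert E) (LTree.Hom.map f) i).trans ((d.rprod_alg L _ _).trans ?_)
  refine (d.alg L).h0.o.rprod_congr fun l _ => ?_
  rw [d.prod_alg L, LTree.nonHor, _root_.id]
  cases T.fam.flag l <;> rfl

theorem powOmega_fib (i : S.fam.Pos) : d.powOmega E (LTree.fib f i).omega =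
    (d.alg L).h0.o.rprod ((overLev (LTree.Hom.map f) i.1).filter T.nonHor) fun l =>
      (d.alg L).h1.o.prod ((overPos (LTree.Hom.map f) l i).filter T.white) fun q => E (T.ar q) := by
  refine (d.powOmega_omega E _).trans ((d.powRed_fib L E f i).trans ?_)
  simp only [d.prod_vert L]

theorem mulEntry_row {c : S.fam.Lev} {i : S.fam.Pos} (hi : i ∈ S.fam.row c)
    (z : S.fam.Pos → GArr L D) :
    d.mulEntry L E f z i = bif S.white i then z i else (d.alg L).chi ([] : List S.fam.Pos)
      (fun l i => (d.alg L).h1.o.prod (overPos (LTree.Hom.map f) l i) fun q =>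
        d.vert E (T.fam.label q)) ((overLev (LTree.Hom.map f) c).filter T.nonHor) := by
  rw [mulEntry, mem_row.1 hi]

/-- The vertices of `S` that are not white are columns of copies of `v`, and their entry is exactly
the multiplication that `chi_filter_left_prod` deletes. The remaining white vertices see only the
white vertices of `T`, since a factor `v` is neutral for `⊠₁`. -/
theorem chi_mulEntry (c : S.fam.Lev) {z : S.fam.Pos → GArr L D}
    (hz : ∀ i, S.white i = true → (z i).src = d.powOmega E (LTree.fib f i).omega) :
    (d.alg L).comp ((d.alg L).chi (S.fam.row c) (fun l i =>
        (d.alg L).h1.o.prod (overPos (LTree.Hom.map f) l i) fun q => d.vert E (T.fam.label q))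
        ((overLev (LTree.Hom.map f) c).filter T.nonHor))
      ((d.alg L).h1.t.prod (S.fam.row c) (d.mulEntry L E f z)) =
    (d.alg L).comp ((d.alg L).chi ((S.fam.row c).filter S.white) (fun l i =>
        (d.alg L).h1.o.prod ((overPos (LTree.Hom.map f) l i).filter T.white) fun q => E (T.ar q))
        ((overLev (LTree.Hom.map f) c).filter T.nonHor))
      ((d.alg L).h1.t.prod ((S.fam.row c).filter S.white) z) := by
  rw [(d.alg L).h1.t.prod_congr fun i hi => d.mulEntry_row L E f hi z]
  refine ((d.alg L).chi_filter_left_prod S.white (fun l _ i _ hi =>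
    d.prod_vert_overPos L E f hi) fun i hi hw => ?_).trans ?_
  · rw [← mem_row.1 hi, ← d.powRed_fib L E f, ← powOmega_omega]
    exact hz i hw
  · simp only [d.prod_vert L]

/-- The horizontal levels of `T` are rows of copies of `e`, entered by the iterated
comultiplication; `chi_filter_right` deletes them. -/
theorem rprod_chi (c : S.fam.Lev) :
    (d.alg L).comp ((d.alg L).h0.t.rprod (overLev (LTree.Hom.map f) c) fun l =>
        bif T.fam.flag l then (d.alg L).e1 (S.fam.row c) else
          (d.alg L).id ((d.alg L).h1.o.prod (T.fam.row l) fun q => d.vert E (T.fam.label q)))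
      ((d.alg L).chi (S.fam.row c) (fun l i => bif T.fam.flag l then d.e else
        (d.alg L).h1.o.prod (overPos (LTree.Hom.map f) l i) fun q => d.vert E (T.fam.label q))
        (overLev (LTree.Hom.map f) c)) =
    (d.alg L).chi (S.fam.row c) (fun l i =>
        (d.alg L).h1.o.prod (overPos (LTree.Hom.map f) l i) fun q => d.vert E (T.fam.label q))
        ((overLev (LTree.Hom.map f) c).filter T.nonHor) := by
  have h : ∀ (G : T.fam.Lev → S.fam.Pos → D), (∀ l i, G l i = bif T.fam.flag l then d.e else
        (d.alg L).h1.o.prod (overPos (LTree.Hom.map f) l i) fun q => d.vert E (T.fam.label q)) →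
      (d.alg L).comp ((d.alg L).h0.t.rprod (overLev (LTree.Hom.map f) c) fun l =>
        bif T.fam.flag l then (d.alg L).e1 (S.fam.row c) else
          (d.alg L).id ((d.alg L).h1.o.prod (T.fam.row l) fun q => d.vert E (T.fam.label q)))
        ((d.alg L).chi (S.fam.row c) G (overLev (LTree.Hom.map f) c)) =
      (d.alg L).chi (S.fam.row c) G ((overLev (LTree.Hom.map f) c).filter T.nonHor) := by
    intro G hG
    refine Eq.trans (congrArg (fun u => (d.alg L).comp u _) ((d.alg L).h0.t.rprod_congr
      fun l hl => ?_)) ((d.alg L).chi_filter_right (S.fam.row c) T.nonHor fun l _ i _ hl => ?_)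
    · rw [LTree.nonHor]
      cases hl' : T.fam.flag l
      · rw [cond_false, Bool.not_false, cond_true, d.prod_vert_row L E f, mem_overLev.1 hl]
        refine congrArg (d.alg L).id ((d.alg L).h1.o.prod_congr fun i _ => ?_)
        rw [hG, hl', cond_false]
      · rfl
    · rw [hG, show T.fam.flag l = true by simpa [LTree.nonHor] using hl]
      rfl
  refine (h _ fun _ _ => rfl).trans ((d.alg L).chi_congr fun l hl i _ => ?_)
  rw [show T.fam.flag l = false by simpa [LTree.nonHor] using List.of_mem_filter hl]
  rfl

theorem arr_Lambda (T : LTree) (y : L.E ((d.endTree E).obj T)) :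
    arr (X := d.powOmega E T.omega) (Y := E T.arity) (L.map (d.Lambda E T) y) =
      (d.alg L).comp (ofHom L (d.theta E T)) (arr (X := d.powTree E T) (Y := E T.arity) y) :=
  arr_eHomWhiskerRight _ _

/-- Level by level: over a horizontal level of `S` both sides are its comultiplication; over any
other level, deleting the horizontal rows and the columns that are not white leaves the interchange
of the 2-ordinals. -/
theorem comul_mulEntry {z : S.fam.Pos → GArr L D}
    (hs : ∀ i, S.white i = true → (z i).src = d.powOmega E (LTree.fib f i).omega)
    (ht : ∀ i, S.white i = true → (z i).tgt = E (S.ar i)) :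
    (d.alg L).comp (ofHom L (d.comul id (d.vert E) (LTree.Hom.map f) id (LTree.Hom.hor f)))
      ((d.alg L).h0.t.rprod (List.finRange S.fam.length) fun c =>
        bif S.fam.flag c then ofHom L (d.expand (S.fam.row c).length) else
          (d.alg L).h1.t.prod (S.fam.row c) (d.mulEntry L E f z)) =
    (d.alg L).comp ((d.alg L).comp
      ((d.alg L).com (LTree.omegaMap f).map fun q => E (T.omegaFam.label q))
      (big (d.alg L).h0.t (d.alg L).h1.t S.omegaFam fun p => z (S.omegaInc.pos p)))
      (ofHom L (d.theta E S)) := by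
  have e : (fun q => E (T.omegaFam.label q)) = fun q => E (T.ar (T.omegaInc.pos q)) :=
    funext fun q => congrArg E (T.label_omega q)
  rw [e, (d.alg L).com_omega_big f (fun q => E (T.ar q)) (z := z) fun i hi =>
    (hs i hi).trans (d.powOmega_fib L E f i), ofHom_theta, ofHom_expandTree, ofHom_comul]
  rw [← (d.alg L).h0.rprod_comp fun c _ => ?_, ← (d.alg L).h0.rprod_comp fun c _ => ?_]
  · refine (d.alg L).h0.t.rprod_congr fun c _ => ?_
    simp only [_root_.id]
    cases S.fam.flag c
    · simp only [cond_false]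
      rw [d.rprod_chi L E f c, d.chi_mulEntry L E f c hs]
      refine ((d.alg L).comp_id ?_).symm
      rw [DuoAlg.tgt_comp, DuoAlg.tgt_prod₁, prod_vert]
      exact (d.alg L).h1.o.prod_congr fun i hi => ht i (List.of_mem_filter hi)
    · rfl
  · cases S.fam.flag c
    · simp only [cond_false]
      refine Eq.trans ?_ ((d.alg L).src_id _).symm
      rw [DuoAlg.tgt_comp, DuoAlg.tgt_prod₁, prod_vert]
      exact (d.alg L).h1.o.prod_congr fun i hi => ht i (List.of_mem_filter hi)
    · rfl
  · simp only [_root_.id]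
    cases S.fam.flag c
    · simp only [cond_false]
      rw [d.rprod_chi L E f c, DuoAlg.tgt_chi, DuoAlg.src_prod₁]
      refine (d.alg L).h1.o.prod_congr fun i hi => ?_
      rw [d.mulEntry_row L E f hi]
      cases hw : S.white i
      · simp [d.prod_vert_overPos L E f hw]
      · rw [cond_true, ← mem_row.1 hi, ← d.powRed_fib L E f, ← powOmega_omega]
        exact (hs i hw).symm
    · rfl

theorem Lambda_elements (x : ∀ i : S.Idx, L.E ((d.endTree E).obj (LTree.fib f i.1)))
    (y : L.E ((d.endTree E).obj S)) :
    L.map (d.Lambda E T) ((d.endTree E).emul L (O := LTrOC) f x y) =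
      (d.endOmegaTree E).emul L (O := LTrOC) f (fun i => L.map (d.Lambda E (LTree.fib f i.1)) (x i))
        (L.map (d.Lambda E S) y) := by
  refine arr_injective (X := d.powOmega E T.omega) (Y := E T.arity) ?_
  have o : GArr L D := GArr.id L d.e
  refine (d.arr_Lambda L E T _).trans ((congrArg ((d.alg L).comp _)
    (d.arr_endTree L E f x y o)).trans (Eq.trans ?_ (d.arr_endOmegaTree L E f _ _ o).symm))
  refine Eq.trans ?_ (congrArg ((d.alg L).comp _) (d.arr_Lambda L E S y).symm)
  simp only [← (d.alg L).assoc]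
  refine congrArg (fun u => (d.alg L).comp u _) ?_
  -- The map `θ` for `T` is cancelled by the `shrinkTree` with which the operation begins.
  rw [ofHom_theta, ofHom_expandTree_shrinkTree, (d.alg L).id_comp (X := d.powRed E T.fam)
    (a := ofHom L (d.comul _ _ _ _ _)) rfl]
  have hz : (fun i : S.Idx => arr (X := d.powOmega E (LTree.fib f i.1).omega) (Y := E (S.ar i.1))
      (L.map (d.Lambda E (LTree.fib f i.1)) (x i))) = fun i : S.Idx =>
        (d.alg L).comp (ofHom L (d.theta E (LTree.fib f i.1)))
          (arr (X := d.powTree E (LTree.fib f i.1)) (Y := E (S.ar i.1)) (x i)) :=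
    funext fun i => d.arr_Lambda L E (LTree.fib f i.1) (x i)
  refine (d.comul_mulEntry L E f (fun i hi => ?_) fun i hi => ?_).trans
    (congrArg (fun u => (d.alg L).comp ((d.alg L).comp _ (big _ _ _ fun p =>
      S.extend o u (S.omegaInc.pos p))) _) hz.symm)
  · rw [LTree.extend, dif_pos hi]
    rfl
  · rw [LTree.extend, dif_pos hi]
    rfl

/-- It holds without the square, since `shrink` occurs only after `expand`, where it is cancelled by
the counit law. -/
theorem Lambda_commutes : Commutes (d.endTree E) (d.endOmegaTree E) (d.Lambda E) := by
  refine Commutes.of_elements _ (fun n => unit_ext _ _ fun L => ?_) fun L => d.Lambda_elements L E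
  refine arr_injective (X := d.powOmega E (LTree.U n).omega) (Y := E n) ?_
  refine Eq.trans ?_ (d.arr_unit_endOmega L E n).symm
  refine (congrArg arr (L.map_comp _ _ _)).trans ((d.arr_Lambda L E (LTree.U n) _).trans ?_)
  have h : ofHom L (d.theta E (LTree.U n)) = GArr.id L (E n) := by
    rw [ofHom_theta, ofHom_expandTree]
    exact (Mon.rprod_single _ (⟨0, Nat.one_pos⟩ : (LTree.U n).fam.Lev) _).trans (congrArg (GArr.id L)
      (Mon.prod_single _ (⟨⟨0, Nat.one_pos⟩, ⟨0, Nat.one_pos⟩⟩ : (LTree.U n).fam.Pos) _))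
  rw [h]
  exact ((d.alg L).id_comp (a := ofHom L (eqToHom (d.powTree_U E n))) (d.powTree_U E n)).trans
    ((ofHom_eqToHom _).trans (congrArg (GArr.id L) (d.powTree_U E n)))

end StrictDuoidal

/-! ### Untyped 1-operads -/

/-- A 1-operad in an untyped strict duoidal category. -/
structure OneAlg {D A : Type*} (d : DuoAlg D A) where
  obj : ℕ → D
  γ : List ℕ → A
  j : A
  src_γ : ∀ ks, d.src (γ ks) = d.h0.o.mul (d.h1.o.prod ks obj) (obj ks.length)
  tgt_γ : ∀ ks, d.tgt (γ ks) = obj ks.sum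
  src_j : d.src j = d.h0.o.one
  tgt_j : d.tgt j = obj 1
  assoc : ∀ kss : List (List ℕ), d.comp (d.h0.t.mul (d.comp
      (d.z2 (fun ks => d.h1.o.prod ks obj) (fun ks => obj ks.length) kss) (d.h1.t.prod kss γ))
      (d.id (obj kss.length))) (γ (kss.map List.sum)) =
    d.comp (d.h0.t.mul (d.id (d.h1.o.prod kss fun ks => d.h1.o.prod ks obj))
      (γ (kss.map List.length))) (γ kss.flatten)
  unit_left : ∀ n : ℕ, d.comp (d.h0.t.mul (d.comp (d.e1 (List.replicate n 1))
      (d.h1.t.prod (List.replicate n 1) fun _ => j)) (d.id (obj n))) (γ (List.replicate n 1)) =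
    d.id (obj n)
  unit_right : ∀ k : ℕ, d.comp (d.h0.t.mul (d.id (obj k)) j) (γ [k]) = d.id (obj k)

namespace OneAlg

variable {D A : Type*} {d : DuoAlg D A} (O : OneAlg d) {ι κ : Type}

attribute [simp] src_γ tgt_γ src_j tgt_j

local infixl:65 " ⨟ " => d.comp
local infixl:70 " ⊠₀ " => d.h0.t.mul
local infixl:70 " ⊠₁ " => d.h1.t.mul
local infixl:70 " ⊙₀ " => d.h0.o.mul
local infixl:70 " ⊙₁ " => d.h1.o.mul

/-- The source of the structure map, without the last factor. -/
def pow (ks : List ℕ) : D := d.h1.o.prod ks O.obj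

/-- The iterated structure map along a sequence of levels with the given numbers of inputs. -/
def comps : ℕ → List (List ℕ) → A
  | p, [] => d.id (O.obj p)
  | _, r :: w => d.id (d.h0.o.rprod w O.pow) ⊠₀ O.γ r ⨟ comps r.sum w

/-- The rows are the levels of a forest of `p` trees with `n` leaves. -/
def Fits (p : ℕ) (w : List (List ℕ)) (n : ℕ) : Prop :=
  IsTree.Chain p (w.map fun r => (r.length, r.sum)) n

theorem src_comps : ∀ {p : ℕ} {w : List (List ℕ)} {n : ℕ}, Fits p w n →
    d.src (O.comps p w) = d.h0.o.rprod w O.pow ⊙₀ O.obj p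
  | p, [], n, _ => by simp [comps, d.h0.o.one_mul]
  | _, r :: w, n, h => by
    obtain rfl : r.length = _ := h.1
    simp [comps, Mon.rprod_cons, d.h0.o.assoc, pow]

theorem tgt_comps : ∀ {p : ℕ} {w : List (List ℕ)} {n : ℕ}, Fits p w n →
    d.tgt (O.comps p w) = O.obj n
  | p, [], n, h => by
    obtain rfl : p = n := h
    simp [comps]
  | _, r :: w, n, h => by
    rw [comps, d.tgt_comp]
    exact tgt_comps h.2

theorem comps_append {w' : List (List ℕ)} {m : ℕ} (h' : Fits m w' n) :
    ∀ {p : ℕ} {w : List (List ℕ)}, Fits p w m →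
    O.comps p (w ++ w') = d.id (d.h0.o.rprod w' O.pow) ⊠₀ O.comps p w ⨟ O.comps m w'
  | p, [], h => by
    obtain rfl : p = m := h
    rw [List.nil_append, comps, ← d.h0.id_mul, d.id_comp (O.src_comps h')]
  | _, r :: w, h => by
    rw [List.cons_append, comps, comps, comps_append h' h.2, ← d.assoc]
    refine congrArg (fun u => u ⨟ _) ?_
    rw [Mon.rprod_append, d.h0.id_mul, d.h0.t.assoc, d.comp_mul₀ (by simp) (by
      rw [O.src_comps h.2]; simp), d.id_comp (by simp)]

/-- Compatibility of the iterated structure maps with the interchange. -/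
theorem comps_flatMap (t : List ι) (ks : κ → ι → List ℕ) (v : ι → ℕ) :
    ∀ (s : List κ) (u : ι → ℕ), (∀ i ∈ t, Fits (u i) (s.map (ks · i)) (v i)) →
    d.id (d.h0.o.rprod s fun k => d.h1.o.prod t fun i => O.pow (ks k i)) ⊠₀ O.γ (t.map u) ⨟
        O.comps (t.map u).sum (s.map fun k => t.flatMap (ks k)) =
      (d.chi t (fun k i => O.pow (ks k i)) s ⊠₀ d.id (d.h1.o.prod t fun i => O.obj (u i)) ⨟
        d.z2 (fun i => d.h0.o.rprod s fun k => O.pow (ks k i)) (fun i => O.obj (u i)) t ⨟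
        d.h1.t.prod t fun i => O.comps (u i) (s.map (ks · i))) ⊠₀ d.id (O.obj t.length) ⨟
      O.γ (t.map v)
  | [], u, h => by
    -- Without levels the forest `i` consists of `u i = v i` bare edges, and everything else is an
    -- identity.
    have e : t.map u = t.map v := List.map_congr_left fun i hi => h i hi
    simp only [List.map_nil, comps, Mon.rprod_nil, DuoAlg.chi]
    rw [d.z2_unit_left, ← d.h1.id_prod, d.id_comp (by simp), ← e,
      d.comp_id (by simp [d.h0.o.one_mul]),
      ← d.h0.id_mul, d.id_comp (by simp [Mon.prod_map, Function.comp_def]), d.h0.id_one,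
      d.h0.t.one_mul]
  | k :: s, u, h => by
    -- The level `k` is nearest to the root; above it, the forest `i` continues with `(ks k i).sum`
    -- edges.
    have ih := comps_flatMap t ks v s (fun i => (ks k i).sum) fun i hi => (h i hi).2
    have hl : ∀ i ∈ t, (ks k i).length = u i := fun i hi => (h i hi).1
    set U := d.h1.o.prod t fun i => O.obj (u i) with hU
    set P := d.h1.o.prod t fun i => O.pow (ks k i) with hP
    set R : ι → D := fun i => d.h0.o.rprod s fun k => O.pow (ks k i) with hR
    set C := d.chi t (fun k i => O.pow (ks k i)) s with hC
    have hC' : d.tgt C = d.h1.o.prod t R := by simp [hC, hR]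
    set Z := d.z2 (fun i => O.pow (ks k i)) (fun i => O.obj (u i)) t ⨟
      d.h1.t.prod t fun i => O.γ (ks k i) with hZ
    have hZs : d.src Z = P ⊙₀ U := by simp [hZ, hP, hU]
    have hZt : d.tgt Z = d.h1.o.prod t fun i => O.obj (ks k i).sum := by simp [hZ]
    -- The associativity of the 1-operad, used once for each level.
    have as : Z ⊠₀ d.id (O.obj t.length) ⨟ O.γ (t.map fun i => (ks k i).sum) =
        d.id P ⊠₀ O.γ (t.map u) ⨟ O.γ (t.flatMap (ks k)) := by
      have as := O.assoc (t.map (ks k))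
      simp only [List.map_map, List.length_map, d.z2_map, Mon.prod_map, Function.comp_def] at as
      rw [List.map_congr_left hl] at as
      rw [hZ, hP, ← d.z2_congr (fun _ _ => rfl) fun i hi => congrArg O.obj (hl i hi)]
      exact as
    -- By `z2_assoc` and naturality, level `k` may first be interchanged and composed with the edges
    -- below it, which is `Z`; the higher levels are interchanged with the result.
    have h1 : (d.chi t (fun k i => O.pow (ks k i)) (k :: s) ⊠₀ d.id U ⨟
        d.z2 (fun i => R i ⊙₀ O.pow (ks k i)) (fun i => O.obj (u i)) t) ⨟
        d.h1.t.prod t (fun i => d.id (R i) ⊠₀ O.γ (ks k i)) =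
        C ⊠₀ Z ⨟ d.z2 R (fun i => O.obj (ks k i).sum) t := by
      have e1 : d.chi t (fun k i => O.pow (ks k i)) (k :: s) ⊠₀ d.id U =
          C ⊠₀ (d.id P ⊠₀ d.id U) ⨟ d.z2 R (fun i => O.pow (ks k i)) t ⊠₀ d.id U := by
        rw [← d.h0.t.assoc, d.comp_mul₀ (by simp [hC', hP]) (by simp), d.id_comp (by simp)]
        rfl
      have e2 : C ⊠₀ Z = C ⊠₀ (d.id P ⊠₀ d.id U) ⨟ (d.id (d.h1.o.prod t R) ⊠₀
          d.z2 (fun i => O.pow (ks k i)) (fun i => O.obj (u i)) t ⨟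
          d.h1.t.prod t (fun i => d.id (R i)) ⊠₀ d.h1.t.prod t fun i => O.γ (ks k i)) := by
        rw [d.comp_mul₀ (by simp) (by
            simp only [DuoAlg.tgt_z2, DuoAlg.src_prod₁, src_γ]
            exact d.h1.o.prod_congr fun i hi => by rw [hl i hi, pow]), ← d.h1.id_prod, d.id_comp (by simp),
          d.comp_mul₀ (by simp [hC']) (by simp [hP, hU]), d.comp_id hC', ← d.h0.id_mul,
          d.id_comp (by simp [hP, hU])]
      rw [e1, e2, d.assoc _ _ (d.z2 _ _ t), d.z2_assoc, d.assoc, d.assoc, d.assoc, d.assoc,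
        d.z2_nat (fun i _ => by simp) (fun i _ => by simp)]
      simp only [d.src_id]
      rw [d.z2_congr (fun _ _ => rfl) fun i hi => (O.src_γ _).trans
        (congrArg (d.h0.o.mul _) (congrArg O.obj (hl i hi)))]
      rfl
    have h2 : d.h1.t.prod t (fun i => O.comps (u i) ((k :: s).map (ks · i))) =
        d.h1.t.prod t (fun i => d.id (R i) ⊠₀ O.γ (ks k i)) ⨟
          d.h1.t.prod t fun i => O.comps (ks k i).sum (s.map (ks · i)) := by
      rw [← d.h1.prod_comp fun i hi => by
        rw [O.src_comps (h i hi).2]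
        simp [hR, Mon.rprod_map, Function.comp_def]]
      refine d.h1.t.prod_congr fun i _ => ?_
      rw [List.map_cons, comps, Mon.rprod_map]
      rfl
    have h3 : d.id (d.h0.o.rprod (k :: s) fun k => d.h1.o.prod t fun i => O.pow (ks k i)) =
        d.id (d.h0.o.rprod s fun k => d.h1.o.prod t fun i => O.pow (ks k i)) ⊠₀ d.id P := by
      rw [Mon.rprod_cons, d.h0.id_mul]
    set Q := d.h0.o.rprod s fun k => d.h1.o.prod t fun i => O.pow (ks k i) with hQ
    have hCs : d.src C = Q := by simp [hC, hQ]
    set U' := d.h1.o.prod t fun i => O.obj (ks k i).sum with hU'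
    -- `C` and `Z` act on different factors. Doing `Z` first isolates the part to which `as` applies
    -- from the part covered by the induction hypothesis.
    have h4 : C ⊠₀ Z = d.id Q ⊠₀ Z ⨟ C ⊠₀ d.id U' := by
      rw [d.comp_mul₀ (by simp [hCs]) (by simp [hZt]), d.id_comp hCs, d.comp_id hZt]
    have h5 : (C ⊠₀ Z ⨟ d.z2 R (fun i => O.obj (ks k i).sum) t ⨟
        d.h1.t.prod t fun i => O.comps (ks k i).sum (s.map (ks · i))) ⊠₀ d.id (O.obj t.length) =
        d.id Q ⊠₀ (Z ⊠₀ d.id (O.obj t.length)) ⨟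
          (C ⊠₀ d.id U' ⨟ d.z2 R (fun i => O.obj (ks k i).sum) t ⨟
          d.h1.t.prod t fun i => O.comps (ks k i).sum (s.map (ks · i))) ⊠₀
            d.id (O.obj t.length) := by
      rw [← d.h0.t.assoc, d.comp_mul₀ (by simp [hCs, hZt]) (by simp), d.id_comp (d.src_id _), h4]
      simp only [d.assoc]
    have h6 : (t.map fun i => (ks k i).sum).sum = (t.flatMap (ks k)).sum := by
      rw [List.flatMap, List.sum_flatten, List.map_map]
      rfl
    have h7 : d.h0.o.rprod (s.map fun k => t.flatMap (ks k)) O.pow = Q := by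
      rw [Mon.rprod_map, hQ]
      exact d.h0.o.rprod_congr fun k _ => d.h1.o.prod_flatMap _ _ _
    rw [h2, ← d.assoc _ _ (d.h1.t.prod t _)]
    refine Eq.trans ?_ (congrArg (fun u => (u ⨟ _) ⊠₀ _ ⨟ _) h1).symm
    rw [h5, d.assoc, ← ih, ← d.assoc (d.id Q ⊠₀ (Z ⊠₀ _)), d.comp_mul₀ (by simp) (by
      simp [hZt, hU', Mon.prod_map, Function.comp_def]), d.id_comp (d.src_id _), as, h3,
      List.map_cons, comps, h7, d.h0.t.assoc, ← d.assoc, d.comp_mul₀ (by simp) (by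
        simp only [DuoAlg.tgt_mul₀, DuoAlg.tgt_id, tgt_γ, src_γ, hP, List.length_flatMap, pow,
          d.h1.o.prod_flatMap, List.map_congr_left hl]), d.id_comp (d.src_id _), h6]

/-- The action along a sequence of levels, starting with the unit at the root. -/
def tree (w : List (List ℕ)) : A := d.id (d.h0.o.rprod w O.pow) ⊠₀ O.j ⨟ O.comps 1 w

theorem src_tree (w : List (List ℕ)) : d.src (O.tree w) = d.h0.o.rprod w O.pow := by
  simp [tree, d.h0.o.mul_one]

theorem tgt_tree {w : List (List ℕ)} {n : ℕ} (h : Fits 1 w n) : d.tgt (O.tree w) = O.obj n := by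
  rw [tree, d.tgt_comp, O.tgt_comps h]

theorem Fits.block {t : List ι} {ks : κ → ι → List ℕ} {v : ι → ℕ} {s : List κ}
    (h : ∀ i ∈ t, Fits 1 (s.map (ks · i)) (v i)) :
    Fits t.length (s.map fun k => t.flatMap (ks k)) (t.map v).sum := by
  have := IsTree.Chain.sum (fun i k => (ks k i).length) (fun i k => (ks k i).sum) v t s
    (fun _ => 1) fun i hi => by simpa [Fits, Function.comp_def] using h i hi
  simpa [Fits, Function.comp_def, List.length_flatMap, List.flatMap, List.sum_flatten] using this

theorem Fits.blocks {μ : Type} {t : μ → List ι} {s : μ → List κ} {ks : κ → ι → List ℕ}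
    {v : ι → ℕ} : ∀ {m : List μ} {p n : ℕ}, Fits p (m.map fun c => (t c).map v) n →
    (∀ c ∈ m, ∀ i ∈ t c, Fits 1 ((s c).map (ks · i)) (v i)) →
    Fits p (m.flatMap fun c => (s c).map fun k => (t c).flatMap (ks k)) n
  | [], _, _, h, _ => h
  | c :: m, p, n, h, h' => by
    obtain rfl : (t c).length = p := by simpa using h.1
    rw [List.flatMap_cons, Fits, List.map_append]
    exact IsTree.Chain.append (Fits.blocks h.2 fun c hc => h' c (List.mem_cons_of_mem _ hc))
      (Fits.block (h' c List.mem_cons_self))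

/-- Compatibility of the iterated structure maps with the interchange, for a family of trees. -/
theorem comps_block (t : List ι) (ks : κ → ι → List ℕ) (v : ι → ℕ) (s : List κ)
    (h : ∀ i ∈ t, Fits 1 (s.map (ks · i)) (v i)) :
    O.comps t.length (s.map fun k => t.flatMap (ks k)) =
      (d.chi t (fun k i => O.pow (ks k i)) s ⨟ d.h1.t.prod t fun i => O.tree (s.map (ks · i))) ⊠₀
        d.id (O.obj t.length) ⨟ O.γ (t.map v) := by
  -- Every tree starts with one edge, so `u = 1`. The left unit law then removes the `γ` at the
  -- bottom, at the cost of a unit `j` at the root of each tree.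
  have h0 := O.comps_flatMap t ks v s (fun _ => 1) h
  have hr : t.map (fun _ => 1) = List.replicate t.length 1 := List.map_const' ..
  set Q := d.h0.o.rprod s fun k => d.h1.o.prod t fun i => O.pow (ks k i) with hQ
  set R : ι → D := fun i => d.h0.o.rprod s fun k => O.pow (ks k i) with hR
  set C := d.chi t (fun k i => O.pow (ks k i)) s with hC
  have hCs : d.src C = Q := by simp [hC, hQ]
  have hC' : d.tgt C = d.h1.o.prod t R := by simp [hC, hR]
  have hQ' : d.h0.o.rprod (s.map fun k => t.flatMap (ks k)) O.pow = Q := by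
    rw [Mon.rprod_map, hQ]
    exact d.h0.o.rprod_congr fun k _ => d.h1.o.prod_flatMap _ _ _
  have hf := Fits.block h
  set J := d.e1 t ⨟ d.h1.t.prod t (fun _ => O.j) with hJ
  have hJt : d.tgt J = d.h1.o.prod t fun _ => O.obj 1 := by simp [hJ]
  have hJs : d.src J = d.h0.o.one := by simp [hJ]
  have h1 : d.id Q ⊠₀ (J ⊠₀ d.id (O.obj t.length)) ⨟ (d.id Q ⊠₀ O.γ (t.map fun _ => 1)) =
      d.id Q ⊠₀ d.id (O.obj t.length) := by
    have hu := O.unit_left t.length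
    rw [← hr, d.e1_map, Mon.prod_map] at hu
    rw [d.comp_mul₀ (by simp) (by
      rw [DuoAlg.tgt_mul₀, hJt, src_γ, Mon.prod_map, List.length_map, DuoAlg.tgt_id]; rfl),
      d.id_comp (d.src_id _)]
    exact congrArg _ hu
  have h2 := congrArg (fun u => d.id Q ⊠₀ (J ⊠₀ d.id (O.obj t.length)) ⨟ u) h0
  simp only [← d.assoc] at h2
  rw [h1, ← d.h0.id_mul, d.id_comp (by
    rw [show (t.map fun _ => 1).sum = t.length by simp, O.src_comps hf, hQ'])] at h2
  rw [show (t.map fun _ => 1).sum = t.length by simp] at h2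
  rw [h2]
  refine congrArg (fun u => u ⨟ _) ?_
  rw [← d.h0.t.assoc, d.comp_mul₀ (by simp [hCs, hJt]) (by simp), d.id_comp (d.src_id _)]
  refine congrArg (fun u => u ⊠₀ _) ?_
  have h3 : d.id Q ⊠₀ J ⨟ C ⊠₀ d.id (d.h1.o.prod t fun _ => O.obj 1) =
      C ⊠₀ d.e1 t ⨟ d.h1.t.prod t (fun i => d.id (R i)) ⊠₀ d.h1.t.prod t (fun _ => O.j) := by
    rw [d.comp_mul₀ (by simp [hCs]) (by simp [hJt]), d.comp_mul₀ (by simp [hC']) (by simp),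
      d.id_comp hCs, d.comp_id hJt, ← d.h1.id_prod, d.comp_id hC']
  -- The comultiplication that distributes the units `j` to the roots is neutral for the
  -- interchange.
  have h4 : C ⊠₀ d.e1 t ⨟ d.z2 R (fun _ => d.h0.o.one) t = C := by
    have e : C ⊠₀ d.e1 t = C ⊠₀ d.id d.h0.o.one ⨟ d.id (d.h1.o.prod t R) ⊠₀ d.e1 t := by
      rw [d.comp_mul₀ (by simp [hC']) (by simp), d.comp_id hC', d.id_comp (by simp)]
    rw [e, d.assoc, d.z2_unit_right, d.h0.id_one, d.h0.t.mul_one, d.comp_id hC']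
  rw [← d.assoc, ← d.assoc, h3, d.assoc (C ⊠₀ _), d.z2_nat (fun i _ => by simp) fun i _ => by simp]
  simp only [DuoAlg.src_id, src_j]
  rw [← d.assoc, h4, d.assoc, ← d.h1.prod_comp fun i hi => by
    rw [O.src_comps (h i hi)]
    simp [hR, Mon.rprod_map, Function.comp_def]]
  refine congrArg _ (d.h1.t.prod_congr fun i _ => ?_)
  rw [tree, Mon.rprod_map]
  rfl

/-- Induction over the levels of the target: `comps_append` splits off the levels lying over the
first one, and `comps_block` contracts them to a single structure map, preceded by the actions of
the fibres. -/
theorem comps_blocks {μ : Type} (t : μ → List ι) (s : μ → List κ) (ks : κ → ι → List ℕ)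
    (v : ι → ℕ) : ∀ (m : List μ) (p n : ℕ), Fits p (m.map fun c => (t c).map v) n →
    (∀ c ∈ m, ∀ i ∈ t c, Fits 1 ((s c).map (ks · i)) (v i)) →
    O.comps p (m.flatMap fun c => (s c).map fun k => (t c).flatMap (ks k)) =
      d.h0.t.rprod m (fun c => d.chi (t c) (fun k i => O.pow (ks k i)) (s c) ⨟
        d.h1.t.prod (t c) fun i => O.tree ((s c).map (ks · i))) ⊠₀ d.id (O.obj p) ⨟
      O.comps p (m.map fun c => (t c).map v)
  | [], p, n, _, _ => by
    simp only [List.flatMap_nil, comps, Mon.rprod_nil, List.map_nil]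
    rw [d.h0.t.one_mul, d.id_comp (by simp)]
  | c :: m, p, n, h, h' => by
    obtain rfl : (t c).length = p := by simpa using h.1
    have hm : ∀ c ∈ m, ∀ i ∈ t c, Fits 1 ((s c).map (ks · i)) (v i) :=
      fun c hc => h' c (List.mem_cons_of_mem _ hc)
    have hc := h' c List.mem_cons_self
    have ih := comps_blocks t s ks v m _ _ h.2 hm
    set F : μ → A := fun c => d.chi (t c) (fun k i => O.pow (ks k i)) (s c) ⨟
      d.h1.t.prod (t c) fun i => O.tree ((s c).map (ks · i)) with hF
    have hs : d.src (d.h0.t.rprod m F) = d.h0.o.rprod (m.flatMap fun c => (s c).map fun k =>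
        (t c).flatMap (ks k)) O.pow := by
      rw [DuoAlg.src_rprod₀, Mon.rprod_flatMap]
      refine d.h0.o.rprod_congr fun c _ => ?_
      rw [hF, DuoAlg.src_comp, DuoAlg.src_chi, Mon.rprod_map]
      exact d.h0.o.rprod_congr fun k _ => (d.h1.o.prod_flatMap _ _ _).symm
    have ht' : ∀ c, (∀ i ∈ t c, Fits 1 ((s c).map (ks · i)) (v i)) →
        d.tgt (F c) = O.pow ((t c).map v) := by
      intro c hc
      rw [hF, DuoAlg.tgt_comp, DuoAlg.tgt_prod₁, pow, Mon.prod_map]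
      exact d.h1.o.prod_congr fun i hi => O.tgt_tree (hc i hi)
    have ht : d.tgt (d.h0.t.rprod m F) = d.h0.o.rprod (m.map fun c => (t c).map v) O.pow := by
      rw [DuoAlg.tgt_rprod₀, Mon.rprod_map]
      exact d.h0.o.rprod_congr fun c hc => ht' c (hm c hc)
    have hf := Fits.block hc
    rw [List.flatMap_cons, O.comps_append (Fits.blocks h.2 hm) hf, ih, ← d.assoc,
      d.comp_mul₀ (by simp [hs]) (by simp [O.tgt_comps hf]), d.id_comp hs,
      d.comp_id (O.tgt_comps hf), O.comps_block _ _ _ _ hc, Mon.rprod_cons, List.map_cons, comps,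
      ← d.assoc, d.h0.t.assoc, d.comp_mul₀ (by simp [ht]) (by
        rw [DuoAlg.tgt_mul₀, ht' c hc, src_γ, List.length_map, DuoAlg.tgt_id]; rfl), d.comp_id ht]

/-- The action along a tree is determined by the actions along the fibres. -/
theorem tree_blocks {μ : Type} (t : μ → List ι) (s : μ → List κ) (ks : κ → ι → List ℕ)
    (v : ι → ℕ) (m : List μ) (n : ℕ) (h : Fits 1 (m.map fun c => (t c).map v) n)
    (hm : ∀ c ∈ m, ∀ i ∈ t c, Fits 1 ((s c).map (ks · i)) (v i)) :
    O.tree (m.flatMap fun c => (s c).map fun k => (t c).flatMap (ks k)) =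
      d.h0.t.rprod m (fun c => d.chi (t c) (fun k i => O.pow (ks k i)) (s c)) ⨟
      d.h0.t.rprod m (fun c => d.h1.t.prod (t c) fun i => O.tree ((s c).map (ks · i))) ⨟
      O.tree (m.map fun c => (t c).map v) := by
  set F : μ → A := fun c => d.chi (t c) (fun k i => O.pow (ks k i)) (s c) ⨟
    d.h1.t.prod (t c) fun i => O.tree ((s c).map (ks · i)) with hF
  have hs : d.src (d.h0.t.rprod m F) = d.h0.o.rprod (m.flatMap fun c => (s c).map fun k =>
      (t c).flatMap (ks k)) O.pow := by
    rw [DuoAlg.src_rprod₀, Mon.rprod_flatMap]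
    refine d.h0.o.rprod_congr fun c _ => ?_
    rw [hF, DuoAlg.src_comp, DuoAlg.src_chi, Mon.rprod_map]
    exact d.h0.o.rprod_congr fun k _ => (d.h1.o.prod_flatMap _ _ _).symm
  have ht : d.tgt (d.h0.t.rprod m F) = d.h0.o.rprod (m.map fun c => (t c).map v) O.pow := by
    rw [DuoAlg.tgt_rprod₀, Mon.rprod_map]
    refine d.h0.o.rprod_congr fun c hc => ?_
    rw [hF, DuoAlg.tgt_comp, DuoAlg.tgt_prod₁, Function.comp, pow, Mon.prod_map]
    exact d.h1.o.prod_congr fun i hi => O.tgt_tree (hm c hc i hi)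
  rw [← d.h0.rprod_comp fun c _ => by
      rw [DuoAlg.tgt_chi, DuoAlg.src_prod₁]
      exact d.h1.o.prod_congr fun i _ => by rw [src_tree, Mon.rprod_map]; rfl,
    tree, tree, O.comps_blocks t s ks v m 1 n h hm, ← d.assoc, ← d.assoc,
    d.comp_mul₀ (by rw [DuoAlg.tgt_id, hs]) (by simp), d.id_comp hs, d.comp_id O.tgt_j]
  refine congrArg (fun u => u ⨟ _) ?_
  conv_rhs => rw [← d.h0.t.mul_one (d.h0.t.rprod m F), ← d.h0.id_one]
  rw [d.comp_mul₀ (by simp [ht]) (by simp), d.comp_id ht, d.id_comp O.src_j]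

end OneAlg

/-! ### The untyped 1-operad of a 1-operad -/

section

open GArr LevFam

namespace StrictDuoidal

variable {V : Type uV} [Category.{vV} V] [MonoidalCategory V] [SymmetricCategory V]
  {D : Type uD} [Category.{vD} D] [EnrichedOrdinaryCategory V D] (d : StrictDuoidal V D)
  (L : LaxSym.{w} V)

theorem comp_ofHom {X Y Z : D} (f : X ⟶ Y) (g : Y ⟶ Z) :
    ofHom L (f ≫ g) = (d.alg L).comp (ofHom L f) (ofHom L g) := ofHom_comp f g

theorem id_ofHom (X : D) : ofHom L (𝟙 X) = (d.alg L).id X := ofHom_id X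

theorem tens₀_ofHom {X X' Y Y' : D} (f : X ⟶ X') (g : Y ⟶ Y') :
    ofHom L (d.h0.tens f g) = (d.alg L).h0.t.mul (ofHom L f) (ofHom L g) := ofHom_tens d.h0 f g

theorem tens₁_ofHom {X X' Y Y' : D} (f : X ⟶ X') (g : Y ⟶ Y') :
    ofHom L (d.h1.tens f g) = (d.alg L).h1.t.mul (ofHom L f) (ofHom L g) := ofHom_tens d.h1 f g

/-- The untyped 1-operad of generalized arrows. -/
noncomputable def _root_.OneOperad.alg {d : StrictDuoidal V D} (O : OneOperad d)
    (L : LaxSym.{w} V) : OneAlg (d.alg L) where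
  obj := O.obj
  γ ks := ofHom L (O.γ ks)
  j := ofHom L O.j
  src_γ ks := congrArg (d.h0.mul · _) (d.prod_alg L ks O.obj)
  tgt_γ _ := rfl
  src_j := rfl
  tgt_j := rfl
  assoc kss := by
    have h := congrArg (ofHom L) (O.assoc kss)
    -- Transports are invisible to generalized arrows; the axiom becomes an equation without them.
    simp only [d.comp_ofHom, d.tens₀_ofHom, d.id_ofHom, ↓ofHom_eqToHom_comp,
      ↓ofHom_comp_eqToHom, d.ofHom_inter₂ L,
      ofHom_prodMap d.h1 (l := kss) (a := fun ks => ofHom L (O.γ ks)) fun _ _ => rfl] at h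
    simp only [d.prod_alg L] at h
    exact h
  unit_left n := by
    have h := congrArg (ofHom L) (O.unit_left n)
    simp only [d.comp_ofHom, d.tens₀_ofHom, d.id_ofHom, ↓ofHom_eqToHom_comp,
      eTo, d.ofHom_eProd1,
      ofHom_prodMap d.h1 (l := List.replicate n 1) (a := fun _ => ofHom L O.j)
        fun _ _ => ofHom_comp_eqToHom _ _, ofHom_eqToHom] at h
    exact h.trans (congrArg (GArr.id L) (d.h0.one_mul _))
  unit_right k := by
    have h := congrArg (ofHom L) (O.unit_right k)
    simp only [d.comp_ofHom, d.tens₀_ofHom, d.id_ofHom, ↓ofHom_eqToHom_comp, ofHom_eqToHom] at h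
    exact h.trans (congrArg (GArr.id L) (d.h0.mul_one _))

end StrictDuoidal

end

/-! ### Untyped multiplicative 1-operads -/

/-- A multiplicative 1-operad in an untyped strict duoidal category. -/
structure MultAlg {D A : Type*} (d : DuoAlg D A) extends OneAlg d where
  α : ℕ → A
  src_α : ∀ n, d.src (α n) = d.h1.o.one
  tgt_α : ∀ n, d.tgt (α n) = obj n
  α_γ : ∀ ks, d.comp (d.h0.t.mul (d.h1.t.prod ks α) (α ks.length)) (γ ks) = d.comp d.μ (α ks.sum)
  α_j : d.comp d.ε (α 1) = j

namespace DuoAlg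

variable {D A : Type*} (d : DuoAlg D A) {ι κ : Type}

local infixl:65 " ⨟ " => d.comp

/-- The combination needed for the action of a multiplicative 1-operad. Columns outside of `p`
consist of `v` and are contracted by its multiplication, so they are deleted; rows outside of `q`
consist of `v` and come from counits, which are pushed into the remaining columns. The maps `g` on
the contracted columns are left for the end. -/
theorem chi_filter_filter {t : List ι} {s : List κ} {G : κ → ι → D} (p : ι → Bool) (q : κ → Bool)
    {b g : ι → A} {B : ι → D} (hp : ∀ k ∈ s, ∀ i ∈ t, p i = false → G k i = d.h1.o.one)
    (hq : ∀ k ∈ s, ∀ i ∈ t, q k = false → G k i = d.h1.o.one)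
    (hs : ∀ i ∈ t, p i = true → d.src (b i) = d.h0.o.rprod s fun k => G k i)
    (ht : ∀ i ∈ t, p i = true → d.tgt (b i) = B i)
    (hg : ∀ i ∈ t, p i = false → d.src (g i) = d.h1.o.one) :
    d.h0.t.rprod s (fun k => bif q k then d.id (d.h1.o.prod t (G k)) else d.ε) ⨟ d.chi t G s ⨟
        d.h1.t.prod t (fun i => bif p i then b i else d.chi ([] : List ι) G s ⨟ g i) =
      d.chi (t.filter p) G (s.filter q) ⨟ d.h1.t.prod (t.filter p) (fun i =>
          d.h0.t.rprod s (fun k => bif q k then d.id (G k i) else d.ε) ⨟ b i) ⨟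
        d.h1.t.prod t (fun i => bif p i then d.id (B i) else g i) := by
  -- Only the multiplications of `v` are kept next to the interchange, where `chi_filter_left`
  -- absorbs them.
  have h1 : d.h1.t.prod t (fun i => bif p i then b i else d.chi ([] : List ι) G s ⨟ g i) =
      d.h1.t.prod t (fun i => bif p i then d.id (d.h0.o.rprod s fun k => G k i) else
        d.chi ([] : List ι) G s) ⨟ d.h1.t.prod t (fun i => bif p i then b i else g i) := by
    rw [← d.h1.prod_comp fun i hi => by
      cases h : p i
      · simp [hg i hi h]
      · simp [hs i hi h]]
    refine d.h1.t.prod_congr fun i hi => ?_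
    cases h : p i
    · rfl
    · exact (d.id_comp (hs i hi h)).symm
  have h2 : d.h1.t.prod (t.filter p) b ⨟ d.h1.t.prod t (fun i => bif p i then d.id (B i) else g i) =
      d.h1.t.prod t (fun i => bif p i then b i else g i) := by
    rw [Mon.prod_filter, ← d.h1.prod_comp fun i hi => by
      cases h : p i
      · simp [hg i hi h, d.h1.tgt_one]
      · simp [ht i hi h]]
    refine d.h1.t.prod_congr fun i hi => ?_
    cases h : p i
    · simp only [Bool.false_eq_true, if_false, cond_false]
      rw [← d.h1.id_one, d.id_comp (hg i hi h)]
    · exact d.comp_id (ht i hi h)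
  -- Columns of copies of `v` do not contribute to the product of a row.
  have h3 : d.h0.t.rprod s (fun k => bif q k then d.id (d.h1.o.prod t (G k)) else d.ε) =
      d.h0.t.rprod s (fun k => bif q k then d.id (d.h1.o.prod (t.filter p) (G k)) else d.ε) := by
    refine d.h0.t.rprod_congr fun k hk => ?_
    congr 2
    rw [Mon.prod_filter]
    refine d.h1.o.prod_congr fun i hi => ?_
    cases h : p i
    · exact hp k hk i hi h
    · rfl
  rw [h1, ← d.assoc, d.assoc _ (d.chi t G s), d.chi_filter_left p hp, h3,
    d.chi_filter_counit (t.filter p) q fun k hk i hi => hq k hk i (List.mem_of_mem_filter hi),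
    d.h1.prod_comp fun i hi => by
      rw [hs i (List.mem_of_mem_filter hi) (List.of_mem_filter hi), DuoAlg.tgt_rprod₀]
      refine d.h0.o.rprod_congr fun k hk => ?_
      cases h : q k
      · simp [hq k hk i (List.mem_of_mem_filter hi) h]
      · simp,
    ← h2]
  simp only [d.assoc]

end DuoAlg

namespace MultAlg

variable {D A : Type*} {d : DuoAlg D A} (O : MultAlg d) {ι κ : Type}

attribute [simp] src_α tgt_α

local infixl:65 " ⨟ " => d.comp
local infixl:70 " ⊠₀ " => d.h0.t.mul

/-- A morphism from `UAss` turns `γ` into `μ`. Level by level the structure maps become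
multiplications of `v`, which are collected in the interchange without columns, the iterated
multiplication. -/
theorem comps_α {n : ℕ} : ∀ {p : ℕ} {w : List (List ℕ)}, OneAlg.Fits p w n →
    d.h0.t.rprod w (fun r => d.h1.t.prod r O.α) ⊠₀ O.α p ⨟ O.comps p w =
      d.chi ([] : List Unit) (fun _ _ => d.h1.o.one) w ⊠₀ d.id d.h1.o.one ⨟ d.μ ⨟ O.α n
  | p, [], h => by
    obtain rfl : p = n := h
    simp only [Mon.rprod_nil, OneAlg.comps, DuoAlg.chi, DuoAlg.e1]
    rw [d.h0.t.one_mul, d.comp_id (O.tgt_α p), d.ε_μ, d.id_comp (O.src_α p)]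
  | _, r :: w, h => by
    obtain rfl : r.length = _ := h.1
    have ih := comps_α h.2
    set R := d.h0.t.rprod w fun r => d.h1.t.prod r O.α with hR
    set X := d.chi ([] : List Unit) (fun _ _ => d.h1.o.one) w with hX
    have hRt : d.tgt R = d.h0.o.rprod w O.pow := by
      simp only [hR, DuoAlg.tgt_rprod₀, DuoAlg.tgt_prod₁, tgt_α]
      rfl
    have hXt : d.tgt X = d.h1.o.one := by simp [hX]
    have hXs : d.src X = d.src R := by simp [hX, hR]
    have h1 : d.chi ([] : List Unit) (fun _ _ => d.h1.o.one) (r :: w) =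
      X ⊠₀ d.id d.h1.o.one ⨟ d.μ := rfl
    have h2 : d.id (d.src R) ⊠₀ d.μ ⨟ (R ⊠₀ O.α r.sum) =
        R ⊠₀ d.h1.t.prod r O.α ⊠₀ O.α r.length ⨟ (d.id (d.h0.o.rprod w O.pow) ⊠₀ O.γ r) := by
      rw [d.h0.t.assoc, d.comp_mul₀ (by simp) (by simp), d.comp_mul₀ (by simp [hRt]) (by
        simp), O.α_γ, d.id_comp rfl, d.comp_id hRt]
    -- `comps` multiplies from the root on, `chi` from the top level on; the associativity of `μ`
    -- reconciles the two orders.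
    have h3 : (X ⊠₀ d.id d.h1.o.one ⨟ d.μ) ⊠₀ d.id d.h1.o.one ⨟ d.μ =
        d.id (d.src R) ⊠₀ d.μ ⨟ (X ⊠₀ d.id d.h1.o.one) ⨟ d.μ := by
      have e1 : (X ⊠₀ d.id d.h1.o.one ⨟ d.μ) ⊠₀ d.id d.h1.o.one =
          X ⊠₀ d.id d.h1.o.one ⊠₀ d.id d.h1.o.one ⨟ (d.μ ⊠₀ d.id d.h1.o.one) := by
        rw [d.comp_mul₀ (by simp [hXt]) (by simp), d.id_comp (by simp)]
      rw [e1, d.assoc, d.μ_assoc, ← d.assoc, d.h0.t.assoc, d.comp_mul₀ (by simp [hXt]) (by simp),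
        d.comp_mul₀ (by simp [hXs]) (by simp), d.comp_id hXt, d.id_comp hXs, ← d.h0.id_mul,
        d.id_comp (by simp), d.comp_id (by simp)]
    rw [h1, h3, d.assoc, d.assoc, ← d.assoc (X ⊠₀ _), ← ih, ← d.assoc, h2, d.assoc]
    rfl

/-- The action of a tree is trivial on the images of the unit maps. -/
theorem tree_α {w : List (List ℕ)} {n : ℕ} (h : OneAlg.Fits 1 w n) :
    d.h0.t.rprod w (fun r => d.h1.t.prod r O.α) ⨟ O.tree w =
      d.chi ([] : List Unit) (fun _ _ => d.h1.o.one) w ⨟ O.α n := by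
  have ih := O.comps_α h
  set R := d.h0.t.rprod w fun r => d.h1.t.prod r O.α with hR
  set X := d.chi ([] : List Unit) (fun _ _ => d.h1.o.one) w with hX
  have hRt : d.tgt R = d.h0.o.rprod w O.pow := by
    simp only [hR, DuoAlg.tgt_rprod₀, DuoAlg.tgt_prod₁, tgt_α]
    rfl
  have hXt : d.tgt X = d.h1.o.one := by simp [hX]
  have hXs : d.src X = d.src R := by simp [hX, hR]
  have h1 : R ⨟ (d.id (d.h0.o.rprod w O.pow) ⊠₀ O.j) = d.id (d.src R) ⊠₀ d.ε ⨟ (R ⊠₀ O.α 1) := by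
    conv_lhs => rw [← d.h0.t.mul_one R, ← d.h0.id_one]
    rw [d.comp_mul₀ (by simp [hRt]) (by simp), d.comp_mul₀ (by simp) (by simp), d.comp_id hRt,
      d.id_comp (by simp), d.id_comp rfl, O.α_j]
  -- The unit `ε` at the root acts on a factor of its own, so it can be moved behind `X` and
  -- cancelled by `μ_ε`.
  have h2 : d.id (d.src R) ⊠₀ d.ε ⨟ (X ⊠₀ d.id d.h1.o.one) = X ⨟ (d.id d.h1.o.one ⊠₀ d.ε) := by
    conv_rhs => rw [← d.h0.t.mul_one X, ← d.h0.id_one]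
    rw [d.comp_mul₀ (by simp [hXs]) (by simp), d.comp_mul₀ (by simp [hXt]) (by simp),
      d.comp_id (by simp), d.id_comp hXs, d.id_comp (by simp), d.comp_id hXt]
  rw [OneAlg.tree, ← d.assoc, h1, d.assoc, ih, ← d.assoc, ← d.assoc, h2, d.assoc X, d.μ_ε,
    d.comp_id hXt]

end MultAlg

/-! ### The action along a tree and its decomposition along a map of trees -/

namespace MultAlg

open LevFam

variable {D A : Type*} {d : DuoAlg D A} (O : MultAlg d)

local infixl:65 " ⨟ " => d.comp

/-- The numbers of inputs of the vertices, level by level. -/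
def _root_.LevFam.arities (X : LevFam Bool (Bool × ℕ)) : List (List ℕ) :=
  (List.finRange X.length).map fun c => (X.row c).map fun p => (X.label p).2

theorem fits_arities {X : LevFam Bool (Bool × ℕ)} {p n : ℕ} (h : IsTree p X n) :
    OneAlg.Fits p X.arities n := by
  have h' := (IsTree.iff_chain _ _ _).1 h
  rw [IsTree.stat_self] at h'
  simpa [OneAlg.Fits, arities, IsTree.stat, Function.comp_def] using h'

theorem arities_fib {X Y : LevFam Bool (Bool × ℕ)} (f : Map X Y) (i : Y.Pos) :
    (fib f i).arities = (overLev f i.1).map fun l => (overPos f l i).map fun p => (X.label p).2 := by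
  rw [← map_incLev_fib, List.map_map, arities]
  refine List.map_congr_left fun l _ => ?_
  rw [Function.comp, ← map_incPos_row_fib, List.map_map]
  exact List.map_congr_left fun p _ => congrArg Prod.snd (label_sub p)

theorem arities_over {X Y : LevFam Bool (Bool × ℕ)} (f : Map X Y) :
    X.arities = (List.finRange Y.length).flatMap fun c => (overLev f c).map fun l =>
      (Y.row c).flatMap fun i => (overPos f l i).map fun p => (X.label p).2 := by
  rw [arities, finRange_eq f, List.map_flatMap]
  refine List.flatMap_congr fun c _ => List.map_congr_left fun l hl => ?_
  rw [row_eq f l, mem_overLev.1 hl, List.map_flatMap]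

/-- The object of a vertex. -/
def vert (b : Bool × ℕ) : D := bif b.1 then O.obj b.2 else d.h1.o.one

/-- The map from the object of a vertex. -/
def entry (b : Bool × ℕ) : A := bif b.1 then d.id (O.obj b.2) else O.α b.2

@[simp] theorem src_entry (b : Bool × ℕ) : d.src (O.entry b) = O.vert b := by
  rcases b with ⟨_ | _, n⟩ <;> simp [entry, vert]

@[simp] theorem tgt_entry (b : Bool × ℕ) : d.tgt (O.entry b) = O.obj b.2 := by
  rcases b with ⟨_ | _, n⟩ <;> simp [entry]

/-- The action of a tree. -/
def act (X : LevFam Bool (Bool × ℕ)) : A :=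
  big d.h0.t d.h1.t X (fun p => O.entry (X.label p)) ⨟ O.tree X.arities

theorem src_act (X : LevFam Bool (Bool × ℕ)) :
    d.src (O.act X) = big d.h0.o d.h1.o X fun p => O.vert (X.label p) := by simp [act]

theorem tgt_act {X : LevFam Bool (Bool × ℕ)} {n : ℕ} (h : IsTree 1 X n) :
    d.tgt (O.act X) = O.obj n := by rw [act, d.tgt_comp, O.tgt_tree (fits_arities h)]

theorem tgt_big_entry (X : LevFam Bool (Bool × ℕ)) :
    d.tgt (big d.h0.t d.h1.t X fun p => O.entry (X.label p)) = d.h0.o.rprod X.arities O.pow := by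
  rw [DuoAlg.tgt_big, arities, Mon.rprod_map, big]
  refine d.h0.o.rprod_congr fun c _ => ?_
  rw [Function.comp, OneAlg.pow, Mon.prod_map]
  exact d.h1.o.prod_congr fun p _ => by rw [tgt_entry]; rfl

/-- The action of a tree in terms of the actions of the fibres of a map. -/
theorem act_over {X Y : LevFam Bool (Bool × ℕ)} (f : Map X Y) {n : ℕ} (hY : IsTree 1 Y n)
    (hf : ∀ i, IsTree 1 (fib f i) (Y.label i).2) :
    O.act X = d.com f (fun p => O.vert (X.label p)) ⨟
      big d.h0.t d.h1.t Y (fun i => O.act (fib f i)) ⨟ O.tree Y.arities := by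
  have h1 := O.tree_blocks Y.row (overLev f)
    (fun l i => (overPos f l i).map fun p => (X.label p).2) (fun i => (Y.label i).2)
    (List.finRange Y.length) n (fits_arities hY) fun c _ i hi => by
      have := fits_arities (hf i)
      rwa [arities_fib, mem_row.1 hi] at this
  have h2 : (d.h0.t.rprod (List.finRange Y.length) fun c => d.chi (Y.row c) (fun l i =>
      O.pow ((overPos f l i).map fun p => (X.label p).2)) (overLev f c)) =
      d.com f fun p => O.obj (X.label p).2 := by
    refine d.h0.t.rprod_congr fun c _ => d.chi_congr fun l _ i _ => ?_
    rw [OneAlg.pow, Mon.prod_map]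
    rfl
  have h3 : (d.h0.t.rprod (List.finRange Y.length) fun c => d.h1.t.prod (Y.row c) fun i =>
      O.tree ((overLev f c).map fun l => (overPos f l i).map fun p => (X.label p).2)) =
      big d.h0.t d.h1.t Y fun i => O.tree (fib f i).arities := by
    refine d.h0.t.rprod_congr fun c _ => d.h1.t.prod_congr fun i hi => ?_
    rw [arities_fib, mem_row.1 hi]
  have h4 : ∀ i, big d.h0.t d.h1.t (fib f i) (fun p => O.entry (X.label (incPos p))) =
      big d.h0.t d.h1.t (fib f i) fun p => O.entry ((fib f i).label p) :=
    fun i => big_congr fun p => congrArg O.entry (label_sub p).symm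
  rw [h2, h3, ← arities_over f] at h1
  rw [act, h1, ← d.assoc, ← d.assoc, d.com_nat f fun p => O.tgt_entry _, d.assoc (d.com f _),
    ← d.big_comp fun i => by rw [h4, tgt_big_entry, O.src_tree]]
  simp only [h4, src_entry]
  rfl

/-- The action of a tree without white vertices. -/
theorem act_of_not_white {X : LevFam Bool (Bool × ℕ)} {n : ℕ} (h : IsTree 1 X n)
    (hX : ∀ p, (X.label p).1 = false) {ι κ : Type} (G : κ → ι → D) {s : List κ}
    (hs : s.length = X.length) :
    O.act X = d.chi ([] : List ι) G s ⨟ O.α n := by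
  have h1 : (big d.h0.t d.h1.t X fun p => O.entry (X.label p)) =
      d.h0.t.rprod X.arities fun r => d.h1.t.prod r O.α := by
    rw [arities, Mon.rprod_map]
    refine d.h0.t.rprod_congr fun c _ => ?_
    rw [Function.comp, Mon.prod_map]
    exact d.h1.t.prod_congr fun p _ => by rw [entry, hX]; rfl
  -- The iterated multiplication depends only on the number of factors, so the levels may be listed
  -- by any `s` of the right length.
  have h2 : ∀ {κ κ' : Type} (s : List κ) (s' : List κ'), s.length = s'.length →
      d.chi ([] : List Unit) (fun _ _ => d.h1.o.one) s =
        d.chi ([] : List Unit) (fun _ _ => d.h1.o.one) s' := by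
    intro κ κ' s s' e
    have h3 : ∀ {κ : Type} (s : List κ), d.chi ([] : List Unit) (fun _ _ => d.h1.o.one) s =
        d.chi ([] : List Unit) (fun _ _ => d.h1.o.one) (List.replicate s.length ()) := by
      intro κ s
      rw [← List.map_const', d.chi_map_right]
    rw [h3 s, h3 s', e]
  rw [act, h1, O.tree_α (fits_arities h), d.chi_nil_left (ι' := Unit) G,
    ← d.chi_nil_left (ι := Unit) (ι' := Unit) (fun _ _ => d.h1.o.one) s, h2 s X.arities]
  rw [hs, arities, List.length_map, List.length_finRange]

/-- The counits on the horizontal levels. -/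
def counits (X : LevFam Bool (Bool × ℕ)) : A :=
  d.h0.t.rprod (List.finRange X.length) fun c => bif X.flag c then d.ε else
    d.id (d.h1.o.prod (X.row c) fun p => O.vert (X.label p))

/-- The action of a tree with `e` for the horizontal levels. -/
def xi (X : LevFam Bool (Bool × ℕ)) : A := O.counits X ⨟ O.act X

theorem prod_vert {T : LTree} (l : List T.fam.Pos) :
    d.h1.o.prod l (fun q => O.vert (T.fam.label q)) =
      d.h1.o.prod (l.filter T.white) fun q => O.obj (T.ar q) := by
  rw [Mon.prod_filter]
  refine d.h1.o.prod_congr fun q _ => ?_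
  rw [vert, LTree.white]
  cases (T.fam.label q).1 <;> rfl

theorem prod_vert_eq_one {T : LTree} {l : List T.fam.Pos} (h : ∀ q ∈ l, T.white q = false) :
    d.h1.o.prod l (fun q => O.vert (T.fam.label q)) = d.h1.o.one := by
  rw [prod_vert, List.filter_eq_nil_iff.2 fun q hq => by rw [h q hq]; exact Bool.false_ne_true]
  rfl

theorem prod_vert_of_flag {T : LTree} {c : T.fam.Lev} (hc : T.fam.flag c = true)
    {l : List T.fam.Pos} (h : ∀ q ∈ l, q.1 = c) :
    d.h1.o.prod l (fun q => O.vert (T.fam.label q)) = d.h1.o.one :=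
  O.prod_vert_eq_one fun q hq => T.hor q (by rw [h q hq, hc])

variable {T S : LTree} (f : T ⟶ S)

theorem counits_fib (i : S.fam.Pos) : O.counits (LTree.fib f i).fam =
    d.h0.t.rprod (overLev (LTree.Hom.map f) i.1) fun l => bif T.nonHor l then
      d.id (d.h1.o.prod (overPos (LTree.Hom.map f) l i) fun p => O.vert (T.fam.label p))
      else d.ε := by
  rw [counits, ← map_incLev_fib, Mon.rprod_map]
  refine d.h0.t.rprod_congr fun l _ => ?_
  rw [Function.comp, ← map_incPos_row_fib, Mon.prod_map, LTree.nonHor, ← LTree.flag_fib f i l]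
  have h : (fun p => O.vert (T.fam.label p)) ∘ incPos =
      fun p => O.vert ((LTree.fib f i).fam.label p) :=
    funext fun p => congrArg O.vert (label_sub p).symm
  rw [h]
  cases (LTree.fib f i).fam.flag l <;> rfl

theorem act_fib {c : S.fam.Lev} {i : S.fam.Pos} (hi : i ∈ S.fam.row c)
    (G : T.fam.Lev → S.fam.Pos → D) : O.act (LTree.fib f i).fam =
      bif S.white i then O.act (LTree.fib f i).fam else
        d.chi ([] : List S.fam.Pos) G (overLev (LTree.Hom.map f) c) ⨟ O.α (S.ar i) := by
  cases h : S.white i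
  · refine O.act_of_not_white (LTree.Hom.fib_tree f i) (fun p => ?_) G ?_
    · rw [label_sub]
      by_contra hp
      have := LTree.Hom.white f (incPos p) (by simpa [LTree.white] using hp)
      rw [pos_incPos, h] at this
      exact absurd this (by simp)
    · rw [← mem_row.1 hi]
      exact (List.length_map _).symm
  · rfl

theorem prod_vert_row (l : T.fam.Lev) {c : S.fam.Lev} (hl : (LTree.Hom.map f).lev l = c) :
    d.h1.o.prod (T.fam.row l) (fun q => O.vert (T.fam.label q)) =
      d.h1.o.prod (S.fam.row c) fun i =>
        d.h1.o.prod (overPos (LTree.Hom.map f) l i) fun q => O.vert (T.fam.label q) := by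
  rw [row_eq (LTree.Hom.map f) l, Mon.prod_flatMap, hl]

theorem src_act_fib {c : S.fam.Lev} {i : S.fam.Pos} (hi : i ∈ S.fam.row c) :
    d.src (O.act (LTree.fib f i).fam) = d.h0.o.rprod (overLev (LTree.Hom.map f) c) fun l =>
      d.h1.o.prod (overPos (LTree.Hom.map f) l i) fun q => O.vert (T.fam.label q) := by
  rw [src_act, ← mem_row.1 hi, ← big_fib]
  exact big_congr fun p => congrArg O.vert (label_sub p)

/-- Vertices of `c` that are not white are columns of copies of `v`, on which the fibre acts by
multiplication and `α` (`act_fib`); horizontal levels of `T` are rows of copies of `v` entered by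
counits. Hence `chi_filter_filter` applies, and keeps the white vertices and the levels that are not
horizontal. -/
theorem xi_level (c : S.fam.Lev) :
    d.h0.t.rprod (overLev (LTree.Hom.map f) c) (fun l => bif T.fam.flag l then d.ε else
        d.id (d.h1.o.prod (T.fam.row l) fun p => O.vert (T.fam.label p))) ⨟
      d.chi (S.fam.row c) (fun l i => d.h1.o.prod (overPos (LTree.Hom.map f) l i) fun q =>
        O.vert (T.fam.label q)) (overLev (LTree.Hom.map f) c) ⨟
      d.h1.t.prod (S.fam.row c) (fun i => O.act (LTree.fib f i).fam) =
    (bif S.fam.flag c then d.id d.h0.o.one else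
        d.chi ((S.fam.row c).filter S.white) (fun l i => d.h1.o.prod
          ((overPos (LTree.Hom.map f) l i).filter T.white) fun q => O.obj (T.ar q))
          ((overLev (LTree.Hom.map f) c).filter T.nonHor) ⨟
        d.h1.t.prod ((S.fam.row c).filter S.white) fun i => O.xi (LTree.fib f i).fam) ⨟
      (bif S.fam.flag c then d.ε else
        d.id (d.h1.o.prod (S.fam.row c) fun p => O.vert (S.fam.label p))) ⨟
      d.h1.t.prod (S.fam.row c) fun p => O.entry (S.fam.label p) := by
  set G : T.fam.Lev → S.fam.Pos → D := fun l i =>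
    d.h1.o.prod (overPos (LTree.Hom.map f) l i) fun q => O.vert (T.fam.label q) with hG
  have h1 : d.h0.t.rprod (overLev (LTree.Hom.map f) c) (fun l => bif T.fam.flag l then d.ε else
      d.id (d.h1.o.prod (T.fam.row l) fun p => O.vert (T.fam.label p))) =
      d.h0.t.rprod (overLev (LTree.Hom.map f) c) fun l => bif T.nonHor l then
        d.id (d.h1.o.prod (S.fam.row c) (G l)) else d.ε := by
    refine d.h0.t.rprod_congr fun l hl => ?_
    rw [O.prod_vert_row f l (mem_overLev.1 hl), LTree.nonHor]
    cases T.fam.flag l <;> rfl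
  have hp : ∀ l ∈ overLev (LTree.Hom.map f) c, ∀ i ∈ S.fam.row c, S.white i = false →
      G l i = d.h1.o.one := by
    intro l _ i _ hi
    refine O.prod_vert_eq_one fun q hq => ?_
    have h := (mem_selPos.1 hq).2
    rw [decide_eq_true_eq] at h
    by_contra hw
    have := LTree.Hom.white f q (by simpa using hw)
    rw [h, hi] at this
    exact absurd this (by simp)
  have hq : ∀ l ∈ overLev (LTree.Hom.map f) c, ∀ i ∈ S.fam.row c, T.nonHor l = false →
      G l i = d.h1.o.one := by
    intro l _ i _ hl
    exact O.prod_vert_of_flag (c := l) (by simpa [LTree.nonHor] using hl)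
      fun q hq => (mem_selPos.1 hq).1
  rw [h1, d.h1.t.prod_congr fun i hi => O.act_fib f hi G,
    d.chi_filter_filter (B := fun i => O.obj (S.ar i)) S.white T.nonHor hp hq
      (fun i hi _ => O.src_act_fib f hi) (fun i hi _ => O.tgt_act (LTree.Hom.fib_tree f i))
      fun i _ _ => O.src_α _]
  have h2 : d.h1.t.prod (S.fam.row c) (fun i => bif S.white i then d.id (O.obj (S.ar i)) else
      O.α (S.ar i)) = d.h1.t.prod (S.fam.row c) fun p => O.entry (S.fam.label p) := rfl
  rw [h2]
  refine congrArg (fun u => u ⨟ _) ?_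
  cases hc : S.fam.flag c
  · simp only [cond_false]
    rw [d.comp_id (by
      rw [d.tgt_comp, DuoAlg.tgt_prod₁, prod_vert]
      refine d.h1.o.prod_congr fun i _ => ?_
      rw [xi, d.tgt_comp]
      exact O.tgt_act (LTree.Hom.fib_tree f i))]
    refine congrArg₂ d.comp (d.chi_congr fun l _ i _ => O.prod_vert _)
      (d.h1.t.prod_congr fun i hi => ?_)
    rw [xi, counits_fib, mem_row.1 (List.mem_of_mem_filter hi)]
  -- A horizontal level has no white vertices, and only horizontal levels lie over it. Nothing is
  -- kept, and the interchange of the empty array is `ε`, the counit of the level `c`.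
  · have h3 : (S.fam.row c).filter S.white = [] := by
      rw [List.filter_eq_nil_iff]
      intro p hp
      rw [LTree.white, S.hor p (by rw [mem_row.1 hp, hc])]
      exact Bool.false_ne_true
    have h4 : (overLev (LTree.Hom.map f) c).filter T.nonHor = [] := by
      rw [List.filter_eq_nil_iff]
      intro l hl
      rw [LTree.nonHor, LTree.Hom.hor f l (by rw [mem_overLev.1 hl, hc])]
      exact Bool.false_ne_true
    rw [h3, h4]
    simp only [cond_true, Mon.prod_nil, DuoAlg.chi, DuoAlg.e1]
    rw [d.id_comp (by simp), ← d.h1.id_one, d.comp_id (by simp)]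

/-- The action of a tree is determined by the actions of the fibres of a map. -/
theorem xi_map : O.xi T.fam =
    d.com (LTree.omegaMap f).map (fun q => O.obj (T.ar (T.omegaInc.pos q))) ⨟
      big d.h0.t d.h1.t S.omegaFam (fun p => O.xi (LTree.fib f (S.omegaInc.pos p)).fam) ⨟
      O.xi S.fam := by
  rw [d.com_omega_big f (fun q => O.obj (T.ar q)) (z := fun i => O.xi (LTree.fib f i).fam) ?_]
  · have h0 : O.xi S.fam = O.counits S.fam ⨟
        (big d.h0.t d.h1.t S.fam (fun p => O.entry (S.fam.label p)) ⨟ O.tree S.fam.arities) := rfl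
    rw [h0, xi, O.act_over (LTree.Hom.map f) S.tree (LTree.Hom.fib_tree f)]
    simp only [← d.assoc]
    refine congrArg (fun u => u ⨟ _) ?_
    have h1 : O.counits T.fam = d.h0.t.rprod (List.finRange S.fam.length) fun c =>
        d.h0.t.rprod (overLev (LTree.Hom.map f) c) fun l => bif T.fam.flag l then d.ε else
          d.id (d.h1.o.prod (T.fam.row l) fun p => O.vert (T.fam.label p)) := by
      rw [counits, finRange_eq (LTree.Hom.map f), Mon.rprod_flatMap]
    rw [h1, DuoAlg.com, big, counits, big]
    -- All factors are now products over the levels of `S`, so the identity is checked one level at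
    -- a time.
    rw [← d.h0.rprod_comp, ← d.h0.rprod_comp, ← d.h0.rprod_comp, ← d.h0.rprod_comp]
    · exact d.h0.t.rprod_congr fun c _ => O.xi_level f c
    · intro c _
      simp only [d.tgt_comp, DuoAlg.src_prod₁, src_entry]
      cases hc : S.fam.flag c
      · simp
      · simp [O.prod_vert_of_flag hc fun q hq => mem_row.1 hq]
    · intro c _
      cases S.fam.flag c
      · simp only [cond_false, d.tgt_comp, DuoAlg.tgt_prod₁, d.src_id, prod_vert]
        exact d.h1.o.prod_congr fun i _ =>
          (d.tgt_comp _ _).trans (O.tgt_act (LTree.Hom.fib_tree f i))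
      · simp
    · intro c _
      rw [d.tgt_comp, DuoAlg.tgt_chi, DuoAlg.src_prod₁]
      exact d.h1.o.prod_congr fun i hi => (O.src_act_fib f hi).symm
    · intro c _
      rw [DuoAlg.tgt_rprod₀, DuoAlg.src_chi]
      refine d.h0.o.rprod_congr fun l hl => ?_
      rw [← O.prod_vert_row f l (mem_overLev.1 hl)]
      cases hc : T.fam.flag l
      · simp
      · simp [O.prod_vert_of_flag hc fun q hq => mem_row.1 hq]
  · intro i _
    rw [xi, d.src_comp, counits_fib, DuoAlg.src_rprod₀, Mon.rprod_filter]
    refine d.h0.o.rprod_congr fun l _ => ?_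
    rw [← prod_vert]
    cases T.nonHor l <;> simp

theorem _root_.OneAlg.tree_single (O : OneAlg d) (n : ℕ) : O.tree [[n]] = d.id (O.obj n) := by
  have h := O.unit_right n
  simp only [OneAlg.tree, OneAlg.comps, Mon.rprod_single, Mon.rprod_nil, OneAlg.pow,
    Mon.prod_single, List.sum_singleton]
  rw [d.h0.id_one, d.h0.t.one_mul, d.comp_id (by simp), h]

theorem xi_U (n : ℕ) : O.xi (LTree.U n).fam = d.id (O.obj n) := by
  have h1 : O.counits (LTree.U n).fam = d.id (O.obj n) :=
    (Mon.rprod_single _ (⟨0, Nat.one_pos⟩ : (LTree.U n).fam.Lev) _).trans (congrArg d.id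
      (Mon.prod_single _ (⟨⟨0, Nat.one_pos⟩, ⟨0, Nat.one_pos⟩⟩ : (LTree.U n).fam.Pos) _))
  have h2 : (big d.h0.t d.h1.t (LTree.U n).fam fun p => O.entry ((LTree.U n).fam.label p)) =
      d.id (O.obj n) :=
    (Mon.rprod_single _ (⟨0, Nat.one_pos⟩ : (LTree.U n).fam.Lev) _).trans
      (Mon.prod_single _ (⟨⟨0, Nat.one_pos⟩, ⟨0, Nat.one_pos⟩⟩ : (LTree.U n).fam.Pos) _)
  have h3 : O.tree (LTree.U n).fam.arities = d.id (O.obj n) := O.tree_single n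
  rw [xi, act, h1, h2, h3, d.id_comp (d.src_id _), d.id_comp (d.src_id _)]

end MultAlg

/-! ### The maps `Ξ` on elements -/

section

open GArr LevFam OperadData

variable {V : Type uV} [Category.{vV} V] [MonoidalCategory V] [SymmetricCategory V]
  {D : Type uD} [Category.{vD} D] [EnrichedOrdinaryCategory V D] {d : StrictDuoidal V D}

/-- The untyped multiplicative 1-operad of generalized arrows. -/
noncomputable def MultOneOperad.alg (O : MultOneOperad d) (L : LaxSym.{w} V) :
    MultAlg (d.alg L) where
  toOneAlg := O.toOneOperad.alg L
  α n := ofHom L (O.α.map n)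
  src_α _ := rfl
  tgt_α _ := rfl
  α_γ ks := by
    have h := congrArg (ofHom L) (O.α.γ ks)
    have h' : ofHom L ((uAss d).γ ks) = (d.alg L).μ := ofHom_eqToHom_comp _ _
    rw [d.comp_ofHom, d.comp_ofHom, h', d.tens₀_ofHom,
      ofHom_prodMap d.h1 (l := ks) (a := fun k => ofHom L (O.α.map k)) fun _ _ => rfl] at h
    exact h.symm
  α_j := (d.comp_ofHom L d.ε (O.α.map 1)).symm.trans (congrArg (ofHom L) O.α.j)

theorem LevFam.map_label_row {A B : Type} (X : LevFam A B) (c : X.Lev) :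
    (X.row c).map X.label = (X.get c).2 := by
  rw [row, List.map_map]
  exact List.map_get_finRange _

theorem LevFam.map_arities (X : LevFam Bool (Bool × ℕ)) :
    X.map (fun K => K.2.map Prod.snd) = X.arities := by
  rw [arities]
  conv_lhs => rw [← List.map_get_finRange X, List.map_map]
  refine List.map_congr_left fun c _ => ?_
  rw [Function.comp, ← X.map_label_row, List.map_map]
  rfl

theorem OneOperad.rprod_pow (O : OneOperad d) (L : LaxSym.{w} V) (X : LevFam Bool (Bool × ℕ)) :
    (d.alg L).h0.o.rprod (X.map fun K => K.2.map Prod.snd) (O.alg L).pow =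
      d.h0.rprod X fun K => d.h1.prod K.2 fun b => O.obj b.2 := by
  rw [Mon.rprod_map, d.rprod_alg L]
  refine (d.alg L).h0.o.rprod_congr fun K _ => ?_
  rw [d.prod_alg L, Function.comp, OneAlg.pow, Mon.prod_map]
  rfl

theorem OneOperad.ofHom_γTree (O : OneOperad d) (L : LaxSym.{w} V) :
    ∀ (p : ℕ) (X : LevFam Bool (Bool × ℕ)) (n : ℕ) (h : IsTree p X n),
    ofHom L (O.γTree p X n h) = (O.alg L).comps p (X.map fun K => K.2.map Prod.snd)
  | p, [], n, h => by
    obtain rfl : p = n := h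
    exact ofHom_eqToHom (L := L) (d.h0.one_mul (O.obj p)) |>.trans
      (congrArg (GArr.id L) (d.h0.one_mul (O.obj p)))
  | p, K :: X, n, h => by
    obtain ⟨rfl, h'⟩ := h

    refine (ofHom_eqToHom_comp _ _).trans ((d.comp_ofHom L _ _).trans ?_)
    rw [OneOperad.ofHom_γTree O L _ X n h', d.tens₀_ofHom, ofHom_eqToHom_comp, List.map_cons,
      OneAlg.comps, O.rprod_pow, d.id_ofHom]
    rfl

namespace MultOneOperad

variable (O : MultOneOperad d) (L : LaxSym.{w} V)

/-- The unit maps. -/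
abbrev unitMap (n : ℕ) : d.v ⟶ O.obj n := O.α.map n

/-- The counits at the vertices of a horizontal level cancel its comultiplication by `e1_counit`, so
a single counit for the whole level is left. This explains the form of `MultAlg.counits`. -/
theorem ofHom_hpowTo {X : ℕ → D} (φ : ∀ n, d.v ⟶ X n) : ∀ l : List (Bool × ℕ),
    (d.alg L).comp (ofHom L (d.expand l.length))
      (ofHom L (d.hpowTo (X := fun b => X b.2) l fun b _ => d.ε ≫ φ b.2)) =
    (d.alg L).comp (d.alg L).ε ((d.alg L).h1.t.prod l fun b => ofHom L (φ b.2)) := by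
  -- `expand` stops at one factor, while `e1` goes on to a counit; for a nonempty list the counit
  -- law identifies them. For the empty list `expand` is the identity, and the `ε` comes from
  -- `hpowTo`.
  suffices h : ∀ l : List (Bool × ℕ), (d.alg L).comp (ofHom L (d.expand l.length))
      (ofHom L (d.hpowTo (X := fun b => X b.2) l fun b _ => d.ε ≫ φ b.2)) =
      (d.alg L).comp ((d.alg L).e1 l) ((d.alg L).h1.t.prod l fun b =>
        (d.alg L).comp (d.alg L).ε (ofHom L (φ b.2))) by
    intro l
    rw [h l, (d.alg L).h1.prod_comp fun _ _ => rfl, ← (d.alg L).assoc, (d.alg L).e1_counit]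
  intro l
  induction l with
  | nil =>
    refine (congrArg (fun u => (d.alg L).comp u (ofHom L d.ε)) (ofHom_id d.e)).trans ?_
    refine ((d.alg L).id_comp (a := ofHom L d.ε) (X := d.e) rfl).trans ?_
    exact ((d.alg L).comp_id (a := ofHom L d.ε) (X := d.v) rfl).symm
  | cons b l ih =>
    rcases l with _ | ⟨b', l⟩
    · have h1 : ofHom L (d.hpowTo (X := fun b => X b.2) [b] fun b _ => d.ε ≫ φ b.2) =
          (d.alg L).comp (d.alg L).ε (ofHom L (φ b.2)) :=
        (ofHom_comp_eqToHom _ _).trans (d.comp_ofHom L _ _)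
      rw [h1, (d.alg L).e1_single, Mon.prod_single]
      exact congrArg (fun u => (d.alg L).comp u _) (ofHom_id d.e)
    · have h1 : ofHom L (d.hpowTo (X := fun b => X b.2) (b :: b' :: l) fun b _ => d.ε ≫ φ b.2) =
          (d.alg L).h1.t.mul (ofHom L (d.ε ≫ φ b.2))
            (ofHom L (d.hpowTo (X := fun b => X b.2) (b' :: l) fun b _ => d.ε ≫ φ b.2)) :=
        d.tens₁_ofHom L (d.ε ≫ φ b.2) _
      have h2 : ofHom L (d.expand (b :: b' :: l).length) = (d.alg L).comp (d.alg L).δ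
          ((d.alg L).h1.t.mul ((d.alg L).id d.e) (ofHom L (d.expand (b' :: l).length))) :=
        d.ofHom_expand_succ L l.length
      rw [h1, h2, (d.alg L).assoc, (d.alg L).comp_mul₁ rfl rfl, ih,
        (d.alg L).id_comp (a := ofHom L (d.ε ≫ φ b.2)) (X := d.e) rfl]
      generalize b' :: l = m
      rw [DuoAlg.e1, Mon.prod_cons, (d.alg L).assoc,
        (d.alg L).comp_mul₁ rfl (by simp), d.comp_ofHom]
      rw [(d.alg L).id_comp (by rfl)]
      rfl

theorem ofHom_ω (X : LevFam Bool (Bool × ℕ)) :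
    ofHom L (O.ω X) = (d.alg L).h0.t.rprod X fun K =>
      bif K.1 then ofHom L (d.hpowTo (X := fun b => O.obj b.2) K.2
        fun b _ => d.ε ≫ O.unitMap b.2) else
      (d.alg L).h1.t.prod K.2 (O.alg L).entry := by
  refine ofHom_rprodMap _ fun K _ => ?_
  split_ifs with h
  · rw [ofHom_eqToHom_comp, h]
    rfl
  · rw [ofHom_eqToHom_comp]
    refine (ofHom_prodMap _ fun b _ => ?_).trans (cond_eq_ite .. ▸ (if_neg h).symm)
    split_ifs with hb
    · rw [ofHom_eqToHom, MultAlg.entry, hb]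
      exact congrArg (GArr.id L) (d.vert_white O.obj hb)
    · refine (ofHom_eqToHom_comp _ _).trans ?_
      rw [Bool.not_eq_true] at hb
      rw [MultAlg.entry, hb]
      rfl

/-- On horizontal levels this is `ofHom_hpowTo`; on the others `expandTree` is the identity and `ω`
consists of the entries of the vertices. -/
theorem ofHom_expandTree_ω (T : LTree) :
    (d.alg L).comp (ofHom L (d.expandTree O.obj T)) (ofHom L (O.ω T.fam)) =
      (d.alg L).comp ((O.alg L).counits T.fam)
        (big (d.alg L).h0.t (d.alg L).h1.t T.fam fun p => (O.alg L).entry (T.fam.label p)) := by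
  have h2 : ∀ c : T.fam.Lev, (d.alg L).h1.t.prod (T.fam.get c).2 (O.alg L).entry =
      (d.alg L).h1.t.prod (T.fam.row c) fun p => (O.alg L).entry (T.fam.label p) := by
    intro c
    rw [← T.fam.map_label_row c, Mon.prod_map]
    rfl
  have h1 : ofHom L (O.ω T.fam) = (d.alg L).h0.t.rprod (List.finRange T.fam.length) fun c =>
      bif T.fam.flag c then ofHom L (d.hpowTo (X := fun b => O.obj b.2) (T.fam.get c).2
        fun b _ => d.ε ≫ O.unitMap b.2) else
      (d.alg L).h1.t.prod (T.fam.get c).2 (O.alg L).entry :=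
    (O.ofHom_ω L T.fam).trans (Mon.rprod_get _ _ _)
  rw [h1, d.ofHom_expandTree, MultAlg.counits, big, ← (d.alg L).h0.rprod_comp,
    ← (d.alg L).h0.rprod_comp]
  · refine (d.alg L).h0.t.rprod_congr fun c _ => ?_
    cases hc : T.fam.flag c
    · simp only [cond_false, h2]
      rfl
    · simp only [cond_true, ← h2]
      have h3 : (d.alg L).h1.t.prod (T.fam.get c).2 (O.alg L).entry =
          (d.alg L).h1.t.prod (T.fam.get c).2 fun b => ofHom L (O.unitMap b.2) := by
        rw [← T.fam.map_label_row c, Mon.prod_map, Mon.prod_map]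
        refine (d.alg L).h1.t.prod_congr fun p hp => ?_
        rw [Function.comp, MultAlg.entry, T.hor p (by rw [mem_row.1 hp, hc])]
        rfl
      have h : (T.fam.row c).length = (T.fam.get c).2.length := by
        rw [← T.fam.map_label_row c, List.length_map]
      rw [h3, h, ofHom_hpowTo]
  · intro c _
    rw [DuoAlg.src_prod₁]
    simp only [MultAlg.src_entry]
    cases hc : T.fam.flag c
    · rfl
    · rw [(O.alg L).prod_vert_of_flag hc fun q hq => mem_row.1 hq]
      rfl
  · intro c _
    cases hc : T.fam.flag c
    · simp only [cond_false, h2, DuoAlg.src_prod₁, MultAlg.src_entry]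
      rfl
    · have h : (T.fam.row c).length = (T.fam.get c).2.length := by
        rw [← T.fam.map_label_row c, List.length_map]
      exact congrArg d.hpow h

theorem ofHom_act (T : LTree) : ofHom L (O.act T) =
    (d.alg L).comp (ofHom L (O.ω T.fam)) ((O.alg L).tree T.fam.arities) := by
  refine (d.comp_ofHom L _ _).trans (congrArg ((d.alg L).comp _) ?_)
  refine (ofHom_eqToHom_comp _ _).trans ((d.comp_ofHom L _ _).trans ?_)
  rw [O.ofHom_γTree L, d.tens₀_ofHom, d.id_ofHom, map_arities]
  rw [← O.rprod_pow L, map_arities]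
  rfl

theorem ofHom_theta_act (T : LTree) :
    (d.alg L).comp (ofHom L (d.theta O.obj T)) (ofHom L (O.act T)) = (O.alg L).xi T.fam := by
  rw [ofHom_act, d.ofHom_theta, ← (d.alg L).assoc, ofHom_expandTree_ω, MultAlg.xi, MultAlg.act,
    (d.alg L).assoc]

/-- The composite of `Ψ` and `Λ`. -/
abbrev Xi (T : LTree) : (one LTrOC V).obj T ⟶ (d.endOmegaTree O.obj).obj T :=
  O.Psi T ≫ d.Lambda O.obj T

theorem arr_Xi (T : LTree) :
    arr (X := d.powOmega O.obj T.omega) (Y := O.obj T.arity) (L.map (O.Xi T) L.one) =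
      (O.alg L).xi T.fam := by
  refine (congrArg arr (L.map_comp _ _ _)).trans ((d.arr_Lambda L O.obj T _).trans ?_)
  exact O.ofHom_theta_act L T

/-- The elements `xi` are closed under the operations by `xi_map`, and contain the units by `xi_U`.
-/
theorem Xi_commutes : Commutes (one LTrOC V) (d.endOmegaTree O.obj) O.Xi := by
  refine Commutes.of_one (fun n => unit_ext _ _ fun L => ?_) fun L T S f => ?_
  · refine arr_injective (X := d.powOmega O.obj (LTree.U n).omega) (Y := O.obj n) ?_
    refine (O.arr_Xi L (LTree.U n)).trans (Eq.trans ?_ (d.arr_unit_endOmega L O.obj n).symm)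
    exact (O.alg L).xi_U n
  · refine arr_injective (X := d.powOmega O.obj T.omega) (Y := O.obj T.arity) ?_
    have o : GArr L D := GArr.id L d.e
    refine (O.arr_Xi L T).trans (Eq.trans ?_ (d.arr_endOmegaTree L O.obj f _ _ o).symm)
    refine ((O.alg L).xi_map f).trans ?_
    refine congrArg₂ (d.alg L).comp (congrArg₂ (d.alg L).comp ?_ ?_) (O.arr_Xi L S).symm
    · exact congrArg ((d.alg L).com _) (funext fun q => congrArg O.obj (T.label_omega q).symm)
    · refine big_congr fun p => ?_
      rw [S.extend_omega]
      exact (O.arr_Xi L _).symm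

end MultOneOperad

end

/-! ### The square and the invertibility of `Λ` -/

section

open GArr LevFam OperadData

namespace DuoAlg

variable {D A : Type*} (d : DuoAlg D A)

local infixl:65 " ⨟ " => d.comp
local infixl:70 " ⊠₁ " => d.h1.t.mul

/-- The left side is `δ` on the first factor followed by `ε` on the third of the resulting factors
`e`. The square moves this counit to the second factor, where it cancels `δ`. -/
theorem counit_comul_of_square
    (h : d.id d.h0.o.one ⊠₁ d.ε = d.ε ⊠₁ d.id d.h0.o.one) :
    d.id d.h0.o.one ⊠₁ d.ε ⨟ d.δ = d.id d.h0.o.one ⊠₁ d.id d.h0.o.one := by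
  have h1 : d.id d.h0.o.one ⊠₁ d.ε ⨟ d.δ =
      d.δ ⊠₁ d.id d.h0.o.one ⨟ (d.id d.h0.o.one ⊠₁ (d.id d.h0.o.one ⊠₁ d.ε)) := by
    conv_lhs => rw [← d.h1.t.mul_one d.δ, ← d.h1.id_one]
    rw [d.comp_mul₁ (by simp) (by simp), d.id_comp (by simp), d.comp_id (by simp),
      ← d.h1.t.assoc, d.comp_mul₁ (by simp) (by simp), d.id_comp (by simp), ← d.h1.id_mul,
      d.comp_id (by simp)]
  rw [h1, h, ← d.h1.t.assoc, d.comp_mul₁ (by simp) (by simp), d.δ_ε, d.comp_id (by simp)]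

end DuoAlg

namespace StrictDuoidal

variable {V : Type uV} [Category.{vV} V] [MonoidalCategory V] [SymmetricCategory V]
  {D : Type uD} [Category.{vD} D] [EnrichedOrdinaryCategory V D] (d : StrictDuoidal V D)
  (E : ℕ → D)

/-- A morphism of `D` is a map from the unit of `V` to a hom object, and such maps are tested at
`L.one` (`unit_ext`). -/
theorem hom_ext {X Y : D} {f g : X ⟶ Y} (h : ∀ L : LaxSym.{vV} V, ofHom L f = ofHom L g) :
    f = g :=
  (eHomEquiv V).injective (unit_ext _ _ fun L => arr_injective (h L))

variable {d} in
theorem ofHom_shrink_expand (h : d.Square) (L : LaxSym.{w} V) : ∀ n,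
    (d.alg L).comp (ofHom L (d.shrink n)) (ofHom L (d.expand n)) = (d.alg L).id (d.hpow n)
  | 0 => ((ofHom_comp (d.shrink 0) (d.expand 0)).symm.trans
      (congrArg (ofHom L) (Category.comp_id _))).trans (ofHom_id _)
  | 1 => ((ofHom_comp (d.shrink 1) (d.expand 1)).symm.trans
      (congrArg (ofHom L) (Category.comp_id _))).trans (ofHom_id _)
  | n + 2 => by
    have hs : (d.alg L).h1.t.mul ((d.alg L).id d.e) (d.alg L).ε =
        (d.alg L).h1.t.mul (d.alg L).ε ((d.alg L).id d.e) := by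
      have h' := congrArg (ofHom L) h
      rw [ofHom_comp_eqToHom, ofHom_comp_eqToHom, d.tens₁_ofHom, d.tens₁_ofHom, d.id_ofHom] at h'
      exact h'
    have h1 : (d.alg L).comp ((d.alg L).h1.t.mul ((d.alg L).id d.e) (d.alg L).ε) (d.alg L).δ =
        (d.alg L).id (d.h1.mul d.e d.e) :=
      ((d.alg L).counit_comul_of_square hs).trans ((d.alg L).h1.id_mul d.e d.e).symm
    have ih := ofHom_shrink_expand h L (n + 1)
    have h2 : (d.alg L).h1.t.mul ((d.alg L).id d.e)
        ((d.alg L).comp (ofHom L (d.shrink (n + 1))) (d.alg L).ε) =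
        (d.alg L).comp ((d.alg L).h1.t.mul ((d.alg L).id d.e) (ofHom L (d.shrink (n + 1))))
          ((d.alg L).h1.t.mul ((d.alg L).id d.e) (d.alg L).ε) := by
      rw [(d.alg L).comp_mul₁ rfl rfl, (d.alg L).id_comp (X := d.e) rfl]
    rw [ofHom_expand_succ, ofHom_shrink_succ, h2, (d.alg L).assoc, ← (d.alg L).assoc _ (d.alg L).δ]
    rw [h1, (d.alg L).id_comp (X := d.h1.mul d.e d.e) rfl, (d.alg L).comp_mul₁ rfl rfl, ih,
      (d.alg L).id_comp (X := d.e) rfl]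
    exact ((d.alg L).h1.id_mul _ _).symm

variable {d} in
theorem ofHom_shrinkTree_expandTree (h : d.Square) (L : LaxSym.{w} V) (T : LTree) :
    (d.alg L).comp (ofHom L (d.shrinkTree E T)) (ofHom L (d.expandTree E T)) =
      (d.alg L).id (d.powTree E T) := by
  rw [ofHom_expandTree, ofHom_shrinkTree]
  refine Eq.trans ?_ (congrArg (d.alg L).id (d.powTree_eq _ _)).symm
  rw [d.rprod_alg L, (d.alg L).h0.id_rprod, ← (d.alg L).h0.rprod_comp fun c _ => by cases T.fam.flag c <;> rfl]
  refine (d.alg L).h0.t.rprod_congr fun c _ => ?_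
  cases T.fam.flag c
  · rw [cond_false, cond_false, d.prod_alg L]
    exact (d.alg L).id_comp ((d.alg L).src_id _)
  · exact ofHom_shrink_expand h L _

variable {d} in
theorem isIso_Lambda (h : d.Square) (T : LTree) : IsIso (d.Lambda E T) := by
  have h1 : d.expandTree E T ≫ d.shrinkTree E T = 𝟙 _ := hom_ext fun L => by
    rw [d.comp_ofHom, d.id_ofHom]
    exact d.ofHom_expandTree_shrinkTree L E T
  have h2 : d.shrinkTree E T ≫ d.expandTree E T = 𝟙 _ := hom_ext fun L => by
    rw [d.comp_ofHom, d.id_ofHom]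
    exact ofHom_shrinkTree_expandTree E h L T
  have h3 : IsIso (d.expandTree E T) := ⟨_, h1, h2⟩
  have h4 : IsIso (d.theta E T) := inferInstanceAs (IsIso (eqToHom _ ≫ d.expandTree E T))
  refine ⟨eHomWhiskerRight V (inv (d.theta E T)) (E T.arity), ?_, ?_⟩
  · exact (eHomWhiskerRight_comp V _ _ _).symm.trans (by
      rw [IsIso.inv_hom_id, eHomWhiskerRight_id]; rfl)
  · exact (eHomWhiskerRight_comp V _ _ _).symm.trans (by
      rw [IsIso.hom_inv_id, eHomWhiskerRight_id]; rfl)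

theorem endOmegaTree_isOperad : (d.endOmegaTree E).IsOperad :=
  OperadData.IsOperad.of_elements fun L => d.endOmegaTree_isElOperad L E

-- `Λ` is then an invertible map into an operad that commutes with the operations, so the axioms are
-- reflected by `IsElOperad.of_iso`.
variable {d} in
theorem endTree_isOperad (h : d.Square) : (d.endTree E).IsOperad :=
  OperadData.IsOperad.of_elements fun L => IsElOperad.of_iso L (d.Lambda_commutes E) (isIso_Lambda E h)
    (d.endOmegaTree_isElOperad L E)

end StrictDuoidal

theorem tensMap_comp {V : Type uV} [Category.{vV} V] [MonoidalCategory V] {ι : Type*}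
    {F G H : ι → V} (φ : ∀ i, F i ⟶ G i) (ψ : ∀ i, G i ⟶ H i) : ∀ l : List ι,
    tensMap (fun i => φ i ≫ ψ i) l = tensMap φ l ≫ tensMap ψ l
  | [] => (Category.id_comp _).symm
  | i :: l => by
    rw [tensMap, tensMap, tensMap, tensMap_comp φ ψ l]
    exact (tensorHom_comp_tensorHom ..).symm

/-- Meant for `Ψ` followed by `Λ`: the composite and `Λ` are known to commute with the operations.
-/
theorem OperadData.Commutes.cancel {O : OperadicCategory} {V : Type uV} [Category.{vV} V]
    [MonoidalCategory V] {P Q R : OperadData O V} {φ : ∀ T, P.obj T ⟶ Q.obj T}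
    {ψ : ∀ T, Q.obj T ⟶ R.obj T} (hψ : ∀ T, Mono (ψ T)) (h : Commutes Q R ψ)
    (h' : Commutes P R fun T => φ T ≫ ψ T) : Commutes P Q φ where
  unit c := by
    rw [← cancel_mono (ψ (O.U c)), Category.assoc, h'.unit, h.unit]
  mul {T S} f := by
    rw [← cancel_mono (ψ T), Category.assoc, h'.mul, Category.assoc, h.mul, tensMap_comp,
      ← tensorHom_comp_tensorHom, Category.assoc]

end

/-! ### Naturality -/

section

open GArr LevFam OperadData

/-- A morphism of untyped multiplicative 1-operads. -/
structure MultAlg.Hom {D A : Type*} {d : DuoAlg D A} (O P : MultAlg d) where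
  map : ℕ → A
  src_map : ∀ n, d.src (map n) = O.obj n
  tgt_map : ∀ n, d.tgt (map n) = P.obj n
  γ_map : ∀ ks, d.comp (O.γ ks) (map ks.sum) =
    d.comp (d.h0.t.mul (d.h1.t.prod ks map) (map ks.length)) (P.γ ks)
  j_map : d.comp O.j (map 1) = P.j

namespace MultAlg.Hom

variable {D A : Type*} {d : DuoAlg D A} {O P : MultAlg d} (F : O.Hom P)

local infixl:65 " ⨟ " => d.comp
local infixl:70 " ⊠₀ " => d.h0.t.mul

attribute [simp] src_map tgt_map

theorem src_rprod (w : List (List ℕ)) :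
    d.src (d.h0.t.rprod w fun r => d.h1.t.prod r F.map) = d.h0.o.rprod w O.pow := by
  simp only [DuoAlg.src_rprod₀, DuoAlg.src_prod₁, src_map]
  rfl

theorem tgt_rprod (w : List (List ℕ)) :
    d.tgt (d.h0.t.rprod w fun r => d.h1.t.prod r F.map) = d.h0.o.rprod w P.pow := by
  simp only [DuoAlg.tgt_rprod₀, DuoAlg.tgt_prod₁, tgt_map]
  rfl

/-- Induction over the levels; each step moves the morphism through one `γ`. -/
theorem comps_map {n : ℕ} : ∀ {p : ℕ} {w : List (List ℕ)}, OneAlg.Fits p w n →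
    O.comps p w ⨟ F.map n =
      d.h0.t.rprod w (fun r => d.h1.t.prod r F.map) ⊠₀ F.map p ⨟ P.comps p w
  | p, [], h => by
    obtain rfl : p = n := h
    simp only [OneAlg.comps, Mon.rprod_nil]
    rw [d.h0.t.one_mul, d.id_comp (F.src_map p), d.comp_id (F.tgt_map p)]
  | _, r :: w, h => by
    obtain rfl : r.length = _ := h.1
    have hs := F.src_rprod w
    have ht := F.tgt_rprod w
    rw [OneAlg.comps, OneAlg.comps, d.assoc, comps_map h.2, ← d.assoc, ← d.assoc, Mon.rprod_cons,
      d.h0.t.assoc]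
    generalize d.h0.t.rprod w (fun r => d.h1.t.prod r F.map) = R at hs ht
    rw [d.comp_mul₀ (by simp [hs]) (by simp), d.comp_mul₀ (by simp [ht]) (by simp),
      d.id_comp hs, d.comp_id ht, F.γ_map]

theorem tree_map {w : List (List ℕ)} {n : ℕ} (h : OneAlg.Fits 1 w n) : O.tree w ⨟ F.map n =
    d.h0.t.rprod w (fun r => d.h1.t.prod r F.map) ⨟ P.tree w := by
  have hs := F.src_rprod w
  have ht := F.tgt_rprod w
  rw [OneAlg.tree, OneAlg.tree, d.assoc, F.comps_map h, ← d.assoc, ← d.assoc]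
  generalize d.h0.t.rprod w (fun r => d.h1.t.prod r F.map) = R at hs ht
  refine congrArg (fun u => u ⨟ _) ?_
  conv_rhs => rw [← d.h0.t.mul_one R, ← d.h0.id_one]
  rw [d.comp_mul₀ (by simp [hs]) (by simp), d.comp_mul₀ (by simp [ht]) (by simp),
    d.id_comp hs, d.comp_id ht, F.j_map, d.id_comp (by simp)]

end MultAlg.Hom

variable {V : Type uV} [Category.{vV} V] [MonoidalCategory V] [SymmetricCategory V]
  {D : Type uD} [Category.{vD} D] [EnrichedOrdinaryCategory V D] {d : StrictDuoidal V D}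

namespace MultOneOperad

variable {A B : MultOneOperad d} (F : A.Hom B) (L : LaxSym.{w} V)

/-- The untyped morphism of generalized arrows. -/
noncomputable def Hom.alg : (A.alg L).Hom (B.alg L) where
  map n := ofHom L (F.hom.map n)
  src_map _ := rfl
  tgt_map _ := rfl
  γ_map ks := by
    have h := congrArg (ofHom L) (F.hom.γ ks)
    rw [d.comp_ofHom, d.comp_ofHom, d.tens₀_ofHom,
      ofHom_prodMap d.h1 (l := ks) (a := fun k => ofHom L (F.hom.map k)) fun _ _ => rfl] at h
    exact h
  j_map := (d.comp_ofHom L A.j (F.hom.map 1)).symm.trans (congrArg (ofHom L) F.hom.j)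

theorem unitMap_comp (n : ℕ) : (d.alg L).comp (ofHom L (A.unitMap n)) (ofHom L (F.hom.map n)) =
    ofHom L (B.unitMap n) :=
  (ofHom_comp _ _).symm.trans (congrArg (ofHom L) (F.α n))

theorem hpowTo_comp : ∀ l : List (Bool × ℕ), (d.alg L).comp
      (ofHom L (d.hpowTo (X := fun b => A.obj b.2) l fun b _ => d.ε ≫ A.unitMap b.2))
      ((d.alg L).h1.t.prod l fun b => ofHom L (F.hom.map b.2)) =
    ofHom L (d.hpowTo (X := fun b => B.obj b.2) l fun b _ => d.ε ≫ B.unitMap b.2)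
  | [] => (d.alg L).comp_id (a := ofHom L d.ε) (X := d.v) rfl
  | [b] => by
    have h : ∀ A : MultOneOperad d,
        ofHom L (d.hpowTo (X := fun b => A.obj b.2) [b] fun b _ => d.ε ≫ A.unitMap b.2) =
          (d.alg L).comp (d.alg L).ε (ofHom L (A.unitMap b.2)) :=
      fun A => (ofHom_comp_eqToHom _ _).trans (d.comp_ofHom L _ _)
    rw [h, h, Mon.prod_single, (d.alg L).assoc, unitMap_comp]
  | b :: b' :: l => by
    have h : ∀ A : MultOneOperad d,
        ofHom L (d.hpowTo (X := fun b => A.obj b.2) (b :: b' :: l) fun b _ => d.ε ≫ A.unitMap b.2) =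
          (d.alg L).h1.t.mul ((d.alg L).comp (d.alg L).ε (ofHom L (A.unitMap b.2)))
            (ofHom L (d.hpowTo (X := fun b => A.obj b.2) (b' :: l) fun b _ => d.ε ≫ A.unitMap b.2)) :=
      fun A => (d.tens₁_ofHom L (d.ε ≫ A.unitMap b.2) _).trans
        (congrArg (fun u => (d.alg L).h1.t.mul u _) (d.comp_ofHom L _ _))
    have ih := hpowTo_comp (b' :: l)
    rw [h, h, Mon.prod_cons, (d.alg L).comp_mul₁ rfl (by
      rw [DuoAlg.src_prod₁]
      exact d.prod_alg L _ _), (d.alg L).assoc, unitMap_comp, ih]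

theorem ofHom_powTreeMap (T : LTree) : ofHom L (d.powTreeMap F.hom.map T) =
    (d.alg L).h0.t.rprod T.fam fun K => bif K.1 then (d.alg L).id (d.hpow K.2.length) else
      (d.alg L).h1.t.prod K.2 fun b => bif b.1 then ofHom L (F.hom.map b.2) else (d.alg L).id d.v := by
  refine ofHom_rprodMap _ fun K _ => ?_
  split_ifs with h
  · rw [ofHom_eqToHom, h]
    rfl
  · rw [ofHom_eqToHom_comp, ofHom_comp_eqToHom]
    refine (ofHom_prodMap _ fun b _ => ?_).trans (cond_eq_ite .. ▸ (if_neg h).symm)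
    split_ifs with hb
    · rw [ofHom_eqToHom_comp, ofHom_comp_eqToHom, hb]
      rfl
    · rw [ofHom_eqToHom]
      rw [Bool.not_eq_true] at hb
      rw [hb, d.vert_vertical A.obj (by simp [hb])]
      rfl

/-- Here the compatibility of the morphism with the units `α` enters: at white vertices both sides
are the morphism itself, at the others they are the unit map of `B`, preceded by counits on
horizontal levels. -/
theorem ω_comp (T : LTree) :
    (d.alg L).comp (ofHom L (A.ω T.fam)) ((d.alg L).h0.t.rprod T.fam.arities fun r =>
      (d.alg L).h1.t.prod r (F.alg L).map) =
    (d.alg L).comp (ofHom L (d.powTreeMap F.hom.map T)) (ofHom L (B.ω T.fam)) := by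
  rw [ofHom_ω, ofHom_ω, ofHom_powTreeMap, ← map_arities, Mon.rprod_map]
  rw [← (d.alg L).h0.rprod_comp, ← (d.alg L).h0.rprod_comp]
  · refine (d.alg L).h0.t.rprod_congr fun K _ => ?_
    rw [Function.comp, Mon.prod_map]
    cases K.1
    · simp only [cond_false]
      rw [← (d.alg L).h1.prod_comp fun b _ => ?_, ← (d.alg L).h1.prod_comp fun b _ => ?_]
      · refine (d.alg L).h1.t.prod_congr fun b _ => ?_
        rcases b with ⟨_ | _, n⟩
        · exact (unitMap_comp F L n).trans ((d.alg L).id_comp (a := ofHom L (B.unitMap n))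
            (X := d.v) rfl).symm
        · exact ((d.alg L).id_comp (a := ofHom L (F.hom.map n)) rfl).trans
            ((d.alg L).comp_id (a := ofHom L (F.hom.map n)) rfl).symm
      · rcases b with ⟨_ | _, n⟩ <;> rfl
      · rcases b with ⟨_ | _, n⟩ <;> rfl
    · refine (hpowTo_comp F L K.2).trans ((d.alg L).id_comp ?_).symm
      rfl
  · intro K _
    cases K.1
    · simp only [cond_false, DuoAlg.tgt_prod₁, DuoAlg.src_prod₁, MultAlg.src_entry]
      refine (d.alg L).h1.o.prod_congr fun b _ => ?_
      rcases b with ⟨_ | _, n⟩ <;> rfl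
    · rfl
  · intro K _
    rw [Function.comp, DuoAlg.src_prod₁, Mon.prod_map]
    cases K.1
    · simp only [cond_false, DuoAlg.tgt_prod₁, MultAlg.tgt_entry]
      rfl
    · exact d.prod_alg L _ _

theorem act_naturality (T : LTree) :
    A.act T ≫ F.hom.map T.arity = d.powTreeMap F.hom.map T ≫ B.act T := by
  refine StrictDuoidal.hom_ext (V := V) fun L => ?_
  rw [d.comp_ofHom, d.comp_ofHom, ofHom_act, ofHom_act, ← (d.alg L).assoc, ← ω_comp,
    (d.alg L).assoc, (d.alg L).assoc]
  exact congrArg ((d.alg L).comp _) ((F.alg L).tree_map (MultAlg.fits_arities T.tree))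

theorem Psi_naturality (T : LTree) :
    A.Psi T ≫ eHomWhiskerLeft V (d.powTree A.obj T) (F.hom.map T.arity) =
      B.Psi T ≫ eHomWhiskerRight V (d.powTreeMap F.hom.map T) (B.obj T.arity) := by
  refine unit_ext _ _ fun L => arr_injective ?_
  refine (congrArg arr (L.map_comp _ _ _)).trans ((arr_eHomWhiskerLeft _ _).trans ?_)
  refine Eq.trans ?_ ((congrArg arr (L.map_comp _ _ _)).trans (arr_eHomWhiskerRight _ _)).symm
  refine (ofHom_comp (A.act T) _).symm.trans ((congrArg (ofHom L) (act_naturality F T)).trans ?_)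
  exact ofHom_comp _ _

/-- Under the square `Λ` is invertible, hence mono, and can be cancelled from `Ξ`. -/
theorem Psi_commutes (A : MultOneOperad d) (h : d.Square) :
    Commutes (one LTrOC V) (d.endTree A.obj) A.Psi :=
  Commutes.cancel (fun T => have := StrictDuoidal.isIso_Lambda A.obj h T; inferInstance)
    (d.Lambda_commutes A.obj) A.Xi_commutes

end MultOneOperad

end

theorem mainTheorem5 {V : Type*} [Category V] [MonoidalCategory V] [SymmetricCategory V]
    {D : Type*} [Category D] [EnrichedOrdinaryCategory V D] (d : StrictDuoidal V D) :
    -- naturality of `Ψ`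
    (∀ (A B : MultOneOperad d) (F : MultOneOperad.Hom A B) (T : LTree),
      A.Psi T ≫ eHomWhiskerLeft V (d.powTree A.obj T) (F.hom.map T.arity) =
        B.Psi T ≫ eHomWhiskerRight V (d.powTreeMap F.hom.map T) (B.obj T.arity)) ∧
    ∀ A : MultOneOperad d,
      -- the composite of `Ψ` and `Λ` is a morphism of operads
      OperadData.IsOperadHom (OperadData.one LTrOC V)
        ((d.endOmega A.obj).restrict omegaOF) (fun T => A.Psi T ≫ d.Lambda A.obj T) ∧
      -- if the square commutes, then `Ψ` and `Λ` are morphisms of operads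
      (d.Square →
        OperadData.IsOperadHom (OperadData.one LTrOC V) (d.endTree A.obj) A.Psi ∧
        OperadData.IsOperadHom (d.endTree A.obj)
          ((d.endOmega A.obj).restrict omegaOF) (d.Lambda A.obj)) :=
  ⟨fun _ _ F T => MultOneOperad.Psi_naturality F T, fun A =>
    ⟨⟨OperadData.one_isOperad, d.endOmegaTree_isOperad A.obj, A.Xi_commutes⟩, fun h =>
      ⟨⟨OperadData.one_isOperad, StrictDuoidal.endTree_isOperad A.obj h, A.Psi_commutes h⟩,
        ⟨StrictDuoidal.endTree_isOperad A.obj h, d.endOmegaTree_isOperad A.obj,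
          d.Lambda_commutes A.obj⟩⟩⟩⟩
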